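/- Let $(\tilde M,\langle\cdot,\cdot\rangle)$ be a pseudo-Riemannian manifold of constant curvature with Levi-Civita connection $\tilde\nabla$, and let $M\subset\tilde M$ be a spacelike (immersed) submanifold, i.e. the induced metric on $M$ is positive definite. Let $NM=(TM)^{\perp}$ be the normal bundle, with normal connection $\nabla^{\perp}_X\xi=pr_{NM}(\tilde\nabla_X\xi)$ and shape operators $A_\xi X=-pr_{TM}(\tilde\nabla_X\xi)$, and let $R^{\perp}(X,Y)=[\nabla^{\perp}_X,\nabla^{\perp}_Y]-\nabla^{\perp}_{[X,Y]}$ be the curvature of $\nabla^\perp$. For $y\in M$ and an orthonormal basis $(o_i)$ of $T_yM$ put $$\mathcal R_y(\xi_1,\xi_2)\xi_3=\sum_i R^{\perp}_y(A_{\xi_1}o_i,A_{\xi_2}o_i)\xi_3,\qquad \xi_1,\xi_2,\xi_3\in N_yM .$$ Fix $x\in M$, and let $\mathfrak{hol}^{\perp}\subset\mathfrak{so}(N_xM)$ be the Lie algebra of the restricted holonomy group of $\nabla^{\perp}$ at $x$ (the group of parallel displacements along null-homotopic piecewise smooth loops at $x$). Let $(v_1,\dots,v_p,e_1,\dots,e_q,w_1,\dots,w_p)$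 be a basis of $N_xM$ with $$\langle v_i,v_j\rangle=\langle w_i,w_j\rangle=\langle v_i,e_j\rangle=\langle w_i,e_j\rangle=0,\qquad \langle e_i,e_j\rangle=\langle v_i,w_j\rangle=\delta_{ij},$$ such that $\Xi=\mathrm{span}\{v_1,\dots,v_p\}$ is invariant under $\mathfrak{hol}^{\perp}$. Let $\mathcal E=\mathrm{span}\{e_1,\dots,e_q\}$, let $pr_{\mathcal E}\colon N_xM\to\mathcal E$, $pr_{\mathcal E}\,\xi=\sum_k\langle\xi,e_k\rangle e_k$, and let $$\mathfrak g=\{pr_{\mathcal E}\circ A|_{\mathcal E}: A\in\mathfrak{hol}^{\perp}\}$$ be the normal screen holonomy algebra. For a piecewise smooth curve $\gamma\colon[0,1]\to M$ with $\gamma(0)=x$ let $\tau_\gamma\colon N_xM\to N_{\gamma(1)}M$ be the parallel displacement of $\nabla^{\perp}$ along $\gamma$, put $\mathcal R^{\tau_\gamma}(\xi_1,\xi_2)=\tau_\gamma^{-1}\circ\mathcal R_{\gamma(1)}(\tau_\gamma\xi_1,\tau_\gamma\xi_2)\circ\tau_\gamma$, and define endomorphisms of $\mathcal E$ by $$\mathcal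 P_0^{\gamma}(Y_1,Y_2)=pr_{\mathcal E}\circ\mathcal R^{\tau_\gamma}(Y_1,Y_2)|_{\mathcal E},\quad \mathcal P_k^{\gamma}(Y)=pr_{\mathcal E}\circ\mathcal R^{\tau_\gamma}(w_k,Y)|_{\mathcal E},\quad \mathcal Q_{ij}^{\gamma}=pr_{\mathcal E}\circ\mathcal R^{\tau_\gamma}(w_i,w_j)|_{\mathcal E}$$ for $Y,Y_1,Y_2\in\mathcal E$ and $1\le i,j,k\le p$. Then $$\mathfrak g=\mathrm{span}\{\mathcal P_0^{\gamma}(Y_1,Y_2),\ \mathcal P_k^{\gamma}(Y),\ \mathcal Q_{ij}^{\gamma}\},$$ where the span is over all such curves $\gamma$, all $Y,Y_1,Y_2\in\mathcal E$ and all $1\le i,j,k\le p$. -/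

import Mathlib

open Set Bundle Manifold
open scoped Manifold ContDiff Topology

noncomputable section

/-! ### Pseudo-Riemannian manifolds of constant curvature -/

section Ambient

variable {F : Type*} [NormedAddCommGroup F] [NormedSpace ℝ F]
  {N : Type*} [TopologicalSpace N] [ChartedSpace F N] [IsManifold 𝓘(ℝ, F) ∞ N]

variable (F N) in
/-- A smooth pseudo-Riemannian metric: a smooth field of symmetric nondegenerate bilinear forms on
the tangent spaces. No condition is put on the signature. -/
structure PseudoRiemannianMetric where
  /-- The scalar product on the tangent spaces. -/
  inner (y : N) : TangentSpace 𝓘(ℝ, F) y →L[ℝ] TangentSpace 𝓘(ℝ, F) y →L[ℝ] ℝ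
  symm (y : N) (v w : TangentSpace 𝓘(ℝ, F) y) : inner y v w = inner y w v
  nondegenerate (y : N) (v : TangentSpace 𝓘(ℝ, F) y) (hv : ∀ w, inner y v w = 0) : v = 0
  contMDiff : ContMDiff 𝓘(ℝ, F) (𝓘(ℝ, F).prod 𝓘(ℝ, F →L[ℝ] F →L[ℝ] ℝ)) ∞
    (fun y ↦ TotalSpace.mk' (F →L[ℝ] F →L[ℝ] ℝ)
      (E := fun y ↦ TangentSpace 𝓘(ℝ, F) y →L[ℝ] TangentSpace 𝓘(ℝ, F) y →L[ℝ] ℝ) y (inner y))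

/-- `cov` is the Levi-Civita connection of `g`: it is torsion free and
`d⟨V, W⟩(u) = ⟨∇_u V, W⟩ + ⟨V, ∇_u W⟩`. Recall that `cov V y u` is `∇_u V` at `y`. -/
structure PseudoRiemannianMetric.IsLeviCivita [FiniteDimensional ℝ F]
    (g : PseudoRiemannianMetric F N)
    (cov : CovariantDerivative 𝓘(ℝ, F) F (TangentSpace 𝓘(ℝ, F) : N → Type _)) : Prop where
  torsion_eq_zero :
    have : CompleteSpace F := FiniteDimensional.complete ℝ F
    cov.torsion = 0
  metric : ∀ (V W : Π y : N, TangentSpace 𝓘(ℝ, F) y) (y : N) (u : TangentSpace 𝓘(ℝ, F) y),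
    MDifferentiableAt 𝓘(ℝ, F) 𝓘(ℝ, F).tangent (fun z ↦ (⟨z, V z⟩ : TangentBundle 𝓘(ℝ, F) N)) y →
    MDifferentiableAt 𝓘(ℝ, F) 𝓘(ℝ, F).tangent (fun z ↦ (⟨z, W z⟩ : TangentBundle 𝓘(ℝ, F) N)) y →
    mvfderiv 𝓘(ℝ, F) (fun z ↦ g.inner z (V z) (W z)) y u =
      g.inner y (cov V y u) (W y) + g.inner y (V y) (cov W y u)

/-- The connection `cov` (meant to be the Levi-Civita connection of `g`) has constant curvature `κ`:
`∇_X ∇_Y Z - ∇_Y ∇_X Z - ∇_[X,Y] Z = κ (⟨Y, Z⟩ X - ⟨X, Z⟩ Y)` for smooth vector fields. -/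
def PseudoRiemannianMetric.HasConstantCurvature (g : PseudoRiemannianMetric F N)
    (cov : CovariantDerivative 𝓘(ℝ, F) F (TangentSpace 𝓘(ℝ, F) : N → Type _)) (κ : ℝ) : Prop :=
  ∀ (X Y Z : Π y : N, TangentSpace 𝓘(ℝ, F) y) (y : N),
    ContMDiffAt 𝓘(ℝ, F) 𝓘(ℝ, F).tangent ∞ (fun z ↦ (⟨z, X z⟩ : TangentBundle 𝓘(ℝ, F) N)) y →
    ContMDiffAt 𝓘(ℝ, F) 𝓘(ℝ, F).tangent ∞ (fun z ↦ (⟨z, Y z⟩ : TangentBundle 𝓘(ℝ, F) N)) y →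
    ContMDiffAt 𝓘(ℝ, F) 𝓘(ℝ, F).tangent ∞ (fun z ↦ (⟨z, Z z⟩ : TangentBundle 𝓘(ℝ, F) N)) y →
    cov (fun z ↦ cov Z z (Y z)) y (X y) - cov (fun z ↦ cov Z z (X z)) y (Y y)
        - cov Z y (VectorField.mlieBracket 𝓘(ℝ, F) X Y y) =
      κ • (g.inner y (Y y) (Z y) • X y - g.inner y (X y) (Z y) • Y y)

/-- The covariant derivative `(D_u ξ)(x)` of a vector field `ξ` along a map `h : S → N`, i.e. of a
section of the pulled back tangent bundle, with respect to the pull-back of `cov`. In the local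
trivialization of `TN` around `h x` write `ξ = ∑ᵢ ξⁱ eᵢ(h)`; then
`D_u ξ = ∑ᵢ dξⁱ(u) eᵢ + ξⁱ(x) ∇_{dh(u)} eᵢ`, and `∑ᵢ ξⁱ(x) eᵢ` is `FiberBundle.extend F (ξ x)`. -/
def covAlong (G : Type*) [NormedAddCommGroup G] [NormedSpace ℝ G]
    {S : Type*} [TopologicalSpace S] [ChartedSpace G S]
    (cov : CovariantDerivative 𝓘(ℝ, F) F (TangentSpace 𝓘(ℝ, F) : N → Type _)) (h : S → N)
    (ξ : Π z : S, TangentSpace 𝓘(ℝ, F) (h z)) (x : S) :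
    TangentSpace 𝓘(ℝ, G) x →L[ℝ] TangentSpace 𝓘(ℝ, F) (h x) :=
  ((trivializationAt F (TangentSpace 𝓘(ℝ, F) : N → Type _) (h x)).symmL ℝ (h x)).comp
      (mvfderiv 𝓘(ℝ, G) (fun z ↦
        (trivializationAt F (TangentSpace 𝓘(ℝ, F) : N → Type _) (h x) ⟨h z, ξ z⟩).2) x)
    + (cov (FiberBundle.extend F (ξ x)) (h x)).comp (mfderiv 𝓘(ℝ, G) 𝓘(ℝ, F) h x)

end Ambient

/-! ### Spacelike submanifolds and their normal bundle -/

/-- A spacelike (immersed) submanifold of `(N, g)`: a smooth map `M → N` for which the induced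
metric on `M` is positive definite. (In particular the differential is injective.) -/
structure SpacelikeImmersion (E : Type*) [NormedAddCommGroup E] [NormedSpace ℝ E]
    (M : Type*) [TopologicalSpace M] [ChartedSpace E M]
    {F : Type*} [NormedAddCommGroup F] [NormedSpace ℝ F]
    {N : Type*} [TopologicalSpace N] [ChartedSpace F N] [IsManifold 𝓘(ℝ, F) ∞ N]
    (g : PseudoRiemannianMetric F N) where
  /-- The underlying map. -/
  toFun : M → N
  contMDiff : ContMDiff 𝓘(ℝ, E) 𝓘(ℝ, F) ∞ toFun
  spacelike (x : M) (u : TangentSpace 𝓘(ℝ, E) x) (hu : u ≠ 0) :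
    0 < g.inner (toFun x) (mfderiv 𝓘(ℝ, E) 𝓘(ℝ, F) toFun x u)
      (mfderiv 𝓘(ℝ, E) 𝓘(ℝ, F) toFun x u)

namespace SpacelikeImmersion

variable {E : Type*} [NormedAddCommGroup E] [NormedSpace ℝ E]
  {M : Type*} [TopologicalSpace M] [ChartedSpace E M]
  {F : Type*} [NormedAddCommGroup F] [NormedSpace ℝ F]
  {N : Type*} [TopologicalSpace N] [ChartedSpace F N] [IsManifold 𝓘(ℝ, F) ∞ N]
  {g : PseudoRiemannianMetric F N}

/-- The differential `T_x M → T_{f x} N`. -/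
def d (f : SpacelikeImmersion E M g) (x : M) :
    TangentSpace 𝓘(ℝ, E) x →ₗ[ℝ] TangentSpace 𝓘(ℝ, F) (f.toFun x) :=
  (mfderiv 𝓘(ℝ, E) 𝓘(ℝ, F) f.toFun x).toLinearMap

/-- The metric induced on `M`. -/
def inducedInner (f : SpacelikeImmersion E M g) (x : M) (u v : TangentSpace 𝓘(ℝ, E) x) : ℝ :=
  g.inner (f.toFun x) (f.d x u) (f.d x v)

/-- The scalar product of `N` at `f x`, as a bilinear form. -/
def form (f : SpacelikeImmersion E M g) (x : M) :
    LinearMap.BilinForm ℝ (TangentSpace 𝓘(ℝ, F) (f.toFun x)) :=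
  LinearMap.mk₂ ℝ (fun v w ↦ g.inner (f.toFun x) v w)
    (by simp) (by simp) (by simp) (by simp)

/-- The normal space `N_x M = (T_x M)^⊥ ⊂ T_{f x} N`. -/
def normalSpace (f : SpacelikeImmersion E M g) (x : M) :
    Submodule ℝ (TangentSpace 𝓘(ℝ, F) (f.toFun x)) :=
  (f.form x).orthogonal (LinearMap.range (f.d x))

/-- The scalar product on the normal space. -/
def normalInner (f : SpacelikeImmersion E M g) (x : M) (ξ η : f.normalSpace x) : ℝ :=
  g.inner (f.toFun x) ξ η

theorem d_injective (f : SpacelikeImmersion E M g) (x : M) : Function.Injective (f.d x) := by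
  rw [← LinearMap.ker_eq_bot, LinearMap.ker_eq_bot']
  intro u hu
  by_contra h
  have h1 := f.spacelike x u h
  have h2 : mfderiv 𝓘(ℝ, E) 𝓘(ℝ, F) f.toFun x u = 0 := hu
  rw [h2] at h1
  simp at h1

/-- `T_{f x} N = T_x M ⊕ N_x M`. -/
theorem isCompl_range_normalSpace [FiniteDimensional ℝ F] (f : SpacelikeImmersion E M g) (x : M) :
    IsCompl (LinearMap.range (f.d x)) (f.normalSpace x) := by
  have : FiniteDimensional ℝ (TangentSpace 𝓘(ℝ, F) (f.toFun x)) :=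
    inferInstanceAs (FiniteDimensional ℝ F)
  have hr : (f.form x).IsRefl := by
    intro v w h
    exact (g.symm _ w v).trans h
  refine LinearMap.BilinForm.isCompl_orthogonal_of_restrict_nondegenerate hr ?_
  have key : ∀ m : LinearMap.range (f.d x), f.form x m m = 0 → m = 0 := by
    rintro ⟨_, u, rfl⟩ h
    by_contra hne
    have hu : u ≠ 0 := by
      rintro rfl
      exact hne (by ext; simp)
    exact (f.spacelike x u hu).ne' h
  exact ⟨fun m hm ↦ key m (hm m), fun m hm ↦ key m (hm m)⟩

section Projections

variable [FiniteDimensional ℝ F]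

/-- The orthogonal projection `T_{f x} N → T_x M`. -/
def tangentProj (f : SpacelikeImmersion E M g) (x : M) :
    TangentSpace 𝓘(ℝ, F) (f.toFun x) →ₗ[ℝ] TangentSpace 𝓘(ℝ, E) x :=
  LinearMap.linearProjOfIsCompl (f.normalSpace x) (f.d x) (f.d_injective x)
    (f.isCompl_range_normalSpace x)

/-- The orthogonal projection `T_{f x} N → N_x M`. -/
def normalProj (f : SpacelikeImmersion E M g) (x : M) :
    TangentSpace 𝓘(ℝ, F) (f.toFun x) →ₗ[ℝ] f.normalSpace x :=
  (f.normalSpace x).projectionOnto (LinearMap.range (f.d x)) (f.isCompl_range_normalSpace x).symm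

/-! ### The normal connection, the shape operator and the normal curvature -/

/-- The normal connection `∇^⊥`, the normal part of the ambient derivative:
`f.normalCov cov ξ x u` is `∇^⊥_u ξ` at `x`. -/
def normalCov (f : SpacelikeImmersion E M g)
    (cov : CovariantDerivative 𝓘(ℝ, F) F (TangentSpace 𝓘(ℝ, F) : N → Type _))
    (ξ : Π z : M, f.normalSpace z) (x : M) :
    TangentSpace 𝓘(ℝ, E) x →ₗ[ℝ] f.normalSpace x :=
  f.normalProj x ∘ₗ (covAlong E cov f.toFun (fun z ↦ (ξ z : TangentSpace 𝓘(ℝ, F) (f.toFun z))) x :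
    TangentSpace 𝓘(ℝ, E) x →ₗ[ℝ] TangentSpace 𝓘(ℝ, F) (f.toFun x))

/-- The shape operator `A_ξ u = - pr_{TM} (∇_u ξ)` of a normal field `ξ`, at `x`. -/
def shapeOperator (f : SpacelikeImmersion E M g)
    (cov : CovariantDerivative 𝓘(ℝ, F) F (TangentSpace 𝓘(ℝ, F) : N → Type _))
    (ξ : Π z : M, f.normalSpace z) (x : M) :
    TangentSpace 𝓘(ℝ, E) x →ₗ[ℝ] TangentSpace 𝓘(ℝ, E) x :=
  -(f.tangentProj x ∘ₗ
    (covAlong E cov f.toFun (fun z ↦ (ξ z : TangentSpace 𝓘(ℝ, F) (f.toFun z))) x :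
      TangentSpace 𝓘(ℝ, E) x →ₗ[ℝ] TangentSpace 𝓘(ℝ, F) (f.toFun x)))

/-- The curvature `R^⊥(X, Y) ξ = ∇^⊥_X ∇^⊥_Y ξ - ∇^⊥_Y ∇^⊥_X ξ - ∇^⊥_[X,Y] ξ` of the normal
connection, for vector fields `X`, `Y` on `M` and a normal field `ξ`. -/
def normalCurvature (f : SpacelikeImmersion E M g)
    (cov : CovariantDerivative 𝓘(ℝ, F) F (TangentSpace 𝓘(ℝ, F) : N → Type _))
    (X Y : Π z : M, TangentSpace 𝓘(ℝ, E) z)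
    (ξ : Π z : M, f.normalSpace z) (x : M) : f.normalSpace x :=
  f.normalCov cov (fun z ↦ f.normalCov cov ξ z (Y z)) x (X x)
    - f.normalCov cov (fun z ↦ f.normalCov cov ξ z (X z)) x (Y x)
    - f.normalCov cov ξ x (VectorField.mlieBracket 𝓘(ℝ, E) X Y x)

/-- A normal field, smooth near `x`, with a prescribed value at `x`. -/
def normalExtend (f : SpacelikeImmersion E M g) {x : M} (ξ : f.normalSpace x) (z : M) :
    f.normalSpace z :=
  f.normalProj z
    (FiberBundle.extend F (ξ : TangentSpace 𝓘(ℝ, F) (f.toFun x)) (f.toFun z))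

/-- The shape operator `A_ξ : T_x M → T_x M` of a normal vector `ξ` at `x`; as `A` is tensorial it
may be computed with any normal field extending `ξ`. -/
def shapeOperatorAt (f : SpacelikeImmersion E M g)
    (cov : CovariantDerivative 𝓘(ℝ, F) F (TangentSpace 𝓘(ℝ, F) : N → Type _))
    {x : M} (ξ : f.normalSpace x) :
    TangentSpace 𝓘(ℝ, E) x →ₗ[ℝ] TangentSpace 𝓘(ℝ, E) x :=
  f.shapeOperator cov (f.normalExtend ξ) x

/-- The value `R^⊥_x(u, v) ξ` of the normal curvature on vectors at `x`; as `R^⊥` is tensorial it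
may be computed with any fields extending `u`, `v` and `ξ`. -/
def normalCurvatureAt [IsManifold 𝓘(ℝ, E) ∞ M] (f : SpacelikeImmersion E M g)
    (cov : CovariantDerivative 𝓘(ℝ, F) F (TangentSpace 𝓘(ℝ, F) : N → Type _))
    {x : M} (u v : TangentSpace 𝓘(ℝ, E) x) (ξ : f.normalSpace x) : f.normalSpace x :=
  f.normalCurvature cov (FiberBundle.extend E u) (FiberBundle.extend E v) (f.normalExtend ξ) x

/-- The tensor `𝓡_x(ξ₁, ξ₂) ξ₃ = ∑ᵢ R^⊥_x(A_{ξ₁} bᵢ, A_{ξ₂} bᵢ) ξ₃` computed with the basis `b` of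
`T_x M`, which is to be orthonormal. -/
def algCurvature [IsManifold 𝓘(ℝ, E) ∞ M] (f : SpacelikeImmersion E M g)
    (cov : CovariantDerivative 𝓘(ℝ, F) F (TangentSpace 𝓘(ℝ, F) : N → Type _))
    {x : M} {ι : Type*} [Fintype ι] (b : Module.Basis ι ℝ (TangentSpace 𝓘(ℝ, E) x))
    (ξ₁ ξ₂ ξ₃ : f.normalSpace x) :
    f.normalSpace x :=
  ∑ i, f.normalCurvatureAt cov (f.shapeOperatorAt cov ξ₁ (b i)) (f.shapeOperatorAt cov ξ₂ (b i)) ξ₃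

/-- The basis `b` of `T_x M` is orthonormal for the induced metric. -/
def IsOrthonormal (f : SpacelikeImmersion E M g) {x : M} {ι : Type*}
    (b : Module.Basis ι ℝ (TangentSpace 𝓘(ℝ, E) x)) : Prop :=
  (∀ i, f.inducedInner x (b i) (b i) = 1) ∧ ∀ i j, i ≠ j → f.inducedInner x (b i) (b j) = 0

/-! ### Parallel displacement and holonomy of the normal connection -/

/-- The normal field `ξ` along the curve `γ : [0, 1] → M` is parallel: it is continuous, and, up to
finitely many exceptional times, differentiable with `∇^⊥ξ/dt = pr_{NM} (D ξ/dt) = 0`. -/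
structure IsParallelAlong (f : SpacelikeImmersion E M g)
    (cov : CovariantDerivative 𝓘(ℝ, F) F (TangentSpace 𝓘(ℝ, F) : N → Type _))
    {x y : M} (γ : Path x y)
    (ξ : Π t : ℝ, f.normalSpace (γ.extend t)) : Prop where
  continuousOn : ContinuousOn
    (fun t ↦ (⟨f.toFun (γ.extend t), (ξ t).1⟩ : TangentBundle 𝓘(ℝ, F) N)) (Icc 0 1)
  parallel : ∃ s : Set ℝ, s.Finite ∧ ∀ t ∈ Ioo (0 : ℝ) 1 \ s,
    MDifferentiableAt 𝓘(ℝ, ℝ) 𝓘(ℝ, F).tangent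
      (fun t ↦ (⟨f.toFun (γ.extend t), (ξ t).1⟩ : TangentBundle 𝓘(ℝ, F) N)) t ∧
    f.normalProj (γ.extend t)
      (covAlong ℝ cov (fun t ↦ f.toFun (γ.extend t)) (fun t ↦ (ξ t).1) t (1 : ℝ)) = 0

/-- `τ : N_x M → N_y M` is the parallel displacement `τ_γ` along `γ` for the normal connection. -/
def IsParallelDisplacement (f : SpacelikeImmersion E M g)
    (cov : CovariantDerivative 𝓘(ℝ, F) F (TangentSpace 𝓘(ℝ, F) : N → Type _))
    {x y : M} (γ : Path x y)
    (τ : f.normalSpace x ≃ₗ[ℝ] f.normalSpace y) : Prop :=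
  ∀ u : f.normalSpace x, ∃ ξ : Π t : ℝ, f.normalSpace (γ.extend t),
    f.IsParallelAlong cov γ ξ ∧
    (⟨f.toFun (γ.extend 0), (ξ 0).1⟩ : TangentBundle 𝓘(ℝ, F) N) = ⟨f.toFun x, u.1⟩ ∧
    (⟨f.toFun (γ.extend 1), (ξ 1).1⟩ : TangentBundle 𝓘(ℝ, F) N) = ⟨f.toFun y, (τ u).1⟩

end Projections

end SpacelikeImmersion

/-- The curve `γ : [0, 1] → M` is piecewise smooth: it is smooth, up to the end points, on the
intervals of a subdivision `0 = t₀ < ⋯ < tₙ = 1`. -/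
def Path.IsPiecewiseSmooth (E : Type*) [NormedAddCommGroup E] [NormedSpace ℝ E]
    {M : Type*} [TopologicalSpace M] [ChartedSpace E M] {x y : M} (γ : Path x y) : Prop :=
  ∃ (n : ℕ) (t : Fin (n + 1) → ℝ), StrictMono t ∧ t 0 = 0 ∧ t (Fin.last n) = 1 ∧
    ∀ i : Fin n, ContMDiffOn 𝓘(ℝ, ℝ) 𝓘(ℝ, E) ∞ γ.extend (Icc (t i.castSucc) (t i.succ))

namespace SpacelikeImmersion

variable {E : Type*} [NormedAddCommGroup E] [NormedSpace ℝ E]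
  {M : Type*} [TopologicalSpace M] [ChartedSpace E M]
  {F : Type*} [NormedAddCommGroup F] [NormedSpace ℝ F] [FiniteDimensional ℝ F]
  {N : Type*} [TopologicalSpace N] [ChartedSpace F N] [IsManifold 𝓘(ℝ, F) ∞ N]
  {g : PseudoRiemannianMetric F N}

/-- The restricted normal holonomy group at `x`: the parallel displacements along null-homotopic
piecewise smooth loops. -/
def restrictedHolonomy (f : SpacelikeImmersion E M g)
    (cov : CovariantDerivative 𝓘(ℝ, F) F (TangentSpace 𝓘(ℝ, F) : N → Type _))
    (x : M) : Set (f.normalSpace x ≃ₗ[ℝ] f.normalSpace x) :=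
  {τ | ∃ γ : Path x x, γ.IsPiecewiseSmooth E ∧ γ.Homotopic (Path.refl x) ∧
    f.IsParallelDisplacement cov γ τ}

/-- The normal holonomy algebra `hol^⊥` at `x`, the Lie algebra of the restricted normal holonomy
group: the initial velocities of the `C¹` curves in the group starting at the identity. -/
def holonomyAlgebra (f : SpacelikeImmersion E M g)
    (cov : CovariantDerivative 𝓘(ℝ, F) F (TangentSpace 𝓘(ℝ, F) : N → Type _))
    (x : M) : Set (Module.End ℝ (f.normalSpace x)) :=
  {A | ∃ c : ℝ → (f.normalSpace x ≃ₗ[ℝ] f.normalSpace x),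
    (∀ t, c t ∈ f.restrictedHolonomy cov x) ∧ c 0 = LinearEquiv.refl ℝ _ ∧
    ∀ u : f.normalSpace x,
      ContDiff ℝ 1 (F := F) (fun t ↦ (c t u).1) ∧
      HasDerivAt (F := F) (fun t ↦ (c t u).1) (A u).1 0}

end SpacelikeImmersion

/-! ### The screen -/

section Screen

variable {E : Type*} [NormedAddCommGroup E] [NormedSpace ℝ E]
  {M : Type*} [TopologicalSpace M] [ChartedSpace E M]
  {F : Type*} [NormedAddCommGroup F] [NormedSpace ℝ F]
  {N : Type*} [TopologicalSpace N] [ChartedSpace F N] [IsManifold 𝓘(ℝ, F) ∞ N]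
  {g : PseudoRiemannianMetric F N}

/-- A pseudo-orthonormal basis `(v₁, …, v_p, e₁, …, e_q, w₁, …, w_p)` of the normal space. (The
relations imply that a spanning family of this kind is a basis.) -/
structure ScreenBasis (f : SpacelikeImmersion E M g) (x : M) (p q : ℕ) where
  /-- The isotropic vectors spanning `Ξ`. -/
  v : Fin p → f.normalSpace x
  /-- The orthonormal vectors spanning the screen. -/
  e : Fin q → f.normalSpace x
  /-- The isotropic vectors dual to the `vᵢ`. -/
  w : Fin p → f.normalSpace x
  span_eq_top : Submodule.span ℝ (range v ∪ range e ∪ range w) = ⊤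
  v_v : ∀ i j, f.normalInner x (v i) (v j) = 0
  w_w : ∀ i j, f.normalInner x (w i) (w j) = 0
  v_e : ∀ i j, f.normalInner x (v i) (e j) = 0
  w_e : ∀ i j, f.normalInner x (w i) (e j) = 0
  e_e : ∀ i j, f.normalInner x (e i) (e j) = if i = j then 1 else 0
  v_w : ∀ i j, f.normalInner x (v i) (w j) = if i = j then 1 else 0

namespace ScreenBasis

variable {f : SpacelikeImmersion E M g} {x : M} {p q : ℕ}

/-- `Ξ = span {v₁, …, v_p}`. -/
def isotropic (b : ScreenBasis f x p q) : Submodule ℝ (f.normalSpace x) :=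
  Submodule.span ℝ (range b.v)

/-- The screen `𝓔 = span {e₁, …, e_q}`. -/
def screen (b : ScreenBasis f x p q) : Submodule ℝ (f.normalSpace x) :=
  Submodule.span ℝ (range b.e)

/-- The projection `pr_𝓔 : N_x M → 𝓔` along `span {v₁, …, v_p, w₁, …, w_p}`,
`pr_𝓔 ξ = ∑ₖ ⟨ξ, eₖ⟩ eₖ`. -/
def proj (b : ScreenBasis f x p q) : f.normalSpace x →ₗ[ℝ] b.screen :=
  ∑ k, LinearMap.smulRight
    ((f.form x).flip (b.e k : TangentSpace 𝓘(ℝ, F) (f.toFun x)) ∘ₗ (f.normalSpace x).subtype)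
    (⟨b.e k, Submodule.subset_span (mem_range_self k)⟩ : b.screen)

variable [FiniteDimensional ℝ F]

/-- The normal screen holonomy algebra `𝔤 = pr_{𝔰𝔬(q)}(hol^⊥)`: the endomorphisms `pr_𝓔 ∘ A|_𝓔` of
the screen, `A` in the normal holonomy algebra. -/
def screenHolonomyAlgebra (b : ScreenBasis f x p q)
    (cov : CovariantDerivative 𝓘(ℝ, F) F (TangentSpace 𝓘(ℝ, F) : N → Type _)) :
    Set (Module.End ℝ b.screen) :=
  (fun A : Module.End ℝ (f.normalSpace x) ↦ b.proj ∘ₗ A ∘ₗ b.screen.subtype) ''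
    f.holonomyAlgebra cov x

/-- `B` is the endomorphism `pr_𝓔 ∘ 𝓡^τ(ξ₁, ξ₂)|_𝓔` of the screen, where
`𝓡^τ(ξ₁, ξ₂) = τ⁻¹ ∘ 𝓡_y(τ ξ₁, τ ξ₂) ∘ τ` for a linear isomorphism `τ : N_x M → N_y M`, and `𝓡_y` is
computed with the orthonormal basis `o` of `T_y M`. -/
def IsScreenCurvature [IsManifold 𝓘(ℝ, E) ∞ M] (b : ScreenBasis f x p q)
    (cov : CovariantDerivative 𝓘(ℝ, F) F (TangentSpace 𝓘(ℝ, F) : N → Type _))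
    {y : M} {ι : Type*} [Fintype ι] (o : Module.Basis ι ℝ (TangentSpace 𝓘(ℝ, E) y))
    (τ : f.normalSpace x ≃ₗ[ℝ] f.normalSpace y) (ξ₁ ξ₂ : f.normalSpace x)
    (B : Module.End ℝ b.screen) : Prop :=
  ∀ Z : b.screen,
    B Z = b.proj (τ.symm (f.algCurvature cov o (τ ξ₁) (τ ξ₂) (τ (Z : f.normalSpace x))))

end ScreenBasis

end Screen

end

set_option linter.unusedSectionVars false

/-! The theorem combines the Ambrose–Singer theorem for the normal connection with the algebra of
the Ricci equation.

Ambrose–Singer: the holonomy algebra, defined by velocities of `C¹` curves in the restricted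
holonomy group, equals `curvatureAlgebra`, the span `W` of the normal curvature operators displaced
to `x` (`mem_holonomyAlgebra_iff_mem_curvatureAlgebra`). The tool is the radial gauge: in the
trivialization by parallel displacement along the segments issuing from a centre, the connection
form is an integral of displaced curvatures (`fderiv_radialTransport`), so it takes values in `W`.
The displacement around a thin triangle has this form as velocity, up to sign, and the curvature is
recovered from the form by a limit. Hence `W` is contained in the holonomy algebra. As `W` is stable
under conjugation by holonomy, differentiating the conjugation shows that `W` is a Lie algebra
(`lie_mem_curvatureAlgebra`). Conversely, a parallel field read in a radial gauge solves `u' = X u`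
with `X` in `W`, and so stays in one coset of the group `expGroup W`. Since `M` is second countable,
countably many gauges suffice, and the displacements along all loops at `x` lie in countably many
cosets. Along a curve in these cosets a first integral of the foliation by cosets takes countably
many values, so it is constant near the identity by connectedness, and the velocity is in `W`
(`mem_of_hasDerivAt_of_countable_cosets`). The theory of Lie subgroups is not needed.

Ricci: in constant curvature, `⟨R^⊥(oᵢ, oⱼ)ξ, η⟩` is the entry `(i, j)` of the commutator of the
symmetric matrices of `A_η` and `A_ξ`. Therefore `⟨𝓡(ξ₁, ξ₂)ξ₃, ξ₄⟩ = tr(A₁A₂[A₃, A₄])`, which has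
all the symmetries of a Riemannian curvature tensor, the Bianchi identity included. Moreover the
values of `𝓡` span all the `R^⊥(oᵢ, oⱼ)` (`RicciDatum.ρ_mem_span_curv`): a functional that kills
these values has a matrix `φ(R^⊥(oₖ, oₗ))` orthogonal to itself for a positive definite scalar
product. So the holonomy algebra is spanned by the `𝓡^τ(ξ, η)`.

Screen: each `𝓡^τ(ξ, η)` belongs to the holonomy algebra and preserves `Ξ`. Since `Ξ` is orthogonal
to the screen, the Bianchi identity and the pair symmetry force the compression of `𝓡^τ(ξ, η)` to
the screen to vanish for `ξ` in `Ξ` (`compress_curv_left`). By bilinearity and skew symmetry only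
the arguments `eₖ` and `wₖ` remain. -/

/-! ### Curves with derivative in a linear subspace -/

/-- A continuous curve on `[a, b]` whose derivative vanishes off a countable set is constant. -/
theorem eq_of_hasDerivAt_zero_off_countable {V : Type*} [NormedAddCommGroup V] [NormedSpace ℝ V]
    [CompleteSpace V] {u : ℝ → V} {a b : ℝ} (hab : a ≤ b) {s : Set ℝ} (hs : s.Countable)
    (hc : ContinuousOn u (Icc a b)) (hd : ∀ t ∈ Ioo a b \ s, HasDerivAt u 0 t) : u b = u a := by
  have := MeasureTheory.integral_eq_of_hasDerivAt_off_countable_of_le u (fun _ ↦ 0) hab hs hc hd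
    (by simp)
  rw [intervalIntegral.integral_zero] at this
  exact (sub_eq_zero.1 this.symm)

/-- A subspace of a finite dimensional space is the kernel of a continuous linear projection. -/
theorem Submodule.exists_clm_projection {V : Type*} [NormedAddCommGroup V] [NormedSpace ℝ V]
    [FiniteDimensional ℝ V] (W : Submodule ℝ V) :
    ∃ q : V →L[ℝ] V, (∀ v, q v = 0 ↔ v ∈ W) ∧ ∀ v, q (q v) = q v := by
  obtain ⟨W', hW⟩ := Submodule.exists_isCompl W
  -- The projection along `W` turns membership in `W` into the linear equation `q v = 0`, which
  -- passes to integrals, derivatives and limits.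
  let q : V →ₗ[ℝ] V := W'.subtype ∘ₗ Submodule.projectionOnto W' W hW.symm
  refine ⟨LinearMap.toContinuousLinearMap q, fun v ↦ ?_, fun v ↦ ?_⟩
  · simp [q]
  · simp [q]

/-- The average of a continuous curve in a subspace is in the subspace. -/
theorem Submodule.intervalIntegral_mem {V : Type*} [NormedAddCommGroup V] [NormedSpace ℝ V]
    [FiniteDimensional ℝ V] (W : Submodule ℝ V) {u : ℝ → V} {a b : ℝ} (hab : a ≤ b)
    (hc : ContinuousOn u (Icc a b)) (hu : ∀ t ∈ Icc a b, u t ∈ W) : ∫ t in a..b, u t ∈ W := by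
  have := FiniteDimensional.complete ℝ V
  obtain ⟨q, hq, -⟩ := W.exists_clm_projection
  rw [← hq, ← ContinuousLinearMap.intervalIntegral_comp_comm q
    (by rw [← uIcc_of_le hab] at hc; exact hc.intervalIntegrable)]
  have : ∫ t in a..b, q (u t) = ∫ t in a..b, (0 : V) := by
    apply intervalIntegral.integral_congr
    intro t ht
    rw [uIcc_of_le hab] at ht
    exact (hq _).2 (hu t ht)
  rw [this, intervalIntegral.integral_zero]

/-! ### Lie subalgebras of a finite dimensional algebra and their leaves -/

section Lie

variable {𝔸 : Type*} [NormedRing 𝔸] [NormedAlgebra ℝ 𝔸]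

open NormedSpace

theorem exp_mul_exp_neg [CompleteSpace 𝔸] (X : 𝔸) : exp X * exp (-X) = 1 := by
  let : NormedAlgebra ℚ 𝔸 := NormedAlgebra.restrictScalars ℚ ℝ 𝔸
  rw [← exp_add_of_commute (Commute.neg_right (Commute.refl X))]
  simp

theorem exp_neg_mul_exp [CompleteSpace 𝔸] (X : 𝔸) : exp (-X) * exp X = 1 := by
  simpa using exp_mul_exp_neg (-X)

theorem contDiff_normedSpace_exp [CompleteSpace 𝔸] : ContDiff ℝ ω (exp : 𝔸 → 𝔸) :=
  contDiff_iff_contDiffAt.2 fun x ↦ (exp_analytic (𝕂 := ℝ) x).contDiffAt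

variable [FiniteDimensional ℝ 𝔸]

/-- `e^X` normalizes a Lie algebra containing `X`. -/
theorem exp_mul_mul_exp_neg_mem {W : Submodule ℝ 𝔸} (hW : ∀ X ∈ W, ∀ Y ∈ W, X * Y - Y * X ∈ W)
    {X Y : 𝔸} (hX : X ∈ W) (hY : Y ∈ W) : exp X * Y * exp (-X) ∈ W := by
  have := FiniteDimensional.complete ℝ 𝔸
  obtain ⟨q, hq, hqq⟩ := W.exists_clm_projection
  let ad : 𝔸 →L[ℝ] 𝔸 := ContinuousLinearMap.mul ℝ 𝔸 X - (ContinuousLinearMap.mul ℝ 𝔸).flip X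
  have had : ∀ Z, ad Z = X * Z - Z * X := fun Z ↦ by simp [ad]
  -- The curve `w` solves `w' = [X, w]` with `w 0 = Y`.
  let w : ℝ → 𝔸 := fun s ↦ exp (s • X) * Y * exp (s • (-X))
  have hw : ∀ s, HasDerivAt w (ad (w s)) s := by
    intro s
    have h1 := hasDerivAt_exp_smul_const' X s
    have h2 := hasDerivAt_exp_smul_const (-X) s
    convert! (h1.mul_const Y).mul h2 using 1
    simp [had, w, mul_assoc, sub_eq_add_neg]
  -- Since `ad` preserves `W`, the kernel of `q`, one has `q ∘ ad = q ∘ ad ∘ q`. So `q ∘ w` solves a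
  -- linear equation of its own, with initial value `0`.
  have hy : ∀ s, HasDerivAt (fun s ↦ q (w s)) ((q ∘L ad) (q (w s))) s := by
    intro s
    have h1 := q.hasFDerivAt.comp_hasDerivAt s (hw s)
    convert! h1 using 1
    have h2 : w s - q (w s) ∈ W := (hq _).1 (by simp [hqq])
    have h3 : q (ad (w s - q (w s))) = 0 := (hq _).2 (by rw [had]; exact hW _ hX _ h2)
    rw [map_sub, map_sub, sub_eq_zero] at h3
    exact h3.symm
  have h0 : q (w 0) = 0 := by simp [w, (hq Y).2 hY]
  have huniq := ODE_solution_unique (v := fun _ ↦ (q ∘L ad)) (K := ‖q ∘L ad‖₊)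
    (f := fun s ↦ q (w s)) (g := fun _ ↦ 0) (a := 0) (b := 1)
    (fun _ ↦ (q ∘L ad).lipschitz) (fun s _ ↦ (hy s).continuousAt.continuousWithinAt)
    (fun s _ ↦ (hy s).hasDerivWithinAt) continuousOn_const
    (fun s _ ↦ by simpa using! (hasDerivAt_const s (0 : 𝔸)).hasDerivWithinAt) h0
  have := huniq (show (1 : ℝ) ∈ Icc 0 1 by simp)
  rw [← hq]
  simpa [w] using this

/-- The logarithmic derivative of the exponential of a Lie algebra is in the Lie algebra. -/
theorem fderiv_exp_mul_exp_neg_mem {W : Submodule ℝ 𝔸}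
    (hW : ∀ X ∈ W, ∀ Y ∈ W, X * Y - Y * X ∈ W) {X Y : 𝔸} (hX : X ∈ W) (hY : Y ∈ W) :
    fderiv ℝ exp X Y * exp (-X) ∈ W := by
  have := FiniteDimensional.complete ℝ 𝔸
  have hec : Continuous (exp : 𝔸 → 𝔸) := (contDiff_normedSpace_exp (𝔸 := 𝔸)).continuous
  let Ad : ℝ → 𝔸 := fun s ↦ exp (s • X) * Y * exp (s • (-X))
  have hAd : ∀ s, Ad s ∈ W := fun s ↦ by
    simpa [Ad] using exp_mul_mul_exp_neg_mem hW (W.smul_mem s hX) hY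
  -- Perturbation of the one-parameter group: integrating the derivative of `v ε` in `s`, dividing
  -- by `ε` and letting `ε → 0` gives `d exp_X(Y) e^{-X} = ∫₀¹ e^{sX} Y e^{-sX} ds`, whose integrand
  -- is in `W`.
  let v : ℝ → ℝ → 𝔸 := fun ε s ↦ exp (s • (X + ε • Y)) * exp (s • (-X))
  have hcont : Continuous (Function.uncurry fun ε s ↦ v ε s * Ad s) := by
    simp only [v, Ad, Function.uncurry_def]
    fun_prop
  have hv : ∀ ε s, HasDerivAt (v ε) (ε • (v ε s * Ad s)) s := by
    intro ε s
    have h1 := hasDerivAt_exp_smul_const (X + ε • Y) s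
    have h2 := hasDerivAt_exp_smul_const' (-X) s
    convert! h1.mul h2 using 1
    have h3 : exp (s • (-X)) * exp (s • X) = 1 := by
      simpa using exp_neg_mul_exp (s • X)
    simp only [v, Ad]
    calc ε • (exp (s • (X + ε • Y)) * exp (s • -X) * (exp (s • X) * Y * exp (s • -X)))
        = ε • (exp (s • (X + ε • Y)) * (exp (s • -X) * exp (s • X)) * Y * exp (s • -X)) := by
          simp only [mul_assoc]
      _ = _ := by rw [h3]; simp only [mul_add, add_mul, mul_assoc, mul_one]; simp
  have hint : ∀ ε, v ε 1 - 1 = ε • ∫ s in (0 : ℝ)..1, v ε s * Ad s := by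
    intro ε
    have hcε : Continuous fun s ↦ v ε s * Ad s := by
      simp only [v, Ad]; fun_prop
    have := intervalIntegral.integral_eq_sub_of_hasDerivAt (fun s _ ↦ hv ε s)
      ((hcε.const_smul ε).intervalIntegrable 0 1)
    rw [intervalIntegral.integral_smul] at this
    rw [this]; simp [v]
  have hder : HasDerivAt (fun ε ↦ v ε 1) (∫ s in (0 : ℝ)..1, v 0 s * Ad s) 0 := by
    rw [hasDerivAt_iff_tendsto_slope]
    have hc := (intervalIntegral.continuous_parametric_intervalIntegral_of_continuous'
      (μ := MeasureTheory.volume) hcont 0 1).tendsto 0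
    refine (hc.mono_left nhdsWithin_le_nhds).congr' ?_
    filter_upwards [self_mem_nhdsWithin] with ε hε
    have h1 : v 0 1 = 1 := by simpa [v] using exp_mul_exp_neg X
    rw [slope_def_module, h1, hint, sub_zero, smul_smul, inv_mul_cancel₀ hε, one_smul]
  have hder' : HasDerivAt (fun ε ↦ v ε 1) (fderiv ℝ exp X Y * exp (-X)) 0 := by
    have h1 : HasFDerivAt exp (fderiv ℝ exp X) (X + (0 : ℝ) • Y) := by
      rw [zero_smul, add_zero]
      exact ((contDiff_normedSpace_exp (𝔸 := 𝔸)).differentiable (by simp)).differentiableAt.hasFDerivAt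
    have h2 : HasDerivAt (fun ε : ℝ ↦ X + ε • Y) Y 0 := by
      simpa using ((hasDerivAt_id (0 : ℝ)).smul_const Y).const_add X
    simpa [v] using (h1.comp_hasDerivAt 0 h2).mul_const (exp (-X))
  rw [hder'.unique hder]
  refine W.intervalIntegral_mem zero_le_one ?_ ?_
  · have : Continuous fun s ↦ v 0 s * Ad s := by simp only [v, Ad]; fun_prop
    exact this.continuousOn
  · intro s _
    have h1 : v 0 s = 1 := by simpa [v] using exp_mul_exp_neg (s • X)
    rw [h1, one_mul]
    exact hAd s

/-- A first integral of the foliation of the units of `𝔸` by the cosets of the connected subgroup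
with Lie algebra `W`, near `1`. -/
theorem exists_first_integral {W : Submodule ℝ 𝔸}
    (hW : ∀ X ∈ W, ∀ Y ∈ W, X * Y - Y * X ∈ W) :
    ∃ (U : Set 𝔸) (I : 𝔸 → 𝔸), IsOpen U ∧ 1 ∈ U ∧ DifferentiableOn ℝ I U ∧ I 1 = 0 ∧
      (∀ X, fderiv ℝ I 1 X = 0 → X ∈ W) ∧ (∀ g ∈ U, ∀ X ∈ W, fderiv ℝ I g (X * g) = 0) ∧
      ∀ g ∈ U, I g = 0 → ∃ X ∈ W, g = exp X := by
  have := FiniteDimensional.complete ℝ 𝔸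
  obtain ⟨q, hq, hqq⟩ := W.exists_clm_projection
  have hexp : ContDiff ℝ 1 (exp : 𝔸 → 𝔸) := (contDiff_normedSpace_exp (𝔸 := 𝔸)).of_le (by simp)
  let p : 𝔸 →L[ℝ] 𝔸 := 1 - q
  have hp : ∀ Y, p Y ∈ W := fun Y ↦ (hq _).1 (by simp [p, hqq])
  -- A chart of `𝔸` near `1` adapted to the splitting by `p` and `q`. The slices with `q Y` fixed
  -- are pieces of the cosets `exp(W) g`, so `q ∘ Φ⁻¹` is the first integral.
  let Φ : 𝔸 → 𝔸 := fun Y ↦ exp (p Y) * (1 + q Y)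
  have hΦ : ContDiff ℝ 1 Φ := (hexp.comp p.contDiff).mul (contDiff_const.add q.contDiff)
  have hΦ' : ∀ Y Z, fderiv ℝ Φ Y Z = exp (p Y) * q Z + fderiv ℝ exp (p Y) (p Z) * (1 + q Y) := by
    intro Y Z
    have h1 : HasFDerivAt (fun Y ↦ exp (p Y)) (fderiv ℝ exp (p Y) ∘L p) Y :=
      ((hexp.differentiable one_ne_zero) _).hasFDerivAt.comp Y p.hasFDerivAt
    have h2 : HasFDerivAt (fun Y ↦ 1 + q Y) q Y := q.hasFDerivAt.const_add 1
    have h3 := (h1.mul' h2).fderiv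
    rw [show Φ = (fun Y ↦ exp (p Y)) * (fun Y ↦ 1 + q Y) from rfl, h3]
    simp
  have hp0 : p 0 = 0 := map_zero _
  have hd1 : fderiv ℝ (exp : 𝔸 → 𝔸) 0 = 1 := (hasFDerivAt_exp_zero (𝕂 := ℝ)).fderiv
  have hΦ0 : HasFDerivAt Φ ((ContinuousLinearEquiv.refl ℝ 𝔸 : 𝔸 ≃L[ℝ] 𝔸) : 𝔸 →L[ℝ] 𝔸) 0 := by
    convert! (hΦ.differentiable one_ne_zero 0).hasFDerivAt using 1
    ext Z
    rw [hΦ', hp0, hd1]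
    simp [p]
  let e := hΦ.contDiffAt.toOpenPartialHomeomorph Φ hΦ0 one_ne_zero
  have he0 : (0 : 𝔸) ∈ e.source := hΦ.contDiffAt.mem_toOpenPartialHomeomorph_source hΦ0 one_ne_zero
  have heΦ : ∀ Y, e Y = Φ Y := fun Y ↦ rfl
  have hΦ1 : Φ 0 = 1 := by simp [Φ]
  -- the set of parameters at which everything is invertible
  have hopen1 : IsOpen {Y : 𝔸 | IsUnit (fderiv ℝ Φ Y)} :=
    Units.isOpen.preimage (hΦ.continuous_fderiv one_ne_zero)
  have hopen2 : IsOpen {Y : 𝔸 | IsUnit (Φ Y)} := Units.isOpen.preimage hΦ.continuous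
  let S : Set 𝔸 := e.source ∩ ({Y : 𝔸 | IsUnit (fderiv ℝ Φ Y)} ∩ {Y : 𝔸 | IsUnit (Φ Y)})
  have hS : IsOpen S := e.open_source.inter (hopen1.inter hopen2)
  have hS0 : (0 : 𝔸) ∈ S := by
    refine ⟨he0, ?_, ?_⟩
    · change IsUnit _
      rw [hΦ0.fderiv]; exact isUnit_one
    · change IsUnit _
      rw [hΦ1]; exact isUnit_one
  have hU : IsOpen (e '' S) := e.isOpen_image_of_subset_source hS inter_subset_left
  have hder : ∀ Y ∈ S, ∃ Ψ : 𝔸 →L[ℝ] 𝔸, HasFDerivAt e.symm Ψ (Φ Y) ∧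
      ∀ Z, Ψ (fderiv ℝ Φ Y Z) = Z := by
    rintro Y ⟨hY, hY1, hY2⟩
    obtain ⟨u, hu⟩ := hY1
    have h1 : HasFDerivAt e ((ContinuousLinearEquiv.ofUnit u : 𝔸 ≃L[ℝ] 𝔸) : 𝔸 →L[ℝ] 𝔸)
        (e.symm (Φ Y)) := by
      rw [← heΦ, e.left_inv hY]
      have : ((ContinuousLinearEquiv.ofUnit u : 𝔸 ≃L[ℝ] 𝔸) : 𝔸 →L[ℝ] 𝔸) = u := rfl
      rw [this, hu]
      exact (hΦ.differentiable one_ne_zero Y).hasFDerivAt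
    refine ⟨_, e.hasFDerivAt_symm (e.map_source hY) h1, fun Z ↦ ?_⟩
    rw [← hu]
    exact (ContinuousLinearEquiv.ofUnit u).symm_apply_apply Z
  refine ⟨e '' S, fun g ↦ q (e.symm g), hU, ⟨0, hS0, hΦ1⟩, ?_, ?_, ?_, ?_, ?_⟩
  · rintro _ ⟨Y, hY, rfl⟩
    obtain ⟨Ψ, hΨ, -⟩ := hder Y hY
    exact (q.hasFDerivAt.comp _ hΨ).differentiableAt.differentiableWithinAt
  · have : e.symm 1 = 0 := by rw [← hΦ1, ← heΦ, e.left_inv he0]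
    simp [this]
  · intro X hX
    obtain ⟨Ψ, hΨ, hΨ'⟩ := hder 0 hS0
    rw [hΦ1] at hΨ
    have h1 := (q.hasFDerivAt.comp _ hΨ).fderiv
    have h2 : Ψ X = X := by simpa [hΦ0.fderiv] using hΨ' X
    rw [show (fun g ↦ q (e.symm g)) = q ∘ e.symm from rfl, h1] at hX
    exact (hq X).1 (by simpa [h2] using hX)
  · rintro _ ⟨Y, hY, rfl⟩ X hX
    obtain ⟨Ψ, hΨ, hΨ'⟩ := hder Y hY
    rw [show (fun g ↦ q (e.symm g)) = q ∘ e.symm from rfl, heΦ, (q.hasFDerivAt.comp _ hΨ).fderiv]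
    obtain ⟨-, hY1, g, hg⟩ := hY
    -- `Z ↦ DΦ(Z) Φ⁻¹` is an automorphism of `W`
    let ℓ : 𝔸 →ₗ[ℝ] 𝔸 :=
      { toFun := fun Z ↦ fderiv ℝ Φ Y Z * (↑g⁻¹ : 𝔸)
        map_add' := fun a b ↦ by simp [add_mul]
        map_smul' := fun a b ↦ by simp }
    have hℓ : ∀ Z ∈ W, ℓ Z ∈ W := by
      intro Z hZ
      have h1 : fderiv ℝ Φ Y Z = (fderiv ℝ exp (p Y) Z * exp (-p Y)) * Φ Y := by
        rw [hΦ', (hq Z).2 hZ]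
        have : p Z = Z := by simp [p, (hq Z).2 hZ]
        rw [this, mul_zero, zero_add, mul_assoc]
        simp only [Φ]
        rw [← mul_assoc (exp (-p Y)), exp_neg_mul_exp, one_mul]
      change fderiv ℝ Φ Y Z * (↑g⁻¹ : 𝔸) ∈ W
      rw [h1, mul_assoc, ← hg, Units.mul_inv, mul_one]
      exact fderiv_exp_mul_exp_neg_mem hW (hp Y) hZ
    have hinj : Function.Injective (ℓ.restrict hℓ) := by
      rw [← LinearMap.ker_eq_bot, LinearMap.ker_eq_bot']
      rintro ⟨Z, hZ⟩ h
      have h2 : fderiv ℝ Φ Y Z * (↑g⁻¹ : 𝔸) = 0 := congrArg Subtype.val h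
      have h3 : fderiv ℝ Φ Y Z = 0 := by
        rw [← mul_one (fderiv ℝ Φ Y Z), ← Units.inv_mul g, ← mul_assoc, h2, zero_mul]
      ext
      simpa [h3] using (hΨ' Z).symm
    -- An injective endomorphism of the finite dimensional space `W` is onto, so `X * Φ Y` is the
    -- image under the derivative of `Φ` of some `Z ∈ W`, and `q` kills `Z`.
    obtain ⟨⟨Z, hZ⟩, hZX⟩ := (LinearMap.injective_iff_surjective.1 hinj) ⟨X, hX⟩
    have h2 : fderiv ℝ Φ Y Z * (↑g⁻¹ : 𝔸) = X := congrArg Subtype.val hZX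
    have h3 : X * Φ Y = fderiv ℝ Φ Y Z := by
      rw [← h2, ← hg, mul_assoc, Units.inv_mul, mul_one]
    simp [h3, hΨ', (hq Z).2 hZ]
  · rintro _ ⟨Y, hY, rfl⟩ h
    change q (e.symm (e Y)) = 0 at h
    rw [e.left_inv hY.1] at h
    exact ⟨p Y, hp Y, by simp [heΦ, Φ, h]⟩

/-! ### The group generated by a Lie algebra, and curves in its cosets. -/

/-- The (connected) group generated by the exponentials of a linear subspace. -/
noncomputable def expGroup (W : Submodule ℝ 𝔸) : Submonoid 𝔸 := Submonoid.closure (exp '' (W : Set 𝔸))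

theorem exp_mem_expGroup {W : Submodule ℝ 𝔸} {X : 𝔸} (hX : X ∈ W) : exp X ∈ expGroup W :=
  Submonoid.subset_closure (mem_image_of_mem _ hX)

/-- As `W` is closed under negation, the monoid `expGroup W` is in fact a group. -/
theorem exists_mul_eq_one_of_mem_expGroup {W : Submodule ℝ 𝔸} {g : 𝔸} (hg : g ∈ expGroup W) :
    ∃ h ∈ expGroup W, h * g = 1 := by
  have := FiniteDimensional.complete ℝ 𝔸
  induction hg using Submonoid.closure_induction with
  | mem x hx =>
    obtain ⟨X, hX, rfl⟩ := hx
    exact ⟨exp (-X), exp_mem_expGroup (W.neg_mem hX), exp_neg_mul_exp X⟩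
  | one => exact ⟨1, one_mem _, one_mul 1⟩
  | mul x y _ _ hx hy =>
    obtain ⟨x', hx', h1⟩ := hx
    obtain ⟨y', hy', h2⟩ := hy
    exact ⟨y' * x', mul_mem hy' hx', by rw [mul_assoc, ← mul_assoc x', h1, one_mul, h2]⟩

/-- If `g` normalizes `W`, it normalizes the group generated by `W`. -/
theorem conj_mem_expGroup {W : Submodule ℝ 𝔸} {g : 𝔸ˣ}
    (hg : ∀ X ∈ W, (g : 𝔸) * X * (↑g⁻¹ : 𝔸) ∈ W) {h : 𝔸} (hh : h ∈ expGroup W) :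
    (g : 𝔸) * h * (↑g⁻¹ : 𝔸) ∈ expGroup W := by
  have := FiniteDimensional.complete ℝ 𝔸
  let : NormedAlgebra ℚ 𝔸 := NormedAlgebra.restrictScalars ℚ ℝ 𝔸
  induction hh using Submonoid.closure_induction with
  | mem x hx =>
    obtain ⟨X, hX, rfl⟩ := hx
    rw [← exp_units_conj]
    exact exp_mem_expGroup (hg X hX)
  | one => rw [mul_one, Units.mul_inv]; exact one_mem _
  | mul x y _ _ hx hy =>
    have := mul_mem hx hy
    rwa [show (g : 𝔸) * x * (↑g⁻¹ : 𝔸) * ((g : 𝔸) * y * (↑g⁻¹ : 𝔸)) =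
      g * (x * y) * (↑g⁻¹ : 𝔸) by simp [mul_assoc]] at this

/-- A curve whose right logarithmic derivative is in a Lie algebra stays in a coset of the group
generated by it. -/
theorem exists_expGroup_of_hasDerivAt {W : Submodule ℝ 𝔸}
    (hW : ∀ X ∈ W, ∀ Y ∈ W, X * Y - Y * X ∈ W) {u : ℝ → 𝔸} {a b : ℝ} {s : Set ℝ}
    (hs : s.Countable) (hc : ContinuousOn u (Icc a b)) (hu : ∀ t ∈ Icc a b, IsUnit (u t))
    (hd : ∀ t ∈ Ioo a b \ s, ∃ X ∈ W, HasDerivAt u (X * u t) t) {t₁ t₂ : ℝ}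
    (h₁ : t₁ ∈ Icc a b) (h₂ : t₂ ∈ Icc a b) : ∃ h ∈ expGroup W, u t₂ = h * u t₁ := by
  have := FiniteDimensional.complete ℝ 𝔸
  obtain ⟨U, I, hU, hU1, hI, hI1, -, hIW, hIexp⟩ := exists_first_integral hW
  have hsymm : ∀ x y : ℝ, x ∈ Icc a b → y ∈ Icc a b → (∃ h ∈ expGroup W, u y = h * u x) →
      ∃ h ∈ expGroup W, u x = h * u y := by
    rintro x y - - ⟨h, hh, hxy⟩
    obtain ⟨h', hh', h1⟩ := exists_mul_eq_one_of_mem_expGroup hh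
    exact ⟨h', hh', by rw [hxy, ← mul_assoc, h1, one_mul]⟩
  -- Lying in the same coset is an equivalence relation on times, so on an interval it is enough to
  -- check it locally.
  refine isPreconnected_Icc.induction₂ (fun t t' ↦ ∃ h ∈ expGroup W, u t' = h * u t) ?_ ?_ hsymm
    h₁ h₂
  · intro t₀ ht₀
    obtain ⟨g, hg⟩ := hu t₀ ht₀
    -- Right multiplication by `u(t₀)⁻¹` does not change the right logarithmic derivative and moves
    -- the curve into the domain of the first integral near `1`.
    let v : ℝ → 𝔸 := fun t ↦ u t * (↑g⁻¹ : 𝔸)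
    have hv : ContinuousOn v (Icc a b) := hc.mul continuousOn_const
    have hv0 : v t₀ = 1 := by simp [v, ← hg]
    have hmem : v ⁻¹' U ∈ 𝓝[Icc a b] t₀ :=
      (hv t₀ ht₀).preimage_mem_nhdsWithin (hU.mem_nhds (by rwa [hv0]))
    obtain ⟨ε, hε, hball⟩ := Metric.mem_nhdsWithin_iff.1 hmem
    filter_upwards [inter_mem_nhdsWithin (Icc a b) (Metric.ball_mem_nhds t₀ hε)] with t ht
    -- the first integral is constant along the curve
    have key : ∀ x y : ℝ, x ∈ Icc a b → y ∈ Icc a b → x ∈ Metric.ball t₀ ε →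
        y ∈ Metric.ball t₀ ε → x ≤ y → I (v y) = I (v x) := by
      intro x y hx hy hxε hyε hxy
      have hsub : Icc x y ⊆ Metric.ball t₀ ε ∩ Icc a b := fun z hz ↦
        ⟨(convex_ball t₀ ε).ordConnected.out hxε hyε hz, hx.1.trans hz.1, hz.2.trans hy.2⟩
      refine eq_of_hasDerivAt_zero_off_countable hxy hs (u := fun t ↦ I (v t)) ?_ ?_
      · exact hI.continuousOn.comp (hv.mono fun z hz ↦ (hsub hz).2) fun z hz ↦ hball (hsub hz)
      · rintro z ⟨hz, hzs⟩
        have hz' : z ∈ Ioo a b \ s := ⟨⟨hx.1.trans_lt hz.1, hz.2.trans_le hy.2⟩, hzs⟩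
        obtain ⟨X, hX, hXu⟩ := hd z hz'
        have hzU : v z ∈ U := hball (hsub (Ioo_subset_Icc_self hz))
        have h1 : HasDerivAt v (X * v z) z := by
          simpa [v, mul_assoc] using hXu.mul_const (↑g⁻¹ : 𝔸)
        have h2 := ((hI.differentiableAt (hU.mem_nhds hzU)).hasFDerivAt).comp_hasDerivAt z h1
        rwa [hIW _ hzU X hX] at h2
    have hI0 : I (v t) = 0 := by
      have ht₀ε : t₀ ∈ Metric.ball t₀ ε := Metric.mem_ball_self hε
      rcases le_total t₀ t with h | h
      · rw [key t₀ t ht₀ ht.1 ht₀ε ht.2 h, hv0, hI1]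
      · rw [← key t t₀ ht.1 ht₀ ht.2 ht₀ε h, hv0, hI1]
    obtain ⟨X, hX, hXv⟩ := hIexp _ (hball ⟨ht.2, ht.1⟩) hI0
    refine ⟨exp X, exp_mem_expGroup hX, ?_⟩
    rw [← hXv, ← hg]
    simp [v]
  · rintro x y z - - - ⟨h, hh, h1⟩ ⟨h', hh', h2⟩
    exact ⟨h' * h, mul_mem hh' hh, by rw [h2, h1, mul_assoc]⟩

/-- The product of `k` exponentials of elements of a subspace, the subspace being given by a
projection `p`. -/
noncomputable def expProd (p : 𝔸 →L[ℝ] 𝔸) : (k : ℕ) → (Fin k → 𝔸) → 𝔸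
  | 0, _ => 1
  | k + 1, X => exp (p (X 0)) * expProd p k (fun i ↦ X i.succ)

/-- By the product rule, the right logarithmic derivative of `x y` is that of `x` plus the conjugate
by `x` of that of `y`. Both are in `W` when `x` is the exponential of an element of `W`. Applying
`p` to the factors lets the parameters range over the whole of `𝔸`. -/
theorem hasFDerivAt_expProd {W : Submodule ℝ 𝔸} (hW : ∀ X ∈ W, ∀ Y ∈ W, X * Y - Y * X ∈ W)
    {p : 𝔸 →L[ℝ] 𝔸} (hp : ∀ Y, p Y ∈ W) (k : ℕ) (X : Fin k → 𝔸) :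
    ∃ D : (Fin k → 𝔸) →L[ℝ] 𝔸, HasFDerivAt (expProd p k) D X ∧
      ∀ Y, ∃ Z ∈ W, D Y = Z * expProd p k X := by
  have := FiniteDimensional.complete ℝ 𝔸
  induction k with
  | zero =>
    refine ⟨0, ?_, fun Y ↦ ⟨0, W.zero_mem, by simp⟩⟩
    rw [show expProd p 0 = fun _ ↦ (1 : 𝔸) from rfl]
    exact hasFDerivAt_const _ _
  | succ k ih =>
    obtain ⟨D, hD, hDW⟩ := ih (fun i ↦ X i.succ)
    let tl : (Fin (k + 1) → 𝔸) →L[ℝ] (Fin k → 𝔸) :=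
      ContinuousLinearMap.pi fun i ↦ ContinuousLinearMap.proj i.succ
    let hd : (Fin (k + 1) → 𝔸) →L[ℝ] 𝔸 := ContinuousLinearMap.proj 0
    have hexp : Differentiable ℝ (exp : 𝔸 → 𝔸) :=
      (contDiff_normedSpace_exp (𝔸 := 𝔸)).differentiable (by simp)
    have h1 : HasFDerivAt (fun X : Fin (k + 1) → 𝔸 ↦ exp (p (X 0)))
        (fderiv ℝ exp (p (X 0)) ∘L p ∘L hd) X :=
      (hexp _).hasFDerivAt.comp X (p ∘L hd).hasFDerivAt
    have h2 : HasFDerivAt (fun X : Fin (k + 1) → 𝔸 ↦ expProd p k (fun i ↦ X i.succ)) (D ∘L tl) X :=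
      HasFDerivAt.comp (g := expProd p k) X hD tl.hasFDerivAt
    refine ⟨_, h1.mul' h2, fun Y ↦ ?_⟩
    obtain ⟨Z, hZ, hDZ⟩ := hDW (tl Y)
    refine ⟨exp (p (X 0)) * Z * exp (-p (X 0)) +
      fderiv ℝ exp (p (X 0)) (p (Y 0)) * exp (-p (X 0)),
      W.add_mem (exp_mul_mul_exp_neg_mem hW (hp _) hZ) (fderiv_exp_mul_exp_neg_mem hW (hp _) (hp _)),
      ?_⟩
    have h3 : exp (-p (X 0)) * expProd p (k + 1) X = expProd p k (fun i ↦ X i.succ) := by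
      rw [expProd, ← mul_assoc, exp_neg_mul_exp, one_mul]
    rw [add_mul, mul_assoc (_ * Z), h3, mul_assoc (fderiv ℝ exp (p (X 0)) (p (Y 0))), h3]
    simp [hDZ, hd, mul_assoc]

/-- Countably many finite dimensional parameter spaces, one for each length, thus cover `expGroup
W`; this is the source of countability in the tangency argument. -/
theorem exists_expProd_eq {W : Submodule ℝ 𝔸} {p : 𝔸 →L[ℝ] 𝔸} (hp : ∀ Y ∈ W, p Y = Y) {h : 𝔸}
    (hh : h ∈ expGroup W) : ∃ (k : ℕ) (X : Fin k → 𝔸), expProd p k X = h := by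
  induction hh using Submonoid.closure_induction_left with
  | one => exact ⟨0, 0, rfl⟩
  | mul_left x hx y hy ih =>
    obtain ⟨X, hX, rfl⟩ := hx
    obtain ⟨k, Y, rfl⟩ := ih
    exact ⟨k + 1, Fin.cons X Y, by simp [expProd, hp X hX]⟩

/-- A differentiable function with vanishing derivative on an open set takes countably many
values. -/
theorem countable_image_of_hasFDerivAt_zero {V V' : Type*} [NormedAddCommGroup V]
    [NormedSpace ℝ V] [SecondCountableTopology V] [NormedAddCommGroup V'] [NormedSpace ℝ V']
    {O : Set V} (hO : IsOpen O) {I : V → V'} (hI : ∀ x ∈ O, HasFDerivAt I (0 : V →L[ℝ] V') x) :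
    (I '' O).Countable := by
  obtain ⟨D, hD, hDd⟩ := TopologicalSpace.exists_countable_dense V
  refine (hD.image I).mono ?_
  rintro _ ⟨x, hx, rfl⟩
  -- Around `x` the function is constant on a ball, and this ball meets the countable dense set.
  obtain ⟨ε, hε, hball⟩ := Metric.isOpen_iff.1 hO x hx
  obtain ⟨y, hy, hyD⟩ := hDd.inter_open_nonempty _ Metric.isOpen_ball (Metric.nonempty_ball.2 hε)
  refine ⟨y, hyD, ?_⟩
  exact Metric.isOpen_ball.is_const_of_fderiv_eq_zero (𝕜 := ℝ) (convex_ball x ε).isPreconnected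
    (fun z hz ↦ (hI z (hball hz)).differentiableAt.differentiableWithinAt)
    (fun z hz ↦ (hI z (hball hz)).fderiv) hy (Metric.mem_ball_self hε)

/-- A curve in a countable union of cosets of the group generated by a Lie algebra is tangent to the
Lie algebra. -/
theorem mem_of_hasDerivAt_of_countable_cosets {W : Submodule ℝ 𝔸}
    (hW : ∀ X ∈ W, ∀ Y ∈ W, X * Y - Y * X ∈ W) {c : ℝ → 𝔸} (hc : Continuous c) (hc1 : c 0 = 1)
    {A : 𝔸} (hA : HasDerivAt c A 0) {G : Set 𝔸} (hG : G.Countable)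
    (hcG : ∀ t, ∃ h ∈ expGroup W, ∃ g ∈ G, c t = h * g) : A ∈ W := by
  have := FiniteDimensional.complete ℝ 𝔸
  have := FiniteDimensional.proper ℝ 𝔸
  obtain ⟨U, I, hU, hU1, hI, hI1, hIA, hIW, -⟩ := exists_first_integral hW
  obtain ⟨q, hq, hqq⟩ := W.exists_clm_projection
  let p : 𝔸 →L[ℝ] 𝔸 := 1 - q
  have hp : ∀ Y, p Y ∈ W := fun Y ↦ (hq _).1 (by simp [p, hqq])
  have hp' : ∀ Y ∈ W, p Y = Y := fun Y hY ↦ by simp [p, (hq Y).2 hY]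
  -- Pulled back to the parameters of a coset the first integral has zero derivative, so it takes
  -- countably many values on each coset.
  have hcount : (⋃ g ∈ G, ⋃ k : ℕ, (fun X ↦ I (expProd p k X * g)) ''
      {X : Fin k → 𝔸 | expProd p k X * g ∈ U}).Countable := by
    refine hG.biUnion fun g _ ↦ countable_iUnion fun k ↦ ?_
    have hcont : Continuous fun X ↦ expProd p k X * g := by
      have : Continuous (expProd p k) := continuous_iff_continuousAt.2 fun X ↦
        (hasFDerivAt_expProd hW hp k X).choose_spec.1.continuousAt
      exact this.mul continuous_const
    refine countable_image_of_hasFDerivAt_zero (hU.preimage hcont) fun X hX ↦ ?_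
    obtain ⟨D, hD, hDW⟩ := hasFDerivAt_expProd hW hp k X
    have h1 := (hI.differentiableAt (hU.mem_nhds hX)).hasFDerivAt.comp X (hD.mul_const' g)
    convert! h1 using 1
    ext Y
    obtain ⟨Z, hZ, hDZ⟩ := hDW Y
    have := hIW _ hX Z hZ
    simp only [zero_apply, ContinuousLinearMap.comp_apply]
    rw [← this]
    congr 1
    simp [hDZ, mul_assoc]
  obtain ⟨ε, hε, hball⟩ := Metric.mem_nhds_iff.1
    (hc.continuousAt.preimage_mem_nhds (hU.mem_nhds (by rwa [hc1])) : c ⁻¹' U ∈ 𝓝 (0 : ℝ))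
  have hsub : (fun t ↦ I (c t)) '' Metric.ball 0 ε ⊆
      ⋃ g ∈ G, ⋃ k : ℕ, (fun X ↦ I (expProd p k X * g)) ''
        {X : Fin k → 𝔸 | expProd p k X * g ∈ U} := by
    rintro _ ⟨t, ht, rfl⟩
    obtain ⟨h, hh, g, hg, hct⟩ := hcG t
    obtain ⟨k, X, rfl⟩ := exists_expProd_eq hp' hh
    have htU : c t ∈ U := hball ht
    simp only [mem_iUnion]
    exact ⟨g, hg, k, X, by rw [mem_ofPred_eq, ← hct]; exact htU, by simp only [hct]⟩
  have hpre : IsPreconnected ((fun t ↦ I (c t)) '' Metric.ball 0 ε) :=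
    (convex_ball (0 : ℝ) ε).isPreconnected.image _
      (hI.continuousOn.comp hc.continuousOn fun t ht ↦ hball ht)
  -- The values of `I ∘ c` on an interval form a set that is both countable and connected, hence a
  -- single point.
  have hss := (hcount.mono hsub).isTotallyDisconnected _ subset_rfl hpre
  have hconst : (fun t ↦ I (c t)) =ᶠ[𝓝 0] fun _ ↦ I (c 0) := by
    filter_upwards [Metric.ball_mem_nhds (0 : ℝ) hε] with t ht
    exact hss (mem_image_of_mem _ ht) (mem_image_of_mem _ (Metric.mem_ball_self hε))
  refine hIA A ?_
  have h1 : HasDerivAt (fun t ↦ I (c t)) (fderiv ℝ I 1 A) 0 := by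
    rw [← hc1]
    exact (hI.differentiableAt (hU.mem_nhds (by rwa [hc1]))).hasFDerivAt.comp_hasDerivAt 0 hA
  exact h1.unique ((hasDerivAt_const 0 (I (c 0))).congr_of_eventuallyEq hconst)

end Lie

/-! ### Linear differential equations and their dependence on parameters -/

section Resolvent

variable {X Y : Type*} [NormedAddCommGroup X] [NormedSpace ℝ X] [CompleteSpace X]
  [NormedAddCommGroup Y] [NormedSpace ℝ Y]

/-- The factorization `1 - (-K)ⁿ = (1 + K) ∑ (-K)ⁱ` has commuting factors, and its left-hand side is
invertible by the Neumann series. A bound on a single power is what Volterra operators provide. -/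
theorem isUnit_one_add_of_norm_pow_lt_one (K : X →L[ℝ] X) {n : ℕ} (hn : ‖K ^ n‖ < 1) :
    IsUnit (1 + K) := by
  have h1 : ‖(-K) ^ n‖ < 1 := by
    rcases neg_one_pow_eq_or (X →L[ℝ] X) n with h | h <;> simpa [neg_pow K, h] using hn
  have h2 : IsUnit (1 - (-K) ^ n) := isUnit_one_sub_of_norm_lt_one h1
  rw [← mul_neg_geom_sum] at h2
  have hcomm : Commute (1 - (-K)) (∑ i ∈ Finset.range n, (-K) ^ i) :=
    (Commute.sum_right _ _ _ fun i _ ↦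
      ((Commute.one_left _).sub_left ((Commute.refl (-K)).pow_right i)))
  simpa using (hcomm.isUnit_mul_iff.1 h2).1

theorem inverse_one_add_apply (K : X →L[ℝ] X) (hK : IsUnit (1 + K)) (x : X) :
    Ring.inverse (1 + K) x + K (Ring.inverse (1 + K) x) = x := by
  have := congrArg (fun T : X →L[ℝ] X ↦ T x) (Ring.mul_inverse_cancel _ hK)
  simpa using this

/-- Inversion is smooth on units; this is how solutions of linear differential equations will be
differentiated with respect to parameters. -/
theorem differentiable_inverse_one_add (T : Y →L[ℝ] X →L[ℝ] X) (hT : ∀ y, IsUnit (1 + T y))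
    (x : X) : Differentiable ℝ fun y ↦ Ring.inverse (1 + T y) x := by
  intro y
  have h1 : DifferentiableAt ℝ Ring.inverse (1 + T y) := by
    obtain ⟨u, hu⟩ := hT y
    rw [← hu]
    exact (contDiffAt_ringInverse (n := 1) ℝ u).differentiableAt one_ne_zero
  have h2 : DifferentiableAt ℝ (fun y ↦ 1 + T y) y := T.differentiableAt.const_add 1
  exact (h1.comp y h2).clm_apply (differentiableAt_const _)

end Resolvent

/-! ### Linear differential equations as Volterra integral equations. -/

section Volterra

variable {𝔸 : Type*} [NormedRing 𝔸] [NormedAlgebra ℝ 𝔸] [CompleteSpace 𝔸]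

theorem continuous_volterra (u : C(Icc (0 : ℝ) 1, 𝔸)) :
    Continuous fun t : ℝ ↦ ∫ s in (0 : ℝ)..t, u (projIcc 0 1 zero_le_one s) :=
  intervalIntegral.continuous_primitive
    (fun _ _ ↦ (u.continuous.comp continuous_projIcc).intervalIntegrable _ _) 0

/-- The Volterra operator `u ↦ ∫₀ᵗ u`. -/
noncomputable def volterra : C(Icc (0 : ℝ) 1, 𝔸) →L[ℝ] C(Icc (0 : ℝ) 1, 𝔸) :=
  LinearMap.mkContinuous
    { toFun := fun u ↦ ⟨fun t ↦ ∫ s in (0 : ℝ)..t, u (projIcc 0 1 zero_le_one s),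
        (continuous_volterra u).comp continuous_subtype_val⟩
      map_add' := fun u v ↦ by
        ext t
        simp only [ContinuousMap.add_apply, ContinuousMap.coe_mk]
        exact intervalIntegral.integral_add
          ((u.continuous.comp continuous_projIcc).intervalIntegrable _ _)
          ((v.continuous.comp continuous_projIcc).intervalIntegrable _ _)
      map_smul' := fun c u ↦ by
        ext t
        simp }
    1 (fun u ↦ by
      rw [one_mul, ContinuousMap.norm_le _ (norm_nonneg u)]
      intro t
      have := intervalIntegral.norm_integral_le_of_norm_le_const (a := 0) (b := (t : ℝ)) (C := ‖u‖)
        (f := fun s ↦ u (projIcc 0 1 zero_le_one s)) (fun s _ ↦ u.norm_coe_le_norm _)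
      refine this.trans ?_
      rw [sub_zero, abs_of_nonneg t.2.1]
      exact mul_le_of_le_one_right (norm_nonneg u) t.2.2)

theorem volterra_apply (u : C(Icc (0 : ℝ) 1, 𝔸)) (t : Icc (0 : ℝ) 1) :
    volterra u t = ∫ s in (0 : ℝ)..t, u (projIcc 0 1 zero_le_one s) := rfl

/-- The operator `u ↦ ∫₀ᵗ A u`. -/
noncomputable def volterraMul (A : C(Icc (0 : ℝ) 1, 𝔸)) :
    C(Icc (0 : ℝ) 1, 𝔸) →L[ℝ] C(Icc (0 : ℝ) 1, 𝔸) :=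
  volterra ∘L ContinuousLinearMap.mul ℝ _ A

theorem volterraMul_apply (A u : C(Icc (0 : ℝ) 1, 𝔸)) : volterraMul A u = volterra (A * u) := rfl

/-- Each application of the operator integrates a power of `t` and gains a factor `‖A‖ t / (n + 1)`,
which accumulates to the factorial. -/
theorem norm_volterraMul_pow_apply_le (A u : C(Icc (0 : ℝ) 1, 𝔸)) (n : ℕ) (t : Icc (0 : ℝ) 1) :
    ‖(volterraMul A ^ n) u t‖ ≤ (‖A‖ * t) ^ n / n.factorial * ‖u‖ := by
  induction n generalizing t with
  | zero => simpa using u.norm_coe_le_norm t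
  | succ n ih =>
    rw [pow_succ', mul_apply_eq_comp, volterraMul_apply, volterra_apply]
    have hb : ∀ s ∈ Ioc (0 : ℝ) t, ‖(A * (volterraMul A ^ n) u) (projIcc 0 1 zero_le_one s)‖ ≤
        ‖A‖ * ((‖A‖ * s) ^ n / n.factorial * ‖u‖) := by
      intro s hs
      have hs' : s ∈ Icc (0 : ℝ) 1 := ⟨hs.1.le, hs.2.trans t.2.2⟩
      rw [ContinuousMap.mul_apply, projIcc_of_mem _ hs']
      exact (norm_mul_le _ _).trans (mul_le_mul (A.norm_coe_le_norm _) (ih ⟨s, hs'⟩)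
        (norm_nonneg _) (norm_nonneg _))
    refine (intervalIntegral.norm_integral_le_of_norm_le t.2.1
      (MeasureTheory.ae_of_all _ hb) ?_).trans ?_
    · exact Continuous.intervalIntegrable (by fun_prop) _ _
    · have hint : ∀ s : ℝ, ‖A‖ * ((‖A‖ * s) ^ n / n.factorial * ‖u‖) =
          (‖A‖ ^ (n + 1) / n.factorial * ‖u‖) * s ^ n := fun s ↦ by
        rw [mul_pow, pow_succ]; ring
      simp_rw [hint]
      rw [intervalIntegral.integral_const_mul, integral_pow]
      apply le_of_eq
      rw [Nat.factorial_succ, mul_pow]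
      push_cast
      have : (n.factorial : ℝ) ≠ 0 := by positivity
      field_simp
      ring

theorem exists_norm_volterraMul_pow_lt_one (A : C(Icc (0 : ℝ) 1, 𝔸)) :
    ∃ n : ℕ, ‖volterraMul A ^ n‖ < 1 := by
  -- The target `1/2` leaves room, as the operator norm bound obtained below is not strict.
  obtain ⟨n, hn⟩ := ((FloorSemiring.tendsto_pow_div_factorial_atTop ‖A‖).eventually
    (gt_mem_nhds (show (0 : ℝ) < 1 / 2 by norm_num))).exists
  refine ⟨n, lt_of_le_of_lt ?_ (show (1 : ℝ) / 2 < 1 by norm_num)⟩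
  refine ContinuousLinearMap.opNorm_le_bound _ (by norm_num) fun u ↦ ?_
  rw [ContinuousMap.norm_le _ (by positivity)]
  intro t
  refine (norm_volterraMul_pow_apply_le A u n t).trans
    (mul_le_mul_of_nonneg_right (le_trans ?_ hn.le) (norm_nonneg u))
  have : ‖A‖ * t ≤ ‖A‖ := mul_le_of_le_one_right (norm_nonneg _) t.2.2
  have h0 : 0 ≤ ‖A‖ * t := mul_nonneg (norm_nonneg _) t.2.1
  exact div_le_div_of_nonneg_right (pow_le_pow_left₀ h0 this n) (by positivity)

theorem isUnit_one_add_volterraMul (A : C(Icc (0 : ℝ) 1, 𝔸)) : IsUnit (1 + volterraMul A) :=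
  isUnit_one_add_of_norm_pow_lt_one _ (exists_norm_volterraMul_pow_lt_one A).choose_spec

/-- The solution of `u' = - A u`, `u(0) = 1` on `[0, 1]`. -/
noncomputable def linearFlow (A : C(Icc (0 : ℝ) 1, 𝔸)) : C(Icc (0 : ℝ) 1, 𝔸) :=
  Ring.inverse (1 + volterraMul A) 1

theorem linearFlow_add (A : C(Icc (0 : ℝ) 1, 𝔸)) :
    linearFlow A + volterra (A * linearFlow A) = 1 :=
  inverse_one_add_apply _ (isUnit_one_add_volterraMul A) 1

/-- The map `A ↦ (u ↦ ∫₀ᵗ A u)`. -/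
noncomputable def volterraMulL :
    C(Icc (0 : ℝ) 1, 𝔸) →L[ℝ] C(Icc (0 : ℝ) 1, 𝔸) →L[ℝ] C(Icc (0 : ℝ) 1, 𝔸) :=
  ContinuousLinearMap.compL ℝ _ _ _ volterra ∘L ContinuousLinearMap.mul ℝ _

theorem isUnit_one_add_volterraMulL (A : C(Icc (0 : ℝ) 1, 𝔸)) : IsUnit (1 + volterraMulL A) :=
  isUnit_one_add_volterraMul A

theorem differentiable_linearFlow :
    Differentiable ℝ (linearFlow : C(Icc (0 : ℝ) 1, 𝔸) → C(Icc (0 : ℝ) 1, 𝔸)) := by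
  have h := differentiable_inverse_one_add (volterraMulL (𝔸 := 𝔸)) isUnit_one_add_volterraMulL 1
  exact h

/-- A family of continuous curves which is pointwise continuously differentiable in the parameter,
jointly with the time, is differentiable. -/
theorem hasFDerivAt_continuousMap {E V : Type*} [NormedAddCommGroup E] [NormedSpace ℝ E]
    [FiniteDimensional ℝ E] [NormedAddCommGroup V] [NormedSpace ℝ V]
    {f : E → C(Icc (0 : ℝ) 1, V)} {f' : E → Icc (0 : ℝ) 1 → E →L[ℝ] V}
    (hf' : Continuous (fun p : E × Icc (0 : ℝ) 1 ↦ f' p.1 p.2))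
    (hf : ∀ z t, HasFDerivAt (fun z ↦ f z t) (f' z t) z) (z : E)
    {D : E →L[ℝ] C(Icc (0 : ℝ) 1, V)} (hD : ∀ u t, D u t = f' z t u) : HasFDerivAt f D z := by
  rw [hasFDerivAt_iff_isLittleO_nhds_zero, Asymptotics.isLittleO_iff]
  intro ε hε
  have := FiniteDimensional.proper ℝ E
  -- Compactness of `Icc 0 1` makes the convergence of `f' y t` to `f' z t` uniform in `t`, so that
  -- the mean value inequality holds with the same `ε` at all times.
  have h0 := Metric.tendstoUniformly_iff.1 (Continuous.tendstoUniformly f' hf' z) ε hε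
  obtain ⟨δ, hδ, hball⟩ := Metric.eventually_nhds_iff_ball.1 h0
  filter_upwards [Metric.ball_mem_nhds (0 : E) hδ] with u hu
  rw [ContinuousMap.norm_le _ (by positivity)]
  intro t
  have hu' : z + u ∈ Metric.ball z δ := by simpa using hu
  have := (convex_ball z δ).norm_image_sub_le_of_norm_hasFDerivWithin_le' (φ := f' z t) (C := ε)
    (f := fun y ↦ f y t) (fun y _ ↦ (hf y t).hasFDerivWithinAt) (fun y hy ↦ ?_)
    (Metric.mem_ball_self hδ) hu'
  · simpa [hD] using this
  · rw [← dist_eq_norm, dist_comm]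
    exact (hball y hy t).le

/-! #### The flow on the real line -/

theorem hasDerivAt_volterra (u : C(Icc (0 : ℝ) 1, 𝔸)) {t : ℝ} (ht : t ∈ Ioo (0 : ℝ) 1) :
    HasDerivAt (fun t ↦ volterra u (projIcc 0 1 zero_le_one t))
      (u (projIcc 0 1 zero_le_one t)) t := by
  have h1 : HasDerivAt (fun t : ℝ ↦ ∫ s in (0 : ℝ)..t, u (projIcc 0 1 zero_le_one s))
      (u (projIcc 0 1 zero_le_one t)) t :=
    intervalIntegral.integral_hasDerivAt_right
      ((u.continuous.comp continuous_projIcc).intervalIntegrable _ _)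
      ((u.continuous.comp continuous_projIcc).stronglyMeasurableAtFilter _ _)
      (u.continuous.comp continuous_projIcc).continuousAt
  refine h1.congr_of_eventuallyEq ?_
  filter_upwards [Ioo_mem_nhds ht.1 ht.2] with s hs
  rw [volterra_apply, projIcc_of_mem _ (Ioo_subset_Icc_self hs)]

theorem hasDerivAt_linearFlow (A : C(Icc (0 : ℝ) 1, 𝔸)) {t : ℝ} (ht : t ∈ Ioo (0 : ℝ) 1) :
    HasDerivAt (fun t ↦ linearFlow A (projIcc 0 1 zero_le_one t))
      (-(A (projIcc 0 1 zero_le_one t) * linearFlow A (projIcc 0 1 zero_le_one t))) t := by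
  have h1 := (hasDerivAt_volterra (A * linearFlow A) ht).const_sub 1
  have h2 : ∀ s, linearFlow A s = 1 - volterra (A * linearFlow A) s := fun s ↦ by
    have := congrArg (fun u : C(Icc (0 : ℝ) 1, 𝔸) ↦ u s) (linearFlow_add A)
    simp only [ContinuousMap.add_apply, ContinuousMap.one_apply] at this
    rw [← this, add_sub_cancel_right]
  have h3 : (fun t ↦ linearFlow A (projIcc 0 1 zero_le_one t)) =
      fun t ↦ 1 - volterra (A * linearFlow A) (projIcc 0 1 zero_le_one t) := funext fun s ↦ h2 _
  rw [h3]
  exact h1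

theorem linearFlow_zero (A : C(Icc (0 : ℝ) 1, 𝔸)) :
    linearFlow A (projIcc 0 1 zero_le_one 0) = 1 := by
  have := congrArg (fun u : C(Icc (0 : ℝ) 1, 𝔸) ↦ u (projIcc 0 1 zero_le_one 0)) (linearFlow_add A)
  simpa [volterra_apply, projIcc_of_mem zero_le_one (left_mem_Icc.2 (zero_le_one' ℝ))] using this

/-- The solution of `l' = l A`, `l(0) = 1` on `[0, 1]`. -/
noncomputable def linearFlowInv (A : C(Icc (0 : ℝ) 1, 𝔸)) (t : Icc (0 : ℝ) 1) : 𝔸 :=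
  MulOpposite.unop
    (linearFlow (𝔸 := 𝔸ᵐᵒᵖ)
      ⟨fun s ↦ MulOpposite.op (-(A s)), MulOpposite.continuous_op.comp A.continuous.neg⟩ t)

theorem hasDerivAt_linearFlowInv (A : C(Icc (0 : ℝ) 1, 𝔸)) {t : ℝ} (ht : t ∈ Ioo (0 : ℝ) 1) :
    HasDerivAt (fun t ↦ linearFlowInv A (projIcc 0 1 zero_le_one t))
      (linearFlowInv A (projIcc 0 1 zero_le_one t) * A (projIcc 0 1 zero_le_one t)) t := by
  have h1 := hasDerivAt_linearFlow (𝔸 := 𝔸ᵐᵒᵖ)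
    ⟨fun s ↦ MulOpposite.op (-(A s)), MulOpposite.continuous_op.comp A.continuous.neg⟩ ht
  have h2 := ((MulOpposite.opContinuousLinearEquiv ℝ (M := 𝔸)).symm :
    𝔸ᵐᵒᵖ →L[ℝ] 𝔸).hasFDerivAt.comp_hasDerivAt t h1
  refine h2.congr_deriv ?_
  change MulOpposite.unop (-(MulOpposite.op (-(A _)) * _)) = _
  rw [MulOpposite.unop_neg, MulOpposite.unop_mul, MulOpposite.unop_op, mul_neg, neg_neg]
  rfl

theorem linearFlowInv_zero (A : C(Icc (0 : ℝ) 1, 𝔸)) :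
    linearFlowInv A (projIcc 0 1 zero_le_one 0) = 1 := by
  rw [linearFlowInv, linearFlow_zero]; rfl

theorem continuous_linearFlowInv (A : C(Icc (0 : ℝ) 1, 𝔸)) : Continuous (linearFlowInv A) :=
  MulOpposite.continuous_unop.comp (ContinuousMap.continuous _)

/-- A solution `u` of `u' = - A u` is `linearFlow A · u(0)`. -/
theorem linearFlowInv_mul_eq (A : C(Icc (0 : ℝ) 1, 𝔸)) {u : ℝ → 𝔸} {s : Set ℝ} (hs : s.Countable)
    (hc : ContinuousOn u (Icc 0 1)) (hd : ∀ t ∈ Ioo (0 : ℝ) 1 \ s,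
      HasDerivAt u (-(A (projIcc 0 1 zero_le_one t) * u t)) t) {t : ℝ} (ht : t ∈ Icc (0 : ℝ) 1) :
    linearFlowInv A (projIcc 0 1 zero_le_one t) * u t = u 0 := by
  -- With `l' = l A` and `u' = -A u` the product `l u` has derivative `l A u - l A u = 0`.
  have := eq_of_hasDerivAt_zero_off_countable ht.1 hs
    (u := fun t ↦ linearFlowInv A (projIcc 0 1 zero_le_one t) * u t)
    (((continuous_linearFlowInv A).comp continuous_projIcc).continuousOn.mul
      (hc.mono (Icc_subset_Icc_right ht.2))) (fun r hr ↦ by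
        have hr' : r ∈ Ioo (0 : ℝ) 1 := ⟨hr.1.1, hr.1.2.trans_le ht.2⟩
        refine ((hasDerivAt_linearFlowInv A hr').mul (hd r ⟨hr', hr.2⟩)).congr_deriv ?_
        rw [mul_assoc, mul_neg, add_neg_cancel])
  rw [this, linearFlowInv_zero, one_mul]

theorem linearFlowInv_mul_linearFlow (A : C(Icc (0 : ℝ) 1, 𝔸)) {t : ℝ} (ht : t ∈ Icc (0 : ℝ) 1) :
    linearFlowInv A (projIcc 0 1 zero_le_one t) * linearFlow A (projIcc 0 1 zero_le_one t) = 1 := by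
  rw [linearFlowInv_mul_eq A (u := fun t ↦ linearFlow A (projIcc 0 1 zero_le_one t))
    countable_empty ((linearFlow A).continuous.comp continuous_projIcc).continuousOn
    (fun r hr ↦ hasDerivAt_linearFlow A hr.1) ht, linearFlow_zero]

end Volterra

/-- In finite dimension, left multiplication by `b` is injective, hence onto, so a left inverse is
an inverse. -/
theorem isUnit_and_inverse_eq_of_mul_eq_one {𝔸 : Type*} [Ring 𝔸] [Algebra ℝ 𝔸]
    [FiniteDimensional ℝ 𝔸] {a b : 𝔸} (h : a * b = 1) : b * a = 1 ∧ IsUnit b ∧ Ring.inverse b = a := by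
  have h1 : b * a = 1 := by
    have hinj : Function.Injective (LinearMap.mulLeft ℝ b) := by
      intro x y hxy
      have : a * (b * x) = a * (b * y) := congrArg (a * ·) hxy
      rwa [← mul_assoc, ← mul_assoc, h, one_mul, one_mul] at this
    obtain ⟨c, hc⟩ := (LinearMap.injective_iff_surjective.1 hinj) 1
    have hc' : b * c = 1 := hc
    rwa [show c = a by rw [← one_mul c, ← h, mul_assoc, hc', mul_one]] at hc'
  refine ⟨h1, ⟨⟨b, a, h1, h⟩, rfl⟩, ?_⟩
  exact Ring.inverse_unit ⟨b, a, h1, h⟩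

/-! ### Radial parallel transport of a matrix valued one-form -/

section Generic

variable {𝔹 Z : Type*} [NormedRing 𝔹] [NormedAlgebra ℝ 𝔹] [NormedAddCommGroup Z] [NormedSpace ℝ Z]

/-- The derivative of a solution is characterized by the linearized equation, found by
differentiating the equation itself. No formula for the derivative of the resolvent is needed. -/
theorem exists_hasFDerivAt_of_add_eq {X : Type*} [NormedAddCommGroup X] [NormedSpace ℝ X]
    (V : X →L[ℝ] X →L[ℝ] X) (x : X) {H : X → X} (hH : Differentiable ℝ H)
    (hV : ∀ A, H A + V A (H A) = x) {f : Z → X} {D : Z →L[ℝ] X} {z : Z}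
    (hf : HasFDerivAt f D z) : ∃ K : Z →L[ℝ] X, HasFDerivAt (fun z ↦ H (f z)) K z ∧
      ∀ u, K u + (V (D u) (H (f z)) + V (f z) (K u)) = 0 := by
  have hK : HasFDerivAt (fun z ↦ H (f z)) (fderiv ℝ H (f z) ∘L D) z :=
    HasFDerivAt.comp (g := H) z (hH (f z)).hasFDerivAt hf
  refine ⟨_, hK, fun u ↦ ?_⟩
  have h0 : HasFDerivAt (fun z ↦ V (f z) (H (f z))) _ z :=
    (HasFDerivAt.comp (g := V) z V.hasFDerivAt hf).clm_apply hK
  have h1 := hK.add h0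
  have h2 := h1.unique ((hasFDerivAt_const x z).congr_of_eventuallyEq
    (Filter.Eventually.of_forall fun z ↦ hV (f z)))
  have h3 := congrArg (fun T : Z →L[ℝ] X ↦ T u) h2
  refine Eq.trans ?_ h3
  rw [add_comm (V (D u) _)]
  rfl

theorem hasFDerivAt_continuousMap_apply {V : Type*} [NormedAddCommGroup V] [NormedSpace ℝ V]
    {f : Z → C(Icc (0 : ℝ) 1, V)} {D : Z →L[ℝ] C(Icc (0 : ℝ) 1, V)} {z : Z}
    (hf : HasFDerivAt f D z) (t : Icc (0 : ℝ) 1) :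
    ∃ D' : Z →L[ℝ] V, HasFDerivAt (fun z ↦ f z t) D' z ∧ ∀ u, D' u = D u t := by
  let e : C(Icc (0 : ℝ) 1, V) →L[ℝ] V := LinearMap.mkContinuous
    { toFun := fun c ↦ c t, map_add' := fun _ _ ↦ rfl, map_smul' := fun _ _ ↦ rfl } 1
    (fun c ↦ by rw [one_mul]; exact c.norm_coe_le_norm t)
  exact ⟨e ∘L D, HasFDerivAt.comp (g := e) z e.hasFDerivAt hf, fun _ ↦ rfl⟩

theorem exists_hasFDerivAt_linearFlow [CompleteSpace 𝔹] {f : Z → C(Icc (0 : ℝ) 1, 𝔹)}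
    {D : Z →L[ℝ] C(Icc (0 : ℝ) 1, 𝔹)} {z : Z} (hf : HasFDerivAt f D z) :
    ∃ K : Z →L[ℝ] C(Icc (0 : ℝ) 1, 𝔹), HasFDerivAt (fun z ↦ linearFlow (f z)) K z ∧
      ∀ u, K u + volterra (D u * linearFlow (f z) + f z * K u) = 0 := by
  obtain ⟨K, hK, h⟩ := exists_hasFDerivAt_of_add_eq (X := C(Icc (0 : ℝ) 1, 𝔹)) volterraMulL 1
    differentiable_linearFlow linearFlow_add hf
  refine ⟨K, hK, fun u ↦ ?_⟩
  rw [map_add]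
  exact h u

theorem hasDerivAt_line (a z : Z) (t : ℝ) : HasDerivAt (fun t : ℝ ↦ a + t • (z - a)) (z - a) t := by
  simpa using ((hasDerivAt_id t).smul_const (z - a)).const_add a

theorem hasDerivAt_clm_line {Ω : Z → Z →L[ℝ] 𝔹} (hd : Differentiable ℝ Ω) (a z u : Z) (t : ℝ) :
    HasDerivAt (fun t : ℝ ↦ Ω (a + t • (z - a)) u) (fderiv ℝ Ω (a + t • (z - a)) (z - a) u) t := by
  have h0 : HasDerivAt (fun t : ℝ ↦ Ω (a + t • (z - a))) (fderiv ℝ Ω (a + t • (z - a)) (z - a)) t :=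
    (hd _).hasFDerivAt.comp_hasDerivAt t (hasDerivAt_line a z t)
  simpa using h0.clm_apply (hasDerivAt_const t u)

/-- Variation of constants. -/
theorem hasDerivAt_mul_add_smul {l k w h : ℝ → 𝔹} {A B C : 𝔹} {t : ℝ}
    (hl : HasDerivAt l (l t * A) t)
    (hk : HasDerivAt k (-((t • B + w t) * h t + A * k t)) t) (hw : HasDerivAt w C t)
    (hh : HasDerivAt h (-(A * h t)) t) :
    HasDerivAt (fun t ↦ l t * (k t + t • (w t * h t)))
      (t • (l t * (C - B + (A * w t - w t * A)) * h t)) t := by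
  -- The terms containing `k` cancel, and those containing `w h` combine. For `A = Ω(z - a)` and `w
  -- = Ω(u)`, with `B` and `C` the corresponding derivatives of `Ω`, the factor `C - B + [A, w]` is
  -- the curvature on `(z - a, u)`.
  refine (hl.mul (hk.add ((hasDerivAt_id t).smul (hw.mul hh)))).congr_deriv ?_
  simp only [id_eq, one_smul, Pi.add_apply, Pi.mul_apply, Pi.smul_apply']
  simp only [mul_add, add_mul, mul_sub, sub_mul, smul_add, smul_sub, mul_smul_comm, smul_mul_assoc,
    mul_neg, neg_add, mul_assoc, smul_neg]
  abel

end Generic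

section RadialTransport

variable {𝔸 : Type*} [NormedRing 𝔸] [NormedAlgebra ℝ 𝔸] [CompleteSpace 𝔸] [FiniteDimensional ℝ 𝔸]

theorem isUnit_linearFlow (A : C(Icc (0 : ℝ) 1, 𝔸)) {t : ℝ} (ht : t ∈ Icc (0 : ℝ) 1) :
    IsUnit (linearFlow A (projIcc 0 1 zero_le_one t)) :=
  (isUnit_and_inverse_eq_of_mul_eq_one (linearFlowInv_mul_linearFlow A ht)).2.1

theorem inverse_linearFlow (A : C(Icc (0 : ℝ) 1, 𝔸)) {t : ℝ} (ht : t ∈ Icc (0 : ℝ) 1) :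
    Ring.inverse (linearFlow A (projIcc 0 1 zero_le_one t)) =
      linearFlowInv A (projIcc 0 1 zero_le_one t) :=
  (isUnit_and_inverse_eq_of_mul_eq_one (linearFlowInv_mul_linearFlow A ht)).2.2

theorem eq_linearFlow_mul (A : C(Icc (0 : ℝ) 1, 𝔸)) {u : ℝ → 𝔸} {s : Set ℝ} (hs : s.Countable)
    (hc : ContinuousOn u (Icc 0 1)) (hd : ∀ t ∈ Ioo (0 : ℝ) 1 \ s,
      HasDerivAt u (-(A (projIcc 0 1 zero_le_one t) * u t)) t) {t : ℝ} (ht : t ∈ Icc (0 : ℝ) 1) :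
    u t = linearFlow A (projIcc 0 1 zero_le_one t) * u 0 := by
  rw [← linearFlowInv_mul_eq A hs hc hd ht, ← mul_assoc,
    (isUnit_and_inverse_eq_of_mul_eq_one (linearFlowInv_mul_linearFlow A ht)).1, one_mul]

variable {E : Type*} [NormedAddCommGroup E] [NormedSpace ℝ E] {Ω : E → E →L[ℝ] 𝔸}

/-- The pull-back of the one-form `Ω` to the segment from `a` to `z`. -/
noncomputable def radialForm (hΩ : ContDiff ℝ 1 Ω) (a z : E) : C(Icc (0 : ℝ) 1, 𝔸) :=
  ⟨fun t ↦ Ω (a + (t : ℝ) • (z - a)) (z - a), by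
    have := hΩ.continuous
    fun_prop⟩

/-- The solution at time `1` of `h' = - Ω(p)(p') h`, `h(0) = 1` along the segment `p` from `a` to
`z`. -/
noncomputable def radialTransport (hΩ : ContDiff ℝ 1 Ω) (a z : E) : 𝔸 :=
  linearFlow (radialForm hΩ a z) (projIcc 0 1 zero_le_one 1)

/-- The curvature `dΩ + Ω ∧ Ω`. -/
noncomputable def formCurvature (Ω : E → E →L[ℝ] 𝔸) (p v u : E) : 𝔸 :=
  fderiv ℝ Ω p v u - fderiv ℝ Ω p u v + (Ω p v * Ω p u - Ω p u * Ω p v)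

variable (hΩ : ContDiff ℝ 1 Ω)

theorem radialForm_apply (a z : E) {t : ℝ} (ht : t ∈ Icc (0 : ℝ) 1) :
    radialForm hΩ a z (projIcc 0 1 zero_le_one t) = Ω (a + t • (z - a)) (z - a) := by
  rw [projIcc_of_mem _ ht]; rfl

theorem isUnit_radialTransport (a z : E) : IsUnit (radialTransport hΩ a z) :=
  isUnit_linearFlow _ (right_mem_Icc.2 zero_le_one)

/-- Reparametrization: `t ↦ flow (s t)` solves the equation of the shortened segment. The values of
the flow at intermediate times are therefore again radial transports, and the time can be dropped.
-/
theorem linearFlow_radialForm (a z : E) {s : ℝ} (hs : s ∈ Icc (0 : ℝ) 1) :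
    linearFlow (radialForm hΩ a z) (projIcc 0 1 zero_le_one s) =
      radialTransport hΩ a (a + s • (z - a)) := by
  have hmul : ∀ t ∈ Icc (0 : ℝ) 1, s * t ∈ Icc (0 : ℝ) 1 := fun t ht ↦
    ⟨mul_nonneg hs.1 ht.1, mul_le_one₀ hs.2 ht.1 ht.2⟩
  have h := eq_linearFlow_mul (radialForm hΩ a (a + s • (z - a))) countable_empty
    (u := fun t ↦ linearFlow (radialForm hΩ a z) (projIcc 0 1 zero_le_one (s * t)))
    (((linearFlow _).continuous.comp continuous_projIcc).comp
      (continuous_const.mul continuous_id)).continuousOn ?_ (right_mem_Icc.2 (zero_le_one' ℝ))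
  · rw [mul_one, mul_zero, linearFlow_zero, mul_one] at h
    exact h
  · rintro t ⟨ht, -⟩
    have ht' := Ioo_subset_Icc_self ht
    rw [radialForm_apply hΩ _ _ ht']
    -- For `s = 0` the time `s * t` is an end point, where the flow has not been differentiated;
    -- there the reparametrized curve is constant.
    rcases hs.1.eq_or_lt with rfl | h0
    · simp [hasDerivAt_const]
    · have h1 : s * t ∈ Ioo (0 : ℝ) 1 := ⟨mul_pos h0 ht.1, by nlinarith [ht.2, hs.2, ht.1]⟩
      have h2 := (hasDerivAt_linearFlow (radialForm hΩ a z) h1).scomp t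
        ((hasDerivAt_id t).const_mul s)
      refine h2.congr_deriv ?_
      rw [radialForm_apply hΩ _ _ (Ioo_subset_Icc_self h1)]
      simp [smul_smul, mul_comm]

/-- A solution `u` of `u' = - Ω(p)(p') u` along the segment from `a` to `z`. -/
theorem eq_radialTransport_mul {a z : E} {u : ℝ → 𝔸} {s : Set ℝ} (hs : s.Countable)
    (hc : ContinuousOn u (Icc 0 1)) (hd : ∀ t ∈ Ioo (0 : ℝ) 1 \ s,
      HasDerivAt u (-(Ω (a + t • (z - a)) (z - a) * u t)) t) :
    u 1 = radialTransport hΩ a z * u 0 :=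
  eq_linearFlow_mul (radialForm hΩ a z) hs hc (fun t ht ↦ by
    rw [radialForm_apply hΩ _ _ (Ioo_subset_Icc_self ht.1)]; exact hd t ht)
    (right_mem_Icc.2 zero_le_one)

theorem hasDerivAt_radialTransport (a z : E) {t : ℝ} (ht : t ∈ Ioo (0 : ℝ) 1) :
    HasDerivAt (fun t ↦ radialTransport hΩ a (a + t • (z - a)))
      (-(Ω (a + t • (z - a)) (z - a) * radialTransport hΩ a (a + t • (z - a)))) t := by
  have h := hasDerivAt_linearFlow (radialForm hΩ a z) ht
  rw [radialForm_apply hΩ _ _ (Ioo_subset_Icc_self ht),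
    linearFlow_radialForm hΩ a z (Ioo_subset_Icc_self ht)] at h
  refine h.congr_of_eventuallyEq ?_
  filter_upwards [Ioo_mem_nhds ht.1 ht.2] with s hs
  rw [linearFlow_radialForm hΩ a z (Ioo_subset_Icc_self hs)]

theorem radialTransport_self (a : E) : radialTransport hΩ a a = 1 := by
  have h := linearFlow_radialForm hΩ a a (left_mem_Icc.2 (zero_le_one' ℝ))
  rw [linearFlow_zero] at h
  simpa using h.symm

/-- A field `Q` of matrices that is parallel along the segment commutes with the transport. -/
theorem mul_radialTransport_eq {Q : E → 𝔸} (a z : E)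
    (hQ : ∀ t ∈ Icc (0 : ℝ) 1, HasDerivAt (fun t : ℝ ↦ Q (a + t • (z - a)))
      (Q (a + t • (z - a)) * Ω (a + t • (z - a)) (z - a) -
        Ω (a + t • (z - a)) (z - a) * Q (a + t • (z - a))) t) :
    Q z * radialTransport hΩ a z = radialTransport hΩ a z * Q a := by
  have hcont : ContinuousOn (fun t : ℝ ↦ radialTransport hΩ a (a + t • (z - a))) (Icc 0 1) :=
    ContinuousOn.congr ((linearFlow (radialForm hΩ a z)).continuous.comp
      continuous_projIcc).continuousOn fun t ht ↦ (linearFlow_radialForm hΩ a z ht).symm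
  have h := eq_radialTransport_mul hΩ (a := a) (z := z) countable_empty
    (u := fun t ↦ Q (a + t • (z - a)) * radialTransport hΩ a (a + t • (z - a)))
    (ContinuousOn.mul (fun t ht ↦ (hQ t ht).continuousAt.continuousWithinAt) hcont) (fun t ht ↦ by
      refine ((hQ t (Ioo_subset_Icc_self ht.1)).mul
        (hasDerivAt_radialTransport hΩ a z ht.1)).congr_deriv ?_
      noncomm_ring)
  simpa [radialTransport_self] using h

variable [FiniteDimensional ℝ E]

theorem exists_hasFDerivAt_radialForm (a z : E) : ∃ D : E →L[ℝ] C(Icc (0 : ℝ) 1, 𝔸),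
    HasFDerivAt (radialForm hΩ a) D z ∧ ∀ u (t : Icc (0 : ℝ) 1), D u t =
      (t : ℝ) • fderiv ℝ Ω (a + (t : ℝ) • (z - a)) u (z - a) + Ω (a + (t : ℝ) • (z - a)) u := by
  have hd := hΩ.differentiable one_ne_zero
  have hc := hΩ.continuous
  have hc' : Continuous (fderiv ℝ Ω) := hΩ.continuous_fderiv one_ne_zero
  let f' : E → Icc (0 : ℝ) 1 → E →L[ℝ] 𝔸 := fun z t ↦
    (t : ℝ) • (fderiv ℝ Ω (a + (t : ℝ) • (z - a))).flip (z - a) + Ω (a + (t : ℝ) • (z - a))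
  have hf' : Continuous (fun p : E × Icc (0 : ℝ) 1 ↦ f' p.1 p.2) := by
    have h1 : Continuous fun p : E × Icc (0 : ℝ) 1 ↦
        (fderiv ℝ Ω (a + (p.2 : ℝ) • (p.1 - a))).flip :=
      (ContinuousLinearMap.flipₗᵢ ℝ E E 𝔸).continuous.comp (hc'.comp (by fun_prop))
    exact ((by fun_prop : Continuous fun p : E × Icc (0 : ℝ) 1 ↦ (p.2 : ℝ)).smul
      (h1.clm_apply (by fun_prop))).add (hc.comp (by fun_prop))
  let D : E →L[ℝ] C(Icc (0 : ℝ) 1, 𝔸) := LinearMap.toContinuousLinearMap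
    { toFun := fun u ↦ ⟨fun t ↦ f' z t u, by
        have : Continuous fun t ↦ f' z t :=
          hf'.comp (Continuous.prodMk continuous_const continuous_id)
        fun_prop⟩
      map_add' := fun u v ↦ by ext t; simp
      map_smul' := fun c u ↦ by ext t; simp }
  refine ⟨D, hasFDerivAt_continuousMap hf' ?_ z (fun u t ↦ rfl), fun u t ↦ ?_⟩
  · intro z t
    have h1 : HasFDerivAt (fun z : E ↦ z - a) (ContinuousLinearMap.id ℝ E) z :=
      (hasFDerivAt_id z).sub_const a
    have h2 : HasFDerivAt (fun z : E ↦ a + (t : ℝ) • (z - a))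
        ((t : ℝ) • ContinuousLinearMap.id ℝ E) z := (h1.const_smul (t : ℝ)).const_add a
    refine (((hd _).hasFDerivAt.comp z h2).clm_apply h1).congr_fderiv ?_
    ext u
    simp [f', add_comm]
  · simp [D, f']

theorem differentiable_radialTransport (a : E) : Differentiable ℝ (radialTransport hΩ a) := by
  intro z
  obtain ⟨D, hD, -⟩ := exists_hasFDerivAt_radialForm hΩ a z
  obtain ⟨K, hK, -⟩ := exists_hasFDerivAt_linearFlow hD
  obtain ⟨D', hD', -⟩ := hasFDerivAt_continuousMap_apply hK (projIcc 0 1 zero_le_one (1 : ℝ))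
  exact hD'.differentiableAt

/-- The connection form in the gauge given by the radial transport from `a`. -/
noncomputable def gaugeForm (hΩ : ContDiff ℝ 1 Ω) (a z u : E) : 𝔸 :=
  ∫ t in (0 : ℝ)..1, t • (Ring.inverse (radialTransport hΩ a (a + t • (z - a))) *
    formCurvature Ω (a + t • (z - a)) (z - a) u * radialTransport hΩ a (a + t • (z - a)))

theorem continuous_inverse_radialTransport (a : E) :
    Continuous fun z ↦ Ring.inverse (radialTransport hΩ a z) := by
  rw [continuous_iff_continuousAt]
  intro z
  obtain ⟨w, hw⟩ := isUnit_radialTransport hΩ a z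
  have h1 : ContinuousAt Ring.inverse (radialTransport hΩ a z) := by
    rw [← hw]; exact NormedRing.inverse_continuousAt w
  exact ContinuousAt.comp (f := radialTransport hΩ a) h1
    (differentiable_radialTransport hΩ a z).continuousAt

theorem continuous_formCurvature (hΩ : ContDiff ℝ 1 Ω) :
    Continuous fun p : E × E × E ↦ formCurvature Ω p.1 p.2.1 p.2.2 := by
  have hc := hΩ.continuous
  have hc' : Continuous (fderiv ℝ Ω) := hΩ.continuous_fderiv one_ne_zero
  unfold formCurvature
  fun_prop

/-- The base point, both tangent vectors and the time are independent variables here, so that every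
continuity of such integrands follows by composition. -/
theorem continuous_gaugeForm_integrand (a : E) : Continuous fun p : E × E × E × ℝ ↦
    p.2.2.2 • (Ring.inverse (radialTransport hΩ a p.1) *
      formCurvature Ω p.1 p.2.1 p.2.2.1 * radialTransport hΩ a p.1) := by
  have h1 := continuous_inverse_radialTransport hΩ a
  have h2 := (differentiable_radialTransport hΩ a).continuous
  have h3 := continuous_formCurvature hΩ
  exact (continuous_snd.comp (continuous_snd.comp continuous_snd)).smul
    (((h1.comp continuous_fst).mul (h3.comp (continuous_fst.prodMk
      ((continuous_fst.comp continuous_snd).prodMk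
        (continuous_fst.comp (continuous_snd.comp continuous_snd)))))).mul
      (h2.comp continuous_fst))

theorem continuous_gaugeForm (a u : E) : Continuous fun z ↦ gaugeForm hΩ a z u := by
  refine intervalIntegral.continuous_parametric_intervalIntegral_of_continuous'
    (f := fun z t ↦ t • (Ring.inverse (radialTransport hΩ a (a + t • (z - a))) *
    formCurvature Ω (a + t • (z - a)) (z - a) u * radialTransport hΩ a (a + t • (z - a)))) ?_ 0 1
  refine (continuous_gaugeForm_integrand hΩ a).comp
    (f := fun p : E × ℝ ↦ (a + p.2 • (p.1 - a), p.1 - a, u, p.2)) ?_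
  fun_prop

/-- With `h` the radial transport this says `h⁻¹ dh + h⁻¹ Ω h = ∫₀¹ t h⁻¹ R(z - a, ·) h dt`: in the
radial gauge the connection form is expressed by the curvature alone. It is obtained by variation of
constants along the segment. -/
theorem fderiv_radialTransport (a z u : E) : fderiv ℝ (radialTransport hΩ a) z u =
    -(Ω z u * radialTransport hΩ a z) + radialTransport hΩ a z * gaugeForm hΩ a z u := by
  obtain ⟨D, hD, hDu⟩ := exists_hasFDerivAt_radialForm hΩ a z
  set A := radialForm hΩ a z with hA
  obtain ⟨K, hKd, hkeq'⟩ := exists_hasFDerivAt_linearFlow hD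
  have hkeq := hkeq' u
  rw [← hA] at hkeq
  set P := fun t : ℝ ↦ projIcc 0 1 zero_le_one t with hP
  have hk0 : K u (P 0) = 0 := by
    have := congrArg (fun c : C(Icc (0 : ℝ) 1, 𝔸) ↦ c (P 0)) hkeq
    simpa [volterra_apply, P, projIcc_of_mem zero_le_one (left_mem_Icc.2 (zero_le_one' ℝ))]
      using this
  -- The variation `K u` of the flow in the direction `u` solves the linearized differential
  -- equation.
  have hkd : ∀ t ∈ Ioo (0 : ℝ) 1, HasDerivAt (fun t ↦ K u (P t))
      (-(D u (P t) * linearFlow A (P t) + A (P t) * K u (P t))) t := by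
    intro t ht
    have h1 := (hasDerivAt_volterra (D u * linearFlow A + A * K u) ht).neg
    have h2 : (fun t ↦ K u (P t)) =
        fun t ↦ -(volterra (D u * linearFlow A + A * K u) (P t)) := funext fun s ↦ by
      have := congrArg (fun c : C(Icc (0 : ℝ) 1, 𝔸) ↦ c (P s)) hkeq
      exact eq_neg_of_add_eq_zero_left this
    rw [h2]
    exact h1
  have hd := hΩ.differentiable one_ne_zero
  have hcP : Continuous P := continuous_projIcc
  -- The fundamental theorem of calculus for `h⁻¹ (k + t Ω(u) h)`, which vanishes at `0`.
  have key := intervalIntegral.integral_eq_sub_of_hasDerivAt_of_le (zero_le_one' ℝ)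
    (f := fun t ↦ linearFlowInv A (P t) * (K u (P t) +
      t • (Ω (a + t • (z - a)) u * linearFlow A (P t))))
    (f' := fun t ↦ t • (Ring.inverse (radialTransport hΩ a (a + t • (z - a))) *
    formCurvature Ω (a + t • (z - a)) (z - a) u * radialTransport hΩ a (a + t • (z - a)))) ?_ ?_ ?_
  · have h1 : fderiv ℝ (radialTransport hΩ a) z u = K u (P 1) := by
      obtain ⟨D', hD', hDu'⟩ := hasFDerivAt_continuousMap_apply hKd (P 1)
      rw [← hDu' u]
      exact congrArg (fun T : E →L[ℝ] 𝔸 ↦ T u) hD'.fderiv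
    have h2 := (isUnit_and_inverse_eq_of_mul_eq_one
      (linearFlowInv_mul_linearFlow A (right_mem_Icc.2 (zero_le_one' ℝ)))).1
    have h3 : linearFlow A (P 1) = radialTransport hΩ a z := rfl
    have h4 : linearFlow A (P 1) * gaugeForm hΩ a z u =
        K u (P 1) + Ω z u * linearFlow A (P 1) := by
      rw [gaugeForm, key, hk0]
      simp only [one_smul, zero_smul, add_zero, mul_zero, sub_zero, add_sub_cancel, ← mul_assoc,
        h2, one_mul, P]
    rw [h1, ← h3, h4]
    abel
  · have hc := hΩ.continuous
    have h1 := (continuous_linearFlowInv A).comp hcP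
    have h2 := (K u).continuous.comp hcP
    have h3 := (linearFlow A).continuous.comp hcP
    exact (h1.mul (h2.add (continuous_id.smul (Continuous.mul (by fun_prop) h3)))).continuousOn
  · intro t ht
    have ht' := Ioo_subset_Icc_self ht
    have hPt : (P t : ℝ) = t := by simp only [P, projIcc_of_mem zero_le_one ht']
    have d2 := hkd t ht
    rw [hDu, hPt] at d2
    refine (hasDerivAt_mul_add_smul (hasDerivAt_linearFlowInv A ht) d2
      (hasDerivAt_clm_line hd a z u t) (hasDerivAt_linearFlow A ht)).congr_deriv ?_
    rw [← linearFlow_radialForm hΩ a z ht', inverse_linearFlow _ ht', ← hA,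
      hA, radialForm_apply hΩ a z ht', ← hA]
    rfl
  · apply Continuous.intervalIntegrable
    exact (continuous_gaugeForm_integrand hΩ a).comp
      (f := fun t : ℝ ↦ (a + t • (z - a), z - a, u, t)) (by fun_prop)

end RadialTransport

/-! ### Submanifold geometry in coordinates -/

section Coordinates

noncomputable local instance clmNormedAddCommGroup {V W : Type*} [NormedAddCommGroup V] [NormedSpace ℝ V]
    [NormedAddCommGroup W] [NormedSpace ℝ W] : NormedAddCommGroup (V →L[ℝ] W) :=
  ContinuousLinearMap.toNormedAddCommGroup

noncomputable local instance clmNormedSpace {V W : Type*} [NormedAddCommGroup V] [NormedSpace ℝ V]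
    [NormedAddCommGroup W] [NormedSpace ℝ W] : NormedSpace ℝ (V →L[ℝ] W) :=
  ContinuousLinearMap.toNormedSpace

local instance clmAddCommGroup {V W : Type*} [NormedAddCommGroup V] [NormedSpace ℝ V]
    [NormedAddCommGroup W] [NormedSpace ℝ W] : AddCommGroup (V →L[ℝ] W) :=
  ContinuousLinearMap.addCommGroup

variable {E F : Type*} [NormedAddCommGroup E] [NormedSpace ℝ E] [FiniteDimensional ℝ E]
  [NormedAddCommGroup F] [NormedSpace ℝ F] [FiniteDimensional ℝ F]

section Generic

variable {𝔸 : Type*} [NormedRing 𝔸] [NormedAlgebra ℝ 𝔸] {Q : E → 𝔸} {R : E → E →L[ℝ] 𝔸} {B : Set E}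

theorem contDiffOn_mul_comp (hQ : ContDiffOn ℝ ∞ Q B) (hR : ContDiffOn ℝ ∞ R B) :
    ContDiffOn ℝ ∞ (fun p ↦ ContinuousLinearMap.mul ℝ 𝔸 (Q p) ∘L R p) B :=
  ((ContinuousLinearMap.contDiff (ContinuousLinearMap.mul ℝ 𝔸)).comp_contDiffOn hQ).clm_comp hR

theorem contDiffOn_mul_flip_comp (hQ : ContDiffOn ℝ ∞ Q B) (hR : ContDiffOn ℝ ∞ R B) :
    ContDiffOn ℝ ∞ (fun p ↦ (ContinuousLinearMap.mul ℝ 𝔸).flip (Q p) ∘L R p) B :=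
  ((ContinuousLinearMap.contDiff (ContinuousLinearMap.mul ℝ 𝔸).flip).comp_contDiffOn hQ).clm_comp hR

end Generic

/-- The data induced on an open set `B` of `E` by a spacelike map into a pseudo-Riemannian manifold
of constant curvature: the metric `G` and the connection `∂ + Θ` of the pulled back tangent bundle
and the differential `L`, in coordinates. -/
structure CoordImmersion (B : Set E) (G : E → F →L[ℝ] F →L[ℝ] ℝ) (L : E → E →L[ℝ] F)
    (Θ : E → E →L[ℝ] F →L[ℝ] F) (κ : ℝ) : Prop where
  isOpen : IsOpen B
  contDiffOn_metric : ContDiffOn ℝ ∞ G B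
  contDiffOn_differential : ContDiffOn ℝ ∞ L B
  contDiffOn_connection : ContDiffOn ℝ ∞ Θ B
  symm : ∀ p ∈ B, ∀ v w, G p v w = G p w v
  metric : ∀ p ∈ B, ∀ u v w, fderiv ℝ G p u v w = G p (Θ p u v) w + G p v (Θ p u w)
  torsion : ∀ p ∈ B, ∀ u v,
    fderiv ℝ L p u v + Θ p u (L p v) = fderiv ℝ L p v u + Θ p v (L p u)
  curvature : ∀ p ∈ B, ∀ u v w,
    formCurvature Θ p u v w = κ • (G p (L p v) w • L p u - G p (L p u) w • L p v)
  pos : ∀ p ∈ B, ∀ u, u ≠ 0 → 0 < G p (L p u) (L p u)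

/-- The adjoint `w ↦ G(w, L ·)`. -/
noncomputable def coordAdjoint (G : E → F →L[ℝ] F →L[ℝ] ℝ) (L : E → E →L[ℝ] F) (p : E) :
    F →L[ℝ] E →L[ℝ] ℝ :=
  ((ContinuousLinearMap.compL ℝ E F ℝ).flip (L p)) ∘L G p

/-- The tangential projection. -/
noncomputable def coordTangentProj (G : E → F →L[ℝ] F →L[ℝ] ℝ) (L : E → E →L[ℝ] F) (p : E) :
    F →L[ℝ] F :=
  L p ∘L ((coordAdjoint G L p ∘L L p).inverse ∘L coordAdjoint G L p)

/-- The normal projection. -/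
noncomputable def coordNormalProj (G : E → F →L[ℝ] F →L[ℝ] ℝ) (L : E → E →L[ℝ] F) (p : E) :
    F →L[ℝ] F :=
  1 - coordTangentProj G L p

/-- The connection form of the sum of the tangential and the normal connection. -/
noncomputable def coordForm (G : E → F →L[ℝ] F →L[ℝ] ℝ) (L : E → E →L[ℝ] F)
    (Θ : E → E →L[ℝ] F →L[ℝ] F) (p : E) : E →L[ℝ] F →L[ℝ] F :=
  (ContinuousLinearMap.mul ℝ (F →L[ℝ] F) (coordNormalProj G L p - coordTangentProj G L p)) ∘L
      fderiv ℝ (coordNormalProj G L) p +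
    (ContinuousLinearMap.mul ℝ (F →L[ℝ] F)).flip (coordNormalProj G L p) ∘L
      ContinuousLinearMap.mul ℝ (F →L[ℝ] F) (coordNormalProj G L p) ∘L Θ p +
    (ContinuousLinearMap.mul ℝ (F →L[ℝ] F)).flip (coordTangentProj G L p) ∘L
      ContinuousLinearMap.mul ℝ (F →L[ℝ] F) (coordTangentProj G L p) ∘L Θ p

/-- The second fundamental form, as an endomorphism exchanging tangential and normal vectors. -/
noncomputable def coordSecond (G : E → F →L[ℝ] F →L[ℝ] ℝ) (L : E → E →L[ℝ] F)
    (Θ : E → E →L[ℝ] F →L[ℝ] F) (p : E) : E →L[ℝ] F →L[ℝ] F :=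
  Θ p - coordForm G L Θ p

namespace CoordImmersion

variable {B : Set E} {G : E → F →L[ℝ] F →L[ℝ] ℝ} {L : E → E →L[ℝ] F}
    {Θ : E → E →L[ℝ] F →L[ℝ] F} {κ : ℝ}

/-- Positivity of the metric on the image of `L` makes the Gram operator injective, hence
invertible. The metric `G` on `F` may be indefinite, and this is what makes the orthogonal
projections well behaved. -/
theorem exists_gram_eq (h : CoordImmersion B G L Θ κ) {p : E} (hp : p ∈ B) :
    ∃ e : E ≃L[ℝ] (E →L[ℝ] ℝ), (e : E →L[ℝ] E →L[ℝ] ℝ) = coordAdjoint G L p ∘L L p := by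
  have hinj : Function.Injective (coordAdjoint G L p ∘L L p).toLinearMap := by
    rw [← LinearMap.ker_eq_bot, LinearMap.ker_eq_bot']
    intro u hu
    by_contra hne
    have := congrArg (fun T : E →L[ℝ] ℝ ↦ T u) hu
    exact (h.pos p hp u hne).ne' this
  have hdim : Module.finrank ℝ E = Module.finrank ℝ (E →L[ℝ] ℝ) := by
    rw [← (LinearMap.toContinuousLinearMap (𝕜 := ℝ) (E := E) (F' := ℝ)).finrank_eq]
    exact (Subspace.dual_finrank_eq (K := ℝ) (V := E)).symm
  exact ⟨(LinearEquiv.ofInjectiveOfFinrankEq _ hinj hdim).toContinuousLinearEquiv, by ext; rfl⟩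

theorem coordAdjoint_apply (p : E) (w : F) (u : E) : coordAdjoint G L p w u = G p w (L p u) := rfl

theorem tangentProj_differential (h : CoordImmersion B G L Θ κ) {p : E} (hp : p ∈ B) (u : E) :
    coordTangentProj G L p (L p u) = L p u := by
  obtain ⟨e, he⟩ := h.exists_gram_eq hp
  have h1 : coordAdjoint G L p (L p u) = e u := by rw [← ContinuousLinearEquiv.coe_coe, he]; rfl
  simp only [coordTangentProj, ContinuousLinearMap.comp_apply, h1]
  rw [← he, ContinuousLinearMap.inverse_equiv]
  simp

theorem metric_tangentProj (h : CoordImmersion B G L Θ κ) {p : E} (hp : p ∈ B) (w : F) (u : E) :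
    G p (coordTangentProj G L p w) (L p u) = G p w (L p u) := by
  obtain ⟨e, he⟩ := h.exists_gram_eq hp
  have h1 : G p (coordTangentProj G L p w) (L p u) =
      (coordAdjoint G L p ∘L L p) ((coordAdjoint G L p ∘L L p).inverse (coordAdjoint G L p w)) u := rfl
  rw [h1, ← he, ContinuousLinearMap.inverse_equiv]
  simp [coordAdjoint_apply]

theorem normalProj_differential (h : CoordImmersion B G L Θ κ) {p : E} (hp : p ∈ B) (u : E) :
    coordNormalProj G L p (L p u) = 0 := by
  simp [coordNormalProj, h.tangentProj_differential hp]

theorem metric_normalProj (h : CoordImmersion B G L Θ κ) {p : E} (hp : p ∈ B) (w : F) (u : E) :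
    G p (coordNormalProj G L p w) (L p u) = 0 := by
  simp [coordNormalProj, h.metric_tangentProj hp]

theorem normalProj_tangentProj (h : CoordImmersion B G L Θ κ) {p : E} (hp : p ∈ B) :
    coordNormalProj G L p * coordTangentProj G L p = 0 := by
  ext w
  exact h.normalProj_differential hp _

theorem normalProj_mul_self (h : CoordImmersion B G L Θ κ) {p : E} (hp : p ∈ B) :
    coordNormalProj G L p * coordNormalProj G L p = coordNormalProj G L p := by
  have := h.normalProj_tangentProj hp
  nth_rewrite 2 [coordNormalProj]
  rw [mul_sub, this, mul_one, sub_zero]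

theorem contDiffOn_tangentProj (h : CoordImmersion B G L Θ κ) :
    ContDiffOn ℝ ∞ (coordTangentProj G L) B := by
  have h1 : ContDiffOn ℝ ∞ (coordAdjoint G L) B :=
    ((ContinuousLinearMap.contDiff ((ContinuousLinearMap.compL ℝ E F ℝ).flip)).comp_contDiffOn
      h.contDiffOn_differential).clm_comp h.contDiffOn_metric
  refine h.contDiffOn_differential.clm_comp (ContDiffOn.clm_comp ?_ h1)
  intro p hp
  obtain ⟨e, he⟩ := h.exists_gram_eq hp
  have h2 : ContDiffAt ℝ ∞ ContinuousLinearMap.inverse (coordAdjoint G L p ∘L L p) := by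
    rw [← he]; exact contDiffAt_map_inverse e
  exact ContDiffAt.comp_contDiffWithinAt (g := ContinuousLinearMap.inverse)
    (f := fun p ↦ coordAdjoint G L p ∘L L p) p h2 (h1.clm_comp h.contDiffOn_differential p hp)

theorem contDiffOn_normalProj (h : CoordImmersion B G L Θ κ) :
    ContDiffOn ℝ ∞ (coordNormalProj G L) B :=
  contDiffOn_const.sub h.contDiffOn_tangentProj

theorem contDiffOn_form (h : CoordImmersion B G L Θ κ) :
    ContDiffOn ℝ ∞ (coordForm G L Θ) B := by
  have h1 := h.contDiffOn_tangentProj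
  have h2 := h.contDiffOn_normalProj
  have h3 : ContDiffOn ℝ ∞ (fderiv ℝ (coordNormalProj G L)) B :=
    h2.fderiv_of_isOpen h.isOpen (by simp)
  exact ((contDiffOn_mul_comp (h2.sub h1) h3).add
    (contDiffOn_mul_flip_comp h2 (contDiffOn_mul_comp h2 h.contDiffOn_connection))).add
    (contDiffOn_mul_flip_comp h1 (contDiffOn_mul_comp h1 h.contDiffOn_connection))

theorem hasFDerivAt_normalProj (h : CoordImmersion B G L Θ κ) {p : E} (hp : p ∈ B) :
    HasFDerivAt (coordNormalProj G L) (fderiv ℝ (coordNormalProj G L) p) p :=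
  ((h.contDiffOn_normalProj.contDiffAt (h.isOpen.mem_nhds hp)).differentiableAt
    (by simp)).hasFDerivAt

theorem coordForm_apply (p u : E) : coordForm G L Θ p u =
    (coordNormalProj G L p - coordTangentProj G L p) * fderiv ℝ (coordNormalProj G L) p u +
    coordNormalProj G L p * Θ p u * coordNormalProj G L p +
    coordTangentProj G L p * Θ p u * coordTangentProj G L p := rfl

theorem tangentProj_eq (p : E) : coordTangentProj G L p = 1 - coordNormalProj G L p := by
  simp [coordNormalProj]

theorem fderiv_normalProj_mul (h : CoordImmersion B G L Θ κ) {p : E} (hp : p ∈ B) (u : E) :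
    coordNormalProj G L p * fderiv ℝ (coordNormalProj G L) p u +
      fderiv ℝ (coordNormalProj G L) p u * coordNormalProj G L p =
    fderiv ℝ (coordNormalProj G L) p u := by
  have h1 := (h.hasFDerivAt_normalProj hp).mul' (h.hasFDerivAt_normalProj hp)
  have h2 := h1.unique ((h.hasFDerivAt_normalProj hp).congr_of_eventuallyEq
    (by filter_upwards [h.isOpen.mem_nhds hp] with q hq using h.normalProj_mul_self hq))
  exact congrArg (fun T : E →L[ℝ] F →L[ℝ] F ↦ T u) h2

/-- Multiply the derivative of `Q² = Q` by `Q`: the derivative of a projection has no block from the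
image to itself. -/
theorem normalProj_fderiv_normalProj (h : CoordImmersion B G L Θ κ) {p : E} (hp : p ∈ B) (u : E) :
    coordNormalProj G L p * fderiv ℝ (coordNormalProj G L) p u * coordNormalProj G L p = 0 := by
  have h1 := h.fderiv_normalProj_mul hp u
  have h2 := congrArg (fun T ↦ coordNormalProj G L p * T) h1
  simp only [mul_add, ← mul_assoc, h.normalProj_mul_self hp] at h2
  simpa using h2

/-- The normal projection is parallel. -/
theorem fderiv_normalProj (h : CoordImmersion B G L Θ κ) {p : E} (hp : p ∈ B) (u : E) :
    fderiv ℝ (coordNormalProj G L) p u =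
      coordNormalProj G L p * coordForm G L Θ p u - coordForm G L Θ p u * coordNormalProj G L p := by
  have h1 := h.fderiv_normalProj_mul hp u
  have h2 := h.normalProj_fderiv_normalProj hp u
  have h3 := h.normalProj_mul_self hp
  rw [coordForm_apply, tangentProj_eq]
  set Q := coordNormalProj G L p
  set D := fderiv ℝ (coordNormalProj G L) p u
  set T := Θ p u
  have e1 : Q * ((Q - (1 - Q)) * D + Q * T * Q + (1 - Q) * T * (1 - Q)) =
      Q * D + Q * T * Q := by
    have a1 : Q * (Q - (1 - Q)) = Q := by rw [mul_sub, mul_sub, mul_one, h3]; abel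
    have a2 : Q * (1 - Q) = 0 := by rw [mul_sub, mul_one, h3, sub_self]
    rw [mul_add, mul_add, ← mul_assoc, a1, ← mul_assoc, ← mul_assoc, h3, ← mul_assoc, ← mul_assoc, a2]
    simp
  have e2 : ((Q - (1 - Q)) * D + Q * T * Q + (1 - Q) * T * (1 - Q)) * Q =
      -(D * Q) + Q * T * Q := by
    have a2 : (1 - Q) * Q = 0 := by rw [sub_mul, one_mul, h3, sub_self]
    rw [add_mul, add_mul, mul_assoc _ Q Q, h3, mul_assoc _ (1 - Q) Q, a2, mul_zero, add_zero,
      mul_assoc, sub_mul, sub_mul, one_mul, ← mul_assoc, h2]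
    abel
  rw [e1, e2]
  nth_rewrite 1 [← h1]
  abel

/-- A normal field satisfies `dξ = dQ ξ + Q dξ`, so `P(dQ ξ + Θ ξ)`, with `P = 1 - Q`, is the
tangential part of its covariant derivative. On normal vectors the second fundamental form is thus
minus the shape operator. -/
theorem second_apply_normal (h : CoordImmersion B G L Θ κ) {p : E} (hp : p ∈ B) (u : E) {ξ : F}
    (hξ : coordNormalProj G L p ξ = ξ) :
    coordForm G L Θ p u ξ = coordNormalProj G L p (Θ p u ξ) - fderiv ℝ (coordNormalProj G L) p u ξ ∧
    coordSecond G L Θ p u ξ =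
      coordTangentProj G L p (fderiv ℝ (coordNormalProj G L) p u ξ + Θ p u ξ) := by
  have h1 : coordNormalProj G L p (fderiv ℝ (coordNormalProj G L) p u ξ) = 0 := by
    have := congrArg (fun T : F →L[ℝ] F ↦ T ξ) (h.normalProj_fderiv_normalProj hp u)
    simpa [hξ] using this
  have h2 : coordForm G L Θ p u ξ =
      coordNormalProj G L p (Θ p u ξ) - fderiv ℝ (coordNormalProj G L) p u ξ := by
    rw [coordForm_apply, tangentProj_eq]
    simp only [add_apply, mul_apply_eq_comp, sub_apply,
      one_apply_eq_self, h1, hξ, sub_self, map_zero]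
    abel
  refine ⟨h2, ?_⟩
  rw [coordSecond, sub_apply, sub_apply, h2, tangentProj_eq]
  simp only [sub_apply, one_apply_eq_self, map_add, h1]
  abel

/-- Differentiating `Q (L w) = 0` exchanges `dQ (L w)` for `-Q (dL w)`. The result is the normal
part of `∇_u (L w)`, the classical second fundamental form, whose symmetry then follows from the
vanishing torsion. -/
theorem second_differential (h : CoordImmersion B G L Θ κ) {p : E} (hp : p ∈ B) (u w : E) :
    coordSecond G L Θ p u (L p w) =
      coordNormalProj G L p (fderiv ℝ L p u w + Θ p u (L p w)) := by
  have hL : HasFDerivAt L (fderiv ℝ L p) p :=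
    ((h.contDiffOn_differential.contDiffAt (h.isOpen.mem_nhds hp)).differentiableAt
      (by simp)).hasFDerivAt
  have h1 : fderiv ℝ (coordNormalProj G L) p u (L p w) +
      coordNormalProj G L p (fderiv ℝ L p u w) = 0 := by
    have d1 := hL.clm_apply (hasFDerivAt_const w p)
    have d2 := (h.hasFDerivAt_normalProj hp).clm_apply d1
    have d3 := d2.unique ((hasFDerivAt_const (0 : F) p).congr_of_eventuallyEq
      (by filter_upwards [h.isOpen.mem_nhds hp] with q hq using h.normalProj_differential hq w))
    have := congrArg (fun T : E →L[ℝ] F ↦ T u) d3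
    simpa [add_comm] using this
  have h2 : coordNormalProj G L p (fderiv ℝ (coordNormalProj G L) p u (L p w)) =
      fderiv ℝ (coordNormalProj G L) p u (L p w) := by
    have := congrArg (fun T : F →L[ℝ] F ↦ T (L p w)) (h.fderiv_normalProj_mul hp u)
    simpa [h.normalProj_differential hp] using this
  have h3 := h.tangentProj_differential hp w
  have h4 := h.normalProj_differential hp w
  rw [coordSecond, sub_apply, sub_apply, coordForm_apply]
  simp only [add_apply, mul_apply_eq_comp, h3, h4, map_zero]
  rw [tangentProj_eq]
  simp only [sub_apply, one_apply_eq_self, map_add, h2]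
  rw [eq_neg_of_add_eq_zero_left h1]
  abel

theorem second_differential_comm (h : CoordImmersion B G L Θ κ) {p : E} (hp : p ∈ B) (u w : E) :
    coordSecond G L Θ p u (L p w) = coordSecond G L Θ p w (L p u) := by
  rw [h.second_differential hp, h.second_differential hp, h.torsion p hp]

-- Obtained by differentiating `G(L w, Q ξ) = 0` with the help of the metric property: the second
-- fundamental form and the shape operator are adjoint up to sign.
set_option synthInstance.maxHeartbeats 200000 in
theorem metric_second (h : CoordImmersion B G L Θ κ) {p : E} (hp : p ∈ B) (u w : E) {ξ : F}
    (hξ : coordNormalProj G L p ξ = ξ) :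
    G p (coordSecond G L Θ p u (L p w)) ξ = -G p (L p w) (coordSecond G L Θ p u ξ) := by
  have hG : HasFDerivAt G (fderiv ℝ G p) p :=
    ((h.contDiffOn_metric.contDiffAt (h.isOpen.mem_nhds hp)).differentiableAt
      (by simp)).hasFDerivAt
  have hL : HasFDerivAt L (fderiv ℝ L p) p :=
    ((h.contDiffOn_differential.contDiffAt (h.isOpen.mem_nhds hp)).differentiableAt
      (by simp)).hasFDerivAt
  have h1 : G p (fderiv ℝ L p u w + Θ p u (L p w)) ξ +
      G p (L p w) (fderiv ℝ (coordNormalProj G L) p u ξ + Θ p u ξ) = 0 := by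
    have d1 := hL.clm_apply (hasFDerivAt_const w p)
    have d2 := (h.hasFDerivAt_normalProj hp).clm_apply (hasFDerivAt_const ξ p)
    have d3 := (hG.clm_apply d1).clm_apply d2
    have d4 := d3.unique ((hasFDerivAt_const (0 : ℝ) p).congr_of_eventuallyEq
      (by
        filter_upwards [h.isOpen.mem_nhds hp] with q hq
        rw [h.symm q hq, h.metric_normalProj hq]))
    have := congrArg (fun T : E →L[ℝ] ℝ ↦ T u) d4
    simp [hξ] at this
    rw [h.metric p hp] at this
    simp only [map_add, add_apply]
    linarith
  have h5 : ∀ v, G p (coordNormalProj G L p v) ξ = G p v ξ := fun v ↦ by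
    rw [coordNormalProj, sub_apply, map_sub, sub_apply,
      one_apply_eq_self, sub_eq_self, h.symm p hp, ← hξ]
    exact h.metric_normalProj hp ξ _
  have h6 : ∀ v, G p (L p w) (coordTangentProj G L p v) = G p (L p w) v := fun v ↦ by
    rw [h.symm p hp, h.metric_tangentProj hp, h.symm p hp]
  rw [h.second_differential hp, h5, (h.second_apply_normal hp u hξ).2, h6]
  linarith

/-- Write `Θ = Ω + S`, where `S` exchanges tangential and normal vectors. Then the curvature of `Θ`
is that of `Ω`, plus the covariant derivative terms of `S`, plus `S ∧ S`. The normal block of the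
first vanishes by constant curvature, and that of the derivative of `S` because `Q S Q = 0` and `Q`
is parallel. -/
theorem normalProj_formCurvature (h : CoordImmersion B G L Θ κ) {p : E} (hp : p ∈ B) (u v : E) :
    coordNormalProj G L p * formCurvature (coordForm G L Θ) p u v * coordNormalProj G L p =
      coordNormalProj G L p * (coordSecond G L Θ p v * coordSecond G L Θ p u -
        coordSecond G L Θ p u * coordSecond G L Θ p v) * coordNormalProj G L p := by
  have hΘ : HasFDerivAt Θ (fderiv ℝ Θ p) p :=
    ((h.contDiffOn_connection.contDiffAt (h.isOpen.mem_nhds hp)).differentiableAt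
      (by simp)).hasFDerivAt
  have hΩ : HasFDerivAt (coordForm G L Θ) (fderiv ℝ (coordForm G L Θ) p) p :=
    ((h.contDiffOn_form.contDiffAt (h.isOpen.mem_nhds hp)).differentiableAt
      (by simp)).hasFDerivAt
  have hS : HasFDerivAt (coordSecond G L Θ) (fderiv ℝ Θ p - fderiv ℝ (coordForm G L Θ) p) p :=
    hΘ.sub hΩ
  have hQ3 := h.normalProj_mul_self hp
  have hblock : ∀ q ∈ B, ∀ v, coordNormalProj G L q * coordSecond G L Θ q v *
      coordNormalProj G L q = 0 := by
    intro q hq v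
    ext w
    have hw : coordNormalProj G L q (coordNormalProj G L q w) = coordNormalProj G L q w :=
      congrArg (fun T : F →L[ℝ] F ↦ T w) (h.normalProj_mul_self hq)
    have := (h.second_apply_normal hq v hw).2
    simp only [mul_apply_eq_comp, this]
    exact h.normalProj_differential hq _
  -- the derivative of the second fundamental form is off-diagonal as well
  have hder : ∀ u v, coordNormalProj G L p * ((fderiv ℝ Θ p - fderiv ℝ (coordForm G L Θ) p) u v +
      (coordForm G L Θ p u * coordSecond G L Θ p v - coordSecond G L Θ p v * coordForm G L Θ p u)) *
      coordNormalProj G L p = 0 := by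
    intro u v
    have d1 := hS.clm_apply (hasFDerivAt_const v p)
    have hQ := h.hasFDerivAt_normalProj hp
    have d2 := ((hQ.mul' d1).mul' hQ).unique
      ((hasFDerivAt_const (0 : F →L[ℝ] F) p).congr_of_eventuallyEq
      (by filter_upwards [h.isOpen.mem_nhds hp] with q hq using hblock q hq v))
    have d3 := congrArg (fun T : E →L[ℝ] F →L[ℝ] F ↦ T u) d2
    have hb := hblock p hp v
    simp only [add_apply, smul_apply, smul_eq_mul,
      MulOpposite.smul_eq_mul_unop, MulOpposite.unop_op, Pi.mul_apply,
      h.fderiv_normalProj hp u, zero_apply,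
      ContinuousLinearMap.comp_zero, zero_add, ContinuousLinearMap.flip_apply] at d3
    set Q := coordNormalProj G L p
    set S := coordSecond G L Θ p v
    set W := coordForm G L Θ p u
    rw [mul_add, add_mul, mul_sub, sub_mul]
    rw [add_mul, mul_sub, sub_mul, sub_mul] at d3
    have e1 : Q * S * (Q * W) = 0 := by rw [← mul_assoc, hb, zero_mul]
    have e2 : W * Q * S * Q = 0 := by rw [mul_assoc, mul_assoc, ← mul_assoc Q, hb, mul_zero]
    rw [e1, e2] at d3
    rw [← d3]
    simp only [mul_assoc, zero_sub, sub_zero]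
    abel
  have h1 := hder u v
  have h2 := hder v u
  -- The constant curvature operator takes tangential values here, so it has no normal block. This
  -- is the only place where the constancy of the curvature acts.
  have h3 : coordNormalProj G L p * formCurvature Θ p u v * coordNormalProj G L p = 0 := by
    ext w
    simp only [mul_apply_eq_comp, h.curvature p hp, map_smul, map_sub, h.normalProj_differential hp]
    simp
  have hΘeq : ∀ u, Θ p u = coordForm G L Θ p u + coordSecond G L Θ p u := fun u ↦ by
    simp [coordSecond]
  have e : formCurvature (coordForm G L Θ) p u v = formCurvature Θ p u v -
      ((fderiv ℝ Θ p - fderiv ℝ (coordForm G L Θ) p) u v +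
      (coordForm G L Θ p u * coordSecond G L Θ p v - coordSecond G L Θ p v * coordForm G L Θ p u)) +
      ((fderiv ℝ Θ p - fderiv ℝ (coordForm G L Θ) p) v u +
      (coordForm G L Θ p v * coordSecond G L Θ p u - coordSecond G L Θ p u * coordForm G L Θ p v)) +
      (coordSecond G L Θ p v * coordSecond G L Θ p u -
        coordSecond G L Θ p u * coordSecond G L Θ p v) := by
    simp only [formCurvature, hΘeq u, hΘeq v, sub_apply]
    noncomm_ring
  rw [e, mul_add, mul_add, mul_sub, add_mul, add_mul, sub_mul, h1, h2, h3]
  simp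

/-- The Ricci equation. -/
theorem metric_formCurvature (h : CoordImmersion B G L Θ κ) {p : E} (hp : p ∈ B) (u v : E) {ξ η : F}
    (hξ : coordNormalProj G L p ξ = ξ) (hη : coordNormalProj G L p η = η) :
    G p (coordNormalProj G L p (formCurvature (coordForm G L Θ) p u v ξ)) η =
      G p (coordSecond G L Θ p v ξ) (coordSecond G L Θ p u η) -
      G p (coordSecond G L Θ p u ξ) (coordSecond G L Θ p v η) := by
  have h1 := congrArg (fun T : F →L[ℝ] F ↦ T ξ) (h.normalProj_formCurvature hp u v)
  simp only [mul_apply_eq_comp, hξ, sub_apply] at h1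
  have h5 : ∀ v, G p (coordNormalProj G L p v) η = G p v η := fun v ↦ by
    rw [coordNormalProj, sub_apply, map_sub, sub_apply,
      one_apply_eq_self, sub_eq_self, h.symm p hp, ← hη]
    exact h.metric_normalProj hp η _
  have h6 : ∀ u v, G p (coordSecond G L Θ p v (coordSecond G L Θ p u ξ)) η =
      -G p (coordSecond G L Θ p u ξ) (coordSecond G L Θ p v η) := fun u v ↦ by
    rw [(h.second_apply_normal hp u hξ).2]
    exact h.metric_second hp v _ hη
  rw [h1, h5, map_sub, sub_apply, h6, h6]
  ring

end CoordImmersion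

end Coordinates

/-! ### Frames of the tangent bundle given by charts -/

section ChartFrame

variable {F : Type*} [NormedAddCommGroup F] [NormedSpace ℝ F]
  {N : Type*} [TopologicalSpace N] [ChartedSpace F N] [IsManifold 𝓘(ℝ, F) ∞ N]
  {V : Type*} [NormedAddCommGroup V] [NormedSpace ℝ V]

/-- The coordinates of tangent vectors in the chart at `q`. -/
noncomputable def chartCoord (q z : N) : TangentSpace 𝓘(ℝ, F) z →L[ℝ] F :=
  (trivializationAt F (TangentSpace 𝓘(ℝ, F) : N → Type _) q).continuousLinearMapAt ℝ z

/-- The tangent vector with given coordinates in the chart at `q`. -/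
noncomputable def chartFrame (q z : N) : F →L[ℝ] TangentSpace 𝓘(ℝ, F) z :=
  (trivializationAt F (TangentSpace 𝓘(ℝ, F) : N → Type _) q).symmL ℝ z

theorem chartCoord_chartFrame {q z : N} (hz : z ∈ (chartAt F q).source) (v : F) :
    chartCoord q z (chartFrame q z v) = v :=
  Trivialization.continuousLinearMapAt_symmL _ (by simpa using hz) v

theorem chartFrame_chartCoord {q z : N} (hz : z ∈ (chartAt F q).source)
    (v : TangentSpace 𝓘(ℝ, F) z) : chartFrame q z (chartCoord q z v) = v :=
  Trivialization.symmL_continuousLinearMapAt _ (by simpa using hz) v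

theorem trivializationAt_snd {q z : N} (hz : z ∈ (chartAt F q).source)
    (v : TangentSpace 𝓘(ℝ, F) z) :
    (trivializationAt F (TangentSpace 𝓘(ℝ, F) : N → Type _) q ⟨z, v⟩).2 = chartCoord q z v :=
  (Trivialization.continuousLinearMapAt_apply_of_mem ℝ
    (trivializationAt F (TangentSpace 𝓘(ℝ, F) : N → Type _) q) (by simpa using hz) v).symm

theorem eventually_mem_chartSource {q z : N} (hz : z ∈ (chartAt F q).source) :
    ∀ᶠ y in 𝓝 z, y ∈ (chartAt F q).source :=
  (chartAt F q).open_source.mem_nhds hz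

theorem hasMFDerivAt_chart {q z : N} (hz : z ∈ (chartAt F q).source) :
    HasMFDerivAt 𝓘(ℝ, F) 𝓘(ℝ, F) (extChartAt 𝓘(ℝ, F) q) z (chartCoord q z) := by
  have h := (mdifferentiableAt_extChartAt (I := 𝓘(ℝ, F)) hz).hasMFDerivAt
  rw [← TangentBundle.continuousLinearMapAt_trivializationAt hz] at h
  exact h

theorem hasMFDerivAt_of_chart {q z : N} (hz : z ∈ (chartAt F q).source) {h : N → V} {h' : F →L[ℝ] V}
    (hh : HasFDerivAt (h ∘ (extChartAt 𝓘(ℝ, F) q).symm) h' (extChartAt 𝓘(ℝ, F) q z)) :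
    HasMFDerivAt 𝓘(ℝ, F) 𝓘(ℝ, V) h z (h' ∘L chartCoord q z) := by
  have h1 := HasMFDerivAt.comp z hh.hasMFDerivAt (hasMFDerivAt_chart hz)
  refine h1.congr_of_eventuallyEq ?_
  filter_upwards [eventually_mem_chartSource hz] with y hy
  simp only [Function.comp_apply]
  rw [(extChartAt 𝓘(ℝ, F) q).left_inv (by simpa using hy)]

theorem HasMFDerivAt.mvfderiv_eq {E' M' : Type*} [NormedAddCommGroup E'] [NormedSpace ℝ E']
    [TopologicalSpace M'] [ChartedSpace E' M'] {h : M' → V} {z : M'}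
    {h' : TangentSpace 𝓘(ℝ, E') z →L[ℝ] V}
    (hh : HasMFDerivAt 𝓘(ℝ, E') 𝓘(ℝ, V) h z h') : mvfderiv 𝓘(ℝ, E') h z = h' :=
  hh.mfderiv

theorem contMDiffAt_section_chart_iff {n : WithTop ℕ∞} (hn : n ≤ ∞) {q z : N}
    (hz : z ∈ (chartAt F q).source)
    {σ : Π y : N, TangentSpace 𝓘(ℝ, F) y} :
    ContMDiffAt 𝓘(ℝ, F) 𝓘(ℝ, F).tangent n (fun y ↦ (⟨y, σ y⟩ : TangentBundle 𝓘(ℝ, F) N)) z ↔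
      ContMDiffAt 𝓘(ℝ, F) 𝓘(ℝ, F) n (fun y ↦ chartCoord q y (σ y)) z := by
  have : IsManifold 𝓘(ℝ, F) (n + 1) N := IsManifold.of_le (n := ∞) (by
    have : n + 1 ≤ ∞ + 1 := by gcongr
    simpa using this)
  have : ContMDiffVectorBundle n F (TangentSpace 𝓘(ℝ, F) : N → Type _) 𝓘(ℝ, F) :=
    TangentBundle.contMDiffVectorBundle
  refine ((trivializationAt F (TangentSpace 𝓘(ℝ, F) : N → Type _) q).contMDiffAt_section_iff
    (n := n) (IB := 𝓘(ℝ, F)) (s := σ) (by simpa using hz)).trans ?_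
  refine Filter.EventuallyEq.contMDiffAt_iff ?_
  filter_upwards [eventually_mem_chartSource hz] with y hy using trivializationAt_snd hy _

theorem mdifferentiableAt_section_chart_iff {q z : N} (hz : z ∈ (chartAt F q).source)
    {σ : Π y : N, TangentSpace 𝓘(ℝ, F) y} :
    MDifferentiableAt 𝓘(ℝ, F) 𝓘(ℝ, F).tangent
        (fun y ↦ (⟨y, σ y⟩ : TangentBundle 𝓘(ℝ, F) N)) z ↔
      MDifferentiableAt 𝓘(ℝ, F) 𝓘(ℝ, F) (fun y ↦ chartCoord q y (σ y)) z := by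
  have : IsManifold 𝓘(ℝ, F) (1 + 1) N := IsManifold.of_le (n := ∞) (by norm_cast)
  have : ContMDiffVectorBundle 1 F (TangentSpace 𝓘(ℝ, F) : N → Type _) 𝓘(ℝ, F) :=
    TangentBundle.contMDiffVectorBundle
  refine ((trivializationAt F (TangentSpace 𝓘(ℝ, F) : N → Type _) q).mdifferentiableAt_section_iff
    (IB := 𝓘(ℝ, F)) (s := σ) (by simpa using hz)).trans ?_
  refine Filter.EventuallyEq.mdifferentiableAt_iff ?_
  filter_upwards [eventually_mem_chartSource hz] with y hy using trivializationAt_snd hy _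

theorem contMDiffAt_chartFrame {q z : N} (hz : z ∈ (chartAt F q).source) (v : F) :
    ContMDiffAt 𝓘(ℝ, F) 𝓘(ℝ, F).tangent ∞
      (fun y ↦ (⟨y, chartFrame q y v⟩ : TangentBundle 𝓘(ℝ, F) N)) z := by
  rw [contMDiffAt_section_chart_iff le_rfl hz]
  refine (contMDiffAt_const (c := v)).congr_of_eventuallyEq ?_
  filter_upwards [eventually_mem_chartSource hz] with y hy using chartCoord_chartFrame hy v

theorem mdifferentiableAt_chartFrame {q z : N} (hz : z ∈ (chartAt F q).source) (v : F) :
    MDifferentiableAt 𝓘(ℝ, F) 𝓘(ℝ, F).tangent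
      (fun y ↦ (⟨y, chartFrame q y v⟩ : TangentBundle 𝓘(ℝ, F) N)) z :=
  (contMDiffAt_chartFrame hz v).mdifferentiableAt (by simp)

/-- The extensions that occur in the definition of the normal curvature are thereby coordinate
fields, whose brackets vanish. -/
theorem extend_eq_chartFrame {q z : N} (hz : z ∈ (chartAt F q).source)
    (v : TangentSpace 𝓘(ℝ, F) q) :
    FiberBundle.extend F v z = chartFrame q z (chartCoord q q v) := by
  rw [FiberBundle.extend, trivializationAt_snd (mem_chart_source F q)]
  exact (Trivialization.symmL_apply _ (by simpa using hz) _).symm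

/-- The constant vector field on a vector space. -/
def constVectorField (v : F) (x : F) : TangentSpace 𝓘(ℝ, F) x := v

theorem mdifferentiableAt_constVectorField (v x : F) :
    MDifferentiableAt 𝓘(ℝ, F) 𝓘(ℝ, F).tangent
      (fun y ↦ (⟨y, constVectorField v y⟩ : TangentBundle 𝓘(ℝ, F) F)) x :=
  (contMDiffAt_vectorSpace_iff_contDiffAt (n := 1) (V := constVectorField v)).2
    (contDiffAt_const (c := v)) |>.mdifferentiableAt one_ne_zero

theorem mlieBracket_constVectorField (v w x : F) :
    VectorField.mlieBracket 𝓘(ℝ, F) (constVectorField v) (constVectorField w) x = 0 := by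
  have h : VectorField.mlieBracket 𝓘(ℝ, F) (constVectorField v) (constVectorField w) =
      VectorField.lieBracketWithin ℝ (constVectorField v) (constVectorField w) univ := by
    rw [← VectorField.mlieBracketWithin_univ, VectorField.mlieBracketWithin_eq_lieBracketWithin]
  have h1 : ∀ v : F, fderiv ℝ (fun y : F ↦ (constVectorField v y : F)) x = 0 := fun v ↦
    (hasFDerivAt_const v x).fderiv
  have h2 := congrArg (fun T : F →L[ℝ] F ↦ T v) (h1 w)
  have h3 := congrArg (fun T : F →L[ℝ] F ↦ T w) (h1 v)
  rw [h]
  refine (congrArg (fun b : (F → F) → (F → F) → F → F ↦ b (fun _ ↦ v) (fun _ ↦ w) x)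
    (funext₂ fun _ _ ↦ VectorField.lieBracketWithin_univ)).trans ?_
  exact (congrArg₂ (fun a b : F ↦ a - b) h2 h3).trans (sub_zero _)

theorem mpullback_constVectorField {q y : N} (hy : y ∈ (chartAt F q).source) (v : F) :
    VectorField.mpullback 𝓘(ℝ, F) 𝓘(ℝ, F) (extChartAt 𝓘(ℝ, F) q) (constVectorField v) y =
      chartFrame q y v := by
  have h1 : mfderiv 𝓘(ℝ, F) 𝓘(ℝ, F) (extChartAt 𝓘(ℝ, F) q) y = chartCoord q y :=
    (hasMFDerivAt_chart hy).mfderiv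
  have h2 : (mfderiv 𝓘(ℝ, F) 𝓘(ℝ, F) (extChartAt 𝓘(ℝ, F) q) y).inverse =
      chartFrame (F := F) q y := by
    refine ContinuousLinearMap.inverse_eq ?_ ?_
    · rw [h1]; ext v; exact chartCoord_chartFrame hy v
    · rw [h1]; ext v; exact chartFrame_chartCoord hy v
  rw [VectorField.mpullback_apply, h2]
  rfl

/-- Coordinate fields are pull-backs of constant fields by the chart, and pull-back commutes with
the bracket. -/
theorem mlieBracket_chartFrame [CompleteSpace F] {q z : N} (hz : z ∈ (chartAt F q).source)
    (v w : F) :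
    VectorField.mlieBracket 𝓘(ℝ, F) (fun y ↦ chartFrame q y v) (fun y ↦ chartFrame q y w) z = 0 := by
  have : IsManifold 𝓘(ℝ, F) (minSmoothness ℝ 3) N :=
    IsManifold.of_le (n := ∞) (by simp; norm_cast)
  have key : ∀ v : F, (fun y ↦ chartFrame q y v) =ᶠ[𝓝 z] VectorField.mpullback 𝓘(ℝ, F) 𝓘(ℝ, F)
      (extChartAt 𝓘(ℝ, F) q) (constVectorField v) := by
    intro v
    filter_upwards [eventually_mem_chartSource hz] with y hy
      using (mpullback_constVectorField hy v).symm
  rw [(key v).mlieBracket_vectorField_eq (key w),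
    ← VectorField.mpullback_mlieBracket (n := ∞) (mdifferentiableAt_constVectorField v _)
      (mdifferentiableAt_constVectorField w _) (contMDiffAt_extChartAt' hz) (by simp; norm_cast),
    VectorField.mpullback_apply, mlieBracket_constVectorField, map_zero]

end ChartFrame

/-! ### Connection coefficients -/

section Christoffel

noncomputable local instance clmNormedAddCommGroup2 {V W : Type*} [NormedAddCommGroup V] [NormedSpace ℝ V]
    [NormedAddCommGroup W] [NormedSpace ℝ W] : NormedAddCommGroup (V →L[ℝ] W) :=
  ContinuousLinearMap.toNormedAddCommGroup

noncomputable local instance clmNormedSpace2 {V W : Type*} [NormedAddCommGroup V] [NormedSpace ℝ V]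
    [NormedAddCommGroup W] [NormedSpace ℝ W] : NormedSpace ℝ (V →L[ℝ] W) :=
  ContinuousLinearMap.toNormedSpace

local instance clmAddCommGroup2 {V W : Type*} [NormedAddCommGroup V] [NormedSpace ℝ V]
    [NormedAddCommGroup W] [NormedSpace ℝ W] : AddCommGroup (V →L[ℝ] W) :=
  ContinuousLinearMap.addCommGroup

variable {F : Type*} [NormedAddCommGroup F] [NormedSpace ℝ F] [FiniteDimensional ℝ F]
  {N : Type*} [TopologicalSpace N] [ChartedSpace F N] [IsManifold 𝓘(ℝ, F) ∞ N]

/-- The flat connection of the chart at `q`. -/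
noncomputable def flatCov (q : N) (σ : Π y : N, TangentSpace 𝓘(ℝ, F) y) (z : N) :
    TangentSpace 𝓘(ℝ, F) z →L[ℝ] TangentSpace 𝓘(ℝ, F) z :=
  (chartFrame q z).comp (mvfderiv 𝓘(ℝ, F) (fun y ↦ chartCoord q y (σ y)) z)

/-- The difference of two covariant derivatives is tensorial, so comparison with the flat one yields
the connection coefficients. -/
theorem isCovariantDerivativeOn_flatCov (q : N) :
    IsCovariantDerivativeOn F (flatCov q : (Π y : N, TangentSpace 𝓘(ℝ, F) y) → _)
      (chartAt F q).source where
  add {σ σ' z} hσ hσ' hz := by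
    have h := mvfderiv_add ((mdifferentiableAt_section_chart_iff hz).1 hσ)
      ((mdifferentiableAt_section_chart_iff hz).1 hσ')
    have h0 : (fun y ↦ chartCoord q y ((σ + σ') y)) =
        (fun y ↦ chartCoord q y (σ y)) + fun y ↦ chartCoord q y (σ' y) := by
      ext y; simp
    rw [flatCov, h0, h, ContinuousLinearMap.comp_add]
    rfl
  leibniz {σ h z} hσ hh hz := by
    have h1 := mvfderiv_smul hh ((mdifferentiableAt_section_chart_iff hz).1 hσ)
    have h0 : (fun y ↦ chartCoord q y ((h • σ) y)) =
        h • (fun y ↦ chartCoord q y (σ y)) := by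
      ext y; simp
    ext u
    rw [flatCov, h0, h1]
    simp [flatCov, chartFrame_chartCoord hz]

variable (cov : CovariantDerivative 𝓘(ℝ, F) F (TangentSpace 𝓘(ℝ, F) : N → Type _))

/-- The connection coefficients in the chart at `q`. -/
noncomputable def christoffelAt (q z : N) : F →L[ℝ] F →L[ℝ] F :=
  LinearMap.toContinuousBilinearMap <| LinearMap.mk₂ ℝ (fun u v : F ↦ chartCoord q z
    (IsCovariantDerivativeOn.difference (cov.isCovariantDerivativeOn (s := (chartAt F q).source))
      (isCovariantDerivativeOn_flatCov q) z (chartFrame q z v) (chartFrame q z u)))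
    (by simp) (by simp) (by simp) (by simp)

theorem chartCoord_cov {q z : N} (hz : z ∈ (chartAt F q).source)
    {σ : Π y : N, TangentSpace 𝓘(ℝ, F) y}
    (hσ : MDifferentiableAt 𝓘(ℝ, F) 𝓘(ℝ, F).tangent
      (fun y ↦ (⟨y, σ y⟩ : TangentBundle 𝓘(ℝ, F) N)) z) (u : TangentSpace 𝓘(ℝ, F) z) :
    chartCoord q z (cov σ z u) = mvfderiv 𝓘(ℝ, F) (fun y ↦ chartCoord q y (σ y)) z u +
      christoffelAt cov q z (chartCoord q z u) (chartCoord q z (σ z)) := by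
  have h := IsCovariantDerivativeOn.difference_apply
    (cov.isCovariantDerivativeOn (s := (chartAt F q).source))
    (isCovariantDerivativeOn_flatCov q) hz hσ
  have h1 := congrArg (fun T : TangentSpace 𝓘(ℝ, F) z →L[ℝ] TangentSpace 𝓘(ℝ, F) z ↦
    chartCoord q z (T u)) h
  have h2 : christoffelAt cov q z (chartCoord q z u) (chartCoord q z (σ z)) =
      chartCoord q z (IsCovariantDerivativeOn.difference
        (cov.isCovariantDerivativeOn (s := (chartAt F q).source))
        (isCovariantDerivativeOn_flatCov q) z (chartFrame q z (chartCoord q z (σ z)))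
        (chartFrame q z (chartCoord q z u))) := rfl
  rw [h2, chartFrame_chartCoord hz, chartFrame_chartCoord hz]
  refine eq_add_of_sub_eq' (Eq.trans ?_ h1.symm)
  change _ = chartCoord q z (cov σ z u - flatCov q σ z u)
  rw [map_sub]
  congr 1
  exact (chartCoord_chartFrame hz _).symm

theorem chartCoord_cov_chartFrame {q z : N} (hz : z ∈ (chartAt F q).source) (u v : F) :
    chartCoord q z (cov (fun y ↦ chartFrame q y v) z (chartFrame q z u)) =
      christoffelAt cov q z u v := by
  rw [chartCoord_cov cov hz (mdifferentiableAt_chartFrame hz v), chartCoord_chartFrame hz,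
    chartCoord_chartFrame hz]
  have h : HasMFDerivAt 𝓘(ℝ, F) 𝓘(ℝ, F) (fun y ↦ chartCoord q y (chartFrame q y v)) z 0 := by
    refine (hasMFDerivAt_const v z).congr_of_eventuallyEq ?_
    filter_upwards [eventually_mem_chartSource hz] with y hy using chartCoord_chartFrame hy v
  rw [h.mvfderiv_eq]
  exact zero_add _

/-- The connection coefficients in coordinates. -/
noncomputable def christoffel (q : N) (p : F) : F →L[ℝ] F →L[ℝ] F :=
  christoffelAt cov q ((extChartAt 𝓘(ℝ, F) q).symm p)

variable (g : PseudoRiemannianMetric F N)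

/-- The metric in coordinates. -/
noncomputable def coordMetric (q : N) (p : F) : F →L[ℝ] F →L[ℝ] ℝ :=
  LinearMap.toContinuousBilinearMap <| LinearMap.mk₂ ℝ (fun v w : F ↦
    g.inner ((extChartAt 𝓘(ℝ, F) q).symm p) (chartFrame q _ v) (chartFrame q _ w))
    (fun _ _ _ ↦ by simp only [map_add, add_apply]) (fun _ _ _ ↦ by simp only [map_smul, smul_apply])
    (fun _ _ _ ↦ by simp only [map_add]) (fun _ _ _ ↦ by simp only [map_smul])

theorem coordMetric_apply (q : N) (p v w : F) : coordMetric g q p v w =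
    g.inner ((extChartAt 𝓘(ℝ, F) q).symm p) (chartFrame q _ v) (chartFrame q _ w) := rfl

theorem mem_chartSource_of_mem_target {q : N} {p : F} (hp : p ∈ (extChartAt 𝓘(ℝ, F) q).target) :
    (extChartAt 𝓘(ℝ, F) q).symm p ∈ (chartAt F q).source := by
  simpa using (extChartAt 𝓘(ℝ, F) q).map_target hp

theorem coordMetric_symm (q : N) (p v w : F) : coordMetric g q p v w = coordMetric g q p w v :=
  g.symm _ (chartFrame q _ v) (chartFrame q _ w)

theorem coordMetric_nondegenerate {q : N} {p : F} (hp : p ∈ (extChartAt 𝓘(ℝ, F) q).target) (v : F)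
    (hv : ∀ w, coordMetric g q p v w = 0) : v = 0 := by
  have hz := mem_chartSource_of_mem_target hp
  have h := g.nondegenerate _ (chartFrame q ((extChartAt 𝓘(ℝ, F) q).symm p) v) (fun w ↦ by
    rw [← chartFrame_chartCoord hz w]; exact hv _)
  rw [← chartCoord_chartFrame hz v, h, map_zero]

theorem contMDiffAt_inner {z : N} {V W : Π y : N, TangentSpace 𝓘(ℝ, F) y}
    (hV : ContMDiffAt 𝓘(ℝ, F) 𝓘(ℝ, F).tangent ∞ (fun y ↦ (⟨y, V y⟩ : TangentBundle 𝓘(ℝ, F) N)) z)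
    (hW : ContMDiffAt 𝓘(ℝ, F) 𝓘(ℝ, F).tangent ∞ (fun y ↦ (⟨y, W y⟩ : TangentBundle 𝓘(ℝ, F) N)) z) :
    ContMDiffAt 𝓘(ℝ, F) 𝓘(ℝ, ℝ) ∞ (fun y ↦ g.inner y (V y) (W y)) z := by
  have : ContMDiffAt 𝓘(ℝ, F) (𝓘(ℝ, F).prod 𝓘(ℝ)) ∞
      (fun m ↦ TotalSpace.mk' ℝ (E := Bundle.Trivial N ℝ) m (g.inner m (V m) (W m))) z := by
    apply ContMDiffAt.clm_bundle_apply₂ (F₁ := F) (F₂ := F)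
    · exact g.contMDiff.contMDiffAt
    · exact hV
    · exact hW
  simp only [contMDiffAt_totalSpace] at this
  exact this.2

theorem ContMDiffAt.contDiffAt_chart {V : Type*} [NormedAddCommGroup V] [NormedSpace ℝ V] {q : N}
    {p : F} (hp : p ∈ (extChartAt 𝓘(ℝ, F) q).target) {h : N → V}
    (hh : ContMDiffAt 𝓘(ℝ, F) 𝓘(ℝ, V) ∞ h ((extChartAt 𝓘(ℝ, F) q).symm p)) :
    ContDiffAt ℝ ∞ (h ∘ (extChartAt 𝓘(ℝ, F) q).symm) p := by
  rw [← contMDiffAt_iff_contDiffAt]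
  refine ContMDiffAt.comp (I' := 𝓘(ℝ, F)) _ hh ?_
  exact (contMDiffOn_extChartAt_symm (I := 𝓘(ℝ, F)) (n := ∞) q).contMDiffAt
    ((isOpen_extChartAt_target q).mem_nhds hp)

theorem contDiffOn_coordMetric (q : N) :
    ContDiffOn ℝ ∞ (coordMetric g q) (extChartAt 𝓘(ℝ, F) q).target := by
  refine contDiffOn_clm_apply.2 fun v ↦ contDiffOn_clm_apply.2 fun w p hp ↦ ?_
  have hz := mem_chartSource_of_mem_target hp
  exact (ContMDiffAt.contDiffAt_chart hp (contMDiffAt_inner g (contMDiffAt_chartFrame hz v)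
    (contMDiffAt_chartFrame hz w))).contDiffWithinAt

variable {g cov}

theorem christoffel_symm (hcov : g.IsLeviCivita cov) {q : N} {p : F}
    (hp : p ∈ (extChartAt 𝓘(ℝ, F) q).target) (u v : F) :
    christoffel cov q p u v = christoffel cov q p v u := by
  have : CompleteSpace F := FiniteDimensional.complete ℝ F
  have : IsManifold 𝓘(ℝ, F) 2 N := IsManifold.of_le (n := ∞) (by norm_cast)
  have hz := mem_chartSource_of_mem_target hp
  have h := (CovariantDerivative.torsion_eq_zero_iff cov).1 hcov.torsion_eq_zero
    (mdifferentiableAt_chartFrame hz u) (mdifferentiableAt_chartFrame hz v)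
  rw [mlieBracket_chartFrame hz] at h
  have h1 := congrArg (chartCoord q _) h
  rw [map_sub, chartCoord_cov_chartFrame cov hz, chartCoord_cov_chartFrame cov hz, map_zero,
    sub_eq_zero] at h1
  exact h1

set_option synthInstance.maxHeartbeats 200000 in
theorem fderiv_coordMetric (hcov : g.IsLeviCivita cov) {q : N} {p : F}
    (hp : p ∈ (extChartAt 𝓘(ℝ, F) q).target) (u v w : F) :
    fderiv ℝ (coordMetric g q) p u v w = coordMetric g q p (christoffel cov q p u v) w +
      coordMetric g q p v (christoffel cov q p u w) := by
  have hz := mem_chartSource_of_mem_target hp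
  have hp' : extChartAt 𝓘(ℝ, F) q ((extChartAt 𝓘(ℝ, F) q).symm p) = p :=
    (extChartAt 𝓘(ℝ, F) q).right_inv hp
  have h := hcov.metric _ _ _ (chartFrame q ((extChartAt 𝓘(ℝ, F) q).symm p) u)
    (mdifferentiableAt_chartFrame hz v) (mdifferentiableAt_chartFrame hz w)
  have hd : HasFDerivAt (coordMetric g q) (fderiv ℝ (coordMetric g q) p) p :=
    (((contDiffOn_coordMetric g q).contDiffAt
      ((isOpen_extChartAt_target q).mem_nhds hp)).differentiableAt (by simp)).hasFDerivAt
  have hd' := (hd.clm_apply (hasFDerivAt_const v p)).clm_apply (hasFDerivAt_const w p)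
  have hm := hasMFDerivAt_of_chart hz (h := fun z ↦ g.inner z (chartFrame q z v) (chartFrame q z w))
    (by rw [hp']; exact hd')
  rw [hm.mvfderiv_eq] at h
  have e : ∀ u v, chartFrame q _ (christoffel cov q p u v) =
      cov (fun y ↦ chartFrame q y v) ((extChartAt 𝓘(ℝ, F) q).symm p) (chartFrame q _ u) := by
    intro u v
    rw [← chartFrame_chartCoord hz (cov _ _ _), chartCoord_cov_chartFrame cov hz]
    rfl
  rw [coordMetric_apply, coordMetric_apply, e, e, ← h]
  have hs : ∀ a : F, (coordMetric g q p v ∘SL (0 : F →L[ℝ] F) + (coordMetric g q p ∘SL (0 : F →L[ℝ] F) +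
      (fderiv ℝ (coordMetric g q) p).flip v).flip w) a = fderiv ℝ (coordMetric g q) p a v w := by
    intro a
    change coordMetric g q p v 0 + (coordMetric g q p 0 w + fderiv ℝ (coordMetric g q) p a v w) = _
    rw [map_zero, map_zero, zero_apply, zero_add, zero_add]
  exact (hs u).symm.trans (congrArg _ (chartCoord_chartFrame hz u).symm)

/-- The Koszul formula. -/
theorem two_mul_coordMetric_christoffel (hcov : g.IsLeviCivita cov) {q : N} {p : F}
    (hp : p ∈ (extChartAt 𝓘(ℝ, F) q).target) (u v w : F) :
    2 * coordMetric g q p (christoffel cov q p u v) w =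
      fderiv ℝ (coordMetric g q) p u v w + fderiv ℝ (coordMetric g q) p v u w -
        fderiv ℝ (coordMetric g q) p w u v := by
  rw [fderiv_coordMetric hcov hp, fderiv_coordMetric hcov hp, fderiv_coordMetric hcov hp,
    christoffel_symm hcov hp v u, christoffel_symm hcov hp w u, christoffel_symm hcov hp w v,
    coordMetric_symm g q p v (christoffel cov q p u w)]
  ring

-- Being Levi-Civita does not include smoothness of `cov`. It is recovered from the Koszul formula,
-- by inverting the smooth nondegenerate metric.
set_option synthInstance.maxHeartbeats 200000 in
theorem contDiffOn_christoffel (hcov : g.IsLeviCivita cov) (q : N) :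
    ContDiffOn ℝ ∞ (christoffel cov q) (extChartAt 𝓘(ℝ, F) q).target := by
  have hG := contDiffOn_coordMetric g q
  have hd : ∀ p ∈ (extChartAt 𝓘(ℝ, F) q).target,
      HasFDerivAt (coordMetric g q) (fderiv ℝ (coordMetric g q) p) p := fun p hp ↦
    ((hG.contDiffAt ((isOpen_extChartAt_target q).mem_nhds hp)).differentiableAt
      (by simp)).hasFDerivAt
  refine contDiffOn_clm_apply.2 fun u ↦ contDiffOn_clm_apply.2 fun v ↦ ?_
  -- Half of the right-hand side of the Koszul formula, as a functional of the third vector.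
  let K : F → F →L[ℝ] ℝ := fun p ↦ (1 / 2 : ℝ) • (fderiv ℝ (coordMetric g q) p u v +
    fderiv ℝ (coordMetric g q) p v u - ((fderiv ℝ (coordMetric g q) p).flip u).flip v)
  have hK : ContDiffOn ℝ ∞ K (extChartAt 𝓘(ℝ, F) q).target := by
    refine contDiffOn_clm_apply.2 fun w ↦ ?_
    have h3 : ∀ a b c : F, ContDiffOn ℝ ∞ (fun p ↦ fderiv ℝ (coordMetric g q) p a b c)
        (extChartAt 𝓘(ℝ, F) q).target := by
      intro a b c
      have h4 : ContDiffOn ℝ ∞ (fun p ↦ coordMetric g q p b c) (extChartAt 𝓘(ℝ, F) q).target :=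
        (hG.clm_apply contDiffOn_const).clm_apply contDiffOn_const
      refine ((h4.fderiv_of_isOpen (m := ∞) (isOpen_extChartAt_target q) (by simp)).clm_apply
        (contDiffOn_const (c := a))).congr fun p hp ↦ ?_
      rw [(((hd p hp).clm_apply (hasFDerivAt_const b p)).clm_apply (hasFDerivAt_const c p)).fderiv]
      simp
    exact ((((h3 u v w).add (h3 v u w)).sub (h3 w u v)).const_smul (1 / 2 : ℝ))
  have hinv : ∀ p ∈ (extChartAt 𝓘(ℝ, F) q).target, ∃ e : F ≃L[ℝ] (F →L[ℝ] ℝ),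
      (e : F →L[ℝ] F →L[ℝ] ℝ) = coordMetric g q p := by
    intro p hp
    have hinj : Function.Injective (coordMetric g q p).toLinearMap := by
      rw [← LinearMap.ker_eq_bot, LinearMap.ker_eq_bot']
      intro v hv
      exact coordMetric_nondegenerate g hp v fun w ↦
        congrArg (fun T : F →L[ℝ] ℝ ↦ T w) hv
    have hdim : Module.finrank ℝ F = Module.finrank ℝ (F →L[ℝ] ℝ) := by
      rw [← (LinearMap.toContinuousLinearMap (𝕜 := ℝ) (E := F) (F' := ℝ)).finrank_eq]
      exact (Subspace.dual_finrank_eq (K := ℝ) (V := F)).symm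
    exact ⟨(LinearEquiv.ofInjectiveOfFinrankEq _ hinj hdim).toContinuousLinearEquiv, by ext; rfl⟩
  have heq : ∀ p ∈ (extChartAt 𝓘(ℝ, F) q).target,
      christoffel cov q p u v = (coordMetric g q p).inverse (K p) := by
    intro p hp
    obtain ⟨e, he⟩ := hinv p hp
    have h1 : K p = e (christoffel cov q p u v) := by
      rw [← ContinuousLinearEquiv.coe_coe, he]
      ext w
      have := two_mul_coordMetric_christoffel hcov hp u v w
      simp only [K, smul_apply, add_apply, sub_apply, ContinuousLinearMap.flip_apply, smul_eq_mul]
      linarith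
    rw [h1, ← he, ContinuousLinearMap.inverse_equiv]
    simp
  refine ContDiffOn.congr (ContDiffOn.clm_apply ?_ hK) heq
  intro p hp
  obtain ⟨e, he⟩ := hinv p hp
  have h2 : ContDiffAt ℝ ∞ ContinuousLinearMap.inverse (coordMetric g q p) := by
    rw [← he]; exact contDiffAt_map_inverse e
  exact ContDiffAt.comp_contDiffWithinAt (g := ContinuousLinearMap.inverse) p h2 (hG p hp)

theorem formCurvature_christoffel (hcov : g.IsLeviCivita cov) {κ : ℝ}
    (hκ : g.HasConstantCurvature cov κ) {q : N} {p : F}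
    (hp : p ∈ (extChartAt 𝓘(ℝ, F) q).target) (u v w : F) :
    formCurvature (christoffel cov q) p u v w =
      κ • (coordMetric g q p v w • u - coordMetric g q p u w • v) := by
  have : CompleteSpace F := FiniteDimensional.complete ℝ F
  have hz := mem_chartSource_of_mem_target hp
  have hp' : extChartAt 𝓘(ℝ, F) q ((extChartAt 𝓘(ℝ, F) q).symm p) = p :=
    (extChartAt 𝓘(ℝ, F) q).right_inv hp
  have h := hκ _ _ _ _ (contMDiffAt_chartFrame hz u) (contMDiffAt_chartFrame hz v)
    (contMDiffAt_chartFrame hz w)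
  rw [mlieBracket_chartFrame hz, map_zero, sub_zero] at h
  have hd : HasFDerivAt (christoffel cov q) (fderiv ℝ (christoffel cov q) p) p :=
    (((contDiffOn_christoffel hcov q).contDiffAt
      ((isOpen_extChartAt_target q).mem_nhds hp)).differentiableAt (by simp)).hasFDerivAt
  -- The second covariant derivative of a coordinate field is `∂Γ + ΓΓ`; its skew part is the
  -- curvature of the form, as the brackets of coordinate fields vanish.
  have key : ∀ u v : F, chartCoord q ((extChartAt 𝓘(ℝ, F) q).symm p)
      (cov (fun z ↦ cov (fun y ↦ chartFrame q y w) z (chartFrame q z v))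
        ((extChartAt 𝓘(ℝ, F) q).symm p) (chartFrame q ((extChartAt 𝓘(ℝ, F) q).symm p) u)) =
      fderiv ℝ (christoffel cov q) p u v w +
        christoffel cov q p u (christoffel cov q p v w) := by
    intro u v
    have hd' := (hd.clm_apply (hasFDerivAt_const v p)).clm_apply (hasFDerivAt_const w p)
    have hm := (hasMFDerivAt_of_chart hz (h := fun z ↦ christoffelAt cov q z v w)
        (by rw [hp']; exact hd')).congr_of_eventuallyEq
      (f₁ := fun z ↦ (chartCoord q z (cov (fun y ↦ chartFrame q y w) z (chartFrame q z v)) : F)) (by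
      filter_upwards [eventually_mem_chartSource hz] with y hy
        using chartCoord_cov_chartFrame cov hy v w)
    rw [chartCoord_cov cov hz ((mdifferentiableAt_section_chart_iff hz).2 hm.mdifferentiableAt),
      hm.mvfderiv_eq, chartCoord_cov_chartFrame cov hz, chartCoord_chartFrame hz]
    have hs : ∀ a : F, (christoffel cov q p v ∘SL (0 : F →L[ℝ] F) + (christoffel cov q p ∘SL (0 : F →L[ℝ] F) +
        (fderiv ℝ (christoffel cov q) p).flip v).flip w) a =
        fderiv ℝ (christoffel cov q) p a v w := by
      intro a
      simp only [ContinuousLinearMap.comp_zero, zero_add, ContinuousLinearMap.flip_apply]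
    exact congrArg (· + christoffel cov q p u (christoffel cov q p v w))
      ((congrArg _ (chartCoord_chartFrame hz u)).trans (hs u))
  have h1 := congrArg (chartCoord q _) h
  rw [map_sub, key, key, map_smul, map_sub, map_smul, map_smul, chartCoord_chartFrame hz,
    chartCoord_chartFrame hz] at h1
  rw [coordMetric_apply, coordMetric_apply, ← h1]
  simp only [formCurvature, add_apply, sub_apply, mul_apply_eq_comp]
  abel

end Christoffel

/-! ### Spacelike immersions in coordinates -/

section Generic

variable {F : Type*} [NormedAddCommGroup F] [NormedSpace ℝ F] [FiniteDimensional ℝ F]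
  {N : Type*} [TopologicalSpace N] [ChartedSpace F N] [IsManifold 𝓘(ℝ, F) ∞ N]

theorem coordMetric_chart (g : PseudoRiemannianMetric F N) {q z : N}
    (hz : z ∈ (chartAt F q).source) (v w : F) :
    coordMetric g q (extChartAt 𝓘(ℝ, F) q z) v w =
      g.inner z (chartFrame q z v) (chartFrame q z w) := by
  have : ∀ z', z' = z → g.inner z' (chartFrame q z' v) (chartFrame q z' w) =
      g.inner z (chartFrame q z v) (chartFrame q z w) := by rintro _ rfl; rfl
  exact this _ ((extChartAt 𝓘(ℝ, F) q).left_inv (by simpa using hz))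

theorem coordMetric_chartCoord (g : PseudoRiemannianMetric F N) {q z : N}
    (hz : z ∈ (chartAt F q).source) (v w : TangentSpace 𝓘(ℝ, F) z) :
    coordMetric g q (extChartAt 𝓘(ℝ, F) q z) (chartCoord q z v) (chartCoord q z w) =
      g.inner z v w := by
  rw [coordMetric_chart g hz, chartFrame_chartCoord hz, chartFrame_chartCoord hz]

theorem christoffel_chart
    (cov : CovariantDerivative 𝓘(ℝ, F) F (TangentSpace 𝓘(ℝ, F) : N → Type _)) {q z : N}
    (hz : z ∈ (chartAt F q).source) :
    christoffel cov q (extChartAt 𝓘(ℝ, F) q z) = christoffelAt cov q z :=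
  congrArg (christoffelAt cov q) ((extChartAt 𝓘(ℝ, F) q).left_inv (by simpa using hz))

variable {G : Type*} [NormedAddCommGroup G] [NormedSpace ℝ G]
  {S : Type*} [TopologicalSpace S] [ChartedSpace G S]

theorem HasMFDerivAt.clm_apply_space {V W : Type*} [NormedAddCommGroup V] [NormedSpace ℝ V]
    [NormedAddCommGroup W] [NormedSpace ℝ W] {c : S → V →L[ℝ] W} {u : S → V} {s : S}
    {c' : G →L[ℝ] V →L[ℝ] W} {u' : G →L[ℝ] V}
    (hc : HasMFDerivAt 𝓘(ℝ, G) 𝓘(ℝ, V →L[ℝ] W) c s c')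
    (hu : HasMFDerivAt 𝓘(ℝ, G) 𝓘(ℝ, V) u s u') :
    HasMFDerivAt 𝓘(ℝ, G) 𝓘(ℝ, W) (fun t ↦ c t (u t)) s
      ((c s).comp u' + c'.flip (u s) : G →L[ℝ] W) := by
  refine ⟨hc.1.clm_apply hu.1, ?_⟩
  have h1 := HasFDerivWithinAt.clm_apply (𝕜 := ℝ) hc.2 hu.2
  have e1 : writtenInExtChartAt 𝓘(ℝ, G) 𝓘(ℝ, V →L[ℝ] W) s c (extChartAt 𝓘(ℝ, G) s s) = c s :=
    congrArg c ((chartAt G s).left_inv (mem_chart_source G s))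
  have e2 : writtenInExtChartAt 𝓘(ℝ, G) 𝓘(ℝ, V) s u (extChartAt 𝓘(ℝ, G) s s) = u s :=
    congrArg u ((chartAt G s).left_inv (mem_chart_source G s))
  rw [e1, e2] at h1
  exact h1

theorem hasMFDerivAt_chart_comp {q : N} {h : S → N} {s : S} (hs : h s ∈ (chartAt F q).source)
    (hh : MDifferentiableAt 𝓘(ℝ, G) 𝓘(ℝ, F) h s) :
    HasMFDerivAt 𝓘(ℝ, G) 𝓘(ℝ, F) (fun t ↦ extChartAt 𝓘(ℝ, F) q (h t)) s
      ((chartCoord (F := F) q (h s)).comp (mfderiv 𝓘(ℝ, G) 𝓘(ℝ, F) h s) : G →L[ℝ] F) :=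
  HasMFDerivAt.comp s (hasMFDerivAt_chart hs) hh.hasMFDerivAt

/-- The change of coordinates on tangent vectors between two charts. -/
noncomputable def chartChange (q' q z : N) : F →L[ℝ] F :=
  (chartCoord (F := F) q z).comp (chartFrame q' z)

theorem mdifferentiableAt_chartChange {q' q z : N} (hz' : z ∈ (chartAt F q').source)
    (hz : z ∈ (chartAt F q).source) :
    MDifferentiableAt 𝓘(ℝ, F) 𝓘(ℝ, F →L[ℝ] F) (chartChange (F := F) q' q) z := by
  have : IsManifold 𝓘(ℝ, F) (1 + 1) N := IsManifold.of_le (n := ∞) (by norm_cast)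
  have : ContMDiffVectorBundle 1 F (TangentSpace 𝓘(ℝ, F) : N → Type _) 𝓘(ℝ, F) :=
    TangentBundle.contMDiffVectorBundle
  have h := (contMDiffAt_coordChangeL (IB := 𝓘(ℝ, F)) (n := 1)
    (e := trivializationAt F (TangentSpace 𝓘(ℝ, F) : N → Type _) q')
    (e' := trivializationAt F (TangentSpace 𝓘(ℝ, F) : N → Type _) q)
    (x := z) (by simpa using hz') (by simpa using hz)).mdifferentiableAt (by simp)
  refine h.congr_of_eventuallyEq ?_
  filter_upwards [eventually_mem_chartSource hz, eventually_mem_chartSource hz'] with y hy hy'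
  ext v
  rw [ContinuousLinearEquiv.coe_coe, Trivialization.coordChangeL_apply _ _
    ⟨by simpa using hy', by simpa using hy⟩]
  have h2 : (trivializationAt F (TangentSpace 𝓘(ℝ, F) : N → Type _) q').symm y v =
    chartFrame q' y v := (Trivialization.symmL_apply _ (by simpa using hy') _).symm
  rw [h2, trivializationAt_snd hy]
  rfl

theorem mdifferentiableAt_along_iff {q : N} {h : S → N} {ξ : Π s : S, TangentSpace 𝓘(ℝ, F) (h s)}
    {s : S} (hs : h s ∈ (chartAt F q).source) :
    MDifferentiableAt 𝓘(ℝ, G) 𝓘(ℝ, F).tangent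
        (fun t ↦ (⟨h t, ξ t⟩ : TangentBundle 𝓘(ℝ, F) N)) s ↔
      MDifferentiableAt 𝓘(ℝ, G) 𝓘(ℝ, F) h s ∧
      MDifferentiableAt 𝓘(ℝ, G) 𝓘(ℝ, F) (fun t ↦ (chartCoord q (h t) (ξ t) : F)) s := by
  have : IsManifold 𝓘(ℝ, F) (1 + 1) N := IsManifold.of_le (n := ∞) (by norm_cast)
  have : ContMDiffVectorBundle 1 F (TangentSpace 𝓘(ℝ, F) : N → Type _) 𝓘(ℝ, F) :=
    TangentBundle.contMDiffVectorBundle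
  have he : ContinuousAt h s →
      (fun t ↦ (trivializationAt F (TangentSpace 𝓘(ℝ, F) : N → Type _) q ⟨h t, ξ t⟩).2)
      =ᶠ[𝓝 s] fun t ↦ (chartCoord q (h t) (ξ t) : F) := by
    intro hc
    filter_upwards [hc.eventually (eventually_mem_chartSource hs)] with t ht
      using trivializationAt_snd ht _
  refine (Trivialization.mdifferentiableAt_totalSpace_iff (IB := 𝓘(ℝ, F))
    (e := trivializationAt F (TangentSpace 𝓘(ℝ, F) : N → Type _) q)
    (f := fun t ↦ (⟨h t, ξ t⟩ : TangentBundle 𝓘(ℝ, F) N)) (x₀ := s)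
    (by simpa [Trivialization.mem_source] using hs)).trans ?_
  exact and_congr_right fun hc ↦ (he hc.continuousAt).mdifferentiableAt_iff

/-- The covariant derivative along a map in the coordinates of a chart. -/
theorem chartCoord_covAlong
    (cov : CovariantDerivative 𝓘(ℝ, F) F (TangentSpace 𝓘(ℝ, F) : N → Type _)) {q : N} {h : S → N}
    {ξ : Π s : S, TangentSpace 𝓘(ℝ, F) (h s)} {s : S} (hs : h s ∈ (chartAt F q).source)
    (hξ : MDifferentiableAt 𝓘(ℝ, G) 𝓘(ℝ, F).tangent
        (fun t ↦ (⟨h t, ξ t⟩ : TangentBundle 𝓘(ℝ, F) N)) s) (w : TangentSpace 𝓘(ℝ, G) s) :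
    chartCoord q (h s) (covAlong G cov h ξ s w) =
      mvfderiv 𝓘(ℝ, G) (fun t ↦ (chartCoord q (h t) (ξ t) : F)) s w +
        christoffelAt cov q (h s) (chartCoord q (h s) (mfderiv 𝓘(ℝ, G) 𝓘(ℝ, F) h s w))
          (chartCoord q (h s) (ξ s)) := by
  have hs' : h s ∈ (chartAt F (h s)).source := mem_chart_source F (h s)
  obtain ⟨hh, hξ'⟩ := (mdifferentiableAt_along_iff hs').1 hξ
  set a : S → F := fun t ↦ chartCoord (h s) (h t) (ξ t) with ha
  obtain ⟨D, hT⟩ : ∃ D : F →L[ℝ] F →L[ℝ] F, HasMFDerivAt 𝓘(ℝ, F) 𝓘(ℝ, F →L[ℝ] F)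
      (chartChange (F := F) (h s) q) (h s) D :=
    ⟨_, (mdifferentiableAt_chartChange hs' hs).hasMFDerivAt⟩
  have e1 : mvfderiv 𝓘(ℝ, G) (fun z ↦
      (trivializationAt F (TangentSpace 𝓘(ℝ, F) : N → Type _) (h s) ⟨h z, ξ z⟩).2) s =
      mvfderiv 𝓘(ℝ, G) a s := by
    have : (fun z ↦ (trivializationAt F (TangentSpace 𝓘(ℝ, F) : N → Type _) (h s) ⟨h z, ξ z⟩).2)
        =ᶠ[𝓝 s] a := by
      filter_upwards [hh.continuousAt.eventually (eventually_mem_chartSource hs')] with t ht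
        using trivializationAt_snd ht _
    have h1 := (hξ'.hasMFDerivAt.congr_of_eventuallyEq this)
    exact h1.mvfderiv_eq
  have hTh := HasMFDerivAt.comp s hT hh.hasMFDerivAt
  have e2 := (HasMFDerivAt.clm_apply_space hTh hξ'.hasMFDerivAt).congr_of_eventuallyEq
    (f₁ := fun t ↦ (chartCoord q (h t) (ξ t) : F)) (by
      filter_upwards [hh.continuousAt.eventually (eventually_mem_chartSource hs')] with t ht
      change _ = chartCoord q (h t) (chartFrame (h s) (h t) (chartCoord (h s) (h t) (ξ t)))
      rw [chartFrame_chartCoord ht])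
  -- In the chart at `q` the extension of `ξ s` has coordinates `T (a s)`, where `T` is the change
  -- of charts with derivative `D`. Differentiating it supplies the term with `D` that `T a'` lacks
  -- in order to be the derivative of `T a`.
  have e3 : HasMFDerivAt 𝓘(ℝ, F) 𝓘(ℝ, F)
      (fun y ↦ (chartCoord q y (FiberBundle.extend F (ξ s) y) : F)) (h s)
      (D.flip (a s)) := by
    have h1 := HasMFDerivAt.clm_apply_space hT (hasMFDerivAt_const (a s) (h s))
    have h2 : ∀ (A : F →L[ℝ] F) (B : F →L[ℝ] F), A.comp (0 : F →L[ℝ] F) + B = B := by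
      intro A B; simp
    rw [← h2 (chartChange (h s) q (h s)) (D.flip (a s))]
    refine h1.congr_of_eventuallyEq ?_
    filter_upwards [eventually_mem_chartSource hs'] with y hy
    rw [extend_eq_chartFrame hy]
    rfl
  have e4 : FiberBundle.extend F (ξ s) (h s) = ξ s := by
    rw [extend_eq_chartFrame hs', chartFrame_chartCoord hs']
  have h5 := chartCoord_cov cov hs (σ := FiberBundle.extend F (ξ s))
    ((mdifferentiableAt_section_chart_iff hs).2 e3.mdifferentiableAt)
    (mfderiv 𝓘(ℝ, G) 𝓘(ℝ, F) h s w)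
  rw [e3.mvfderiv_eq, e4] at h5
  have h6 : covAlong G cov h ξ s w = chartFrame (h s) (h s) (mvfderiv 𝓘(ℝ, G) a s w) +
      cov (FiberBundle.extend F (ξ s)) (h s) (mfderiv 𝓘(ℝ, G) 𝓘(ℝ, F) h s w) := by
    rw [covAlong, e1]; rfl
  rw [h6, map_add, h5, e2.mvfderiv_eq, ← add_assoc]
  rfl

end Generic

/-! ### The coordinate expression of a spacelike immersion -/

section Generic

variable {V W X : Type*} [NormedAddCommGroup V] [NormedSpace ℝ V]
  [NormedAddCommGroup W] [NormedSpace ℝ W] [NormedAddCommGroup X] [NormedSpace ℝ X]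
  [FiniteDimensional ℝ V]

theorem fderiv_comp_clm_apply {Γ : W → W →L[ℝ] X} {h : V → W} {p : V}
    (hΓ : DifferentiableAt ℝ Γ (h p)) (hh : DifferentiableAt ℝ h p)
    (hh' : DifferentiableAt ℝ (fderiv ℝ h) p) (u v : V) :
    fderiv ℝ (fun p ↦ (Γ (h p)).comp (fderiv ℝ h p)) p u v =
      fderiv ℝ Γ (h p) (fderiv ℝ h p u) (fderiv ℝ h p v) +
        Γ (h p) (fderiv ℝ (fderiv ℝ h) p u v) := by
  have h1 := (hΓ.hasFDerivAt.comp p hh.hasFDerivAt).clm_comp hh'.hasFDerivAt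
  have h2 : fderiv ℝ (fun p ↦ (Γ (h p)).comp (fderiv ℝ h p)) p = _ := h1.fderiv
  rw [h2]
  simp [add_comm]

end Generic

namespace SpacelikeImmersion

variable {E : Type*} [NormedAddCommGroup E] [NormedSpace ℝ E] [FiniteDimensional ℝ E]
  {M : Type*} [TopologicalSpace M] [ChartedSpace E M] [IsManifold 𝓘(ℝ, E) ∞ M]
  {F : Type*} [NormedAddCommGroup F] [NormedSpace ℝ F] [FiniteDimensional ℝ F]
  {N : Type*} [TopologicalSpace N] [ChartedSpace F N] [IsManifold 𝓘(ℝ, F) ∞ N]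
  {g : PseudoRiemannianMetric F N} (f : SpacelikeImmersion E M g)
  (cov : CovariantDerivative 𝓘(ℝ, F) F (TangentSpace 𝓘(ℝ, F) : N → Type _))

/-- The expression of `f` in the charts at `y` and `f y`. -/
noncomputable def coordMap (y : M) (p : E) : F :=
  extChartAt 𝓘(ℝ, F) (f.toFun y) (f.toFun ((extChartAt 𝓘(ℝ, E) y).symm p))

/-- The domain of `f.coordMap y`. -/
def coordDomain (y : M) : Set E :=
  (extChartAt 𝓘(ℝ, E) y).target ∩
    (extChartAt 𝓘(ℝ, E) y).symm ⁻¹' (f.toFun ⁻¹' (chartAt F (f.toFun y)).source)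

/-- The part of the chart domain at `y` that `f` maps to the chart domain at `f y`. -/
def chartDomain (y : M) : Set M :=
  (chartAt E y).source ∩ f.toFun ⁻¹' (chartAt F (f.toFun y)).source

theorem mem_chartDomain_self (y : M) : y ∈ f.chartDomain y :=
  ⟨mem_chart_source E y, mem_chart_source F (f.toFun y)⟩

theorem isOpen_chartDomain (y : M) : IsOpen (f.chartDomain y) :=
  (chartAt E y).open_source.inter ((chartAt F (f.toFun y)).open_source.preimage
    f.contMDiff.continuous)

theorem isOpen_coordDomain (y : M) : IsOpen (f.coordDomain y) :=
  (continuousOn_extChartAt_symm (I := 𝓘(ℝ, E)) y).isOpen_inter_preimage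
    (isOpen_extChartAt_target y)
    ((chartAt F (f.toFun y)).open_source.preimage f.contMDiff.continuous)

theorem chart_mem_coordDomain {y z : M} (hz : z ∈ f.chartDomain y) :
    extChartAt 𝓘(ℝ, E) y z ∈ f.coordDomain y := by
  have h1 : z ∈ (extChartAt 𝓘(ℝ, E) y).source := by simpa using hz.1
  refine ⟨(extChartAt 𝓘(ℝ, E) y).map_source h1, ?_⟩
  rw [mem_preimage, (extChartAt 𝓘(ℝ, E) y).left_inv h1]
  exact hz.2

theorem symm_mem_chartDomain {y : M} {p : E} (hp : p ∈ f.coordDomain y) :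
    (extChartAt 𝓘(ℝ, E) y).symm p ∈ f.chartDomain y :=
  ⟨mem_chartSource_of_mem_target hp.1, hp.2⟩

theorem coordMap_mem_target {y : M} {p : E} (hp : p ∈ f.coordDomain y) :
    f.coordMap y p ∈ (extChartAt 𝓘(ℝ, F) (f.toFun y)).target :=
  (extChartAt 𝓘(ℝ, F) (f.toFun y)).map_source (by simpa using hp.2)

theorem coordMap_chart {y z : M} (hz : z ∈ f.chartDomain y) :
    f.coordMap y (extChartAt 𝓘(ℝ, E) y z) = extChartAt 𝓘(ℝ, F) (f.toFun y) (f.toFun z) := by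
  rw [coordMap, (extChartAt 𝓘(ℝ, E) y).left_inv (by simpa using hz.1)]

theorem contDiffOn_coordMap (y : M) : ContDiffOn ℝ ∞ (f.coordMap y) (f.coordDomain y) := by
  intro p hp
  have h1 : ContMDiffAt 𝓘(ℝ, E) 𝓘(ℝ, F) ∞ (f.coordMap y) p := by
    refine ContMDiffAt.comp (I' := 𝓘(ℝ, F)) p (g := extChartAt 𝓘(ℝ, F) (f.toFun y))
      (f := fun p ↦ f.toFun ((extChartAt 𝓘(ℝ, E) y).symm p)) (contMDiffAt_extChartAt' hp.2) ?_
    refine ContMDiffAt.comp (I' := 𝓘(ℝ, E)) p f.contMDiff.contMDiffAt ?_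
    exact (contMDiffOn_extChartAt_symm (I := 𝓘(ℝ, E)) (n := ∞) y).contMDiffAt
      ((isOpen_extChartAt_target y).mem_nhds hp.1)
  exact (contMDiffAt_iff_contDiffAt.1 h1).contDiffWithinAt

/-- The metric along `f` in coordinates. -/
noncomputable def coordMetricAlong (y : M) (p : E) : F →L[ℝ] F →L[ℝ] ℝ :=
  coordMetric g (f.toFun y) (f.coordMap y p)

/-- The differential of `f` in coordinates. -/
noncomputable def coordDifferential (y : M) (p : E) : E →L[ℝ] F := fderiv ℝ (f.coordMap y) p

/-- The connection form of the pulled back connection in coordinates. -/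
noncomputable def coordConnection (y : M) (p : E) : E →L[ℝ] F →L[ℝ] F :=
  (christoffel cov (f.toFun y) (f.coordMap y p)).comp (f.coordDifferential y p)

theorem chartCoord_mfderiv {y z : M} (hz : z ∈ f.chartDomain y) (u : TangentSpace 𝓘(ℝ, E) z) :
    chartCoord (f.toFun y) (f.toFun z) (mfderiv 𝓘(ℝ, E) 𝓘(ℝ, F) f.toFun z u) =
      f.coordDifferential y (extChartAt 𝓘(ℝ, E) y z) (chartCoord y z u) := by
  have h1 := hasMFDerivAt_chart_comp (S := M) (G := E) hz.2
    (f.contMDiff.mdifferentiableAt (by simp))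
  have h2 := hasMFDerivAt_of_chart (V := F) hz.1
    (h := fun z ↦ extChartAt 𝓘(ℝ, F) (f.toFun y) (f.toFun z))
    (h' := f.coordDifferential y (extChartAt 𝓘(ℝ, E) y z))
    ((((f.contDiffOn_coordMap y).contDiffAt ((f.isOpen_coordDomain y).mem_nhds
      (f.chart_mem_coordDomain hz))).differentiableAt (by simp)).hasFDerivAt)
  exact congrArg (fun T : E →L[ℝ] F ↦ T u) (hasMFDerivAt_unique h1 h2)

variable {cov}

-- The structure equations of the target are pulled back by the chain rule. The second derivative of
-- the coordinate map is symmetric, so it drops out of the torsion and of the curvature; positivity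
-- comes from the spacelike condition.
set_option synthInstance.maxHeartbeats 200000 in
theorem coordImmersion (hcov : g.IsLeviCivita cov) {κ : ℝ} (hκ : g.HasConstantCurvature cov κ)
    (y : M) : CoordImmersion (f.coordDomain y) (f.coordMetricAlong y) (f.coordDifferential y)
      (f.coordConnection cov y) κ := by
  have hB := f.isOpen_coordDomain y
  have hmap := f.contDiffOn_coordMap y
  have hT : MapsTo (f.coordMap y) (f.coordDomain y) (extChartAt 𝓘(ℝ, F) (f.toFun y)).target :=
    fun p hp ↦ f.coordMap_mem_target hp
  have hG := contDiffOn_coordMetric g (f.toFun y)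
  have hΓ := contDiffOn_christoffel hcov (f.toFun y)
  have hL : ContDiffOn ℝ ∞ (f.coordDifferential y) (f.coordDomain y) :=
    hmap.fderiv_of_isOpen hB (by simp)
  have dmap : ∀ p ∈ f.coordDomain y, DifferentiableAt ℝ (f.coordMap y) p := fun p hp ↦
    (hmap.contDiffAt (hB.mem_nhds hp)).differentiableAt (by simp)
  have dL : ∀ p ∈ f.coordDomain y, DifferentiableAt ℝ (f.coordDifferential y) p := fun p hp ↦
    (hL.contDiffAt (hB.mem_nhds hp)).differentiableAt (by simp)
  have dG : ∀ p ∈ f.coordDomain y,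
      DifferentiableAt ℝ (coordMetric g (f.toFun y)) (f.coordMap y p) := fun p hp ↦
    (hG.contDiffAt ((isOpen_extChartAt_target _).mem_nhds (hT hp))).differentiableAt (by simp)
  have dΓ : ∀ p ∈ f.coordDomain y,
      DifferentiableAt ℝ (christoffel cov (f.toFun y)) (f.coordMap y p) := fun p hp ↦
    (hΓ.contDiffAt ((isOpen_extChartAt_target _).mem_nhds (hT hp))).differentiableAt (by simp)
  have hsymm : ∀ p ∈ f.coordDomain y, ∀ u v, fderiv ℝ (f.coordDifferential y) p u v =
      fderiv ℝ (f.coordDifferential y) p v u := by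
    intro p hp u v
    exact ((hmap.contDiffAt (hB.mem_nhds hp)).isSymmSndFDerivAt (by simp; norm_cast)) u v
  refine ⟨hB, hG.comp hmap hT, hL, (hΓ.comp hmap hT).clm_comp hL, fun p _ v w ↦
    coordMetric_symm _ _ _ _ _, ?_, ?_, ?_, ?_⟩
  · intro p hp u v w
    have h1 : fderiv ℝ (f.coordMetricAlong y) p = (fderiv ℝ (coordMetric g (f.toFun y))
        (f.coordMap y p)).comp (f.coordDifferential y p) :=
      fderiv_comp (G := F →L[ℝ] F →L[ℝ] ℝ) (g := coordMetric g (f.toFun y)) p (dG p hp) (dmap p hp)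
    rw [h1]
    exact fderiv_coordMetric hcov (hT hp) _ v w
  · intro p hp u v
    rw [hsymm p hp]
    congr 1
    exact christoffel_symm hcov (hT hp) _ _
  · intro p hp u v w
    have h1 := fun u v ↦ fderiv_comp_clm_apply (dΓ p hp) (dmap p hp) (dL p hp) u v
    have h2 := formCurvature_christoffel hcov hκ (hT hp) (f.coordDifferential y p u)
      (f.coordDifferential y p v) w
    refine Eq.trans ?_ h2
    refine congrArg (fun T : F →L[ℝ] F ↦ T w) ?_
    simp only [formCurvature]
    have h3 : ∀ u v, fderiv ℝ (f.coordConnection cov y) p u v =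
      fderiv ℝ (christoffel cov (f.toFun y)) (f.coordMap y p) (f.coordDifferential y p u)
        (f.coordDifferential y p v) + christoffel cov (f.toFun y) (f.coordMap y p)
        (fderiv ℝ (f.coordDifferential y) p u v) := h1
    rw [h3, h3, hsymm p hp u v]
    have h4 : ∀ u, f.coordConnection cov y p u = christoffel cov (f.toFun y) (f.coordMap y p)
      (f.coordDifferential y p u) := fun _ ↦ rfl
    rw [h4, h4]
    abel
  · intro p hp u hu
    have hz := f.symm_mem_chartDomain hp
    have hp' : extChartAt 𝓘(ℝ, E) y ((extChartAt 𝓘(ℝ, E) y).symm p) = p :=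
      (extChartAt 𝓘(ℝ, E) y).right_inv hp.1
    have h1 := f.chartCoord_mfderiv hz (chartFrame y _ u)
    rw [chartCoord_chartFrame hz.1, hp'] at h1
    rw [← h1]
    have h2 := coordMetric_chartCoord g hz.2
      (mfderiv 𝓘(ℝ, E) 𝓘(ℝ, F) f.toFun ((extChartAt 𝓘(ℝ, E) y).symm p) (chartFrame y _ u))
      (mfderiv 𝓘(ℝ, E) 𝓘(ℝ, F) f.toFun ((extChartAt 𝓘(ℝ, E) y).symm p) (chartFrame y _ u))
    rw [← f.coordMap_chart hz, hp'] at h2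
    refine lt_of_lt_of_eq (f.spacelike _ _ fun h0 ↦ hu ?_) h2.symm
    rw [← chartCoord_chartFrame hz.1 u, h0, map_zero]

end SpacelikeImmersion

/-! ### The normal connection in coordinates -/

namespace SpacelikeImmersion

variable {E : Type*} [NormedAddCommGroup E] [NormedSpace ℝ E] [FiniteDimensional ℝ E]
  {M : Type*} [TopologicalSpace M] [ChartedSpace E M] [IsManifold 𝓘(ℝ, E) ∞ M]
  {F : Type*} [NormedAddCommGroup F] [NormedSpace ℝ F] [FiniteDimensional ℝ F]
  {N : Type*} [TopologicalSpace N] [ChartedSpace F N] [IsManifold 𝓘(ℝ, F) ∞ N]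
  {g : PseudoRiemannianMetric F N} (f : SpacelikeImmersion E M g)
  (cov : CovariantDerivative 𝓘(ℝ, F) F (TangentSpace 𝓘(ℝ, F) : N → Type _))

/-- The normal projection in coordinates. -/
noncomputable def coordNormal (y : M) (p : E) : F →L[ℝ] F :=
  coordNormalProj (f.coordMetricAlong y) (f.coordDifferential y) p

/-- The form of the normal connection in coordinates. -/
noncomputable def coordOmega (y : M) (p : E) : E →L[ℝ] F →L[ℝ] F :=
  coordForm (f.coordMetricAlong y) (f.coordDifferential y) (f.coordConnection cov y) p

/-- The second fundamental form in coordinates. -/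
noncomputable def coordShape (y : M) (p : E) : E →L[ℝ] F →L[ℝ] F :=
  coordSecond (f.coordMetricAlong y) (f.coordDifferential y) (f.coordConnection cov y) p

theorem mem_normalSpace_iff {z : M} {ξ : TangentSpace 𝓘(ℝ, F) (f.toFun z)} :
    ξ ∈ f.normalSpace z ↔ ∀ u, g.inner (f.toFun z) (f.d z u) ξ = 0 := by
  rw [normalSpace, LinearMap.BilinForm.mem_orthogonal_iff]
  constructor
  · exact fun h u ↦ h _ ⟨u, rfl⟩
  · rintro h _ ⟨u, rfl⟩
    exact h u

theorem d_tangentProj_add_normalProj {z : M} (w : TangentSpace 𝓘(ℝ, F) (f.toFun z)) :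
    f.d z (f.tangentProj z w) + f.normalProj z w = w := by
  obtain ⟨a, ha, n, hn, rfl⟩ := Submodule.mem_sup.1
    ((f.isCompl_range_normalSpace z).sup_eq_top ▸ Submodule.mem_top : w ∈ _ ⊔ f.normalSpace z)
  obtain ⟨u, rfl⟩ := ha
  have h1 : f.tangentProj z (f.d z u) = u := LinearMap.linearProjOfIsCompl_apply_left _ _ _ _ _
  have h2 : f.tangentProj z n = 0 :=
    LinearMap.linearProjOfIsCompl_apply_right _ _ _ _ ⟨n, hn⟩
  have h3 : f.normalProj z (f.d z u) = 0 :=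
    Submodule.projectionOnto_apply_right _
      (⟨f.d z u, LinearMap.mem_range_self _ u⟩ : LinearMap.range (f.d z))
  have h4 : f.normalProj z n = ⟨n, hn⟩ := Submodule.projectionOnto_apply_left _ ⟨n, hn⟩
  rw [map_add (f.tangentProj z), map_add (f.normalProj z), h1, h2, h3, h4]
  simp

variable {f cov} {κ : ℝ}

theorem chartCoord_d {y z : M} (hz : z ∈ f.chartDomain y) (u : TangentSpace 𝓘(ℝ, E) z) :
    chartCoord (f.toFun y) (f.toFun z) (f.d z u) =
      f.coordDifferential y (extChartAt 𝓘(ℝ, E) y z) (chartCoord y z u) :=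
  f.chartCoord_mfderiv hz u

theorem inner_eq_coordMetricAlong {y z : M} (hz : z ∈ f.chartDomain y)
    (v w : TangentSpace 𝓘(ℝ, F) (f.toFun z)) :
    g.inner (f.toFun z) v w = f.coordMetricAlong y (extChartAt 𝓘(ℝ, E) y z)
      (chartCoord (f.toFun y) (f.toFun z) v) (chartCoord (f.toFun y) (f.toFun z) w) := by
  rw [coordMetricAlong, f.coordMap_chart hz, coordMetric_chartCoord g hz.2]

theorem coordNormal_of_mem {y z : M} (hz : z ∈ f.chartDomain y)
    {ξ : TangentSpace 𝓘(ℝ, F) (f.toFun z)} (hξ : ξ ∈ f.normalSpace z) :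
    f.coordNormal y (extChartAt 𝓘(ℝ, E) y z) (chartCoord (f.toFun y) (f.toFun z) ξ) =
      chartCoord (f.toFun y) (f.toFun z) ξ := by
  have h1 : coordAdjoint (f.coordMetricAlong y) (f.coordDifferential y) (extChartAt 𝓘(ℝ, E) y z)
      (chartCoord (f.toFun y) (f.toFun z) ξ) = 0 := by
    ext u
    rw [CoordImmersion.coordAdjoint_apply, ← chartCoord_chartFrame hz.1 u, ← chartCoord_d hz,
      ← inner_eq_coordMetricAlong hz, g.symm]
    exact f.mem_normalSpace_iff.1 hξ _
  have h2 : coordTangentProj (f.coordMetricAlong y) (f.coordDifferential y)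
      (extChartAt 𝓘(ℝ, E) y z) (chartCoord (f.toFun y) (f.toFun z) ξ) = 0 := by
    rw [coordTangentProj, ContinuousLinearMap.comp_apply, ContinuousLinearMap.comp_apply, h1,
      map_zero, map_zero]
  rw [coordNormal, coordNormalProj, sub_apply, h2, sub_zero, one_apply_eq_self]

theorem coordNormal_chartCoord_d {y : M} (h : CoordImmersion (f.coordDomain y) (f.coordMetricAlong y)
    (f.coordDifferential y) (f.coordConnection cov y) κ) {z : M} (hz : z ∈ f.chartDomain y)
    (u : TangentSpace 𝓘(ℝ, E) z) :
    f.coordNormal y (extChartAt 𝓘(ℝ, E) y z) (chartCoord (f.toFun y) (f.toFun z) (f.d z u)) = 0 := by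
  rw [chartCoord_d hz]
  exact h.normalProj_differential (f.chart_mem_coordDomain hz) _

theorem chartCoord_normalProj {y : M} (h : CoordImmersion (f.coordDomain y) (f.coordMetricAlong y)
    (f.coordDifferential y) (f.coordConnection cov y) κ) {z : M} (hz : z ∈ f.chartDomain y)
    (w : TangentSpace 𝓘(ℝ, F) (f.toFun z)) :
    chartCoord (f.toFun y) (f.toFun z) (f.normalProj z w).1 =
      f.coordNormal y (extChartAt 𝓘(ℝ, E) y z) (chartCoord (f.toFun y) (f.toFun z) w) := by
  conv_rhs => rw [← f.d_tangentProj_add_normalProj w]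
  rw [map_add, map_add, coordNormal_chartCoord_d h hz, zero_add,
    coordNormal_of_mem hz (f.normalProj z w).2]

theorem chartCoord_d_tangentProj {y : M} (h : CoordImmersion (f.coordDomain y) (f.coordMetricAlong y)
    (f.coordDifferential y) (f.coordConnection cov y) κ) {z : M} (hz : z ∈ f.chartDomain y)
    (w : TangentSpace 𝓘(ℝ, F) (f.toFun z)) :
    chartCoord (f.toFun y) (f.toFun z) (f.d z (f.tangentProj z w)) =
      coordTangentProj (f.coordMetricAlong y) (f.coordDifferential y) (extChartAt 𝓘(ℝ, E) y z)
        (chartCoord (f.toFun y) (f.toFun z) w) := by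
  rw [CoordImmersion.tangentProj_eq, sub_apply]
  change _ = chartCoord _ _ w - f.coordNormal y _ _
  rw [← chartCoord_normalProj h hz]
  conv_rhs => rw [← f.d_tangentProj_add_normalProj w]
  rw [map_add, d_tangentProj_add_normalProj]
  simp

theorem mem_normalSpace_iff_coord {y : M} (h : CoordImmersion (f.coordDomain y) (f.coordMetricAlong y)
    (f.coordDifferential y) (f.coordConnection cov y) κ) {z : M} (hz : z ∈ f.chartDomain y)
    {ξ : TangentSpace 𝓘(ℝ, F) (f.toFun z)} :
    ξ ∈ f.normalSpace z ↔
      f.coordNormal y (extChartAt 𝓘(ℝ, E) y z) (chartCoord (f.toFun y) (f.toFun z) ξ) =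
      chartCoord (f.toFun y) (f.toFun z) ξ := by
  refine ⟨coordNormal_of_mem hz, fun h1 ↦ ?_⟩
  rw [← chartCoord_normalProj h hz] at h1
  rw [← chartFrame_chartCoord hz.2 ξ, ← h1, chartFrame_chartCoord hz.2]
  exact (f.normalProj z ξ).2

section Along

variable {G : Type*} [NormedAddCommGroup G] [NormedSpace ℝ G]
  {S : Type*} [TopologicalSpace S] [ChartedSpace G S]

theorem chartCoord_mfderiv_comp {y : M} {c : S → M} {s : S} (hs : c s ∈ f.chartDomain y)
    {c' : G →L[ℝ] E} (hc0 : ContinuousAt c s)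
    (hc : HasMFDerivAt 𝓘(ℝ, G) 𝓘(ℝ, E) (fun t ↦ extChartAt 𝓘(ℝ, E) y (c t)) s c')
    (hh : MDifferentiableAt 𝓘(ℝ, G) 𝓘(ℝ, F) (fun t ↦ f.toFun (c t)) s) (w : G) :
    chartCoord (f.toFun y) (f.toFun (c s)) (mfderiv 𝓘(ℝ, G) 𝓘(ℝ, F) (fun t ↦ f.toFun (c t)) s w) =
      f.coordDifferential y (extChartAt 𝓘(ℝ, E) y (c s)) (c' w) := by
  have h1 := hasMFDerivAt_chart_comp (S := S) (G := G) (h := fun t ↦ f.toFun (c t)) hs.2 hh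
  have h2 : HasFDerivAt (f.coordMap y) (f.coordDifferential y (extChartAt 𝓘(ℝ, E) y (c s)))
      (extChartAt 𝓘(ℝ, E) y (c s)) :=
    (((f.contDiffOn_coordMap y).contDiffAt ((f.isOpen_coordDomain y).mem_nhds
      (f.chart_mem_coordDomain hs))).differentiableAt (by simp)).hasFDerivAt
  have h3 := (HasMFDerivAt.comp s h2.hasMFDerivAt hc).congr_of_eventuallyEq
    (f₁ := fun t ↦ extChartAt 𝓘(ℝ, F) (f.toFun y) (f.toFun (c t))) (by
    filter_upwards [hc0.eventually ((f.isOpen_chartDomain y).mem_nhds hs)] with t ht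
    exact (f.coordMap_chart ht).symm)
  exact congrArg (fun T : G →L[ℝ] F ↦ T w) (hasMFDerivAt_unique h1 h3)

theorem mdifferentiableAt_comp {y : M} {c : S → M} {s : S} (hs : c s ∈ f.chartDomain y)
    {c' : G →L[ℝ] E} (hc0 : ContinuousAt c s)
    (hc : HasMFDerivAt 𝓘(ℝ, G) 𝓘(ℝ, E) (fun t ↦ extChartAt 𝓘(ℝ, E) y (c t)) s c') :
    MDifferentiableAt 𝓘(ℝ, G) 𝓘(ℝ, F) (fun t ↦ f.toFun (c t)) s := by
  have h1 : MDifferentiableAt 𝓘(ℝ, E) 𝓘(ℝ, E) (extChartAt 𝓘(ℝ, E) y).symm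
      (extChartAt 𝓘(ℝ, E) y (c s)) :=
    ((contMDiffOn_extChartAt_symm (I := 𝓘(ℝ, E)) (n := ∞) y).contMDiffAt
      ((isOpen_extChartAt_target y).mem_nhds (f.chart_mem_coordDomain hs).1)).mdifferentiableAt
      (by simp)
  have h2 : MDifferentiableAt 𝓘(ℝ, G) 𝓘(ℝ, E) c s := by
    refine (MDifferentiableAt.comp s h1 hc.mdifferentiableAt).congr_of_eventuallyEq ?_
    filter_upwards [hc0.eventually ((f.isOpen_chartDomain y).mem_nhds hs)] with t ht
    exact ((extChartAt 𝓘(ℝ, E) y).left_inv (by simpa using ht.1)).symm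
  exact (f.contMDiff.mdifferentiableAt (by simp)).comp s h2

/-- The normal and the tangential part of the derivative of a normal field along a map `c`. -/
theorem coord_covAlong {y : M} (h : CoordImmersion (f.coordDomain y) (f.coordMetricAlong y)
    (f.coordDifferential y) (f.coordConnection cov y) κ) {c : S → M} {s : S}
    (hs : c s ∈ f.chartDomain y) {c' : G →L[ℝ] E} (hc0 : ContinuousAt c s)
    (hc : HasMFDerivAt 𝓘(ℝ, G) 𝓘(ℝ, E) (fun t ↦ extChartAt 𝓘(ℝ, E) y (c t)) s c')
    {ξ : Π t : S, TangentSpace 𝓘(ℝ, F) (f.toFun (c t))} (hξn : ∀ t, ξ t ∈ f.normalSpace (c t))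
    {ξ' : G →L[ℝ] F} (hξ : HasMFDerivAt 𝓘(ℝ, G) 𝓘(ℝ, F)
      (fun t ↦ (chartCoord (f.toFun y) (f.toFun (c t)) (ξ t) : F)) s ξ') (w : G) :
    chartCoord (f.toFun y) (f.toFun (c s)) (f.normalProj (c s)
        (covAlong G cov (fun t ↦ f.toFun (c t)) ξ s w)).1 =
      ξ' w + f.coordOmega cov y (extChartAt 𝓘(ℝ, E) y (c s)) (c' w)
        (chartCoord (f.toFun y) (f.toFun (c s)) (ξ s)) ∧
    chartCoord (f.toFun y) (f.toFun (c s)) (f.d (c s) (f.tangentProj (c s)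
        (covAlong G cov (fun t ↦ f.toFun (c t)) ξ s w))) =
      f.coordShape cov y (extChartAt 𝓘(ℝ, E) y (c s)) (c' w)
        (chartCoord (f.toFun y) (f.toFun (c s)) (ξ s)) := by
  have hh := mdifferentiableAt_comp hs hc0 hc
  set p := extChartAt 𝓘(ℝ, E) y (c s) with hp
  have hpB : p ∈ f.coordDomain y := f.chart_mem_coordDomain hs
  set x : F := chartCoord (f.toFun y) (f.toFun (c s)) (ξ s) with hx
  have hQx : f.coordNormal y p x = x := coordNormal_of_mem hs (hξn s)
  -- differentiate `Q ξ = ξ`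
  have h1 : ξ' w = f.coordNormal y p (ξ' w) +
      fderiv ℝ (f.coordNormal y) p (c' w) x := by
    have h2 : HasFDerivAt (f.coordNormal y) (fderiv ℝ (f.coordNormal y) p) p :=
      h.hasFDerivAt_normalProj hpB
    have h3 := HasMFDerivAt.clm_apply_space (HasMFDerivAt.comp s h2.hasMFDerivAt hc) hξ
    have h4 := hξ.congr_of_eventuallyEq (f₁ := fun t ↦ ((f.coordNormal y ∘
      fun t ↦ extChartAt 𝓘(ℝ, E) y (c t)) t) (chartCoord (f.toFun y) (f.toFun (c t)) (ξ t) : F)) (by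
        filter_upwards [hc0.eventually ((f.isOpen_chartDomain y).mem_nhds hs)] with t ht
        exact coordNormal_of_mem ht (hξn t))
    exact congrArg (fun T : G →L[ℝ] F ↦ T w) (hasMFDerivAt_unique h4 h3)
  have h5 := chartCoord_covAlong cov (q := f.toFun y) (h := fun t ↦ f.toFun (c t)) (ξ := ξ) (s := s)
    hs.2 ((mdifferentiableAt_along_iff (h := fun t ↦ f.toFun (c t)) hs.2).2 ⟨hh, hξ.mdifferentiableAt⟩) w
  rw [hξ.mvfderiv_eq, chartCoord_mfderiv_comp hs hc0 hc hh w, ← christoffel_chart cov hs.2,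
    ← f.coordMap_chart hs] at h5
  have h6 : chartCoord (f.toFun y) (f.toFun (c s))
      (covAlong G cov (fun t ↦ f.toFun (c t)) ξ s w) =
      ξ' w + f.coordConnection cov y p (c' w) x := h5
  obtain ⟨h7, h8⟩ := h.second_apply_normal hpB (c' w) hQx
  refine ⟨?_, ?_⟩
  · rw [chartCoord_normalProj h hs, h6, map_add]
    have h9 : f.coordOmega cov y p (c' w) x = f.coordNormal y p (f.coordConnection cov y p (c' w) x)
      - fderiv ℝ (f.coordNormal y) p (c' w) x := h7
    rw [h9]
    conv_rhs => rw [h1]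
    abel
  · rw [chartCoord_d_tangentProj h hs, h6]
    refine Eq.trans ?_ h8.symm
    have h9 : coordTangentProj (f.coordMetricAlong y) (f.coordDifferential y) p
        (f.coordNormal y p (ξ' w)) = 0 := by
      rw [CoordImmersion.tangentProj_eq, sub_apply]
      have := congrArg (fun T : F →L[ℝ] F ↦ T (ξ' w)) (h.normalProj_mul_self hpB)
      exact sub_eq_zero.2 this.symm
    conv_lhs => rw [h1]
    rw [add_assoc, map_add, h9, zero_add]
    rfl

end Along

end SpacelikeImmersion

/-! ### Shape operator and normal curvature in coordinates -/

namespace SpacelikeImmersion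

variable {E : Type*} [NormedAddCommGroup E] [NormedSpace ℝ E] [FiniteDimensional ℝ E]
  {M : Type*} [TopologicalSpace M] [ChartedSpace E M] [IsManifold 𝓘(ℝ, E) ∞ M]
  {F : Type*} [NormedAddCommGroup F] [NormedSpace ℝ F] [FiniteDimensional ℝ F]
  {N : Type*} [TopologicalSpace N] [ChartedSpace F N] [IsManifold 𝓘(ℝ, F) ∞ N]
  {g : PseudoRiemannianMetric F N} {f : SpacelikeImmersion E M g}
  {cov : CovariantDerivative 𝓘(ℝ, F) F (TangentSpace 𝓘(ℝ, F) : N → Type _)} {κ : ℝ}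

/-- A normal field with differentiable coordinates: the normal derivative and the shape operator. -/
theorem coord_normalCov {y : M} (h : CoordImmersion (f.coordDomain y) (f.coordMetricAlong y)
    (f.coordDifferential y) (f.coordConnection cov y) κ) {z : M} (hz : z ∈ f.chartDomain y)
    {ξ : Π z : M, f.normalSpace z} {X : E → F} {X' : E →L[ℝ] F}
    (hX : HasFDerivAt X X' (extChartAt 𝓘(ℝ, E) y z))
    (hξ : ∀ᶠ t in 𝓝 z, chartCoord (f.toFun y) (f.toFun t) (ξ t).1 = X (extChartAt 𝓘(ℝ, E) y t))
    (u : TangentSpace 𝓘(ℝ, E) z) :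
    chartCoord (f.toFun y) (f.toFun z) (f.normalCov cov ξ z u).1 =
      X' (chartCoord y z u) + f.coordOmega cov y (extChartAt 𝓘(ℝ, E) y z) (chartCoord y z u)
        (X (extChartAt 𝓘(ℝ, E) y z)) ∧
    chartCoord (f.toFun y) (f.toFun z) (f.d z (f.shapeOperator cov ξ z u)) =
      -f.coordShape cov y (extChartAt 𝓘(ℝ, E) y z) (chartCoord y z u)
        (X (extChartAt 𝓘(ℝ, E) y z)) := by
  have hX' := (HasMFDerivAt.comp z hX.hasMFDerivAt (hasMFDerivAt_chart hz.1)).congr_of_eventuallyEq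
    (f₁ := fun t ↦ (chartCoord (f.toFun y) (f.toFun t) (ξ t).1 : F)) hξ
  obtain ⟨h1, h2⟩ := coord_covAlong h (c := fun t ↦ t) hz continuousAt_id
    (hasMFDerivAt_chart hz.1) (fun t ↦ (ξ t).2) hX' u
  have h3 := hξ.self_of_nhds
  simp only [h3] at h1 h2
  refine ⟨h1, ?_⟩
  refine Eq.trans ?_ (congrArg Neg.neg h2)
  have h4 : f.shapeOperator cov ξ z u =
      -f.tangentProj z (covAlong E cov f.toFun (fun z ↦ (ξ z).1) z u) := rfl
  rw [h4, map_neg, map_neg]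

theorem chartCoord_normalExtend {y : M} (h : CoordImmersion (f.coordDomain y) (f.coordMetricAlong y)
    (f.coordDifferential y) (f.coordConnection cov y) κ) (ξ : f.normalSpace y) :
    ∀ᶠ t in 𝓝 y, chartCoord (f.toFun y) (f.toFun t) (f.normalExtend ξ t).1 =
      f.coordNormal y (extChartAt 𝓘(ℝ, E) y t) (chartCoord (f.toFun y) (f.toFun y) ξ.1) := by
  filter_upwards [(f.isOpen_chartDomain y).mem_nhds (f.mem_chartDomain_self y)] with t ht
  rw [normalExtend, chartCoord_normalProj h ht, extend_eq_chartFrame ht.2,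
    chartCoord_chartFrame ht.2]

theorem hasFDerivAt_coordNormal_apply {y : M} (h : CoordImmersion (f.coordDomain y)
    (f.coordMetricAlong y) (f.coordDifferential y) (f.coordConnection cov y) κ) {p : E}
    (hp : p ∈ f.coordDomain y) (x : F) :
    HasFDerivAt (fun p ↦ f.coordNormal y p x) ((fderiv ℝ (f.coordNormal y) p).flip x) p := by
  have h2 : HasFDerivAt (f.coordNormal y) (fderiv ℝ (f.coordNormal y) p) p :=
    h.hasFDerivAt_normalProj hp
  refine (h2.clm_apply (hasFDerivAt_const x p)).congr_fderiv ?_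
  ext; simp

/-- The normal curvature in the chart centred at the point considered. -/
theorem chartCoord_normalCurvatureAt_self {y : M} (h : CoordImmersion (f.coordDomain y)
    (f.coordMetricAlong y) (f.coordDifferential y) (f.coordConnection cov y) κ)
    (u v : TangentSpace 𝓘(ℝ, E) y) (ξ : f.normalSpace y) :
    chartCoord (f.toFun y) (f.toFun y) (f.normalCurvatureAt cov u v ξ).1 =
      f.coordNormal y (extChartAt 𝓘(ℝ, E) y y) (formCurvature (f.coordOmega cov y)
        (extChartAt 𝓘(ℝ, E) y y) (chartCoord y y u) (chartCoord y y v)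
        (chartCoord (f.toFun y) (f.toFun y) ξ.1)) := by
  have : CompleteSpace E := FiniteDimensional.complete ℝ E
  have hy := f.mem_chartDomain_self y
  set x : F := chartCoord (f.toFun y) (f.toFun y) ξ.1 with hx
  set a := extChartAt 𝓘(ℝ, E) y y with ha
  have haB : a ∈ f.coordDomain y := f.chart_mem_coordDomain hy
  -- the first derivative
  have h1 : ∀ v : TangentSpace 𝓘(ℝ, E) y, ∀ᶠ t in 𝓝 y, chartCoord (f.toFun y) (f.toFun t)
      (f.normalCov cov (f.normalExtend ξ) t (FiberBundle.extend E v t)).1 =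
      (f.coordNormal y (extChartAt 𝓘(ℝ, E) y t) *
        f.coordOmega cov y (extChartAt 𝓘(ℝ, E) y t) (chartCoord y y v)) x := by
    intro v
    filter_upwards [(f.isOpen_chartDomain y).mem_nhds hy,
      (chartCoord_normalExtend h ξ).eventually_nhds] with t ht ht'
    have h2 := (coord_normalCov h ht (hasFDerivAt_coordNormal_apply h
      (f.chart_mem_coordDomain ht) x) ht' (FiberBundle.extend E v t)).1
    rw [h2, extend_eq_chartFrame ht.1, chartCoord_chartFrame ht.1]
    -- Because `Q` is parallel, `dQ + Ω Q = Q Ω`: the derivative of the normal field `Q x` is again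
    -- `Q` applied to something explicit, and can be differentiated once more.
    have h3 := congrArg (fun T : F →L[ℝ] F ↦ T x)
      (h.fderiv_normalProj (f.chart_mem_coordDomain ht) (chartCoord y y v))
    simp only [sub_apply, mul_apply_eq_comp] at h3
    rw [ContinuousLinearMap.flip_apply]
    exact (congrArg (· + _) h3).trans (sub_add_cancel _ _)
  have hΩ : HasFDerivAt (f.coordOmega cov y) (fderiv ℝ (f.coordOmega cov y) a) a :=
    ((h.contDiffOn_form.contDiffAt (h.isOpen.mem_nhds haB)).differentiableAt
      (by simp)).hasFDerivAt
  have hQ : HasFDerivAt (f.coordNormal y) (fderiv ℝ (f.coordNormal y) a) a :=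
    h.hasFDerivAt_normalProj haB
  -- the second derivative
  have h4 : ∀ u v : TangentSpace 𝓘(ℝ, E) y, chartCoord (f.toFun y) (f.toFun y)
      (f.normalCov cov (fun z ↦ f.normalCov cov (f.normalExtend ξ) z
        (FiberBundle.extend E v z)) y u).1 =
      f.coordNormal y a (fderiv ℝ (f.coordOmega cov y) a (chartCoord y y u) (chartCoord y y v) x +
        f.coordOmega cov y a (chartCoord y y u)
          (f.coordOmega cov y a (chartCoord y y v) x)) := by
    intro u v
    have h5 := hQ.clm_apply ((hΩ.clm_apply (hasFDerivAt_const (chartCoord y y v : E) a)).clm_apply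
      (hasFDerivAt_const x a))
    rw [(coord_normalCov h hy h5 (h1 v) u).1]
    have h3 := congrArg (fun T : F →L[ℝ] F ↦ T (f.coordOmega cov y a (chartCoord y y v) x))
      (h.fderiv_normalProj haB (chartCoord y y u))
    simp only [sub_apply, mul_apply_eq_comp] at h3
    refine (congrArg (· + _) (a₂ := f.coordNormal y a (fderiv ℝ (f.coordOmega cov y) a
      (chartCoord y y u) (chartCoord y y v) x) + (fderiv ℝ (f.coordNormal y) a (chartCoord y y u))
      (f.coordOmega cov y a (chartCoord y y v) x)) ?_).trans ?_
    · simp only [add_apply, ContinuousLinearMap.comp_apply, ContinuousLinearMap.flip_apply,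
        zero_apply, map_zero, zero_add]
    · rw [map_add, add_assoc]
      congr 1
      exact (congrArg (· + _) h3).trans (sub_add_cancel _ _)
  have e : ∀ v : TangentSpace 𝓘(ℝ, E) y, FiberBundle.extend E v y = v := fun v ↦ by
    rw [extend_eq_chartFrame hy.1, chartFrame_chartCoord hy.1]
  have h6 : VectorField.mlieBracket 𝓘(ℝ, E) (FiberBundle.extend E u) (FiberBundle.extend E v) y
      = 0 := by
    rw [← mlieBracket_chartFrame hy.1 (chartCoord y y u) (chartCoord y y v)]
    refine Filter.EventuallyEq.mlieBracket_vectorField_eq ?_ ?_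
    all_goals
      filter_upwards [eventually_mem_chartSource hy.1] with t ht using extend_eq_chartFrame ht _
  rw [normalCurvatureAt, normalCurvature, h6, e, e, map_zero, sub_zero,
    Submodule.coe_sub, map_sub, h4, h4, ← map_sub]
  congr 1
  simp only [formCurvature, add_apply, sub_apply, mul_apply_eq_comp]
  abel

/-- The extension of `ξ` is made in the chart at `z` and is read here in another chart. Only its
value at `z` survives, since the tangential part of the derivative of a normal field is tensorial.
-/
theorem chartCoord_d_shapeOperatorAt {y : M} (h : CoordImmersion (f.coordDomain y)
    (f.coordMetricAlong y) (f.coordDifferential y) (f.coordConnection cov y) κ) {z : M}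
    (hz : z ∈ f.chartDomain y) (ξ : f.normalSpace z) (u : TangentSpace 𝓘(ℝ, E) z) :
    chartCoord (f.toFun y) (f.toFun z) (f.d z (f.shapeOperatorAt cov ξ u)) =
      -f.coordShape cov y (extChartAt 𝓘(ℝ, E) y z) (chartCoord y z u)
        (chartCoord (f.toFun y) (f.toFun z) ξ.1) := by
  have hzz : f.toFun z ∈ (chartAt F (f.toFun z)).source := mem_chart_source F _
  set x : F := chartCoord (f.toFun z) (f.toFun z) ξ.1 with hx
  have hQ : HasFDerivAt (f.coordNormal y) (fderiv ℝ (f.coordNormal y) (extChartAt 𝓘(ℝ, E) y z))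
      (extChartAt 𝓘(ℝ, E) y z) := h.hasFDerivAt_normalProj (f.chart_mem_coordDomain hz)
  obtain ⟨D, hD⟩ : ∃ D : F →L[ℝ] F →L[ℝ] F, HasMFDerivAt 𝓘(ℝ, F) 𝓘(ℝ, F →L[ℝ] F)
      (chartChange (F := F) (f.toFun z) (f.toFun y)) (f.toFun z) D :=
    ⟨_, (mdifferentiableAt_chartChange hzz hz.2).hasMFDerivAt⟩
  have hf : MDifferentiableAt 𝓘(ℝ, E) 𝓘(ℝ, F) f.toFun z := f.contMDiff.mdifferentiableAt (by simp)
  have h1 := HasMFDerivAt.clm_apply_space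
    (HasMFDerivAt.comp z hQ.hasMFDerivAt (hasMFDerivAt_chart hz.1))
    (HasMFDerivAt.clm_apply_space (HasMFDerivAt.comp z hD hf.hasMFDerivAt)
      (hasMFDerivAt_const x z))
  have h2 := h1.congr_of_eventuallyEq
    (f₁ := fun t ↦ (chartCoord (f.toFun y) (f.toFun t) (f.normalExtend ξ t).1 : F)) (by
      filter_upwards [(f.isOpen_chartDomain y).mem_nhds hz,
        (f.contMDiff.continuous.continuousAt (x := z)).eventually (eventually_mem_chartSource hzz)]
        with t ht ht'
      rw [normalExtend, chartCoord_normalProj h ht, extend_eq_chartFrame ht']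
      rfl)
  have h3 := (coord_covAlong h (c := fun t ↦ t) hz continuousAt_id
    (hasMFDerivAt_chart hz.1) (fun t ↦ (f.normalExtend ξ t).2) h2 u).2
  have h4 : f.shapeOperatorAt cov ξ u = -f.tangentProj z
      (covAlong E cov f.toFun (fun z ↦ (f.normalExtend ξ z).1) z u) := rfl
  have h5 : (f.normalExtend ξ z).1 = ξ.1 := by
    have e : FiberBundle.extend F ξ.1 (f.toFun z) = ξ.1 := by
      rw [extend_eq_chartFrame hzz, chartFrame_chartCoord hzz]
    rw [normalExtend, e]
    exact congrArg Subtype.val (Submodule.projectionOnto_apply_left _ ξ)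
  rw [h5] at h3
  rw [h4, map_neg, map_neg]
  exact congrArg Neg.neg h3

/-- The shape operator and the second fundamental form. -/
theorem inner_shapeOperatorAt {y : M} (h : CoordImmersion (f.coordDomain y)
    (f.coordMetricAlong y) (f.coordDifferential y) (f.coordConnection cov y) κ)
    (ξ : f.normalSpace y) (u w : TangentSpace 𝓘(ℝ, E) y) :
    f.inducedInner y (f.shapeOperatorAt cov ξ u) w =
      f.coordMetricAlong y (extChartAt 𝓘(ℝ, E) y y) (f.coordShape cov y (extChartAt 𝓘(ℝ, E) y y)
        (chartCoord y y u) (f.coordDifferential y (extChartAt 𝓘(ℝ, E) y y) (chartCoord y y w)))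
        (chartCoord (f.toFun y) (f.toFun y) ξ.1) := by
  have hy := f.mem_chartDomain_self y
  have haB := f.chart_mem_coordDomain hy
  rw [inducedInner, inner_eq_coordMetricAlong hy, chartCoord_d_shapeOperatorAt h hy,
    chartCoord_d hy]
  refine Eq.trans ?_ (h.metric_second haB _ _ (coordNormal_of_mem hy ξ.2)).symm
  rw [map_neg, neg_apply, h.symm _ haB]
  rfl

theorem inducedInner_shapeOperatorAt_comm {y : M} (h : CoordImmersion (f.coordDomain y)
    (f.coordMetricAlong y) (f.coordDifferential y) (f.coordConnection cov y) κ)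
    (ξ : f.normalSpace y) (u w : TangentSpace 𝓘(ℝ, E) y) :
    f.inducedInner y (f.shapeOperatorAt cov ξ u) w =
      f.inducedInner y (f.shapeOperatorAt cov ξ w) u := by
  have haB := f.chart_mem_coordDomain (f.mem_chartDomain_self y)
  rw [inner_shapeOperatorAt h, inner_shapeOperatorAt h]
  congr 2
  exact h.second_differential_comm haB _ _

/-- The Ricci equation. -/
theorem inner_normalCurvatureAt {y : M} (h : CoordImmersion (f.coordDomain y)
    (f.coordMetricAlong y) (f.coordDifferential y) (f.coordConnection cov y) κ)
    (u v : TangentSpace 𝓘(ℝ, E) y) (ξ η : f.normalSpace y) :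
    f.normalInner y (f.normalCurvatureAt cov u v ξ) η =
      f.inducedInner y (f.shapeOperatorAt cov ξ v) (f.shapeOperatorAt cov η u) -
      f.inducedInner y (f.shapeOperatorAt cov ξ u) (f.shapeOperatorAt cov η v) := by
  have hy := f.mem_chartDomain_self y
  have haB := f.chart_mem_coordDomain hy
  rw [normalInner, inducedInner, inducedInner, inner_eq_coordMetricAlong hy,
    inner_eq_coordMetricAlong hy, inner_eq_coordMetricAlong hy,
    chartCoord_normalCurvatureAt_self h]
  refine (h.metric_formCurvature haB _ _ (coordNormal_of_mem hy ξ.2)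
    (coordNormal_of_mem hy η.2)).trans ?_
  have h1 : ∀ u ξ, coordSecond (f.coordMetricAlong y) (f.coordDifferential y)
      (f.coordConnection cov y) (extChartAt 𝓘(ℝ, E) y y) (chartCoord y y u)
      (chartCoord (f.toFun y) (f.toFun y) ξ.1) =
      -chartCoord (f.toFun y) (f.toFun y) (f.d y (f.shapeOperatorAt cov ξ u)) := fun u ξ ↦ by
    rw [chartCoord_d_shapeOperatorAt h hy, neg_neg]; rfl
  rw [h1, h1, h1, h1]
  simp only [map_neg, neg_apply, neg_neg]

/-- The ambient metric is nondegenerate, and a normal vector is already orthogonal to the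
complementary tangent space. -/
theorem eq_zero_of_normalInner_eq_zero {z : M} {ζ : f.normalSpace z}
    (hζ : ∀ η, f.normalInner z ζ η = 0) : ζ = 0 := by
  refine Subtype.ext (g.nondegenerate _ _ fun w ↦ ?_)
  rw [← f.d_tangentProj_add_normalProj w, map_add, g.symm, f.mem_normalSpace_iff.1 ζ.2, zero_add]
  exact hζ _

/-- The normal curvature in the coordinates of any chart. -/
theorem chartCoord_normalCurvatureAt (h : ∀ y, CoordImmersion (f.coordDomain y)
    (f.coordMetricAlong y) (f.coordDifferential y) (f.coordConnection cov y) κ) {y z : M}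
    (hz : z ∈ f.chartDomain y) (u v : TangentSpace 𝓘(ℝ, E) z) (ξ : f.normalSpace z) :
    chartCoord (f.toFun y) (f.toFun z) (f.normalCurvatureAt cov u v ξ).1 =
      f.coordNormal y (extChartAt 𝓘(ℝ, E) y z) (formCurvature (f.coordOmega cov y)
        (extChartAt 𝓘(ℝ, E) y z) (chartCoord y z u) (chartCoord y z v)
        (chartCoord (f.toFun y) (f.toFun z) ξ.1)) := by
  have haB := f.chart_mem_coordDomain hz
  set x : F := f.coordNormal y (extChartAt 𝓘(ℝ, E) y z) (formCurvature (f.coordOmega cov y)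
        (extChartAt 𝓘(ℝ, E) y z) (chartCoord y z u) (chartCoord y z v)
        (chartCoord (f.toFun y) (f.toFun z) ξ.1)) with hx
  have hQ : f.coordNormal y (extChartAt 𝓘(ℝ, E) y z) x = x :=
    congrArg (fun T : F →L[ℝ] F ↦ T _) ((h y).normalProj_mul_self haB)
  let ζ : f.normalSpace z := ⟨chartFrame (f.toFun y) (f.toFun z) x,
    (mem_normalSpace_iff_coord (h y) hz).2 (by rw [chartCoord_chartFrame hz.2, hQ])⟩
  -- Both vectors satisfy the Ricci equation, one in the chart at `z` and the other in the chart at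
  -- `y`. The right-hand side involves only the chart-free shape operators, so nondegeneracy
  -- identifies them and no transformation law of the curvature is needed.
  have h0 : f.normalCurvatureAt cov u v ξ - ζ = 0 := by
    refine eq_zero_of_normalInner_eq_zero fun η ↦ ?_
    have e1 : f.normalInner z (f.normalCurvatureAt cov u v ξ - ζ) η =
        f.normalInner z (f.normalCurvatureAt cov u v ξ) η - f.normalInner z ζ η := by
      simp only [normalInner, Submodule.coe_sub, map_sub, sub_apply]
    have e2 : f.normalInner z ζ η = f.inducedInner z (f.shapeOperatorAt cov ξ v)
        (f.shapeOperatorAt cov η u) -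
        f.inducedInner z (f.shapeOperatorAt cov ξ u) (f.shapeOperatorAt cov η v) := by
      rw [normalInner, inducedInner, inducedInner, inner_eq_coordMetricAlong hz,
        inner_eq_coordMetricAlong hz, inner_eq_coordMetricAlong hz, chartCoord_chartFrame hz.2]
      refine ((h y).metric_formCurvature haB _ _ (coordNormal_of_mem hz ξ.2)
        (coordNormal_of_mem hz η.2)).trans ?_
      have h1 : ∀ u ξ, coordSecond (f.coordMetricAlong y) (f.coordDifferential y)
          (f.coordConnection cov y) (extChartAt 𝓘(ℝ, E) y z) (chartCoord y z u)
          (chartCoord (f.toFun y) (f.toFun z) ξ.1) =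
          -chartCoord (f.toFun y) (f.toFun z) (f.d z (f.shapeOperatorAt cov ξ u)) := fun u ξ ↦ by
        rw [chartCoord_d_shapeOperatorAt (h y) hz, neg_neg]; rfl
      rw [h1, h1, h1, h1]
      simp only [map_neg, neg_apply, neg_neg]
    rw [e1, e2, inner_normalCurvatureAt (h z), sub_self]
  rw [sub_eq_zero.1 h0]
  exact chartCoord_chartFrame hz.2 x

end SpacelikeImmersion

/-! ### Piecewise smooth paths -/

namespace Path

variable {E : Type*} [NormedAddCommGroup E] [NormedSpace ℝ E]
  {M : Type*} [TopologicalSpace M] [ChartedSpace E M] {x y z : M}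

/-- A finite set of break points is easier to rescale, reflect and unite than an ordered
subdivision. -/
theorem isPiecewiseSmooth_iff {γ : Path x y} : γ.IsPiecewiseSmooth E ↔
    ∃ P : Set ℝ, P.Finite ∧ ∀ a b : ℝ, 0 ≤ a → a < b → b ≤ 1 → Disjoint (Ioo a b) P →
      ContMDiffOn 𝓘(ℝ, ℝ) 𝓘(ℝ, E) ∞ γ.extend (Icc a b) := by
  constructor
  · rintro ⟨n, t, ht, h0, h1, h⟩
    refine ⟨range t, finite_range t, fun a b ha hab hb hd ↦ ?_⟩
    obtain ⟨i, hi1, hi2⟩ : ∃ i : Fin n, t i.castSucc ≤ a ∧ a < t i.succ := by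
      by_contra! hcon
      have : ∀ i, t i ≤ a := by
        intro i
        induction i using Fin.induction with
        | zero => rw [h0]; exact ha
        | succ i ih => exact hcon i ih
      linarith [this (Fin.last n)]
    refine (h i).mono (Icc_subset_Icc hi1 ?_)
    by_contra! hcon
    exact disjoint_left.1 hd ⟨hi2, hcon⟩ (mem_range_self _)
  · rintro ⟨P, hP, h⟩
    -- The break points in the unit interval together with its end points; their increasing
    -- enumeration is the subdivision.
    let T : Finset ℝ := ((hP.inter_of_left (Icc 0 1)).toFinset ∪ {0, 1})
    have h0T : (0 : ℝ) ∈ T := by simp [T]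
    have h1T : (1 : ℝ) ∈ T := by simp [T]
    have hT : ∀ s ∈ T, 0 ≤ s ∧ s ≤ 1 := by
      intro s hs
      simp only [T, Finset.mem_union, Finite.mem_toFinset, mem_inter_iff, mem_Icc,
        Finset.mem_insert, Finset.mem_singleton] at hs
      rcases hs with hs | rfl | rfl
      · exact hs.2
      · simp
      · simp
    have hcard : 0 < T.card := Finset.card_pos.2 ⟨0, h0T⟩
    obtain ⟨n, hn⟩ : ∃ n, T.card = n + 1 := ⟨T.card - 1, by omega⟩
    let t := T.orderEmbOfFin hn
    have hr : ∀ s ∈ T, ∃ i, t i = s := by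
      intro s hs
      have : s ∈ range (T.orderEmbOfFin hn) := by rw [Finset.range_orderEmbOfFin]; exact hs
      exact this
    have htT : ∀ i, t i ∈ T := fun i ↦ Finset.orderEmbOfFin_mem T hn i
    refine ⟨n, t, t.strictMono, ?_, ?_, fun i ↦ ?_⟩
    · obtain ⟨i, hi⟩ := hr 0 h0T
      exact le_antisymm (hi ▸ t.monotone (Fin.zero_le i)) (hT _ (htT _)).1
    · obtain ⟨i, hi⟩ := hr 1 h1T
      exact le_antisymm (hT _ (htT _)).2 (hi ▸ t.monotone (Fin.le_last i))
    · refine h _ _ (hT _ (htT _)).1 (t.strictMono Fin.castSucc_lt_succ) (hT _ (htT _)).2 ?_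
      refine disjoint_left.2 fun s hs hsP ↦ ?_
      obtain ⟨j, hj⟩ := hr s (by
        simp only [T, Finset.mem_union, Finite.mem_toFinset, mem_inter_iff]
        exact Or.inl ⟨hsP, (hT _ (htT _)).1.trans hs.1.le, hs.2.le.trans (hT _ (htT _)).2⟩)
      rw [← hj] at hs
      have h1 := t.lt_iff_lt.1 hs.1
      have h2 := t.lt_iff_lt.1 hs.2
      simp only [Fin.lt_def, Fin.val_castSucc, Fin.val_succ] at h1 h2
      omega

theorem IsPiecewiseSmooth.of_contMDiffOn {γ : Path x y}
    (h : ContMDiffOn 𝓘(ℝ, ℝ) 𝓘(ℝ, E) ∞ γ.extend (Icc 0 1)) : γ.IsPiecewiseSmooth E :=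
  isPiecewiseSmooth_iff.2 ⟨∅, finite_empty, fun _ _ ha _ hb _ ↦ h.mono (Icc_subset_Icc ha hb)⟩

theorem IsPiecewiseSmooth.contMDiffAt {γ : Path x y} (h : γ.IsPiecewiseSmooth E) :
    ∃ P : Set ℝ, P.Finite ∧ ∀ t ∈ Ioo (0 : ℝ) 1 \ P,
      ContMDiffAt 𝓘(ℝ, ℝ) 𝓘(ℝ, E) ∞ γ.extend t := by
  obtain ⟨P, hP, h⟩ := isPiecewiseSmooth_iff.1 h
  refine ⟨P, hP, fun t ht ↦ ?_⟩
  have h1 : Ioo (0 : ℝ) 1 \ P ∈ 𝓝 t := (isOpen_Ioo.sdiff hP.isClosed).mem_nhds ht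
  obtain ⟨ε, hε, hs⟩ := Metric.mem_nhds_iff.1 h1
  have hs' : ∀ s, t - ε < s → s < t + ε → s ∈ Ioo (0 : ℝ) 1 \ P := fun s h1 h2 ↦ hs (by
    rw [Real.ball_eq_Ioo]; exact ⟨h1, h2⟩)
  refine (h (t - ε / 2) (t + ε / 2) ?_ (by linarith) ?_ ?_).contMDiffAt
    (Icc_mem_nhds (by linarith) (by linarith))
  · exact (hs' _ (by linarith) (by linarith)).1.1.le
  · exact (hs' _ (by linarith) (by linarith)).1.2.le
  · refine disjoint_left.2 fun s h1 h2 ↦ (hs' s ?_ ?_).2 h2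
    · linarith [h1.1]
    · linarith [h1.2]

theorem isPiecewiseSmooth_refl (x : M) : (Path.refl x).IsPiecewiseSmooth E := by
  refine .of_contMDiffOn ?_
  rw [refl_extend]
  exact contMDiffOn_const

theorem contMDiffOn_comp_affine {γ : ℝ → M} {a b m k : ℝ}
    (h : ContMDiffOn 𝓘(ℝ, ℝ) 𝓘(ℝ, E) ∞ γ ((fun t ↦ m * t + k) '' Icc a b)) :
    ContMDiffOn 𝓘(ℝ, ℝ) 𝓘(ℝ, E) ∞ (fun t ↦ γ (m * t + k)) (Icc a b) := by
  refine ContMDiffOn.comp (I' := 𝓘(ℝ, ℝ)) (g := γ) (f := fun t ↦ m * t + k) h ?_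
    (fun t ht ↦ mem_image_of_mem _ ht)
  exact ((contDiff_const.mul contDiff_id).add contDiff_const).contMDiff.contMDiffOn

theorem IsPiecewiseSmooth.symm {γ : Path x y} (h : γ.IsPiecewiseSmooth E) :
    γ.symm.IsPiecewiseSmooth E := by
  obtain ⟨P, hP, h⟩ := isPiecewiseSmooth_iff.1 h
  refine isPiecewiseSmooth_iff.2 ⟨(fun t ↦ 1 - t) '' P, hP.image _, fun a b ha hab hb hd ↦ ?_⟩
  have h1 := h (1 - b) (1 - a) (by linarith) (by linarith) (by linarith) (disjoint_left.2
    fun s hs hsP ↦ disjoint_left.1 hd (show 1 - s ∈ Ioo a b from ⟨by linarith [hs.2], by linarith [hs.1]⟩)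
      (mem_image_of_mem _ hsP))
  rw [extend_symm]
  have h2 := contMDiffOn_comp_affine (E := E) (γ := γ.extend) (a := a) (b := b) (m := -1) (k := 1)
    (h1.mono (by
      rintro _ ⟨s, hs, rfl⟩
      exact ⟨by dsimp only; linarith [hs.2], by dsimp only; linarith [hs.1]⟩))
  exact h2.congr fun t _ ↦ by congr 1; ring

theorem IsPiecewiseSmooth.trans {γ₁ : Path x y} {γ₂ : Path y z} (h₁ : γ₁.IsPiecewiseSmooth E)
    (h₂ : γ₂.IsPiecewiseSmooth E) : (γ₁.trans γ₂).IsPiecewiseSmooth E := by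
  obtain ⟨P, hP, h₁⟩ := isPiecewiseSmooth_iff.1 h₁
  obtain ⟨R, hR, h₂⟩ := isPiecewiseSmooth_iff.1 h₂
  refine isPiecewiseSmooth_iff.2 ⟨(fun t ↦ t / 2) '' P ∪ (fun t ↦ (t + 1) / 2) '' R ∪ {1 / 2},
    ((hP.image _).union (hR.image _)).union (finite_singleton _), fun a b ha hab hb hd ↦ ?_⟩
  rcases le_or_gt b (1 / 2) with hb' | hb'
  · have h3 := h₁ (2 * a) (2 * b) (by linarith) (by linarith) (by linarith) (disjoint_left.2
      fun s hs hsP ↦ disjoint_left.1 hd (show s / 2 ∈ Ioo a b from ⟨by linarith [hs.1], by linarith [hs.2]⟩)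
        (Or.inl (Or.inl (mem_image_of_mem _ hsP))))
    have h4 := contMDiffOn_comp_affine (E := E) (γ := γ₁.extend) (a := a) (b := b) (m := 2) (k := 0)
      (h3.mono (by
        rintro _ ⟨s, hs, rfl⟩
        exact ⟨by dsimp only; linarith [hs.1], by dsimp only; linarith [hs.2]⟩))
    refine h4.congr fun t ht ↦ ?_
    rw [extend_trans_of_le_half _ _ (ht.2.trans hb'), add_zero]
  · have ha' : 1 / 2 ≤ a := by
      by_contra! hcon
      exact disjoint_left.1 hd (show 1 / 2 ∈ Ioo a b from ⟨hcon, hb'⟩) (Or.inr rfl)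
    have h3 := h₂ (2 * a - 1) (2 * b - 1) (by linarith) (by linarith) (by linarith) (disjoint_left.2
      fun s hs hsP ↦ disjoint_left.1 hd (show (s + 1) / 2 ∈ Ioo a b from
        ⟨by linarith [hs.1], by linarith [hs.2]⟩) (Or.inl (Or.inr (mem_image_of_mem _ hsP))))
    have h4 := contMDiffOn_comp_affine (E := E) (γ := γ₂.extend) (a := a) (b := b) (m := 2)
      (k := -1) (h3.mono (by
        rintro _ ⟨s, hs, rfl⟩
        exact ⟨by dsimp only; linarith [hs.1], by dsimp only; linarith [hs.2]⟩))
    refine h4.congr fun t ht ↦ ?_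
    rw [extend_trans_of_half_le _ _ (ha'.trans ht.1), sub_eq_add_neg]

end Path

/-! ### Parallel normal fields along curves -/

namespace SpacelikeImmersion

variable {E : Type*} [NormedAddCommGroup E] [NormedSpace ℝ E] [FiniteDimensional ℝ E]
  {M : Type*} [TopologicalSpace M] [ChartedSpace E M] [IsManifold 𝓘(ℝ, E) ∞ M]
  {F : Type*} [NormedAddCommGroup F] [NormedSpace ℝ F] [FiniteDimensional ℝ F]
  {N : Type*} [TopologicalSpace N] [ChartedSpace F N] [IsManifold 𝓘(ℝ, F) ∞ N]
  {g : PseudoRiemannianMetric F N}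

/-- The normal spaces as subspaces of the model space. -/
noncomputable def normalF (f : SpacelikeImmersion E M g) (z : M) : Submodule ℝ F := f.normalSpace z

/-- The coordinates in the chart at `f y` of a tangent vector at `f z`, given by its representative
in the model space. -/
noncomputable def vecCoord (f : SpacelikeImmersion E M g) (y z : M) : F →L[ℝ] F :=
  chartCoord (F := F) (f.toFun y) (f.toFun z)

/-- The normal vectors `X t` along the curve `γ` on `[0, 1]` form a parallel field. -/
structure IsParallelField (f : SpacelikeImmersion E M g)
    (cov : CovariantDerivative 𝓘(ℝ, F) F (TangentSpace 𝓘(ℝ, F) : N → Type _))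
    (γ : ℝ → M) (X : ℝ → F) : Prop where
  mem : ∀ t, X t ∈ f.normalF (γ t)
  cont : ContinuousOn (fun t ↦ (⟨f.toFun (γ t), X t⟩ : TangentBundle 𝓘(ℝ, F) N)) (Icc 0 1)
  deriv : ∃ s : Set ℝ, s.Finite ∧ ∀ t ∈ Ioo (0 : ℝ) 1 \ s, ∀ y, γ t ∈ f.chartDomain y →
    ∃ c', HasDerivAt (fun t ↦ extChartAt 𝓘(ℝ, E) y (γ t)) c' t ∧
      HasDerivAt (fun t ↦ f.vecCoord y (γ t) (X t))
        (-f.coordOmega cov y (extChartAt 𝓘(ℝ, E) y (γ t)) c' (f.vecCoord y (γ t) (X t))) t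

variable {f : SpacelikeImmersion E M g}
  {cov : CovariantDerivative 𝓘(ℝ, F) F (TangentSpace 𝓘(ℝ, F) : N → Type _)} {κ : ℝ}

/-- In a chart the normal derivative of `X` has coordinates `X' + Ω(c') X`. As the condition on the
left does not depend on the chart, the equation in one chart implies it in all the others. -/
theorem parallel_iff_coord {y : M} (h : CoordImmersion (f.coordDomain y) (f.coordMetricAlong y)
    (f.coordDifferential y) (f.coordConnection cov y) κ) {γ : ℝ → M} {t : ℝ}
    (ht : γ t ∈ f.chartDomain y) (hγ : ContinuousAt γ t) {c' : E}
    (hc : HasDerivAt (fun t ↦ extChartAt 𝓘(ℝ, E) y (γ t)) c' t)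
    (ξ : Π t : ℝ, f.normalSpace (γ t)) :
    (MDifferentiableAt 𝓘(ℝ, ℝ) 𝓘(ℝ, F).tangent
      (fun t ↦ (⟨f.toFun (γ t), (ξ t).1⟩ : TangentBundle 𝓘(ℝ, F) N)) t ∧
    f.normalProj (γ t) (covAlong ℝ cov (fun t ↦ f.toFun (γ t)) (fun t ↦ (ξ t).1) t (1 : ℝ)) = 0) ↔
    HasDerivAt (fun t ↦ f.vecCoord y (γ t) (ξ t).1)
        (-f.coordOmega cov y (extChartAt 𝓘(ℝ, E) y (γ t)) c' (f.vecCoord y (γ t) (ξ t).1)) t := by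
  have hc1 := hc.hasFDerivAt.hasMFDerivAt
  have key : ∀ X' : F, HasDerivAt (fun t ↦ f.vecCoord y (γ t) (ξ t).1) X' t →
      f.vecCoord y (γ t) (f.normalProj (γ t) (covAlong ℝ cov (fun t ↦ f.toFun (γ t))
        (fun t ↦ (ξ t).1) t (1 : ℝ))).1 =
      X' + f.coordOmega cov y (extChartAt 𝓘(ℝ, E) y (γ t)) c' (f.vecCoord y (γ t) (ξ t).1) := by
    intro X' hX'
    have h1 := (coord_covAlong h ht hγ hc1 (fun t ↦ (ξ t).2) hX'.hasFDerivAt.hasMFDerivAt 1).1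
    refine h1.trans ?_
    rw [ContinuousLinearMap.toSpanSingleton_apply, ContinuousLinearMap.toSpanSingleton_apply,
      one_smul, one_smul]
    rfl
  constructor
  · rintro ⟨h1, h2⟩
    have h3 := ((mdifferentiableAt_along_iff (h := fun t ↦ f.toFun (γ t)) ht.2).1 h1).2
    have h4 := (mdifferentiableAt_iff_differentiableAt.1 h3).hasDerivAt
    have h5 := key _ h4
    rw [h2] at h5
    refine h4.congr_deriv (eq_neg_of_add_eq_zero_left (h5.symm.trans ?_))
    exact map_zero (f.vecCoord y (γ t))
  · intro h1
    refine ⟨(mdifferentiableAt_along_iff (h := fun t ↦ f.toFun (γ t)) ht.2).2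
      ⟨mdifferentiableAt_comp ht hγ hc1, h1.differentiableAt.mdifferentiableAt⟩, ?_⟩
    have h5 := key _ h1
    rw [neg_add_cancel] at h5
    refine Subtype.ext ?_
    have h6 := congrArg (chartFrame (f.toFun y) (f.toFun (γ t))) h5
    exact (chartFrame_chartCoord ht.2 _).symm.trans (h6.trans (map_zero _))

theorem hasDerivAt_chart_of_contMDiffAt {y : M} {γ : ℝ → M} {t : ℝ} (ht : γ t ∈ (chartAt E y).source)
    (hγ : ContMDiffAt 𝓘(ℝ, ℝ) 𝓘(ℝ, E) ∞ γ t) :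
    ∃ c', HasDerivAt (fun t ↦ extChartAt 𝓘(ℝ, E) y (γ t)) c' t := by
  have h1 := hasMFDerivAt_chart_comp (G := ℝ) ht (hγ.mdifferentiableAt (by simp))
  exact ⟨_, (mdifferentiableAt_iff_differentiableAt.1 h1.mdifferentiableAt).hasDerivAt⟩

theorem IsParallelAlong.isParallelField (h : ∀ y, CoordImmersion (f.coordDomain y)
    (f.coordMetricAlong y) (f.coordDifferential y) (f.coordConnection cov y) κ) {x y : M}
    {γ : Path x y} (hγ : γ.IsPiecewiseSmooth E) {ξ : Π t : ℝ, f.normalSpace (γ.extend t)}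
    (hξ : f.IsParallelAlong cov γ ξ) : f.IsParallelField cov γ.extend (fun t ↦ (ξ t).1) where
  mem t := (ξ t).2
  cont := hξ.continuousOn
  deriv := by
    obtain ⟨P, hP, hγ⟩ := hγ.contMDiffAt
    obtain ⟨s, hs, hξ⟩ := hξ.parallel
    refine ⟨s ∪ P, hs.union hP, fun t ht z hz ↦ ?_⟩
    obtain ⟨c', hc'⟩ := hasDerivAt_chart_of_contMDiffAt hz.1
      (hγ t ⟨ht.1, fun h ↦ ht.2 (Or.inr h)⟩)
    exact ⟨c', hc', (parallel_iff_coord (h z) hz γ.continuous_extend.continuousAt hc' ξ).1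
      (hξ t ⟨ht.1, fun h ↦ ht.2 (Or.inl h)⟩)⟩

theorem IsParallelField.isParallelAlong (h : ∀ y, CoordImmersion (f.coordDomain y)
    (f.coordMetricAlong y) (f.coordDifferential y) (f.coordConnection cov y) κ) {x y : M}
    {γ : Path x y} {X : ℝ → F} (hX : f.IsParallelField cov γ.extend X) :
    f.IsParallelAlong cov γ (fun t ↦ ⟨X t, hX.mem t⟩) where
  continuousOn := hX.cont
  parallel := by
    obtain ⟨s, hs, h1⟩ := hX.deriv
    refine ⟨s, hs, fun t ht ↦ ?_⟩
    obtain ⟨c', hc', h2⟩ := h1 t ht _ (f.mem_chartDomain_self _)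
    exact (parallel_iff_coord (h _) (f.mem_chartDomain_self _) γ.continuous_extend.continuousAt hc'
      (fun t ↦ ⟨X t, hX.mem t⟩)).2 h2

end SpacelikeImmersion

/-! ### Operations on parallel fields -/

namespace CoordImmersion

section

noncomputable local instance clmNormedAddCommGroup3 {V W : Type*} [NormedAddCommGroup V] [NormedSpace ℝ V]
    [NormedAddCommGroup W] [NormedSpace ℝ W] : NormedAddCommGroup (V →L[ℝ] W) :=
  ContinuousLinearMap.toNormedAddCommGroup

noncomputable local instance clmNormedSpace3 {V W : Type*} [NormedAddCommGroup V] [NormedSpace ℝ V]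
    [NormedAddCommGroup W] [NormedSpace ℝ W] : NormedSpace ℝ (V →L[ℝ] W) :=
  ContinuousLinearMap.toNormedSpace

local instance clmAddCommGroup3 {V W : Type*} [NormedAddCommGroup V] [NormedSpace ℝ V]
    [NormedAddCommGroup W] [NormedSpace ℝ W] : AddCommGroup (V →L[ℝ] W) :=
  ContinuousLinearMap.addCommGroup

variable {E F : Type*} [NormedAddCommGroup E] [NormedSpace ℝ E] [FiniteDimensional ℝ E]
  [NormedAddCommGroup F] [NormedSpace ℝ F] [FiniteDimensional ℝ F]
  {B : Set E} {G : E → F →L[ℝ] F →L[ℝ] ℝ} {L : E → E →L[ℝ] F} {Θ : E → E →L[ℝ] F →L[ℝ] F} {κ : ℝ}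

theorem metric_connection (h : CoordImmersion B G L Θ κ) {p : E} (hp : p ∈ B) (u : E) {v w : F}
    (hv : coordNormalProj G L p v = v) (hw : coordNormalProj G L p w = w) :
    G p (Θ p u v) w = G p (coordForm G L Θ p u v) w := by
  have e2 : Θ p u v = coordForm G L Θ p u v + coordSecond G L Θ p u v := by
    rw [coordSecond, sub_apply, sub_apply]; abel
  rw [e2, map_add, add_apply, (h.second_apply_normal hp u hv).2, add_eq_left, h.symm p hp, ← hw]
  exact h.metric_normalProj hp _ _

set_option synthInstance.maxHeartbeats 200000 in
theorem hasDerivAt_metric_parallel (h : CoordImmersion B G L Θ κ) {c : ℝ → E} {x y : ℝ → F} {t : ℝ}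
    {c' : E} (hc : HasDerivAt c c' t) (hcB : c t ∈ B)
    (hx : coordNormalProj G L (c t) (x t) = x t) (hy : coordNormalProj G L (c t) (y t) = y t)
    (hx' : HasDerivAt x (-coordForm G L Θ (c t) c' (x t)) t)
    (hy' : HasDerivAt y (-coordForm G L Θ (c t) c' (y t)) t) :
    HasDerivAt (fun t ↦ G (c t) (x t) (y t)) 0 t := by
  have hG : HasFDerivAt G (fderiv ℝ G (c t)) (c t) :=
    ((h.contDiffOn_metric.contDiffAt (h.isOpen.mem_nhds hcB)).differentiableAt
      (by simp)).hasFDerivAt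
  have d5 := ((hG.comp_hasDerivAt t hc).clm_apply hx').clm_apply hy'
  refine d5.congr_deriv ?_
  have e4 := h.metric _ hcB c' (x t) (y t)
  have e5 := h.metric_connection hcB c' hx hy
  have e6 := h.metric_connection hcB c' hy hx
  rw [h.symm _ hcB, h.symm _ hcB (coordForm G L Θ (c t) c' _)] at e6
  simp only [Function.comp_apply, add_apply, map_neg, neg_apply]
  rw [e4, e5, e6]
  ring

end

end CoordImmersion

namespace SpacelikeImmersion

variable {E : Type*} [NormedAddCommGroup E] [NormedSpace ℝ E] [FiniteDimensional ℝ E]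
  {M : Type*} [TopologicalSpace M] [ChartedSpace E M] [IsManifold 𝓘(ℝ, E) ∞ M]
  {F : Type*} [NormedAddCommGroup F] [NormedSpace ℝ F] [FiniteDimensional ℝ F]
  {N : Type*} [TopologicalSpace N] [ChartedSpace F N] [IsManifold 𝓘(ℝ, F) ∞ N]
  {g : PseudoRiemannianMetric F N} {f : SpacelikeImmersion E M g}
  {cov : CovariantDerivative 𝓘(ℝ, F) F (TangentSpace 𝓘(ℝ, F) : N → Type _)} {κ : ℝ}

/-- The field `X` along `γ` is differentiable and parallel at the time `t`. -/
def ParallelAt (f : SpacelikeImmersion E M g)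
    (cov : CovariantDerivative 𝓘(ℝ, F) F (TangentSpace 𝓘(ℝ, F) : N → Type _))
    (γ : ℝ → M) (X : ℝ → F) (t : ℝ) : Prop :=
  ∀ y, γ t ∈ f.chartDomain y →
    ∃ c', HasDerivAt (fun t ↦ extChartAt 𝓘(ℝ, E) y (γ t)) c' t ∧
      HasDerivAt (fun t ↦ f.vecCoord y (γ t) (X t))
        (-f.coordOmega cov y (extChartAt 𝓘(ℝ, E) y (γ t)) c' (f.vecCoord y (γ t) (X t))) t

theorem ParallelAt.comp_affine {γ : ℝ → M} {X : ℝ → F} {m k t : ℝ}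
    (h : f.ParallelAt cov γ X (m * t + k)) :
    f.ParallelAt cov (fun t ↦ γ (m * t + k)) (fun t ↦ X (m * t + k)) t := by
  intro y hy
  obtain ⟨c', h1, h2⟩ := h y hy
  have h3 : HasDerivAt (fun t : ℝ ↦ m * t + k) m t := by
    simpa using ((hasDerivAt_id t).const_mul m).add_const k
  refine ⟨m • c', HasDerivAt.scomp (g₁ := fun t ↦ extChartAt 𝓘(ℝ, E) y (γ t)) t h1 h3,
    (HasDerivAt.scomp (g₁ := fun t ↦ f.vecCoord y (γ t) (X t)) t h2 h3).congr_deriv ?_⟩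
  simp

theorem ParallelAt.congr {γ γ' : ℝ → M} {X X' : ℝ → F} {t : ℝ} (h : f.ParallelAt cov γ X t)
    (hγ : γ' =ᶠ[𝓝 t] γ) (hX : X' =ᶠ[𝓝 t] X) : f.ParallelAt cov γ' X' t := by
  intro y hy
  rw [hγ.self_of_nhds] at hy ⊢
  obtain ⟨c', h1, h2⟩ := h y hy
  refine ⟨c', h1.congr_of_eventuallyEq ?_, ?_⟩
  · filter_upwards [hγ] with s hs
    rw [hs]
  · rw [hX.self_of_nhds]
    refine h2.congr_of_eventuallyEq ?_
    filter_upwards [hγ, hX] with s hs hs'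
    rw [hs, hs']

theorem ParallelAt.linearCombination {γ : ℝ → M} {X Y : ℝ → F} {t : ℝ} (a b : ℝ)
    (hX : f.ParallelAt cov γ X t) (hY : f.ParallelAt cov γ Y t) :
    f.ParallelAt cov γ (fun t ↦ a • X t + b • Y t) t := by
  intro y hy
  obtain ⟨c', h1, h2⟩ := hX y hy
  obtain ⟨d', h3, h4⟩ := hY y hy
  rw [h3.unique h1] at h4
  refine ⟨c', h1, ?_⟩
  have h5 := (h2.const_smul a).add (h4.const_smul b)
  simp only [map_add, map_smul, neg_add]
  refine h5.congr_deriv ?_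
  simp

theorem continuousWithinAt_vecCoord {γ : ℝ → M} {X : ℝ → F} {S : Set ℝ} {t : ℝ} {y : M}
    (hy : γ t ∈ f.chartDomain y) (hγ : ContinuousWithinAt γ S t)
    (hX : ContinuousWithinAt (fun t ↦ (⟨f.toFun (γ t), X t⟩ : TangentBundle 𝓘(ℝ, F) N)) S t) :
    ContinuousWithinAt (fun t ↦ f.vecCoord y (γ t) (X t)) S t := by
  have h1 : ContinuousAt (trivializationAt F (TangentSpace 𝓘(ℝ, F) : N → Type _) (f.toFun y))
      (⟨f.toFun (γ t), X t⟩ : TangentBundle 𝓘(ℝ, F) N) :=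
    (trivializationAt F (TangentSpace 𝓘(ℝ, F) : N → Type _) (f.toFun y)).continuousAt
      (by simpa [Trivialization.mem_source] using hy.2)
  have h2 := (h1.comp_continuousWithinAt (f := fun t ↦
    (⟨f.toFun (γ t), X t⟩ : TangentBundle 𝓘(ℝ, F) N)) hX).snd
  refine h2.congr_of_eventuallyEq ?_ (trivializationAt_snd hy.2 _).symm
  filter_upwards [hγ.eventually ((f.isOpen_chartDomain y).mem_nhds hy)] with s hs
    using (trivializationAt_snd hs.2 _).symm

theorem continuousWithinAt_of_vecCoord {γ : ℝ → M} {X : ℝ → F} {S : Set ℝ} {t : ℝ} {y : M}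
    (hy : γ t ∈ f.chartDomain y) (hγ : ContinuousWithinAt γ S t)
    (hX : ContinuousWithinAt (fun t ↦ f.vecCoord y (γ t) (X t)) S t) :
    ContinuousWithinAt (fun t ↦ (⟨f.toFun (γ t), X t⟩ : TangentBundle 𝓘(ℝ, F) N)) S t := by
  refine ((trivializationAt F (TangentSpace 𝓘(ℝ, F) : N → Type _) (f.toFun y)).tendsto_nhds_iff
    (by simpa [Trivialization.mem_source] using hy.2)).2
    ⟨f.contMDiff.continuous.continuousAt.comp_continuousWithinAt hγ, ?_⟩
  have h1 : ContinuousWithinAt (fun t ↦ (trivializationAt F (TangentSpace 𝓘(ℝ, F) : N → Type _)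
      (f.toFun y) (⟨f.toFun (γ t), X t⟩ : TangentBundle 𝓘(ℝ, F) N)).2) S t := by
    refine hX.congr_of_eventuallyEq ?_ (trivializationAt_snd hy.2 _)
    filter_upwards [hγ.eventually ((f.isOpen_chartDomain y).mem_nhds hy)] with s hs
      using (trivializationAt_snd hs.2 _)
  exact h1

namespace IsParallelField

theorem linearCombination {γ : ℝ → M} (hγ : Continuous γ) {X Y : ℝ → F} (a b : ℝ)
    (hX : f.IsParallelField cov γ X) (hY : f.IsParallelField cov γ Y) :
    f.IsParallelField cov γ (fun t ↦ a • X t + b • Y t) where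
  mem t := Submodule.add_mem _ (Submodule.smul_mem _ _ (hX.mem t))
    (Submodule.smul_mem _ _ (hY.mem t))
  cont t ht := by
    have h0 := f.mem_chartDomain_self (γ t)
    have h1 := continuousWithinAt_vecCoord h0 hγ.continuousWithinAt (hX.cont t ht)
    have h2 := continuousWithinAt_vecCoord h0 hγ.continuousWithinAt (hY.cont t ht)
    refine continuousWithinAt_of_vecCoord h0 hγ.continuousWithinAt ?_
    simp only [map_add, map_smul]
    exact (h1.const_smul a).add (h2.const_smul b)
  deriv := by
    obtain ⟨s, hs, h1⟩ := hX.deriv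
    obtain ⟨s', hs', h2⟩ := hY.deriv
    exact ⟨s ∪ s', hs.union hs', fun t ht ↦ ParallelAt.linearCombination a b
      (h1 t ⟨ht.1, fun h ↦ ht.2 (Or.inl h)⟩) (h2 t ⟨ht.1, fun h ↦ ht.2 (Or.inr h)⟩)⟩

/-- Some parallel field is needed as input, because it carries the differentiability of `γ` off a
finite set. -/
theorem zero {γ : ℝ → M} (hγ : Continuous γ) {X : ℝ → F} (hX : f.IsParallelField cov γ X) :
    f.IsParallelField cov γ (fun _ ↦ 0) := by
  simpa using hX.linearCombination hγ 0 0 hX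

theorem sum {γ : ℝ → M} (hγ : Continuous γ) {ι : Type*} [Nonempty ι] (s : Finset ι) (a : ι → ℝ)
    {X : ι → ℝ → F} (hX : ∀ i, f.IsParallelField cov γ (X i)) :
    f.IsParallelField cov γ (fun t ↦ ∑ i ∈ s, a i • X i t) := by
  classical
  induction s using Finset.induction_on with
  | empty => simpa using (hX (Classical.arbitrary ι)).zero hγ
  | insert i s hi ih =>
    simp only [Finset.sum_insert hi]
    simpa using (hX i).linearCombination hγ (a i) 1 ih

theorem comp_symm {γ : ℝ → M} {X : ℝ → F} (hX : f.IsParallelField cov γ X) :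
    f.IsParallelField cov (fun t ↦ γ (1 - t)) (fun t ↦ X (1 - t)) where
  mem t := hX.mem _
  cont := by
    refine hX.cont.comp (f := fun t ↦ 1 - t) (by fun_prop) fun t ht ↦ ?_
    exact ⟨by linarith [ht.2], by linarith [ht.1]⟩
  deriv := by
    obtain ⟨s, hs, h1⟩ := hX.deriv
    refine ⟨(fun t ↦ 1 - t) '' s, hs.image _, fun t ht ↦ ?_⟩
    have h2 : f.ParallelAt cov γ X (-1 * t + 1) := by
      refine h1 _ ⟨⟨by linarith [ht.1.2], by linarith [ht.1.1]⟩, fun h ↦ ht.2 ⟨_, h, ?_⟩⟩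
      dsimp only; ring
    have h3 := h2.comp_affine
    have e : ∀ t : ℝ, -1 * t + 1 = 1 - t := fun t ↦ by ring
    simp only [e] at h3
    exact h3

theorem trans {x y z : M} {γ₁ : Path x y} {γ₂ : Path y z} {X₁ X₂ : ℝ → F}
    (h₁ : f.IsParallelField cov γ₁.extend X₁) (h₂ : f.IsParallelField cov γ₂.extend X₂)
    (h : X₁ 1 = X₂ 0) : f.IsParallelField cov (γ₁.trans γ₂).extend
      (fun t ↦ if t ≤ 1 / 2 then X₁ (2 * t) else X₂ (2 * t - 1)) := by
  set X : ℝ → F := fun t ↦ if t ≤ 1 / 2 then X₁ (2 * t) else X₂ (2 * t - 1) with hXdef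
  have hX1 : ∀ t ≤ 1 / 2, X t = X₁ (2 * t) := fun t ht ↦ if_pos ht
  have hX2 : ∀ t, 1 / 2 ≤ t → X t = X₂ (2 * t - 1) := by
    intro t ht
    rcases ht.eq_or_lt with rfl | ht
    · rw [hX1 _ le_rfl]; norm_num; exact h
    · exact if_neg (not_le.2 ht)
  have hγ1 : ∀ t : ℝ, t ≤ 1 / 2 → (γ₁.trans γ₂).extend t = γ₁.extend (2 * t) := fun t ht ↦
    Path.extend_trans_of_le_half _ _ ht
  have hγ2 : ∀ t : ℝ, 1 / 2 ≤ t → (γ₁.trans γ₂).extend t = γ₂.extend (2 * t - 1) := fun t ht ↦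
    Path.extend_trans_of_half_le _ _ ht
  refine ⟨fun t ↦ ?_, ?_, ?_⟩
  · rcases le_total t (1 / 2) with ht | ht
    · rw [hγ1 t ht, hX1 t ht]; exact h₁.mem _
    · rw [hγ2 t ht, hX2 t ht]; exact h₂.mem _
  · have e : Icc (0 : ℝ) 1 = Icc 0 (1 / 2) ∪ Icc (1 / 2) 1 :=
      (Icc_union_Icc_eq_Icc (by norm_num) (by norm_num)).symm
    rw [e]
    refine ContinuousOn.union_of_isClosed ?_ ?_ isClosed_Icc isClosed_Icc
    · refine (h₁.cont.comp (f := fun t ↦ 2 * t) (by fun_prop) fun t ht ↦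
        ⟨by linarith [ht.1], by linarith [ht.2]⟩).congr fun t ht ↦ ?_
      simp only [Function.comp_apply]
      rw [hX1 t ht.2, hγ1 t ht.2]
    · refine (h₂.cont.comp (f := fun t ↦ 2 * t - 1) (by fun_prop) fun t ht ↦
        ⟨by linarith [ht.1], by linarith [ht.2]⟩).congr fun t ht ↦ ?_
      simp only [Function.comp_apply]
      rw [hX2 t ht.1, hγ2 t ht.1]
  · obtain ⟨s, hs, h1⟩ := h₁.deriv
    obtain ⟨s', hs', h2⟩ := h₂.deriv
    refine ⟨(fun t ↦ t / 2) '' s ∪ (fun t ↦ (t + 1) / 2) '' s' ∪ {1 / 2},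
      ((hs.image _).union (hs'.image _)).union (finite_singleton _), fun t ht ↦ ?_⟩
    have hne : t ≠ 1 / 2 := fun h ↦ ht.2 (Or.inr h)
    rcases lt_or_gt_of_ne hne with hlt | hlt
    · have h3 : f.ParallelAt cov γ₁.extend X₁ (2 * t + 0) := by
        refine h1 _ ⟨⟨by linarith [ht.1.1], by linarith⟩, fun h ↦ ht.2 (Or.inl (Or.inl ⟨_, h, ?_⟩))⟩
        dsimp only; ring
      refine h3.comp_affine.congr ?_ ?_
      · filter_upwards [Iio_mem_nhds hlt] with r hr
        rw [hγ1 r (le_of_lt hr), add_zero]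
      · filter_upwards [Iio_mem_nhds hlt] with r hr
        rw [hX1 r (le_of_lt hr), add_zero]
    · have h3 : f.ParallelAt cov γ₂.extend X₂ (2 * t + -1) := by
        refine h2 _ ⟨⟨by linarith, by linarith [ht.1.2]⟩,
          fun h ↦ ht.2 (Or.inl (Or.inr ⟨_, h, ?_⟩))⟩
        dsimp only; ring
      refine h3.comp_affine.congr ?_ ?_
      · filter_upwards [Ioi_mem_nhds hlt] with r hr
        rw [hγ2 r (le_of_lt hr), sub_eq_add_neg]
      · filter_upwards [Ioi_mem_nhds hlt] with r hr
        rw [hX2 r (le_of_lt hr), sub_eq_add_neg]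

set_option synthInstance.maxHeartbeats 200000 in
/-- Parallel fields have constant scalar products. -/
theorem inner_eq (h : ∀ y, CoordImmersion (f.coordDomain y) (f.coordMetricAlong y)
    (f.coordDifferential y) (f.coordConnection cov y) κ) {γ : ℝ → M} (hγ : Continuous γ)
    {X Y : ℝ → F} (hX : f.IsParallelField cov γ X) (hY : f.IsParallelField cov γ Y) {t : ℝ}
    (ht : t ∈ Icc (0 : ℝ) 1) :
    g.inner (f.toFun (γ t)) (X t) (Y t) = g.inner (f.toFun (γ 0)) (X 0) (Y 0) := by
  obtain ⟨s, hs, h1⟩ := hX.deriv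
  obtain ⟨s', hs', h2⟩ := hY.deriv
  have key : ∀ t, γ t ∈ f.chartDomain (γ t) := fun t ↦ f.mem_chartDomain_self _
  have hcoord : ∀ t, (fun r ↦ g.inner (f.toFun (γ r)) (X r) (Y r)) =ᶠ[𝓝 t]
      fun r ↦ f.coordMetricAlong (γ t) (extChartAt 𝓘(ℝ, E) (γ t) (γ r))
        (f.vecCoord (γ t) (γ r) (X r)) (f.vecCoord (γ t) (γ r) (Y r)) := by
    intro t
    filter_upwards [hγ.continuousAt.eventually ((f.isOpen_chartDomain _).mem_nhds (key t))]
      with r hr using inner_eq_coordMetricAlong hr _ _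
  refine eq_of_hasDerivAt_zero_off_countable
    (u := fun t ↦ g.inner (f.toFun (γ t)) (X t) (Y t)) ht.1 (hs.union hs').countable ?_ ?_
  · intro r hr
    have hr' : r ∈ Icc (0 : ℝ) 1 := ⟨hr.1, hr.2.trans ht.2⟩
    have c1 := continuousWithinAt_vecCoord (key r) hγ.continuousWithinAt (hX.cont r hr')
    have c2 := continuousWithinAt_vecCoord (key r) hγ.continuousWithinAt (hY.cont r hr')
    have c3 : ContinuousAt (f.coordMetricAlong (γ r)) (extChartAt 𝓘(ℝ, E) (γ r) (γ r)) :=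
      ((h _).contDiffOn_metric.contDiffAt ((h _).isOpen.mem_nhds
        (f.chart_mem_coordDomain (key r)))).continuousAt
    have c4 : ContinuousAt (fun t ↦ extChartAt 𝓘(ℝ, E) (γ r) (γ t)) r :=
      (continuousAt_extChartAt (I := 𝓘(ℝ, E)) (γ r)).comp hγ.continuousAt
    have c5 : ContinuousWithinAt (fun t ↦ f.coordMetricAlong (γ r) (extChartAt 𝓘(ℝ, E) (γ r) (γ t)))
      (Icc 0 1) r := (ContinuousAt.comp (f := fun t ↦ extChartAt 𝓘(ℝ, E) (γ r) (γ t)) c3 c4).continuousWithinAt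
    have c6 := (c5.clm_apply c1).clm_apply c2
    refine (c6.mono (Icc_subset_Icc le_rfl ht.2)).congr_of_eventuallyEq
      ((hcoord r).filter_mono nhdsWithin_le_nhds) (hcoord r).self_of_nhds
  · intro r hr
    have hr' : r ∈ Ioo (0 : ℝ) 1 := ⟨hr.1.1, hr.1.2.trans_le ht.2⟩
    obtain ⟨c', d1, d2⟩ := h1 r ⟨hr', fun hh ↦ hr.2 (Or.inl hh)⟩ _ (key r)
    obtain ⟨c'', d3, d4⟩ := h2 r ⟨hr', fun hh ↦ hr.2 (Or.inr hh)⟩ _ (key r)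
    rw [d3.unique d1] at d4
    have hB := f.chart_mem_coordDomain (key r)
    have hx := coordNormal_of_mem (key r) (hX.mem r)
    have hy := coordNormal_of_mem (key r) (hY.mem r)
    exact ((h _).hasDerivAt_metric_parallel d1 hB hx hy d2 d4).congr_of_eventuallyEq (hcoord r)

end IsParallelField

end SpacelikeImmersion

/-! ### Parallel displacements -/

namespace SpacelikeImmersion

variable {E : Type*} [NormedAddCommGroup E] [NormedSpace ℝ E] [FiniteDimensional ℝ E]
  {M : Type*} [TopologicalSpace M] [ChartedSpace E M] [IsManifold 𝓘(ℝ, E) ∞ M]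
  {F : Type*} [NormedAddCommGroup F] [NormedSpace ℝ F] [FiniteDimensional ℝ F]
  {N : Type*} [TopologicalSpace N] [ChartedSpace F N] [IsManifold 𝓘(ℝ, F) ∞ N]
  {g : PseudoRiemannianMetric F N} {f : SpacelikeImmersion E M g}
  {cov : CovariantDerivative 𝓘(ℝ, F) F (TangentSpace 𝓘(ℝ, F) : N → Type _)} {κ : ℝ}

/-- `f` satisfies the structure equations in all charts. -/
def HasCoordImmersions (f : SpacelikeImmersion E M g)
    (cov : CovariantDerivative 𝓘(ℝ, F) F (TangentSpace 𝓘(ℝ, F) : N → Type _)) (κ : ℝ) : Prop :=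
  ∀ y, CoordImmersion (f.coordDomain y) (f.coordMetricAlong y) (f.coordDifferential y)
    (f.coordConnection cov y) κ

/-- `τ` is the parallel displacement along the piecewise smooth path `γ`. -/
structure IsDisplacement (f : SpacelikeImmersion E M g)
    (cov : CovariantDerivative 𝓘(ℝ, F) F (TangentSpace 𝓘(ℝ, F) : N → Type _))
    {x y : M} (γ : Path x y) (τ : f.normalF x ≃ₗ[ℝ] f.normalF y) : Prop where
  smooth : γ.IsPiecewiseSmooth E
  parallel : f.IsParallelDisplacement cov γ τ

theorem totalSpace_eq_iff {z z' : N} (hz : z = z') (v w : F) :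
    (⟨z, v⟩ : TangentBundle 𝓘(ℝ, F) N) = ⟨z', w⟩ ↔ v = w := by
  subst hz
  refine ⟨fun h ↦ ?_, fun h ↦ by rw [h]⟩
  have := TotalSpace.mk_inj.1 h
  exact this

theorem isDisplacement_iff (h : f.HasCoordImmersions cov κ) {x y : M} {γ : Path x y}
    {τ : f.normalF x ≃ₗ[ℝ] f.normalF y} : f.IsDisplacement cov γ τ ↔
      γ.IsPiecewiseSmooth E ∧ ∀ u : f.normalF x, ∃ X : ℝ → F, f.IsParallelField cov γ.extend X ∧
        X 0 = u ∧ X 1 = τ u := by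
  have e0 : f.toFun (γ.extend 0) = f.toFun x := by rw [γ.extend_zero]
  have e1 : f.toFun (γ.extend 1) = f.toFun y := by rw [γ.extend_one]
  constructor
  · rintro ⟨h1, h2⟩
    refine ⟨h1, fun u ↦ ?_⟩
    obtain ⟨ξ, h3, h4, h5⟩ := h2 u
    exact ⟨fun t ↦ (ξ t).1, h3.isParallelField h h1, (totalSpace_eq_iff e0 _ _).1 h4,
      (totalSpace_eq_iff e1 _ _).1 h5⟩
  · rintro ⟨h1, h2⟩
    refine ⟨h1, fun u ↦ ?_⟩
    obtain ⟨X, h3, h4, h5⟩ := h2 u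
    exact ⟨fun t ↦ ⟨X t, h3.mem t⟩, h3.isParallelAlong h, (totalSpace_eq_iff e0 _ _).2 h4,
      (totalSpace_eq_iff e1 _ _).2 h5⟩

theorem isParallelField_const {x : M} {v : F} (hv : v ∈ f.normalF x) :
    f.IsParallelField cov (fun _ ↦ x) (fun _ ↦ v) where
  mem _ := hv
  cont := continuousOn_const
  deriv := ⟨∅, finite_empty, fun t _ y _ ↦ ⟨0, hasDerivAt_const _ _,
    (hasDerivAt_const _ _).congr_deriv (by simp)⟩⟩

namespace IsDisplacement

theorem refl (h : f.HasCoordImmersions cov κ) (x : M) :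
    f.IsDisplacement cov (Path.refl x) (LinearEquiv.refl ℝ _) := by
  refine (isDisplacement_iff h).2 ⟨Path.isPiecewiseSmooth_refl x, fun u ↦ ⟨fun _ ↦ u, ?_, rfl, rfl⟩⟩
  rw [Path.refl_extend]
  exact isParallelField_const u.2

theorem symm (h : f.HasCoordImmersions cov κ) {x y : M} {γ : Path x y}
    {τ : f.normalF x ≃ₗ[ℝ] f.normalF y} (hτ : f.IsDisplacement cov γ τ) :
    f.IsDisplacement cov γ.symm τ.symm := by
  obtain ⟨h1, h2⟩ := (isDisplacement_iff h).1 hτ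
  refine (isDisplacement_iff h).2 ⟨h1.symm, fun u ↦ ?_⟩
  obtain ⟨X, h3, h4, h5⟩ := h2 (τ.symm u)
  refine ⟨fun t ↦ X (1 - t), ?_, ?_, ?_⟩
  · rw [Path.extend_symm]; exact h3.comp_symm
  · dsimp only
    rw [sub_zero, h5, τ.apply_symm_apply]
  · dsimp only
    rw [sub_self, h4]

theorem trans (h : f.HasCoordImmersions cov κ) {x y z : M} {γ₁ : Path x y} {γ₂ : Path y z}
    {τ₁ : f.normalF x ≃ₗ[ℝ] f.normalF y} {τ₂ : f.normalF y ≃ₗ[ℝ] f.normalF z}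
    (h₁ : f.IsDisplacement cov γ₁ τ₁) (h₂ : f.IsDisplacement cov γ₂ τ₂) :
    f.IsDisplacement cov (γ₁.trans γ₂) (τ₁.trans τ₂) := by
  obtain ⟨s1, p1⟩ := (isDisplacement_iff h).1 h₁
  obtain ⟨s2, p2⟩ := (isDisplacement_iff h).1 h₂
  refine (isDisplacement_iff h).2 ⟨s1.trans s2, fun u ↦ ?_⟩
  obtain ⟨X₁, h3, h4, h5⟩ := p1 u
  obtain ⟨X₂, h6, h7, h8⟩ := p2 (τ₁ u)
  refine ⟨_, h3.trans h6 (h5.trans h7.symm), ?_, ?_⟩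
  · norm_num; exact h4
  · norm_num; exact h8

/-- The parallel fields along `γ` form a linear family. -/
theorem exists_family (h : f.HasCoordImmersions cov κ) {x y : M} {γ : Path x y}
    {τ : f.normalF x ≃ₗ[ℝ] f.normalF y} (hτ : f.IsDisplacement cov γ τ) :
    ∃ Φ : ℝ → f.normalF x →ₗ[ℝ] F, (∀ u, f.IsParallelField cov γ.extend fun t ↦ Φ t u) ∧
      (∀ u, Φ 0 u = u) ∧ ∀ u, Φ 1 u = τ u := by
  -- Parallel fields are chosen on a basis and extended linearly, so linearity of the family does
  -- not rest on the uniqueness of parallel fields.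
  choose s X hX hX0 hX1 using ((isDisplacement_iff h).1 hτ).imp_right id
  let b := Module.finBasis ℝ (f.normalF x)
  let Φ : ℝ → f.normalF x →ₗ[ℝ] F := fun t ↦ b.constr ℝ fun i ↦ X (b i) t
  have hΦ : ∀ (u) (t), Φ t u = ∑ i, b.repr u i • X (b i) t := fun u t ↦ by
    simp only [Φ, Module.Basis.constr_apply_fintype]
    rfl
  refine ⟨Φ, fun u ↦ ?_, fun u ↦ ?_, fun u ↦ ?_⟩
  · simp only [hΦ]
    -- When the normal space is zero the sum is empty, and the zero field is obtained from the field
    -- attached to the vector `0`.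
    have h0 : Nonempty (Fin (Module.finrank ℝ (f.normalF x))) ∨
        IsEmpty (Fin (Module.finrank ℝ (f.normalF x))) := (isEmpty_or_nonempty _).symm
    rcases h0 with h0 | h0
    · exact IsParallelField.sum γ.continuous_extend _ _ fun i ↦ hX (b i)
    · simpa using (hX 0).zero γ.continuous_extend
  · simp only [hΦ, hX0]
    have := congrArg (fun v : f.normalF x ↦ (v : F)) (b.sum_repr u)
    simp only [Submodule.coe_sum, Submodule.coe_smul] at this
    exact this
  · simp only [hΦ, hX1]
    have := congrArg (fun v : f.normalF x ↦ ((τ v : f.normalF y) : F)) (b.sum_repr u)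
    simp only [map_sum, map_smul, Submodule.coe_sum, Submodule.coe_smul] at this
    exact this

theorem inner_eq (h : f.HasCoordImmersions cov κ) {x y : M} {γ : Path x y}
    {τ : f.normalF x ≃ₗ[ℝ] f.normalF y} (hτ : f.IsDisplacement cov γ τ) (u v : f.normalF x) :
    f.normalInner y (τ u) (τ v) = f.normalInner x u v := by
  obtain ⟨X, h3, h4, h5⟩ := ((isDisplacement_iff h).1 hτ).2 u
  obtain ⟨Y, h6, h7, h8⟩ := ((isDisplacement_iff h).1 hτ).2 v
  have h9 := h3.inner_eq h γ.continuous_extend h6 (right_mem_Icc.2 zero_le_one)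
  have key : ∀ {z z' : M} (_ : z = z') (a b : F),
      (g.inner (f.toFun z) a b : ℝ) = g.inner (f.toFun z') a b := by rintro _ _ rfl _ _; rfl
  rw [key γ.extend_one, key γ.extend_zero, h4, h5, h7, h8] at h9
  exact h9

end IsDisplacement

end SpacelikeImmersion

/-! ### Radial gauges -/

section Generic

variable {V X : Type*} [NormedAddCommGroup V] [NormedSpace ℝ V] [FiniteDimensional ℝ V]
  [NormedAddCommGroup X] [NormedSpace ℝ X]

theorem ContDiffBump.contDiff_smul {o : V} (b : ContDiffBump o) {w : V → X} {U : Set V}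
    (hU : IsOpen U) (hw : ContDiffOn ℝ ∞ w U) (hb : Metric.closedBall o b.rOut ⊆ U) :
    ContDiff ℝ 1 fun p ↦ b p • w p := by
  rw [contDiff_iff_contDiffAt]
  intro p
  by_cases hp : p ∈ Metric.closedBall o b.rOut
  · exact b.contDiff.contDiffAt.smul
      ((hw.contDiffAt (hU.mem_nhds (hb hp))).of_le (by exact_mod_cast le_top))
  · refine (contDiffAt_const (c := (0 : X))).congr_of_eventuallyEq ?_
    filter_upwards [Metric.isClosed_closedBall.isOpen_compl.mem_nhds hp] with q hq
    rw [b.zero_of_le_dist, zero_smul]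
    rw [mem_compl_iff, Metric.mem_closedBall, not_le] at hq
    exact hq.le

theorem formCurvature_congr {𝔸 : Type*} [NormedRing 𝔸] [NormedAlgebra ℝ 𝔸] {Ω Ω' : V → V →L[ℝ] 𝔸}
    {p : V} (hΩ : Ω =ᶠ[𝓝 p] Ω') : formCurvature Ω p = formCurvature Ω' p := by
  ext v u
  rw [formCurvature, formCurvature, hΩ.fderiv_eq, hΩ.self_of_nhds]

theorem add_smul_sub_mem_ball {o a z : V} {r : ℝ} (ha : a ∈ Metric.ball o r)
    (hz : z ∈ Metric.ball o r) {t : ℝ} (ht : t ∈ Icc (0 : ℝ) 1) :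
    a + t • (z - a) ∈ Metric.ball o r :=
  (convex_ball o r).add_smul_sub_mem ha hz ht

end Generic

namespace SpacelikeImmersion

variable {E : Type*} [NormedAddCommGroup E] [NormedSpace ℝ E] [FiniteDimensional ℝ E]
  {M : Type*} [TopologicalSpace M] [ChartedSpace E M] [IsManifold 𝓘(ℝ, E) ∞ M]
  {F : Type*} [NormedAddCommGroup F] [NormedSpace ℝ F] [FiniteDimensional ℝ F]
  {N : Type*} [TopologicalSpace N] [ChartedSpace F N] [IsManifold 𝓘(ℝ, F) ∞ N]
  {g : PseudoRiemannianMetric F N} {f : SpacelikeImmersion E M g}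
  {cov : CovariantDerivative 𝓘(ℝ, F) F (TangentSpace 𝓘(ℝ, F) : N → Type _)} {κ : ℝ}

/-- The vector of `T_{f z} N` with given coordinates in the chart at `f y`. -/
noncomputable def vecFrame (f : SpacelikeImmersion E M g) (y z : M) : F →L[ℝ] F :=
  chartFrame (F := F) (f.toFun y) (f.toFun z)

theorem vecCoord_vecFrame {y z : M} (hz : z ∈ f.chartDomain y) (w : F) :
    f.vecCoord y z (f.vecFrame y z w) = w :=
  chartCoord_chartFrame hz.2 w

theorem vecFrame_vecCoord {y z : M} (hz : z ∈ f.chartDomain y) (w : F) :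
    f.vecFrame y z (f.vecCoord y z w) = w :=
  chartFrame_chartCoord hz.2 w

theorem mem_normalF_iff (h : f.HasCoordImmersions cov κ) {y z : M} (hz : z ∈ f.chartDomain y) {w : F} :
    w ∈ f.normalF z ↔ f.coordNormal y (extChartAt 𝓘(ℝ, E) y z) (f.vecCoord y z w) =
      f.vecCoord y z w :=
  mem_normalSpace_iff_coord (h y) hz

theorem ParallelAt.of_chart (h : f.HasCoordImmersions cov κ) {γ : ℝ → M} {X : ℝ → F} {t : ℝ}
    (hX : ∀ t, X t ∈ f.normalF (γ t)) (hγ : ContMDiffAt 𝓘(ℝ, ℝ) 𝓘(ℝ, E) ∞ γ t) {y : M}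
    (hy : γ t ∈ f.chartDomain y) {c' : E}
    (hc : HasDerivAt (fun t ↦ extChartAt 𝓘(ℝ, E) y (γ t)) c' t)
    (hd : HasDerivAt (fun t ↦ f.vecCoord y (γ t) (X t))
      (-f.coordOmega cov y (extChartAt 𝓘(ℝ, E) y (γ t)) c' (f.vecCoord y (γ t) (X t))) t) :
    f.ParallelAt cov γ X t := by
  intro z hz
  obtain ⟨d', hd'⟩ := hasDerivAt_chart_of_contMDiffAt hz.1 hγ
  exact ⟨d', hd', (parallel_iff_coord (h z) hz hγ.continuousAt hd' (fun t ↦ ⟨X t, hX t⟩)).1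
    ((parallel_iff_coord (h y) hy hγ.continuousAt hc (fun t ↦ ⟨X t, hX t⟩)).2 hd)⟩

/-- A ball in a chart of `M`, on which normal vectors will be displaced along the segments of the
chart. -/
structure GaugeBall (f : SpacelikeImmersion E M g) where
  /-- The point at which the chart is taken. -/
  center : M
  /-- The radius. -/
  radius : ℝ
  pos : 0 < radius
  -- The double radius leaves room for a cut-off function equal to `1` on the ball itself.
  subset : Metric.closedBall (extChartAt 𝓘(ℝ, E) center center) (2 * radius) ⊆ f.coordDomain center

namespace GaugeBall

variable (B : f.GaugeBall)

/-- The coordinates of a point. -/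
noncomputable def coord (z : M) : E := extChartAt 𝓘(ℝ, E) B.center z

/-- The ball in coordinates. -/
def ball : Set E := Metric.ball (B.coord B.center) B.radius

/-- The ball in the manifold. -/
def dom : Set M := {z | z ∈ (chartAt E B.center).source ∧ B.coord z ∈ B.ball}

/-- The point with given coordinates. -/
noncomputable def point (p : E) : M := (extChartAt 𝓘(ℝ, E) B.center).symm p

theorem ball_subset : B.ball ⊆ f.coordDomain B.center :=
  Metric.ball_subset_closedBall.trans
    ((Metric.closedBall_subset_closedBall (by linarith [B.pos])).trans B.subset)

theorem center_mem_dom : B.center ∈ B.dom :=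
  ⟨mem_chart_source E B.center, Metric.mem_ball_self B.pos⟩

theorem point_coord {z : M} (hz : z ∈ B.dom) : B.point (B.coord z) = z :=
  (extChartAt 𝓘(ℝ, E) B.center).left_inv (by simpa using hz.1)

theorem coord_point {p : E} (hp : p ∈ B.ball) : B.coord (B.point p) = p :=
  (extChartAt 𝓘(ℝ, E) B.center).right_inv (B.ball_subset hp).1

theorem point_mem_dom {p : E} (hp : p ∈ B.ball) : B.point p ∈ B.dom :=
  ⟨(f.symm_mem_chartDomain (B.ball_subset hp)).1, by rwa [B.coord_point hp]⟩

theorem dom_subset : B.dom ⊆ f.chartDomain B.center := fun z hz ↦ by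
  have h1 := f.symm_mem_chartDomain (B.ball_subset hz.2)
  rwa [show (extChartAt 𝓘(ℝ, E) B.center).symm (B.coord z) = z from B.point_coord hz] at h1

theorem continuousOn_coord : ContinuousOn B.coord (chartAt E B.center).source := by
  have := continuousOn_extChartAt (I := 𝓘(ℝ, E)) B.center
  rwa [extChartAt_source] at this

theorem isOpen_dom : IsOpen B.dom :=
  B.continuousOn_coord.isOpen_inter_preimage (chartAt E B.center).open_source Metric.isOpen_ball

theorem continuousAt_coord {z : M} (hz : z ∈ B.dom) : ContinuousAt B.coord z :=
  B.continuousOn_coord.continuousAt ((chartAt E B.center).open_source.mem_nhds hz.1)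

theorem contMDiffOn_point : ContMDiffOn 𝓘(ℝ, E) 𝓘(ℝ, E) ∞ B.point B.ball :=
  (contMDiffOn_extChartAt_symm (I := 𝓘(ℝ, E)) (n := ∞) B.center).mono fun _ hp ↦
    (B.ball_subset hp).1

theorem line_mem {p p' : E} (hp : p ∈ B.ball) (hp' : p' ∈ B.ball) {t : ℝ} (ht : t ∈ Icc (0 : ℝ) 1) :
    p + t • (p' - p) ∈ B.ball :=
  add_smul_sub_mem_ball hp hp' ht

theorem exists_center_dom_subset {z : M} {O : Set M} (hO : IsOpen O) (hz : z ∈ O) :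
    ∃ B : f.GaugeBall, B.center = z ∧ B.dom ⊆ O := by
  have h1 : f.coordDomain z ∩ (extChartAt 𝓘(ℝ, E) z).symm ⁻¹' O ∈ 𝓝 (extChartAt 𝓘(ℝ, E) z z) := by
    refine Filter.inter_mem ((f.isOpen_coordDomain z).mem_nhds
      (f.chart_mem_coordDomain (f.mem_chartDomain_self z))) ?_
    refine (continuousAt_extChartAt_symm z).preimage_mem_nhds ?_
    rw [(extChartAt 𝓘(ℝ, E) z).left_inv (mem_extChartAt_source z)]
    exact hO.mem_nhds hz
  obtain ⟨ε, hε, hb⟩ := Metric.nhds_basis_closedBall.mem_iff.1 h1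
  refine ⟨⟨z, ε / 2, by linarith, fun p hp ↦ (hb (by rwa [mul_div_cancel₀ _ two_ne_zero] at hp)).1⟩, rfl, fun w hw ↦ ?_⟩
  have h2 := (hb (Metric.closedBall_subset_closedBall (by linarith)
    (Metric.ball_subset_closedBall hw.2))).2
  have h3 := GaugeBall.point_coord _ hw
  exact h3 ▸ h2

/-- A cut-off function. -/
noncomputable def bump : ContDiffBump (B.coord B.center) :=
  ⟨B.radius, 2 * B.radius, B.pos, by linarith [B.pos]⟩

/-- The form of the normal connection in coordinates, cut off outside the ball. -/
noncomputable def form (cov : CovariantDerivative 𝓘(ℝ, F) F (TangentSpace 𝓘(ℝ, F) : N → Type _))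
    (p : E) : E →L[ℝ] F →L[ℝ] F :=
  B.bump p • f.coordOmega cov B.center p

set_option synthInstance.maxHeartbeats 200000 in
theorem contDiff_form (h : f.HasCoordImmersions cov κ) : ContDiff ℝ 1 (B.form cov) :=
  B.bump.contDiff_smul (f.isOpen_coordDomain B.center) (h B.center).contDiffOn_form B.subset

theorem form_eventuallyEq {p : E} (hp : p ∈ B.ball) :
    B.form cov =ᶠ[𝓝 p] f.coordOmega cov B.center := by
  filter_upwards [Metric.isOpen_ball.mem_nhds hp] with q hq
  rw [form, B.bump.one_of_mem_closedBall (Metric.ball_subset_closedBall hq), one_smul]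

theorem form_eq {p : E} (hp : p ∈ B.ball) : B.form cov p = f.coordOmega cov B.center p :=
  (B.form_eventuallyEq hp).self_of_nhds

theorem formCurvature_form {p : E} (hp : p ∈ B.ball) :
    formCurvature (B.form cov) p = formCurvature (f.coordOmega cov B.center) p :=
  formCurvature_congr (B.form_eventuallyEq hp)

/-- The parallel displacement along the segment from `p` to `p'`, in coordinates. -/
noncomputable def gauge (h : f.HasCoordImmersions cov κ) (p p' : E) : F →L[ℝ] F :=
  radialTransport (B.contDiff_form h) p p'

theorem isUnit_gauge (h : f.HasCoordImmersions cov κ) (p p' : E) : IsUnit (B.gauge h p p') :=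
  isUnit_radialTransport _ p p'

theorem inverse_gauge_gauge (h : f.HasCoordImmersions cov κ) (p p' : E) (w : F) :
    Ring.inverse (B.gauge h p p') (B.gauge h p p' w) = w := by
  rw [← mul_apply_eq_comp, Ring.inverse_mul_cancel _ (B.isUnit_gauge h p p'), one_apply_eq_self]

theorem gauge_inverse_gauge (h : f.HasCoordImmersions cov κ) (p p' : E) (w : F) :
    B.gauge h p p' (Ring.inverse (B.gauge h p p') w) = w := by
  rw [← mul_apply_eq_comp, Ring.mul_inverse_cancel _ (B.isUnit_gauge h p p'), one_apply_eq_self]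

-- The connection form acts on the whole pulled back tangent bundle. Its transport respects normal
-- vectors because the normal projection is parallel.
set_option synthInstance.maxHeartbeats 200000 in
theorem normal_mul_gauge (h : f.HasCoordImmersions cov κ) {p p' : E} (hp : p ∈ B.ball)
    (hp' : p' ∈ B.ball) : f.coordNormal B.center p' * B.gauge h p p' =
      B.gauge h p p' * f.coordNormal B.center p := by
  refine mul_radialTransport_eq (B.contDiff_form h) (Q := f.coordNormal B.center) p p' fun t ht ↦ ?_
  have hq := B.line_mem hp hp' ht
  rw [B.form_eq hq]
  have h1 : HasFDerivAt (f.coordNormal B.center) (fderiv ℝ (f.coordNormal B.center) _) _ :=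
    (h B.center).hasFDerivAt_normalProj (B.ball_subset hq)
  refine (h1.comp_hasDerivAt t (hasDerivAt_line p p' t)).congr_deriv ?_
  exact (h B.center).fderiv_normalProj (B.ball_subset hq) _

theorem normal_mul_inverse_gauge (h : f.HasCoordImmersions cov κ) {p p' : E} (hp : p ∈ B.ball)
    (hp' : p' ∈ B.ball) : f.coordNormal B.center p * Ring.inverse (B.gauge h p p') =
      Ring.inverse (B.gauge h p p') * f.coordNormal B.center p' := by
  have h0 := B.isUnit_gauge h p p'
  rw [← Ring.inverse_mul_cancel_left _ (f.coordNormal B.center p * _) h0,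
    ← mul_assoc (B.gauge h _ _), ← B.normal_mul_gauge h hp hp', mul_assoc,
    Ring.mul_inverse_cancel _ h0, mul_one]

theorem mem_normalF_iff (h : f.HasCoordImmersions cov κ) {z : M} (hz : z ∈ B.dom) {w : F} :
    w ∈ f.normalF z ↔ f.coordNormal B.center (B.coord z) (f.vecCoord B.center z w) =
      f.vecCoord B.center z w :=
  f.mem_normalF_iff h (B.dom_subset hz)

theorem vecFrame_gauge_mem (h : f.HasCoordImmersions cov κ) {z z' : M} (hz : z ∈ B.dom)
    (hz' : z' ∈ B.dom) {w : F} (hw : w ∈ f.normalF z) :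
    f.vecFrame B.center z' (B.gauge h (B.coord z) (B.coord z') (f.vecCoord B.center z w)) ∈
      f.normalF z' := by
  rw [B.mem_normalF_iff h hz', vecCoord_vecFrame (B.dom_subset hz')]
  have h1 := congrArg (fun T : F →L[ℝ] F ↦ T (f.vecCoord B.center z w))
    (B.normal_mul_gauge h hz.2 hz'.2)
  simp only [mul_apply_eq_comp] at h1
  rw [h1, (B.mem_normalF_iff h hz).1 hw]

theorem vecFrame_inverse_gauge_mem (h : f.HasCoordImmersions cov κ) {z z' : M} (hz : z ∈ B.dom)
    (hz' : z' ∈ B.dom) {w : F} (hw : w ∈ f.normalF z') :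
    f.vecFrame B.center z (Ring.inverse (B.gauge h (B.coord z) (B.coord z'))
      (f.vecCoord B.center z' w)) ∈ f.normalF z := by
  rw [B.mem_normalF_iff h hz, vecCoord_vecFrame (B.dom_subset hz)]
  have h2 := congrArg (fun T : F →L[ℝ] F ↦ T (f.vecCoord B.center z' w))
    (B.normal_mul_inverse_gauge h hz.2 hz'.2)
  simp only [mul_apply_eq_comp] at h2
  rw [h2, (B.mem_normalF_iff h hz').1 hw]

/-- The parallel displacement along a segment of the chart. -/
noncomputable def transport (h : f.HasCoordImmersions cov κ) {z z' : M} (hz : z ∈ B.dom)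
    (hz' : z' ∈ B.dom) : f.normalF z ≃ₗ[ℝ] f.normalF z' where
  toFun w := ⟨_, B.vecFrame_gauge_mem h hz hz' w.2⟩
  map_add' v w := Subtype.ext (by simp)
  map_smul' a w := Subtype.ext (by simp)
  invFun w := ⟨_, B.vecFrame_inverse_gauge_mem h hz hz' w.2⟩
  left_inv w := Subtype.ext (by
    simp only [vecCoord_vecFrame (B.dom_subset hz'), B.inverse_gauge_gauge,
      vecFrame_vecCoord (B.dom_subset hz)])
  right_inv w := Subtype.ext (by
    simp only [vecCoord_vecFrame (B.dom_subset hz), B.gauge_inverse_gauge,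
      vecFrame_vecCoord (B.dom_subset hz')])

theorem vecCoord_transport (h : f.HasCoordImmersions cov κ) {z z' : M} (hz : z ∈ B.dom)
    (hz' : z' ∈ B.dom) (w : f.normalF z) :
    f.vecCoord B.center z' (B.transport h hz hz' w) =
      B.gauge h (B.coord z) (B.coord z') (f.vecCoord B.center z w) :=
  vecCoord_vecFrame (B.dom_subset hz') _

theorem vecCoord_transport_symm (h : f.HasCoordImmersions cov κ) {z z' : M} (hz : z ∈ B.dom)
    (hz' : z' ∈ B.dom) (w : f.normalF z') :
    f.vecCoord B.center z ((B.transport h hz hz').symm w) =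
      Ring.inverse (B.gauge h (B.coord z) (B.coord z')) (f.vecCoord B.center z' w) :=
  vecCoord_vecFrame (B.dom_subset hz) _

/-- The segment of the chart. -/
noncomputable def segment {z z' : M} (hz : z ∈ B.dom) (hz' : z' ∈ B.dom) : Path z z' where
  toFun t := B.point (B.coord z + (t : ℝ) • (B.coord z' - B.coord z))
  continuous_toFun := by
    refine B.contMDiffOn_point.continuousOn.comp_continuous (by fun_prop) fun t ↦ ?_
    exact B.line_mem hz.2 hz'.2 t.2
  source' := by simp [B.point_coord hz]
  target' := by simp [B.point_coord hz']

theorem segment_extend {z z' : M} (hz : z ∈ B.dom) (hz' : z' ∈ B.dom) {t : ℝ}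
    (ht : t ∈ Icc (0 : ℝ) 1) : (B.segment hz hz').extend t =
      B.point (B.coord z + t • (B.coord z' - B.coord z)) := by
  rw [Path.extend_apply _ ht]; rfl

theorem segment_mem_dom {z z' : M} (hz : z ∈ B.dom) (hz' : z' ∈ B.dom) (t : unitInterval) :
    B.segment hz hz' t ∈ B.dom :=
  B.point_mem_dom (B.line_mem hz.2 hz'.2 t.2)

theorem segment_extend_mem_dom {z z' : M} (hz : z ∈ B.dom) (hz' : z' ∈ B.dom) (t : ℝ) :
    (B.segment hz hz').extend t ∈ B.dom :=
  B.segment_mem_dom hz hz' _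

theorem contMDiffOn_segment {z z' : M} (hz : z ∈ B.dom) (hz' : z' ∈ B.dom) :
    ContMDiffOn 𝓘(ℝ, ℝ) 𝓘(ℝ, E) ∞ (B.segment hz hz').extend (Icc 0 1) := by
  have h1 : ContMDiffOn 𝓘(ℝ, ℝ) 𝓘(ℝ, E) ∞
      (fun t : ℝ ↦ B.coord z + t • (B.coord z' - B.coord z)) (Icc 0 1) := by
    have : ContDiff ℝ ∞ (fun t : ℝ ↦ B.coord z + t • (B.coord z' - B.coord z)) := by fun_prop
    exact this.contMDiff.contMDiffOn
  exact (B.contMDiffOn_point.comp h1 fun t ht ↦ B.line_mem hz.2 hz'.2 ht).congr fun t ht ↦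
    B.segment_extend hz hz' ht

set_option synthInstance.maxHeartbeats 200000 in
theorem isDisplacement_segment (h : f.HasCoordImmersions cov κ) {z z' : M} (hz : z ∈ B.dom)
    (hz' : z' ∈ B.dom) : f.IsDisplacement cov (B.segment hz hz') (B.transport h hz hz') := by
  refine (isDisplacement_iff h).2 ⟨.of_contMDiffOn (B.contMDiffOn_segment hz hz'), fun u ↦ ?_⟩
  set γ := (B.segment hz hz').extend with hγ
  have hmem : ∀ t, γ t ∈ B.dom := B.segment_extend_mem_dom hz hz'
  let X : ℝ → F := fun t ↦ f.vecFrame B.center (γ t)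
    (B.gauge h (B.coord z) (B.coord (γ t)) (f.vecCoord B.center z u))
  have hX : ∀ t, X t ∈ f.normalF (γ t) := fun t ↦ B.vecFrame_gauge_mem h hz (hmem t) u.2
  have hcoord : ∀ t, f.vecCoord B.center (γ t) (X t) =
      B.gauge h (B.coord z) (B.coord (γ t)) (f.vecCoord B.center z u) := fun t ↦
    vecCoord_vecFrame (B.dom_subset (hmem t)) _
  have hline : ∀ t ∈ Icc (0 : ℝ) 1, B.coord (γ t) = B.coord z + t • (B.coord z' - B.coord z) := by
    intro t ht
    rw [hγ, B.segment_extend hz hz' ht, B.coord_point (B.line_mem hz.2 hz'.2 ht)]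
  have hcγ : Continuous γ := (B.segment hz hz').continuous_extend
  refine ⟨X, ⟨hX, fun t _ ↦ ?_, ∅, finite_empty, fun t ht ↦ ?_⟩, ?_, ?_⟩
  · refine continuousWithinAt_of_vecCoord (B.dom_subset (hmem t)) hcγ.continuousWithinAt ?_
    simp only [hcoord]
    have h1 : ContinuousAt (fun t ↦ B.coord (γ t)) t :=
      ContinuousAt.comp (f := γ) (B.continuousAt_coord (hmem t)) hcγ.continuousAt
    have h2 : Continuous (B.gauge h (B.coord z)) :=
      (differentiable_radialTransport (B.contDiff_form h) _).continuous
    have h3 : ContinuousAt (fun t ↦ B.gauge h (B.coord z) (B.coord (γ t))) t :=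
      ContinuousAt.comp (f := fun t ↦ B.coord (γ t)) h2.continuousAt h1
    exact (h3.clm_apply continuousAt_const).continuousWithinAt
  · have hti := Ioo_subset_Icc_self ht.1
    have hnear : ∀ᶠ s in 𝓝 t, B.coord (γ s) = B.coord z + s • (B.coord z' - B.coord z) := by
      filter_upwards [Ioo_mem_nhds ht.1.1 ht.1.2] with s hs using hline s (Ioo_subset_Icc_self hs)
    refine ParallelAt.of_chart h hX ((B.contMDiffOn_segment hz hz').contMDiffAt
      (Icc_mem_nhds ht.1.1 ht.1.2)) (B.dom_subset (hmem t)) (c' := B.coord z' - B.coord z)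
      ((hasDerivAt_line _ _ t).congr_of_eventuallyEq hnear) ?_
    have h1 := (hasDerivAt_radialTransport (B.contDiff_form h) (B.coord z) (B.coord z') ht.1).clm_apply
      (hasDerivAt_const t (f.vecCoord B.center z u))
    have h2 : (fun t ↦ f.vecCoord B.center (γ t) (X t)) =ᶠ[𝓝 t] fun t ↦
        radialTransport (B.contDiff_form h) (B.coord z)
          (B.coord z + t • (B.coord z' - B.coord z)) (f.vecCoord B.center z u) := by
      filter_upwards [hnear] with s hs
      rw [hcoord, hs]; rfl
    refine (h1.congr_of_eventuallyEq h2).congr_deriv ?_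
    rw [hcoord, B.form_eq (B.line_mem hz.2 hz'.2 hti)]
    change _ = -f.coordOmega cov B.center (B.coord (γ t)) _ _
    rw [hline t hti]
    simp [gauge]
  · have e : γ 0 = z := (B.segment hz hz').extend_zero
    have h1 : B.gauge h (B.coord z) (B.coord z) = 1 := radialTransport_self _ _
    simp only [X]
    rw [e, h1, one_apply_eq_self, vecFrame_vecCoord (B.dom_subset hz)]
  · have e : γ 1 = z' := (B.segment hz hz').extend_one
    simp only [X]
    rw [e]; rfl

/-- Loops in the ball are null-homotopic. -/
theorem homotopic_refl {z : M} (γ : Path z z) (hγ : ∀ t, γ t ∈ B.dom) :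
    γ.Homotopic (Path.refl z) := by
  have hz : z ∈ B.dom := γ.source ▸ hγ 0
  -- Each point `γ t` is moved along a straight segment to the base point; convexity of the ball
  -- keeps the segments inside.
  refine ⟨⟨⟨⟨fun q ↦ B.point (B.coord (γ q.2) + (q.1 : ℝ) • (B.coord z - B.coord (γ q.2))), ?_⟩,
    fun t ↦ ?_, fun t ↦ ?_⟩, fun s t ht ↦ ?_⟩⟩
  · refine B.contMDiffOn_point.continuousOn.comp_continuous ?_ fun q ↦
      B.line_mem (hγ _).2 hz.2 q.1.2
    have h1 : Continuous fun t ↦ B.coord (γ t) :=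
      B.continuousOn_coord.comp_continuous γ.continuous fun t ↦ (hγ t).1
    have h2 : Continuous fun q : unitInterval × unitInterval ↦ B.coord (γ q.2) :=
      h1.comp continuous_snd
    fun_prop
  · simp [B.point_coord (hγ t)]
  · simp [B.point_coord hz]
  · rcases ht with rfl | ht
    · simp [B.point_coord hz]
    · rw [mem_singleton_iff.1 ht]
      simp [B.point_coord hz]

end GaugeBall

end SpacelikeImmersion

/-! ### Curvature and parallel fields in a radial gauge -/

section Generic

theorem hasDerivAt_clm_of_basis {V W : Type*} [NormedAddCommGroup V] [NormedSpace ℝ V]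
    [FiniteDimensional ℝ V] [NormedAddCommGroup W] [NormedSpace ℝ W] {u : ℝ → V →L[ℝ] W}
    {A : V →L[ℝ] W} {t : ℝ} {ι : Type*} [Fintype ι] (b : Module.Basis ι ℝ V)
    (h : ∀ i, HasDerivAt (fun t ↦ u t (b i)) (A (b i)) t) : HasDerivAt u A t := by
  let c : ι → V →L[ℝ] ℝ := fun i ↦ LinearMap.toContinuousLinearMap (b.coord i)
  have key : ∀ T : V →L[ℝ] W, T = ∑ i, ContinuousLinearMap.smulRightL ℝ V W (c i) (T (b i)) := by
    intro T
    ext v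
    conv_lhs => rw [← b.sum_repr v]
    rw [map_sum, sum_apply]
    simp [c]
  have h1 := HasDerivAt.fun_sum (u := Finset.univ) fun i _ ↦
    (ContinuousLinearMap.smulRightL ℝ V W (c i)).hasFDerivAt.comp_hasDerivAt t (h i)
  simp only [Function.comp_apply, ← key] at h1
  exact h1

section Algebra

variable {E 𝔸 : Type*} [NormedAddCommGroup E] [NormedSpace ℝ E] [FiniteDimensional ℝ E]
  [NormedRing 𝔸] [NormedAlgebra ℝ 𝔸] [FiniteDimensional ℝ 𝔸] {Ω : E → E →L[ℝ] 𝔸} (hΩ : ContDiff ℝ 1 Ω)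
  (a : E)

-- Combining the derivative of inversion with that of the transport, the connection form ends up on
-- the right, where it cancels against the derivative of a parallel field, and the gauge form on the
-- left.
set_option synthInstance.maxHeartbeats 200000 in
theorem hasDerivAt_inverse_radialTransport {c : ℝ → E} {c' : E} {t : ℝ} (hc : HasDerivAt c c' t) :
    HasDerivAt (fun t ↦ Ring.inverse (radialTransport hΩ a (c t)))
      (Ring.inverse (radialTransport hΩ a (c t)) * Ω (c t) c' -
        gaugeForm hΩ a (c t) c' * Ring.inverse (radialTransport hΩ a (c t))) t := by
  have := FiniteDimensional.complete ℝ 𝔸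
  obtain ⟨w, hw⟩ := isUnit_radialTransport hΩ a (c t)
  have h1 : HasDerivAt (fun t ↦ radialTransport hΩ a (c t)) _ t :=
    (differentiable_radialTransport hΩ a (c t)).hasFDerivAt.comp_hasDerivAt t hc
  rw [fderiv_radialTransport] at h1
  have h2 := hasFDerivAt_ringInverse (𝕜 := ℝ) w
  rw [hw] at h2
  have h3 : HasDerivAt (fun t ↦ Ring.inverse (radialTransport hΩ a (c t))) _ t :=
    HasFDerivAt.comp_hasDerivAt (l := Ring.inverse) t h2 h1
  refine h3.congr_deriv ?_
  rw [← hw, Ring.inverse_unit]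
  simp only [add_comm, neg_apply, ContinuousLinearMap.mulLeftRight_apply, mul_add,
    Units.inv_mul_cancel_left, mul_neg, add_mul, neg_mul, mul_assoc, Units.mul_inv, mul_one,
    neg_add_rev, neg_neg, sub_eq_add_neg]

/-- The gauge form is an integral, so a linear condition on it needs to be checked only on the
displaced curvatures. -/
theorem map_gaugeForm_mem {W : Type*} [NormedAddCommGroup W] [NormedSpace ℝ W]
    [FiniteDimensional ℝ W] (L : 𝔸 →L[ℝ] W) (S : Submodule ℝ W) (p u : E)
    (hL : ∀ t ∈ Icc (0 : ℝ) 1, L (Ring.inverse (radialTransport hΩ a (a + t • (p - a))) *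
      formCurvature Ω (a + t • (p - a)) (p - a) u * radialTransport hΩ a (a + t • (p - a))) ∈ S) :
    L (gaugeForm hΩ a p u) ∈ S := by
  have := FiniteDimensional.complete ℝ W
  have := FiniteDimensional.complete ℝ 𝔸
  have hcont : Continuous fun t : ℝ ↦ t • (Ring.inverse (radialTransport hΩ a (a + t • (p - a))) *
      formCurvature Ω (a + t • (p - a)) (p - a) u * radialTransport hΩ a (a + t • (p - a))) :=
    (continuous_gaugeForm_integrand hΩ a).comp
      (f := fun t : ℝ ↦ (a + t • (p - a), p - a, u, t)) (by fun_prop)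
  rw [gaugeForm, ← L.intervalIntegral_comp_comm (hcont.intervalIntegrable _ _)]
  refine Submodule.intervalIntegral_mem _ zero_le_one (L.continuous.comp hcont).continuousOn
    fun t ht ↦ ?_
  rw [map_smul]
  exact S.smul_mem _ (hL t ht)

end Algebra

variable {E F : Type*} [NormedAddCommGroup E] [NormedSpace ℝ E] [FiniteDimensional ℝ E]
  [NormedAddCommGroup F] [NormedSpace ℝ F] [FiniteDimensional ℝ F] {Ω : E → E →L[ℝ] F →L[ℝ] F}

/-- In a radial gauge the connection form is `gaugeForm`. -/
theorem hasDerivAt_inverse_radialTransport_apply (hΩ : ContDiff ℝ 1 Ω) (a : E) {c : ℝ → E}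
    {m : ℝ → F} {c' : E} {t : ℝ} (hc : HasDerivAt c c' t) (hm : HasDerivAt m (-Ω (c t) c' (m t)) t) :
    HasDerivAt (fun t ↦ Ring.inverse (radialTransport hΩ a (c t)) (m t))
      (-gaugeForm hΩ a (c t) c' (Ring.inverse (radialTransport hΩ a (c t)) (m t))) t := by
  refine ((hasDerivAt_inverse_radialTransport hΩ a hc).clm_apply hm).congr_deriv ?_
  simp only [sub_apply, mul_apply_eq_comp, map_neg]
  abel

end Generic

namespace SpacelikeImmersion

variable {E : Type*} [NormedAddCommGroup E] [NormedSpace ℝ E] [FiniteDimensional ℝ E]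
  {M : Type*} [TopologicalSpace M] [ChartedSpace E M] [IsManifold 𝓘(ℝ, E) ∞ M]
  {F : Type*} [NormedAddCommGroup F] [NormedSpace ℝ F] [FiniteDimensional ℝ F]
  {N : Type*} [TopologicalSpace N] [ChartedSpace F N] [IsManifold 𝓘(ℝ, F) ∞ N]
  {g : PseudoRiemannianMetric F N} {f : SpacelikeImmersion E M g}
  {cov : CovariantDerivative 𝓘(ℝ, F) F (TangentSpace 𝓘(ℝ, F) : N → Type _)} {κ : ℝ}

/-- The normal curvature, on vectors given by their representatives in the model spaces. -/
noncomputable def curvF (f : SpacelikeImmersion E M g)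
    (cov : CovariantDerivative 𝓘(ℝ, F) F (TangentSpace 𝓘(ℝ, F) : N → Type _)) (z : M) (u v : E)
    (ξ : f.normalF z) : f.normalF z :=
  f.normalCurvatureAt cov (x := z) u v ξ

/-- The span of the normal curvature operators, displaced to `x`. -/
noncomputable def curvatureAlgebra (f : SpacelikeImmersion E M g)
    (cov : CovariantDerivative 𝓘(ℝ, F) F (TangentSpace 𝓘(ℝ, F) : N → Type _)) (x : M) :
    Submodule ℝ (f.normalF x →L[ℝ] f.normalF x) :=
  Submodule.span ℝ {X | ∃ (y : M) (γ : Path x y) (τ : f.normalF x ≃ₗ[ℝ] f.normalF y) (u v : E),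
    f.IsDisplacement cov γ τ ∧ ∀ ξ, X ξ = τ.symm (f.curvF cov y u v (τ ξ))}

namespace GaugeBall

variable (B : f.GaugeBall) {x : M}

/-- Coordinates on `N_x M` induced by an isomorphism to the normal space at the centre. -/
noncomputable def inj (A : f.normalF x ≃ₗ[ℝ] f.normalF B.center) : f.normalF x →L[ℝ] F :=
  LinearMap.toContinuousLinearMap
    ((f.vecCoord B.center B.center : F →ₗ[ℝ] F) ∘ₗ (f.normalF B.center).subtype ∘ₗ (A : _ →ₗ[ℝ] _))

/-- The normal projection at a point of `M`. -/
noncomputable def _root_.SpacelikeImmersion.projF (f : SpacelikeImmersion E M g) (z : M) :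
    F →ₗ[ℝ] f.normalF z := f.normalProj z

/-- A left inverse of `B.inj A`. -/
noncomputable def proj (A : f.normalF x ≃ₗ[ℝ] f.normalF B.center) : F →L[ℝ] f.normalF x :=
  LinearMap.toContinuousLinearMap
    ((A.symm : _ →ₗ[ℝ] _) ∘ₗ f.projF B.center ∘ₗ (f.vecFrame B.center B.center : F →ₗ[ℝ] F))

variable (A : f.normalF x ≃ₗ[ℝ] f.normalF B.center)

theorem inj_apply (v : f.normalF x) : B.inj A v = f.vecCoord B.center B.center (A v) := rfl

theorem proj_apply (w : F) : B.proj A w =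
    A.symm (f.projF B.center (f.vecFrame B.center B.center w)) := rfl

theorem inj_proj (h : f.HasCoordImmersions cov κ) (w : F) :
    B.inj A (B.proj A w) = f.coordNormal B.center (B.coord B.center) w := by
  rw [inj_apply, proj_apply, A.apply_symm_apply]
  have h1 := chartCoord_normalProj (h B.center) (B.dom_subset B.center_mem_dom)
    (f.vecFrame B.center B.center w)
  refine h1.trans ?_
  exact congrArg _ (vecCoord_vecFrame (B.dom_subset B.center_mem_dom) w)

theorem normal_inj (v : f.normalF x) :
    f.coordNormal B.center (B.coord B.center) (B.inj A v) = B.inj A v :=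
  coordNormal_of_mem (B.dom_subset B.center_mem_dom) (A v).2

theorem inj_injective : Function.Injective (B.inj A) := by
  intro v w hvw
  have h1 := congrArg (f.vecFrame B.center B.center) hvw
  simp only [inj_apply, vecFrame_vecCoord (B.dom_subset B.center_mem_dom)] at h1
  exact A.injective (Subtype.ext h1)

theorem proj_inj (h : f.HasCoordImmersions cov κ) (v : f.normalF x) : B.proj A (B.inj A v) = v :=
  B.inj_injective A (by rw [B.inj_proj A h, B.normal_inj])

theorem proj_normal (h : f.HasCoordImmersions cov κ) (w : F) :
    B.proj A (f.coordNormal B.center (B.coord B.center) w) = B.proj A w := by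
  rw [← B.inj_proj A h, B.proj_inj A h]

theorem gauge_inj (h : f.HasCoordImmersions cov κ) {z : M} (hz : z ∈ B.dom) (v : f.normalF x) :
    B.gauge h (B.coord B.center) (B.coord z) (B.inj A v) =
      f.vecCoord B.center z (B.transport h B.center_mem_dom hz (A v)) :=
  (B.vecCoord_transport h B.center_mem_dom hz (A v)).symm

theorem proj_inverse_gauge (h : f.HasCoordImmersions cov κ) {z : M} (hz : z ∈ B.dom)
    (ξ : f.normalF z) : B.proj A (Ring.inverse (B.gauge h (B.coord B.center) (B.coord z))
      (f.vecCoord B.center z ξ)) = A.symm ((B.transport h B.center_mem_dom hz).symm ξ) := by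
  rw [← B.vecCoord_transport_symm h B.center_mem_dom hz]
  have h1 := B.inj_apply A (A.symm ((B.transport h B.center_mem_dom hz).symm ξ))
  rw [A.apply_symm_apply] at h1
  rw [← h1, B.proj_inj A h]

/-- `T ↦ B.proj A ∘ T ∘ B.inj A`. -/
noncomputable def compress : (F →L[ℝ] F) →L[ℝ] (f.normalF x →L[ℝ] f.normalF x) :=
  (ContinuousLinearMap.compL ℝ (f.normalF x) F (f.normalF x) (B.proj A)).comp
    ((ContinuousLinearMap.compL ℝ (f.normalF x) F F).flip (B.inj A))

theorem compress_apply (T : F →L[ℝ] F) (v : f.normalF x) :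
    B.compress A T v = B.proj A (T (B.inj A v)) := rfl

variable {A}

/-- The curvature of the connection form, displaced to the centre, is the normal curvature. -/
theorem compress_formCurvature (h : f.HasCoordImmersions cov κ) {z : M} (hz : z ∈ B.dom) (u v : E)
    (ξ : f.normalF x) :
    B.compress A (Ring.inverse (B.gauge h (B.coord B.center) (B.coord z)) *
      formCurvature (B.form cov) (B.coord z) u v * B.gauge h (B.coord B.center) (B.coord z)) ξ =
      (A.trans (B.transport h B.center_mem_dom hz)).symm (f.curvF cov z
        (chartFrame (F := E) B.center z u) (chartFrame (F := E) B.center z v)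
        ((A.trans (B.transport h B.center_mem_dom hz)) ξ)) := by
  have h1 := chartCoord_normalCurvatureAt h (B.dom_subset hz)
    (chartFrame (F := E) B.center z u) (chartFrame (F := E) B.center z v)
    (B.transport h B.center_mem_dom hz (A ξ))
  rw [chartCoord_chartFrame hz.1, chartCoord_chartFrame hz.1] at h1
  rw [LinearEquiv.trans_symm, LinearEquiv.trans_apply, LinearEquiv.trans_apply,
    ← B.proj_inverse_gauge A h hz, compress_apply, mul_apply_eq_comp, mul_apply_eq_comp,
    B.gauge_inj A h hz, B.formCurvature_form hz.2]
  have h2 := congrArg (fun w ↦ B.proj A (Ring.inverse (B.gauge h (B.coord B.center) (B.coord z)) w)) h1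
  refine Eq.trans ?_ h2.symm
  have h3 := B.normal_mul_inverse_gauge h B.center_mem_dom.2 hz.2
  have h4 : ∀ w : F, Ring.inverse (B.gauge h (B.coord B.center) (B.coord z))
      (f.coordNormal B.center (B.coord z) w) = f.coordNormal B.center (B.coord B.center)
        (Ring.inverse (B.gauge h (B.coord B.center) (B.coord z)) w) := fun w ↦
    (congrArg (fun T : F →L[ℝ] F ↦ T w) h3).symm
  refine Eq.trans ?_ (congrArg (B.proj A) (h4 _)).symm
  rw [B.proj_normal A h]
  rfl

/-- The integrand at time `t` involves the curvature at a point of the segment, brought to `x` along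
`β` followed by the initial piece of the segment. -/
theorem compress_gaugeForm_mem (h : f.HasCoordImmersions cov κ) {β : Path x B.center}
    (hA : f.IsDisplacement cov β A) {p : E} (hp : p ∈ B.ball) (u : E) :
    B.compress A (gaugeForm (B.contDiff_form h) (B.coord B.center) p u) ∈
      f.curvatureAlgebra cov x := by
  refine map_gaugeForm_mem (W := f.normalF x →L[ℝ] f.normalF x) (𝔸 := F →L[ℝ] F)
    (B.contDiff_form h) _ (B.compress A) _ _ _ fun t ht ↦ Submodule.subset_span ?_
  have hq := B.line_mem B.center_mem_dom.2 hp ht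
  have h1 := B.compress_formCurvature (A := A) h (B.point_mem_dom hq) (p - B.coord B.center) u
  rw [B.coord_point hq] at h1
  exact ⟨_, _, _, _, _, hA.trans h (B.isDisplacement_segment h B.center_mem_dom
    (B.point_mem_dom hq)), h1⟩

end GaugeBall

end SpacelikeImmersion

/-! ### The holonomy algebra contains the curvature -/

section Generic

variable {E 𝔸 : Type*} [NormedAddCommGroup E] [NormedSpace ℝ E] [FiniteDimensional ℝ E]
  [NormedRing 𝔸] [NormedAlgebra ℝ 𝔸] [FiniteDimensional ℝ 𝔸] {Ω : E → E →L[ℝ] 𝔸}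
  (hΩ : ContDiff ℝ 1 Ω)

theorem gaugeForm_self (a u : E) : gaugeForm hΩ a a u = 0 := by
  simp [gaugeForm, formCurvature]

/-- The displacement along a triangle, as a function of the last corner. -/
noncomputable def triangleTransport (a z u : E) (s : ℝ) : 𝔸 :=
  Ring.inverse (radialTransport hΩ a (z + s • u)) * radialTransport hΩ z (z + s • u) *
    radialTransport hΩ a z

theorem triangleTransport_zero (a z u : E) : triangleTransport hΩ a z u 0 = 1 := by
  have := FiniteDimensional.complete ℝ 𝔸
  rw [triangleTransport, zero_smul, add_zero, radialTransport_self, mul_one,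
    Ring.inverse_mul_cancel _ (isUnit_radialTransport hΩ a z)]

set_option synthInstance.maxHeartbeats 200000 in
theorem hasDerivAt_triangleTransport (a z u : E) (s : ℝ) :
    HasDerivAt (triangleTransport hΩ a z u)
      (Ring.inverse (radialTransport hΩ a (z + s • u)) * radialTransport hΩ z (z + s • u) *
        gaugeForm hΩ z (z + s • u) u * radialTransport hΩ a z -
        gaugeForm hΩ a (z + s • u) u * triangleTransport hΩ a z u s) s := by
  have hc : HasDerivAt (fun s : ℝ ↦ z + s • u) u s := by
    simpa using ((hasDerivAt_id s).smul_const u).const_add z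
  have h1 := hasDerivAt_inverse_radialTransport hΩ a hc
  have h2 : HasDerivAt (fun s : ℝ ↦ radialTransport hΩ z (z + s • u)) _ s :=
    (differentiable_radialTransport hΩ z _).hasFDerivAt.comp_hasDerivAt s hc
  rw [fderiv_radialTransport] at h2
  refine ((h1.mul h2).mul_const (radialTransport hΩ a z)).congr_deriv ?_
  rw [triangleTransport]
  noncomm_ring

/-- The gauge form with centre `z` vanishes at `z`, so the side from `z` contributes nothing to
first order; the gauge form with centre `a` is what remains. -/
theorem hasDerivAt_triangleTransport_zero (a z u : E) :
    HasDerivAt (triangleTransport hΩ a z u) (-gaugeForm hΩ a z u) 0 := by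
  refine (hasDerivAt_triangleTransport hΩ a z u 0).congr_deriv ?_
  rw [triangleTransport_zero, zero_smul, add_zero, gaugeForm_self]
  simp

theorem contDiff_triangleTransport (a z u : E) : ContDiff ℝ 1 (triangleTransport hΩ a z u) := by
  rw [contDiff_one_iff_deriv]
  refine ⟨fun s ↦ (hasDerivAt_triangleTransport hΩ a z u s).differentiableAt, ?_⟩
  rw [funext fun s ↦ (hasDerivAt_triangleTransport hΩ a z u s).deriv]
  have h1 : Continuous fun s : ℝ ↦ z + s • u := by fun_prop
  have h2 := (continuous_inverse_radialTransport hΩ a).comp h1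
  have h3 := (differentiable_radialTransport hΩ z).continuous.comp h1
  have h4 := (continuous_gaugeForm hΩ z u).comp h1
  have h5 := (continuous_gaugeForm hΩ a u).comp h1
  exact (((h2.mul h3).mul h4).mul continuous_const).sub
    (h5.mul ((h2.mul h3).mul continuous_const))

/-- The curvature is recovered from `gaugeForm`. -/
theorem map_formCurvature_mem {W : Type*} [NormedAddCommGroup W] [NormedSpace ℝ W]
    [FiniteDimensional ℝ W] (L : 𝔸 →L[ℝ] W) (S : Submodule ℝ W) (a v u : E)
    (hL : ∀ᶠ z in 𝓝 a, L (gaugeForm hΩ a z u) ∈ S) : L (formCurvature Ω a v u) ∈ S := by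
  have := FiniteDimensional.complete ℝ 𝔸
  obtain ⟨q, hq, -⟩ := S.exists_clm_projection
  -- This is `gaugeForm` at `a + ε v` divided by `ε`, in a form that makes sense and is continuous
  -- at `ε = 0`. Its value there is half the curvature, because `∫₀¹ t dt = 1/2`.
  let ψ : ℝ → 𝔸 := fun ε ↦ ∫ t in (0 : ℝ)..1, t • (Ring.inverse (radialTransport hΩ a
    (a + t • (ε • v))) * formCurvature Ω (a + t • (ε • v)) v u * radialTransport hΩ a
    (a + t • (ε • v)))
  have hψ : Continuous ψ := by
    refine intervalIntegral.continuous_parametric_intervalIntegral_of_continuous'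
      (f := fun ε t ↦ t • (Ring.inverse (radialTransport hΩ a (a + t • (ε • v))) *
        formCurvature Ω (a + t • (ε • v)) v u * radialTransport hΩ a (a + t • (ε • v)))) ?_ 0 1
    refine (continuous_gaugeForm_integrand hΩ a).comp
      (f := fun p : ℝ × ℝ ↦ (a + p.2 • (p.1 • v), v, u, p.2)) ?_
    fun_prop
  have hgauge : ∀ ε : ℝ, gaugeForm hΩ a (a + ε • v) u = ε • ψ ε := by
    intro ε
    rw [gaugeForm, ← intervalIntegral.integral_smul]
    refine intervalIntegral.integral_congr fun t _ ↦ ?_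
    have h1 : ∀ p, formCurvature Ω p (ε • v) u = ε • formCurvature Ω p v u := by
      intro p
      simp [formCurvature, smul_sub, smul_add]
    simp only [add_sub_cancel_left]
    rw [h1, mul_smul_comm, smul_mul_assoc, smul_comm]
  have h0 : ψ 0 = (1 / 2 : ℝ) • formCurvature Ω a v u := by
    simp only [ψ, zero_smul, smul_zero, add_zero, radialTransport_self, Ring.inverse_one, one_mul,
      mul_one]
    rw [intervalIntegral.integral_smul_const, integral_id]
    norm_num
  have h1 : ∀ᶠ ε : ℝ in 𝓝[≠] 0, q (L (ψ ε)) = 0 := by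
    have h2 : Filter.Tendsto (fun ε : ℝ ↦ a + ε • v) (𝓝[≠] 0) (𝓝 a) := by
      have : ContinuousAt (fun ε : ℝ ↦ a + ε • v) 0 := by fun_prop
      have h3 := this.tendsto.mono_left (nhdsWithin_le_nhds (s := {0}ᶜ))
      simpa using h3
    filter_upwards [h2.eventually hL, self_mem_nhdsWithin] with ε h3 hε
    rw [hgauge, ← hq, map_smul, map_smul] at h3
    exact (smul_eq_zero.1 h3).resolve_left hε
  have h2 : Filter.Tendsto (fun ε ↦ q (L (ψ ε))) (𝓝[≠] 0) (𝓝 (q (L (ψ 0)))) :=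
    ((q.continuous.comp (L.continuous.comp hψ)).tendsto 0).mono_left nhdsWithin_le_nhds
  have h3 : q (L (ψ 0)) = 0 := tendsto_nhds_unique h2
    (Filter.Tendsto.congr' (h1.mono fun _ h ↦ h.symm) tendsto_const_nhds)
  rw [h0, map_smul, map_smul, smul_eq_zero] at h3
  exact (hq _).1 (h3.resolve_left (by norm_num))

/-- The derivative of a curve in a subspace is in the subspace. -/
theorem Submodule.hasDerivAt_mem {W : Type*} [NormedAddCommGroup W] [NormedSpace ℝ W]
    [FiniteDimensional ℝ W] (S : Submodule ℝ W) {c : ℝ → W} {c' : W} {t : ℝ}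
    (hc : HasDerivAt c c' t) (h : ∀ t, c t ∈ S) : c' ∈ S := by
  obtain ⟨q, hq, -⟩ := S.exists_clm_projection
  have h1 := q.hasFDerivAt.comp_hasDerivAt t hc
  have h2 : q ∘ c = fun _ ↦ 0 := funext fun t ↦ (hq _).2 (h t)
  rw [h2] at h1
  exact (hq _).1 (h1.unique (hasDerivAt_const t 0))

theorem hasDerivAt_mul_of_eq_one {C C' : ℝ → 𝔸} {X Y : 𝔸} {t : ℝ} (hX : HasDerivAt C X t)
    (hY : HasDerivAt C' Y t) (h : C t = 1) (h' : C' t = 1) :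
    HasDerivAt (fun t ↦ C t * C' t) (X + Y) t :=
  (hX.mul hY).congr_deriv (by rw [h, h', mul_one, one_mul])

theorem ContinuousLinearMap.hasDerivAt_comp {V W : Type*} [NormedAddCommGroup V] [NormedSpace ℝ V]
    [NormedAddCommGroup W] [NormedSpace ℝ W] (L : V →L[ℝ] W) {c : ℝ → V} {c' : V} {t : ℝ}
    (h : HasDerivAt c c' t) : HasDerivAt (fun t ↦ L (c t)) (L c') t :=
  L.hasFDerivAt.comp_hasDerivAt t h

/-- A linear automorphism as a unit of the algebra of operators. -/
noncomputable def LinearEquiv.opUnit {V : Type*} [NormedAddCommGroup V] [NormedSpace ℝ V]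
    [FiniteDimensional ℝ V] (τ : V ≃ₗ[ℝ] V) : (V →L[ℝ] V)ˣ where
  val := LinearMap.toContinuousLinearMap (τ : V →ₗ[ℝ] V)
  inv := LinearMap.toContinuousLinearMap (τ.symm : V →ₗ[ℝ] V)
  val_inv := by ext v; simp
  inv_val := by ext v; simp

theorem LinearEquiv.opUnit_inv {V : Type*} [NormedAddCommGroup V] [NormedSpace ℝ V]
    [FiniteDimensional ℝ V] (τ : V ≃ₗ[ℝ] V) : τ.opUnit⁻¹ = τ.symm.opUnit := Units.ext rfl

theorem LinearEquiv.opUnit_mul {V : Type*} [NormedAddCommGroup V] [NormedSpace ℝ V]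
    [FiniteDimensional ℝ V] (σ τ : V ≃ₗ[ℝ] V) : σ.opUnit * τ.opUnit = (τ.trans σ).opUnit :=
  Units.ext rfl

end Generic

theorem Path.Homotopic.conj_refl {X : Type*} [TopologicalSpace X] {x y : X} (β : Path x y)
    {ℓ : Path y y} (h : ℓ.Homotopic (Path.refl y)) :
    ((β.trans ℓ).trans β.symm).Homotopic (Path.refl x) := by
  have h1 : (β.trans ℓ).Homotopic β := (Path.Homotopic.hcomp (Path.Homotopic.refl β) h).trans
    ⟨Path.Homotopy.transRefl β⟩
  exact (Path.Homotopic.hcomp h1 (Path.Homotopic.refl β.symm)).trans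
    ⟨(Path.Homotopy.reflTransSymm β).symm⟩

namespace SpacelikeImmersion

variable {E : Type*} [NormedAddCommGroup E] [NormedSpace ℝ E] [FiniteDimensional ℝ E]
  {M : Type*} [TopologicalSpace M] [ChartedSpace E M] [IsManifold 𝓘(ℝ, E) ∞ M]
  {F : Type*} [NormedAddCommGroup F] [NormedSpace ℝ F] [FiniteDimensional ℝ F]
  {N : Type*} [TopologicalSpace N] [ChartedSpace F N] [IsManifold 𝓘(ℝ, F) ∞ N]
  {g : PseudoRiemannianMetric F N} {f : SpacelikeImmersion E M g}
  {cov : CovariantDerivative 𝓘(ℝ, F) F (TangentSpace 𝓘(ℝ, F) : N → Type _)} {κ : ℝ} {x : M}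

/-- `C` is a `C¹` curve in the restricted holonomy group starting at the identity. -/
structure IsHolonomyCurve (f : SpacelikeImmersion E M g)
    (cov : CovariantDerivative 𝓘(ℝ, F) F (TangentSpace 𝓘(ℝ, F) : N → Type _)) (x : M)
    (C : ℝ → f.normalF x →L[ℝ] f.normalF x) : Prop where
  mem : ∀ t, ∃ (γ : Path x x) (τ : f.normalF x ≃ₗ[ℝ] f.normalF x), γ.Homotopic (Path.refl x) ∧
    f.IsDisplacement cov γ τ ∧ C t = τ.opUnit
  zero : C 0 = 1
  contDiff : ContDiff ℝ 1 C

theorem IsHolonomyCurve.mul (h : f.HasCoordImmersions cov κ)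
    {C C' : ℝ → f.normalF x →L[ℝ] f.normalF x} (hC : f.IsHolonomyCurve cov x C)
    (hC' : f.IsHolonomyCurve cov x C') : f.IsHolonomyCurve cov x (fun t ↦ C t * C' t) where
  mem t := by
    obtain ⟨γ, τ, h1, h2, h3⟩ := hC.mem t
    obtain ⟨γ', τ', h1', h2', h3'⟩ := hC'.mem t
    refine ⟨γ'.trans γ, τ'.trans τ, ?_, h2'.trans h h2, ?_⟩
    · exact (Path.Homotopic.hcomp h1' h1).trans ⟨Path.Homotopy.reflTrans _⟩
    · rw [h3, h3', ← Units.val_mul, LinearEquiv.opUnit_mul]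
  zero := by rw [hC.zero, hC'.zero, mul_one]
  contDiff := hC.contDiff.clm_comp hC'.contDiff

theorem IsHolonomyCurve.comp {C : ℝ → f.normalF x →L[ℝ] f.normalF x}
    (hC : f.IsHolonomyCurve cov x C) {r : ℝ → ℝ} (hr : ContDiff ℝ 1 r) (hr0 : r 0 = 0) :
    f.IsHolonomyCurve cov x (fun t ↦ C (r t)) where
  mem t := hC.mem _
  zero := by rw [hr0, hC.zero]
  contDiff := hC.contDiff.comp hr

theorem IsHolonomyCurve.one (h : f.HasCoordImmersions cov κ) :
    f.IsHolonomyCurve cov x (fun _ ↦ 1) where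
  mem _ := ⟨_, _, Path.Homotopic.refl _, .refl h x, rfl⟩
  zero := rfl
  contDiff := contDiff_const

/-- The holonomy algebra, as a subspace of the space of operators. -/
noncomputable def holonomySubspace (h : f.HasCoordImmersions cov κ) (x : M) :
    Submodule ℝ (f.normalF x →L[ℝ] f.normalF x) where
  carrier := {X | ∃ C, f.IsHolonomyCurve cov x C ∧ HasDerivAt C X 0}
  zero_mem' := ⟨_, .one h, hasDerivAt_const (F := f.normalF x →L[ℝ] f.normalF x) (0 : ℝ) 1⟩
  -- The pointwise product of two holonomy curves through `1` adds their velocities; the change of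
  -- time `t ↦ a t` multiplies the velocity by `a`.
  add_mem' := by
    rintro X Y ⟨C, hC, hX⟩ ⟨C', hC', hY⟩
    exact ⟨_, hC.mul h hC', hasDerivAt_mul_of_eq_one (𝔸 := f.normalF x →L[ℝ] f.normalF x)
      hX hY hC.zero hC'.zero⟩
  smul_mem' := by
    rintro a X ⟨C, hC, hX⟩
    have h1 : HasDerivAt (fun t : ℝ ↦ a * t) a 0 := by
      simpa using (hasDerivAt_id (0 : ℝ)).const_mul a
    refine ⟨_, hC.comp (r := fun t ↦ a * t) (by fun_prop) (mul_zero a), ?_⟩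
    have hX' : HasDerivAt C X (a * 0) := by rwa [mul_zero]
    exact HasDerivAt.scomp (g₁ := C) 0 hX' h1

theorem mem_holonomySubspace {h : f.HasCoordImmersions cov κ}
    {X : f.normalF x →L[ℝ] f.normalF x} :
    X ∈ holonomySubspace h x ↔ ∃ C, f.IsHolonomyCurve cov x C ∧ HasDerivAt C X 0 := Iff.rfl

theorem mem_holonomyAlgebra_iff (h : f.HasCoordImmersions cov κ) (A : Module.End ℝ (f.normalF x)) :
    A ∈ f.holonomyAlgebra cov x ↔ LinearMap.toContinuousLinearMap A ∈ holonomySubspace h x := by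
  rw [mem_holonomySubspace]
  constructor
  · rintro ⟨c, h1, h2, h3⟩
    -- Regularity is assumed for curves in `F`. A linear left inverse of the inclusion brings it to
    -- the normal space, and then to operators by finite dimension.
    obtain ⟨p, hp⟩ := LinearMap.exists_leftInverse_of_injective (f.normalF x).subtype
      (Submodule.ker_subtype _)
    have hp' : ∀ v : f.normalF x, p v = v := fun v ↦ congrArg (fun T : _ →ₗ[ℝ] _ ↦ T v) hp
    let P := LinearMap.toContinuousLinearMap p
    let C : ℝ → f.normalF x →L[ℝ] f.normalF x := fun t ↦
      ((show f.normalF x ≃ₗ[ℝ] f.normalF x from c t).opUnit : f.normalF x →L[ℝ] f.normalF x)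
    have hC : ∀ t (v : f.normalF x), C t v = P (c t v).1 := fun t v ↦ (hp' (c t v)).symm
    refine ⟨C, ⟨fun t ↦ ?_, ?_, ?_⟩, ?_⟩
    · obtain ⟨γ, h4, h5, h6⟩ := h1 t
      exact ⟨γ, c t, h5, ⟨h4, h6⟩, rfl⟩
    · have : ((LinearEquiv.refl ℝ (f.normalF x)).opUnit : f.normalF x →L[ℝ] f.normalF x) = 1 := rfl
      exact (congrArg (fun τ : f.normalF x ≃ₗ[ℝ] f.normalF x ↦
        (τ.opUnit : f.normalF x →L[ℝ] f.normalF x)) h2).trans this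
    · refine contDiff_clm_apply_iff.2 fun v ↦ ?_
      simp only [hC]
      exact P.contDiff.comp (h3 v).1
    · refine hasDerivAt_clm_of_basis (Module.finBasis ℝ (f.normalF x)) fun i ↦ ?_
      simp only [hC]
      refine (P.hasFDerivAt.comp_hasDerivAt 0 (h3 _).2).congr_deriv ?_
      exact hp' (A _)
  · rintro ⟨C, hC, hA⟩
    choose γ τ h1 h2 h3 using hC.mem
    have h4 : ∀ (v : f.normalF x) t, (τ t v : F) = (f.normalF x).subtypeL (C t v) := fun v t ↦ by
      rw [h3]; rfl
    have h5 : ∀ v : f.normalF x, ContDiff ℝ 1 (fun t ↦ (τ t v : F)) ∧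
        HasDerivAt (fun t ↦ (τ t v : F)) (A v : F) 0 := by
      intro v
      rw [funext (h4 v)]
      refine ⟨(f.normalF x).subtypeL.contDiff.comp (hC.contDiff.clm_apply contDiff_const), ?_⟩
      have h6 := (f.normalF x).subtypeL.hasFDerivAt.comp_hasDerivAt (0 : ℝ)
        (hA.clm_apply (hasDerivAt_const (0 : ℝ) v))
      rw [map_zero, add_zero] at h6
      exact h6
    refine ⟨τ, fun t ↦ ⟨γ t, (h2 t).smooth, h1 t, (h2 t).parallel⟩, ?_, h5⟩
    refine LinearEquiv.ext fun v ↦ ?_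
    exact congrArg (fun T : f.normalF x →L[ℝ] f.normalF x ↦ T v) ((h3 0).symm.trans hC.zero)

namespace GaugeBall

variable (B : f.GaugeBall) {A : f.normalF x ≃ₗ[ℝ] f.normalF B.center}

-- The displacement along `β`, around the triangle with vertices the centre, `p` and `p + s u`, and
-- back along `β` is a holonomy with velocity minus the gauge form.
set_option synthInstance.maxHeartbeats 200000 in
theorem compress_gaugeForm_mem_holonomySubspace (h : f.HasCoordImmersions cov κ)
    {β : Path x B.center} (hA : f.IsDisplacement cov β A) {p : E} (hp : p ∈ B.ball) (u : E) :
    B.compress A (gaugeForm (B.contDiff_form h) (B.coord B.center) p u) ∈ holonomySubspace h x := by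
  obtain ⟨δ, hδ, hball⟩ : ∃ δ > 0, ∀ s : ℝ, |s| ≤ δ → p + s • u ∈ B.ball := by
    have h1 : ContinuousAt (fun s : ℝ ↦ p + s • u) 0 := by fun_prop
    have h2 : ∀ᶠ s in 𝓝 (0 : ℝ), p + s • u ∈ B.ball :=
      h1.eventually ((Metric.isOpen_ball (x := B.coord B.center)).mem_nhds (by
        simpa only [zero_smul, add_zero, ball] using hp))
    obtain ⟨δ, hδ, h3⟩ := Metric.nhds_basis_closedBall.mem_iff.1 h2
    exact ⟨δ, hδ, fun s hs ↦ h3 (by simpa using hs)⟩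
  -- A holonomy curve is defined for all real times, whereas the triangle must stay in the ball. The
  -- parameter `δ sin(t/δ)` is bounded by `δ` and has derivative `1` at `0`.
  have hs : ∀ t : ℝ, |δ * Real.sin (t / δ)| ≤ δ := fun t ↦ by
    rw [abs_mul, abs_of_pos hδ]
    exact mul_le_of_le_one_right hδ.le (Real.abs_sin_le_one _)
  have hs1 : ContDiff ℝ 1 fun t ↦ δ * Real.sin (t / δ) := by fun_prop
  have hs' : HasDerivAt (fun t ↦ δ * Real.sin (t / δ)) 1 0 := by
    have h1 := (((hasDerivAt_id (0 : ℝ)).div_const δ).sin).const_mul δ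
    refine h1.congr_deriv ?_
    simp [hδ.ne']
  let T : ℝ → F →L[ℝ] F := triangleTransport (B.contDiff_form h) (B.coord B.center) p u
  have hT : ∀ s : ℝ, p + s • u ∈ B.ball → ∃ (γ : Path x x) (τ : f.normalF x ≃ₗ[ℝ] f.normalF x),
      γ.Homotopic (Path.refl x) ∧ f.IsDisplacement cov γ τ ∧ B.compress A (T s) = τ.opUnit := by
    intro s hq
    have m0 := B.center_mem_dom
    have m1 := B.point_mem_dom hp
    have m2 := B.point_mem_dom hq
    have d := (hA.trans h (((B.isDisplacement_segment h m0 m1).trans h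
      (B.isDisplacement_segment h m1 m2)).trans h
      ((B.isDisplacement_segment h m0 m2).symm h))).trans h (hA.symm h)
    -- The triangle lies in the ball and is contractible there; conjugation by `β` preserves this.
    refine ⟨_, _, Path.Homotopic.conj_refl _ (B.homotopic_refl _ fun t ↦ ?_), d, ?_⟩
    · have h1 : range (((B.segment m0 m1).trans (B.segment m1 m2)).trans (B.segment m0 m2).symm) ⊆
          B.dom := by
        rw [Path.trans_range, Path.trans_range, Path.symm_range]
        refine union_subset (union_subset ?_ ?_) ?_
        all_goals
          rintro _ ⟨t, rfl⟩
          exact B.segment_mem_dom _ _ t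
      exact h1 (mem_range_self t)
    · ext1 v
      have h1 := B.gauge_inj A h m1 v
      have h2 := B.vecCoord_transport h m1 m2 (B.transport h m0 m1 (A v))
      have h3 := B.proj_inverse_gauge A h m2 (B.transport h m1 m2 (B.transport h m0 m1 (A v)))
      rw [B.coord_point hp] at h1 h2
      rw [B.coord_point hq] at h2 h3
      rw [h2, ← h1] at h3
      exact h3
  have hcurve : f.IsHolonomyCurve cov x fun t ↦ B.compress A (T (δ * Real.sin (t / δ))) := by
    refine ⟨fun t ↦ hT _ (hball _ (hs t)), ?_, ?_⟩
    · simp only [zero_div, Real.sin_zero, mul_zero]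
      have h0 : T 0 = 1 := triangleTransport_zero (B.contDiff_form h) (B.coord B.center) p u
      rw [h0]
      ext1 v
      exact B.proj_inj A h v
    · have h1 : ContDiff ℝ 1 T :=
        contDiff_triangleTransport (B.contDiff_form h) (B.coord B.center) p u
      exact (ContinuousLinearMap.contDiff (E := F →L[ℝ] F)
        (F := f.normalF x →L[ℝ] f.normalF x) (B.compress A)).comp (h1.comp hs1)
  have hmem : B.compress A (-gaugeForm (B.contDiff_form h) (B.coord B.center) p u) ∈
      holonomySubspace h x := by
    refine mem_holonomySubspace.2 ⟨_, hcurve, ?_⟩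
    have h1 : HasDerivAt T (-gaugeForm (B.contDiff_form h) (B.coord B.center) p u)
        (δ * Real.sin (0 / δ)) := by
      rw [zero_div, Real.sin_zero, mul_zero]
      exact hasDerivAt_triangleTransport_zero (B.contDiff_form h) (B.coord B.center) p u
    have h2 := HasDerivAt.scomp (g₁ := T) 0 h1 hs'
    rw [one_smul] at h2
    have h3 : HasDerivAt (F := F →L[ℝ] F) (fun t ↦ T (δ * Real.sin (t / δ)))
      (-gaugeForm (B.contDiff_form h) (B.coord B.center) p u) 0 := h2
    exact (B.compress A).hasDerivAt_comp (V := F →L[ℝ] F) (W := f.normalF x →L[ℝ] f.normalF x) h3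
  rw [map_neg] at hmem
  exact (Submodule.neg_mem_iff _).1 hmem

end GaugeBall

end SpacelikeImmersion

/-! ### The curvature algebra and parallel fields -/

namespace SpacelikeImmersion

variable {E : Type*} [NormedAddCommGroup E] [NormedSpace ℝ E] [FiniteDimensional ℝ E]
  {M : Type*} [TopologicalSpace M] [ChartedSpace E M] [IsManifold 𝓘(ℝ, E) ∞ M]
  {F : Type*} [NormedAddCommGroup F] [NormedSpace ℝ F] [FiniteDimensional ℝ F]
  {N : Type*} [TopologicalSpace N] [ChartedSpace F N] [IsManifold 𝓘(ℝ, F) ∞ N]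
  {g : PseudoRiemannianMetric F N} {f : SpacelikeImmersion E M g}
  {cov : CovariantDerivative 𝓘(ℝ, F) F (TangentSpace 𝓘(ℝ, F) : N → Type _)} {κ : ℝ} {x : M}

theorem curvatureAlgebra_le_holonomySubspace (h : f.HasCoordImmersions cov κ) :
    f.curvatureAlgebra cov x ≤ holonomySubspace h x := by
  refine Submodule.span_le.2 ?_
  rintro X ⟨y, γ, τ, u, v, hτ, hX⟩
  -- With the ball centred at `y` and `τ` as the frame, the gauge at the centre is `1`, so the
  -- compressed curvature form at the centre is exactly the displaced curvature operator.
  obtain ⟨B, rfl, -⟩ := GaugeBall.exists_center_dom_subset (f := f) isOpen_univ (mem_univ y)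
  have m0 := B.center_mem_dom
  have key := map_formCurvature_mem (𝔸 := F →L[ℝ] F) (W := f.normalF x →L[ℝ] f.normalF x)
    (B.contDiff_form h) (B.compress τ) (holonomySubspace h x) (B.coord B.center)
    (chartCoord (F := E) B.center B.center u) (chartCoord (F := E) B.center B.center v) (by
      filter_upwards [Metric.isOpen_ball.mem_nhds m0.2] with z hz
        using B.compress_gaugeForm_mem_holonomySubspace h hτ hz _)
  refine (?_ : X = _) ▸ key
  ext1 ξ
  have h0 : B.gauge h (B.coord B.center) (B.coord B.center) = 1 := radialTransport_self _ _
  have h1 := B.compress_formCurvature (A := τ) h m0 (chartCoord (F := E) B.center B.center u)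
    (chartCoord (F := E) B.center B.center v) ξ
  have h2 : τ.trans (B.transport h m0 m0) = τ := by
    refine LinearEquiv.ext fun w ↦ Subtype.ext ?_
    have h3 := B.vecCoord_transport h m0 m0 (τ w)
    rw [h0, one_apply_eq_self] at h3
    have h4 := congrArg (f.vecFrame B.center B.center) h3
    rwa [vecFrame_vecCoord (B.dom_subset m0), vecFrame_vecCoord (B.dom_subset m0)] at h4
  have hu : chartFrame (F := E) B.center B.center (chartCoord (F := E) B.center B.center u) = u :=
    chartFrame_chartCoord m0.1 u
  have hv : chartFrame (F := E) B.center B.center (chartCoord (F := E) B.center B.center v) = v :=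
    chartFrame_chartCoord m0.1 v
  rw [h0, Ring.inverse_one, one_mul, mul_one, h2, hu, hv] at h1
  exact (hX ξ).trans h1.symm

/-- The conjugate of a displaced curvature is the same curvature displaced along `γ` followed by the
original path. -/
theorem conj_mem_curvatureAlgebra (h : f.HasCoordImmersions cov κ) {γ : Path x x}
    {τ : f.normalF x ≃ₗ[ℝ] f.normalF x} (hτ : f.IsDisplacement cov γ τ)
    {Y : f.normalF x →L[ℝ] f.normalF x} (hY : Y ∈ f.curvatureAlgebra cov x) :
    (↑τ.opUnit⁻¹ : f.normalF x →L[ℝ] f.normalF x) * Y * τ.opUnit ∈ f.curvatureAlgebra cov x := by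
  induction hY using Submodule.span_induction with
  | mem Y hY =>
    obtain ⟨y, γ', τ', u, v, hτ', hX⟩ := hY
    refine Submodule.subset_span ⟨y, γ.trans γ', τ.trans τ', u, v, hτ.trans h hτ', fun ξ ↦ ?_⟩
    have h1 := congrArg τ.symm (hX (τ ξ))
    exact h1
  | zero => rw [mul_zero, zero_mul]; exact Submodule.zero_mem _
  | add Y Z _ _ hY hZ => rw [mul_add, add_mul]; exact Submodule.add_mem _ hY hZ
  | smul a Y _ hY => rw [mul_smul_comm, smul_mul_assoc]; exact Submodule.smul_mem _ _ hY

section Generic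

variable {𝔸 : Type*} [NormedRing 𝔸] [NormedAlgebra ℝ 𝔸] [FiniteDimensional ℝ 𝔸]

set_option synthInstance.maxHeartbeats 200000 in
theorem _root_.hasDerivAt_conj_of_eq_one {C : ℝ → 𝔸} {X : 𝔸} (hC : HasDerivAt C X 0) (h0 : C 0 = 1)
    (Y : 𝔸) : HasDerivAt (fun t ↦ Ring.inverse (C t) * Y * C t) (Y * X - X * Y) 0 := by
  have := FiniteDimensional.complete ℝ 𝔸
  have h2 := hasFDerivAt_ringInverse (𝕜 := ℝ) (1 : 𝔸ˣ)
  rw [Units.val_one, ← h0] at h2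
  have h3 : HasDerivAt (fun t ↦ Ring.inverse (C t)) _ 0 :=
    HasFDerivAt.comp_hasDerivAt (l := Ring.inverse) (0 : ℝ) h2 hC
  refine ((h3.mul_const Y).mul hC).congr_deriv ?_
  simp only [inv_one, Units.val_one, neg_apply, ContinuousLinearMap.mulLeftRight_apply, one_mul,
    mul_one, neg_mul, h0, Ring.inverse_one, add_comm, sub_eq_add_neg]

theorem _root_.Submodule.lie_mem_of_hasDerivAt {S : Submodule ℝ 𝔸} {C : ℝ → 𝔸} {X Y : 𝔸}
    (hC : HasDerivAt C X 0) (h0 : C 0 = 1) (h : ∀ t, Ring.inverse (C t) * Y * C t ∈ S) :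
    Y * X - X * Y ∈ S :=
  S.hasDerivAt_mem (hasDerivAt_conj_of_eq_one hC h0 Y) h

end Generic

/-- `Y` is the velocity of a holonomy curve `C`, and `C⁻¹ X C` stays in the curvature algebra. The
bracket is the derivative of this curve at `0`. -/
theorem lie_mem_curvatureAlgebra (h : f.HasCoordImmersions cov κ)
    {X Y : f.normalF x →L[ℝ] f.normalF x} (hX : X ∈ f.curvatureAlgebra cov x)
    (hY : Y ∈ f.curvatureAlgebra cov x) : X * Y - Y * X ∈ f.curvatureAlgebra cov x := by
  obtain ⟨C, hC, hCX⟩ := mem_holonomySubspace.1 (curvatureAlgebra_le_holonomySubspace h hY)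
  refine Submodule.lie_mem_of_hasDerivAt (𝔸 := f.normalF x →L[ℝ] f.normalF x) hCX hC.zero
    fun t ↦ ?_
  obtain ⟨γ, τ, -, hτ, hCt⟩ := hC.mem t
  rw [hCt, Ring.inverse_unit]
  exact conj_mem_curvatureAlgebra h hτ hX

/-- Parallel fields have constant scalar products, and the normal metric at the starting point is
nondegenerate. -/
theorem injective_of_isParallelField (h : f.HasCoordImmersions cov κ) {y y' : M} {γ : Path y y'}
    {A : f.normalF x ≃ₗ[ℝ] f.normalF y} {Φ : ℝ → f.normalF x →ₗ[ℝ] F}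
    (hΦ : ∀ v, f.IsParallelField cov γ.extend fun t ↦ Φ t v) (h0 : ∀ v, Φ 0 v = A v) {t : ℝ}
    (ht : t ∈ Icc (0 : ℝ) 1) : Function.Injective (Φ t) := by
  rw [← LinearMap.ker_eq_bot, LinearMap.ker_eq_bot']
  intro v hv
  have key : ∀ w : f.normalF y, f.normalInner y (A v) w = 0 := by
    intro w
    have h1 := (hΦ v).inner_eq h γ.continuous_extend (hΦ (A.symm w)) ht
    rw [hv, h0, h0, A.apply_symm_apply] at h1
    have e : ∀ {z : M} (_ : z = y) (a b : F),
      (g.inner (f.toFun z) a b : ℝ) = g.inner (f.toFun y) a b := by rintro _ rfl _ _; rfl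
    rw [e γ.extend_zero] at h1
    refine h1.symm.trans ?_
    have h2 := (g.inner (f.toFun (γ.extend t))).map_zero
    exact congrArg (fun T : F →L[ℝ] ℝ ↦ T (Φ t (A.symm w))) h2
  have h1 : A v = 0 := eq_zero_of_normalInner_eq_zero (f := f) key
  exact A.map_eq_zero_iff.1 h1

namespace GaugeBall

variable (B : f.GaugeBall) {A : f.normalF x ≃ₗ[ℝ] f.normalF B.center}

variable (A) in
/-- An operator with values in the normal space at `z`, displaced to `x`. -/
noncomputable def pullback (h : f.HasCoordImmersions cov κ) (z : M) (T : f.normalF x →ₗ[ℝ] F) :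
    f.normalF x →L[ℝ] f.normalF x :=
  ((B.proj A).comp (Ring.inverse (B.gauge h (B.coord B.center) (B.coord z)))).comp
    ((f.vecCoord B.center z).comp (LinearMap.toContinuousLinearMap T))

theorem pullback_apply (h : f.HasCoordImmersions cov κ) (z : M) (T : f.normalF x →ₗ[ℝ] F)
    (v : f.normalF x) : B.pullback A h z T v = B.proj A (Ring.inverse
      (B.gauge h (B.coord B.center) (B.coord z)) (f.vecCoord B.center z (T v))) := rfl

theorem transport_pullback (h : f.HasCoordImmersions cov κ) {z : M} (hz : z ∈ B.dom)
    {T : f.normalF x →ₗ[ℝ] F} {v : f.normalF x} (hT : T v ∈ f.normalF z) :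
    B.transport h B.center_mem_dom hz (A (B.pullback A h z T v)) = ⟨T v, hT⟩ := by
  have h1 := B.proj_inverse_gauge A h hz ⟨T v, hT⟩
  rw [pullback_apply, h1, A.apply_symm_apply, LinearEquiv.apply_symm_apply]

theorem inj_pullback (h : f.HasCoordImmersions cov κ) {z : M} (hz : z ∈ B.dom)
    {T : f.normalF x →ₗ[ℝ] F} {v : f.normalF x} (hT : T v ∈ f.normalF z) :
    B.inj A (B.pullback A h z T v) = Ring.inverse (B.gauge h (B.coord B.center) (B.coord z))
      (f.vecCoord B.center z (T v)) := by
  have h1 := B.gauge_inj A h hz (B.pullback A h z T v)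
  rw [B.transport_pullback h hz hT] at h1
  rw [← B.inverse_gauge_gauge h (B.coord B.center) (B.coord z) (B.inj A _), h1]

theorem isUnit_pullback (h : f.HasCoordImmersions cov κ) {z : M} (hz : z ∈ B.dom)
    {T : f.normalF x →ₗ[ℝ] F} (hT : ∀ v, T v ∈ f.normalF z) (hTi : Function.Injective T) :
    IsUnit (B.pullback A h z T) := by
  have h1 : Function.Injective (B.pullback A h z T : f.normalF x →ₗ[ℝ] f.normalF x) := by
    intro v w hvw
    have h2 := congrArg (fun v ↦ B.transport h B.center_mem_dom hz (A v)) hvw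
    refine hTi (congrArg Subtype.val ((B.transport_pullback h hz (hT v)).symm.trans
      (h2.trans (B.transport_pullback h hz (hT w)))))
  exact ⟨(LinearEquiv.ofInjectiveEndo _ h1).opUnit, rfl⟩

-- In the radial gauge the equation of parallel fields is `u' = -(gauge form) u`, and the compressed
-- gauge form is in the curvature algebra. So a family of parallel fields moves inside a coset as
-- long as `γ` stays in the ball.
set_option synthInstance.maxHeartbeats 200000 in
theorem exists_expGroup_pullback (h : f.HasCoordImmersions cov κ) {β : Path x B.center}
    (hA : f.IsDisplacement cov β A) {y y' : M} {γ : Path y y'}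
    {A₀ : f.normalF x ≃ₗ[ℝ] f.normalF y} {Φ : ℝ → f.normalF x →ₗ[ℝ] F}
    (hΦ : ∀ v, f.IsParallelField cov γ.extend fun t ↦ Φ t v) (h0 : ∀ v, Φ 0 v = A₀ v) {a b : ℝ}
    (ha : 0 ≤ a) (hb : b ≤ 1) (hdom : ∀ t ∈ Icc a b, γ.extend t ∈ B.dom) {t₁ t₂ : ℝ}
    (h₁ : t₁ ∈ Icc a b) (h₂ : t₂ ∈ Icc a b) : ∃ k ∈ expGroup (f.curvatureAlgebra cov x),
      B.pullback A h (γ.extend t₂) (Φ t₂) = k * B.pullback A h (γ.extend t₁) (Φ t₁) := by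
  let e := Module.finBasis ℝ (f.normalF x)
  have hd : ∀ v, ∃ s : Set ℝ, s.Finite ∧ ∀ t ∈ Ioo (0 : ℝ) 1 \ s,
      f.ParallelAt cov γ.extend (fun t ↦ Φ t v) t := fun v ↦ (hΦ v).deriv
  choose s hs hd using hd
  have hsub : Icc a b ⊆ Icc 0 1 := Icc_subset_Icc ha hb
  refine exists_expGroup_of_hasDerivAt (𝔸 := f.normalF x →L[ℝ] f.normalF x)
    (fun X hX Y hY ↦ lie_mem_curvatureAlgebra h hX hY)
    (u := fun t ↦ B.pullback A h (γ.extend t) (Φ t)) (a := a) (b := b)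
    (s := s 0 ∪ ⋃ i, s (e i)) ?_ ?_ ?_ ?_ h₁ h₂
  · exact (hs 0).countable.union (countable_iUnion fun i ↦ (hs _).countable)
  · refine continuousOn_clm_apply.2 fun v ↦ ?_
    intro t ht
    have hc : ContinuousAt (fun t ↦ B.coord (γ.extend t)) t :=
      ContinuousAt.comp (f := γ.extend) (B.continuousAt_coord (hdom t ht))
        γ.continuous_extend.continuousAt
    have hm := (continuousWithinAt_vecCoord (B.dom_subset (hdom t ht))
      γ.continuous_extend.continuousWithinAt ((hΦ v).cont t (hsub ht))).mono hsub
    have hG : ContinuousAt (fun t ↦ Ring.inverse (B.gauge h (B.coord B.center)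
        (B.coord (γ.extend t)))) t :=
      ContinuousAt.comp (f := fun t ↦ B.coord (γ.extend t))
        (continuous_inverse_radialTransport (B.contDiff_form h) (B.coord B.center)).continuousAt hc
    exact (B.proj A).continuous.continuousAt.comp_continuousWithinAt
      (hG.continuousWithinAt.clm_apply hm)
  · exact fun t ht ↦ B.isUnit_pullback h (hdom t ht) (fun v ↦ (hΦ v).mem t)
      (injective_of_isParallelField h hΦ h0 (hsub ht))
  · rintro t ⟨ht, hts⟩
    have htd := hdom t (Ioo_subset_Icc_self ht)
    have ht01 : t ∈ Ioo (0 : ℝ) 1 := ⟨ha.trans_lt ht.1, ht.2.trans_le hb⟩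
    obtain ⟨c', hc', -⟩ := hd 0 t ⟨ht01, fun hh ↦ hts (Or.inl hh)⟩ _ (B.dom_subset htd)
    refine ⟨_, Submodule.neg_mem _ (B.compress_gaugeForm_mem h hA htd.2 c'), ?_⟩
    refine hasDerivAt_clm_of_basis e fun i ↦ ?_
    obtain ⟨d', hd', hm⟩ := hd (e i) t ⟨ht01, fun hh ↦ hts (Or.inr (mem_iUnion.2 ⟨i, hh⟩))⟩ _
      (B.dom_subset htd)
    rw [hd'.unique hc'] at hm
    have hm' : HasDerivAt (fun t ↦ f.vecCoord B.center (γ.extend t) (Φ t (e i)))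
        (-B.form cov (B.coord (γ.extend t)) c'
          (f.vecCoord B.center (γ.extend t) (Φ t (e i)))) t := by
      rw [B.form_eq htd.2]; exact hm
    have h3 := (B.proj A).hasDerivAt_comp (hasDerivAt_inverse_radialTransport_apply
      (B.contDiff_form h) (B.coord B.center) (c := fun t ↦ B.coord (γ.extend t)) hc' hm')
    refine HasDerivAt.congr_deriv (f' := _) h3 ?_
    have h4 := B.inj_pullback (A := A) h htd ((hΦ (e i)).mem t)
    rw [map_neg]
    change _ = -(B.compress A _ _)
    exact congrArg (fun w ↦ -(B.proj A (gaugeForm (B.contDiff_form h) (B.coord B.center)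
      (B.coord (γ.extend t)) c' w))) h4.symm

end GaugeBall

end SpacelikeImmersion

/-! ### The holonomy algebra is spanned by the curvature -/

/-- The orbit of `s₀` under finite words in countably many maps is countable. -/
theorem exists_countable_closed {S ι : Type*} [Countable ι] (step : ι → S → S) (s₀ : S) :
    ∃ K : Set S, K.Countable ∧ s₀ ∈ K ∧ ∀ i, ∀ s ∈ K, step i s ∈ K := by
  refine ⟨range fun l : List ι ↦ l.foldr step s₀, countable_range _, ⟨[], rfl⟩, ?_⟩
  rintro i _ ⟨l, rfl⟩
  exact ⟨i :: l, rfl⟩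

section Generic

variable {𝔸 : Type*} [NormedRing 𝔸] [NormedAlgebra ℝ 𝔸] [FiniteDimensional ℝ 𝔸]

theorem mul_mem_expGroup_iff {W : Submodule ℝ 𝔸} {k a : 𝔸} (hk : k ∈ expGroup W) :
    k * a ∈ expGroup W ↔ a ∈ expGroup W := by
  refine ⟨fun h ↦ ?_, mul_mem hk⟩
  obtain ⟨k', hk', h1⟩ := exists_mul_eq_one_of_mem_expGroup hk
  have h2 := mul_mem hk' h
  rwa [← mul_assoc, h1, one_mul] at h2

end Generic

namespace SpacelikeImmersion

variable {E : Type*} [NormedAddCommGroup E] [NormedSpace ℝ E] [FiniteDimensional ℝ E]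
  {M : Type*} [TopologicalSpace M] [ChartedSpace E M] [IsManifold 𝓘(ℝ, E) ∞ M]
  {F : Type*} [NormedAddCommGroup F] [NormedSpace ℝ F] [FiniteDimensional ℝ F]
  {N : Type*} [TopologicalSpace N] [ChartedSpace F N] [IsManifold 𝓘(ℝ, F) ∞ N]
  {g : PseudoRiemannianMetric F N} {f : SpacelikeImmersion E M g}
  {cov : CovariantDerivative 𝓘(ℝ, F) F (TangentSpace 𝓘(ℝ, F) : N → Type _)} {κ : ℝ} {x : M}

variable (f) in
-- For each pair of sets of a countable basis between which some gauge ball fits, one such ball is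
-- chosen. These countably many balls still form a basis.
theorem exists_countable_gaugeBalls [SecondCountableTopology M] :
    ∃ D : Set f.GaugeBall, D.Countable ∧ ∀ (O : Set M) (z : M), IsOpen O → z ∈ O →
      ∃ B ∈ D, z ∈ B.dom ∧ B.dom ⊆ O := by
  classical
  obtain ⟨𝓤, h𝓤, -, hb⟩ := TopologicalSpace.exists_countable_basis M
  let P : Set M × Set M → f.GaugeBall → Prop := fun q B ↦ q.1 ⊆ B.dom ∧ B.dom ⊆ q.2
  let Q : Set (Set M × Set M) := {q ∈ 𝓤 ×ˢ 𝓤 | ∃ B, P q B}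
  have hQ : Q.Countable := (h𝓤.prod h𝓤).mono (sep_subset _ _)
  have hch : ∀ q : Q, ∃ B, P q B := fun q ↦ q.2.2
  choose B hB using hch
  have := hQ.to_subtype
  refine ⟨range B, countable_range B, fun O z hO hz ↦ ?_⟩
  obtain ⟨V, hV, hzV, hVO⟩ := hb.exists_subset_of_mem_open hz hO
  obtain ⟨B', rfl, hB'⟩ := GaugeBall.exists_center_dom_subset (f := f) (hb.isOpen hV) hzV
  obtain ⟨U, hU, hzU, hUB⟩ := hb.exists_subset_of_mem_open B'.center_mem_dom B'.isOpen_dom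
  have hq : (U, V) ∈ Q := ⟨⟨hU, hV⟩, B', hUB, hB'⟩
  exact ⟨B ⟨_, hq⟩, mem_range_self _, (hB ⟨_, hq⟩).1 hzU, (hB ⟨_, hq⟩).2.trans hVO⟩

variable (f) in
/-- A gauge ball with an isomorphism from `N_x M` to the normal space at its centre. -/
structure Frame (x : M) where
  /-- The gauge ball. -/
  ball : f.GaugeBall
  /-- The isomorphism. -/
  iso : f.normalF x ≃ₗ[ℝ] f.normalF ball.center

namespace Frame

/-- The isomorphism is a parallel displacement. -/
def Valid (cov : CovariantDerivative 𝓘(ℝ, F) F (TangentSpace 𝓘(ℝ, F) : N → Type _))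
    (s : f.Frame x) : Prop :=
  ∃ β : Path x s.ball.center, f.IsDisplacement cov β s.iso

open Classical in
/-- Displacement to the centre of another ball, along a segment in the first ball. -/
noncomputable def shrink (h : f.HasCoordImmersions cov κ) (B : f.GaugeBall) (s : f.Frame x) :
    f.Frame x :=
  if hB : B.center ∈ s.ball.dom then
    ⟨B, s.iso.trans (s.ball.transport h s.ball.center_mem_dom hB)⟩ else s

open Classical in
/-- Displacement to the centre of another ball, along a segment in the second ball. -/
noncomputable def enlarge (h : f.HasCoordImmersions cov κ) (B : f.GaugeBall) (s : f.Frame x) :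
    f.Frame x :=
  if hB : s.ball.center ∈ B.dom then
    ⟨B, s.iso.trans (B.transport h B.center_mem_dom hB).symm⟩ else s

theorem Valid.shrink (h : f.HasCoordImmersions cov κ) (B : f.GaugeBall) {s : f.Frame x}
    (hs : s.Valid cov) : (s.shrink h B).Valid cov := by
  unfold Frame.shrink
  split_ifs with hB
  · obtain ⟨β, hβ⟩ := hs
    exact ⟨_, hβ.trans h (s.ball.isDisplacement_segment h s.ball.center_mem_dom hB)⟩
  · exact hs

theorem Valid.enlarge (h : f.HasCoordImmersions cov κ) (B : f.GaugeBall) {s : f.Frame x}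
    (hs : s.Valid cov) : (s.enlarge h B).Valid cov := by
  unfold Frame.enlarge
  split_ifs with hB
  · obtain ⟨β, hβ⟩ := hs
    exact ⟨_, hβ.trans h ((B.isDisplacement_segment h B.center_mem_dom hB).symm h)⟩
  · exact hs

/-- The operator `T : N_x M → N_z M`, displaced by means of the frame, belongs to the group generated
by the exponentials of curvature operators. -/
def Adapted (h : f.HasCoordImmersions cov κ) (s : f.Frame x) (z : M) (T : f.normalF x →ₗ[ℝ] F) :
    Prop :=
  z ∈ s.ball.dom ∧ s.ball.pullback s.iso h z T ∈ expGroup (f.curvatureAlgebra cov x)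

/-- The two pullbacks differ by a left factor: the displacement along a segment of `B'`, measured in
the gauge of `B`. It starts at `1` and remains in the group because `B'` is contained in `B`. -/
theorem pullback_shrink_mem_iff (h : f.HasCoordImmersions cov κ) {B B' : f.GaugeBall}
    {A : f.normalF x ≃ₗ[ℝ] f.normalF B.center} {β : Path x B.center}
    (hA : f.IsDisplacement cov β A) (hsub : B'.dom ⊆ B.dom) {z : M} (hz : z ∈ B'.dom)
    {T : f.normalF x →ₗ[ℝ] F} (hT : ∀ v, T v ∈ f.normalF z) :
    B.pullback A h z T ∈ expGroup (f.curvatureAlgebra cov x) ↔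
    B'.pullback (A.trans (B.transport h B.center_mem_dom (hsub B'.center_mem_dom))) h z T ∈
      expGroup (f.curvatureAlgebra cov x) := by
  set A' := A.trans (B.transport h B.center_mem_dom (hsub B'.center_mem_dom)) with hA'
  obtain ⟨Φ, hΦ, h0, h1⟩ :=
    (B'.isDisplacement_segment h B'.center_mem_dom hz).exists_family h
  obtain ⟨k, hk, hkey⟩ := B.exists_expGroup_pullback (A₀ := A')
    (Φ := fun t ↦ Φ t ∘ₗ (A' : f.normalF x →ₗ[ℝ] f.normalF B'.center)) h hA
    (fun v ↦ hΦ (A' v)) (fun v ↦ h0 (A' v)) le_rfl le_rfl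
    (fun t _ ↦ hsub (B'.segment_extend_mem_dom B'.center_mem_dom hz t))
    (left_mem_Icc.2 zero_le_one) (right_mem_Icc.2 zero_le_one)
  rw [Path.extend_one, Path.extend_zero] at hkey
  have e0 : B.pullback A h B'.center (Φ 0 ∘ₗ (A' : f.normalF x →ₗ[ℝ] f.normalF B'.center)) = 1 := by
    ext1 v
    have h2 := B.proj_inverse_gauge A h (hsub B'.center_mem_dom) (A' v)
    rw [GaugeBall.pullback_apply, LinearMap.comp_apply]
    refine (congrArg (fun w ↦ B.proj A (Ring.inverse (B.gauge h (B.coord B.center)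
      (B.coord B'.center)) (f.vecCoord B.center B'.center w))) (h0 (A' v))).trans (h2.trans ?_)
    rw [hA', LinearEquiv.trans_apply, LinearEquiv.symm_apply_apply, LinearEquiv.symm_apply_apply]
    rfl
  have e1 : B.pullback A h z T = B.pullback A h z
      (Φ 1 ∘ₗ (A' : f.normalF x →ₗ[ℝ] f.normalF B'.center)) * B'.pullback A' h z T := by
    ext1 v
    have h2 := B'.transport_pullback (A := A') h hz (hT v)
    have h3 : Φ 1 (A' (B'.pullback A' h z T v)) = T v := by rw [h1, h2]
    rw [mul_apply_eq_comp, GaugeBall.pullback_apply, GaugeBall.pullback_apply,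
      LinearMap.comp_apply]
    exact (congrArg (fun w ↦ B.proj A (Ring.inverse (B.gauge h (B.coord B.center) (B.coord z))
      (f.vecCoord B.center z w))) h3).symm
  rw [e0, mul_one] at hkey
  rw [e1, hkey]
  exact mul_mem_expGroup_iff (𝔸 := f.normalF x →L[ℝ] f.normalF x) hk

theorem Adapted.shrink {h : f.HasCoordImmersions cov κ} {B : f.GaugeBall} {s : f.Frame x}
    (hs : s.Valid cov) (hsub : B.dom ⊆ s.ball.dom) {z : M} (hz : z ∈ B.dom)
    {T : f.normalF x →ₗ[ℝ] F} (hT : ∀ v, T v ∈ f.normalF z) (hsT : s.Adapted h z T) :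
    (s.shrink h B).ball = B ∧ (s.shrink h B).Adapted h z T := by
  obtain ⟨β, hβ⟩ := hs
  rw [Frame.shrink, dif_pos (hsub B.center_mem_dom)]
  exact ⟨rfl, hz, (pullback_shrink_mem_iff h hβ hsub hz hT).1 hsT.2⟩

theorem Adapted.enlarge {h : f.HasCoordImmersions cov κ} {B : f.GaugeBall} {s : f.Frame x}
    (hs : s.Valid cov) (hsub : s.ball.dom ⊆ B.dom) {z : M}
    {T : f.normalF x →ₗ[ℝ] F} (hT : ∀ v, T v ∈ f.normalF z) (hsT : s.Adapted h z T) :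
    (s.enlarge h B).ball = B ∧ (s.enlarge h B).Adapted h z T := by
  have hB := hsub s.ball.center_mem_dom
  have he : Frame.enlarge h B s = ⟨B, s.iso.trans (B.transport h B.center_mem_dom hB).symm⟩ :=
    dif_pos hB
  have hv := hs.enlarge h B
  rw [he] at hv ⊢
  obtain ⟨β, hβ⟩ := hv
  refine ⟨rfl, hsub hsT.1, (pullback_shrink_mem_iff h hβ hsub hsT.1 hT).2 ?_⟩
  -- Shrinking the enlarged frame gives back the original one, so the previous equivalence applies
  -- in the other direction.
  have e : (s.iso.trans (B.transport h B.center_mem_dom hB).symm).trans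
      (B.transport h B.center_mem_dom hB) = s.iso := by
    ext v; simp
  have h1 := hsT.2
  rw [← e] at h1
  exact h1

end Frame

variable (x) in
/-- Countably many frames suffice for all displacements. -/
theorem exists_countable_frames [SecondCountableTopology M] (h : f.HasCoordImmersions cov κ) :
    ∃ K : Set (f.Frame x), K.Countable ∧ (∀ s ∈ K, s.Valid cov) ∧ ∀ (y : M) (γ : Path x y)
      (Φ : ℝ → f.normalF x →ₗ[ℝ] F), (∀ v, f.IsParallelField cov γ.extend fun t ↦ Φ t v) →
      (∀ v, Φ 0 v = v) → ∃ s ∈ K, s.Adapted h y (Φ 1) := by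
  obtain ⟨D, hD, hDb⟩ := exists_countable_gaugeBalls f
  have := hD.to_subtype
  obtain ⟨B₀, -, hx, -⟩ := hDb univ x isOpen_univ (mem_univ x)
  let s₀ : f.Frame x := ⟨B₀, (B₀.transport h B₀.center_mem_dom hx).symm⟩
  have hs₀ : s₀.Valid cov := ⟨_, (B₀.isDisplacement_segment h B₀.center_mem_dom hx).symm h⟩
  -- The frames reached from `s₀` by finitely many moves between balls of the countable family.
  obtain ⟨K, hK, h0K, hstep⟩ := exists_countable_closed (ι := D ⊕ D)
    (Sum.elim (fun B s ↦ Frame.shrink h B.1 s) fun B s ↦ Frame.enlarge h B.1 s) s₀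
  refine ⟨{s ∈ K | s.Valid cov}, hK.mono (sep_subset _ _), fun s hs ↦ hs.2, ?_⟩
  intro y γ Φ hΦ h0
  -- To change to another ball around `z`, pass to a small ball in the intersection and then
  -- enlarge. Comparing nested balls only avoids joining centres by paths that leave the balls.
  have hmove : ∀ (B : f.GaugeBall), B ∈ D → ∀ (z : M) (T : f.normalF x →ₗ[ℝ] F),
      (∀ v, T v ∈ f.normalF z) → z ∈ B.dom → (∃ s ∈ {s ∈ K | s.Valid cov}, s.Adapted h z T) →
      ∃ s ∈ {s ∈ K | s.Valid cov}, s.ball = B ∧ s.Adapted h z T := by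
    rintro B hB z T hT hz ⟨s, ⟨hsK, hsv⟩, hs⟩
    obtain ⟨B', hB', hz', hsub⟩ := hDb _ z (s.ball.isOpen_dom.inter B.isOpen_dom) ⟨hs.1, hz⟩
    obtain ⟨e, h1⟩ := hs.shrink hsv (hsub.trans inter_subset_left) hz' hT
    have h1v := hsv.shrink h B'
    obtain ⟨e', h2⟩ := h1.enlarge (B := B) h1v (by rw [e]; exact hsub.trans inter_subset_right) hT
    exact ⟨_, ⟨hstep (Sum.inr ⟨B, hB⟩) _ (hstep (Sum.inl ⟨B', hB'⟩) _ hsK), h1v.enlarge h B⟩, e', h2⟩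
  let P : ℝ → Prop := fun t ↦ ∃ s ∈ {s ∈ K | s.Valid cov}, s.Adapted h (γ.extend t) (Φ t)
  have hlocal : ∀ a b : ℝ, 0 ≤ a → b ≤ 1 → ∀ B ∈ D, (∀ t ∈ Icc a b, γ.extend t ∈ B.dom) →
      ∀ t₁ ∈ Icc a b, ∀ t₂ ∈ Icc a b, P t₁ → P t₂ := by
    intro a b ha hb B hB hdom t₁ h₁ t₂ h₂ hP
    obtain ⟨⟨B', A⟩, hs, rfl, hsA⟩ := hmove B hB _ _ (fun v ↦ (hΦ v).mem t₁) (hdom t₁ h₁) hP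
    obtain ⟨β, hβ⟩ := hs.2
    obtain ⟨k, hk, hkey⟩ := GaugeBall.exists_expGroup_pullback _ (A₀ := LinearEquiv.refl ℝ _) h hβ
      hΦ h0 ha hb hdom h₁ h₂
    refine ⟨_, hs, hdom t₂ h₂, ?_⟩
    exact hkey ▸ mul_mem hk hsA.2
  have hP0 : P 0 := by
    refine ⟨s₀, ⟨h0K, hs₀⟩, ?_⟩
    rw [γ.extend_zero]
    refine ⟨hx, ?_⟩
    convert one_mem (expGroup (𝔸 := f.normalF x →L[ℝ] f.normalF x) (f.curvatureAlgebra cov x))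
    ext1 v
    have h2 := B₀.proj_inverse_gauge s₀.iso h hx v
    refine (congrArg (fun w ↦ B₀.proj s₀.iso (Ring.inverse (B₀.gauge h (B₀.coord B₀.center)
      (B₀.coord x)) (f.vecCoord B₀.center x w))) (h0 v)).trans (h2.trans ?_)
    exact LinearEquiv.apply_symm_apply _ _
  -- Near each time the curve stays in one ball of the family, where adapted frames persist;
  -- connectedness of the unit interval does the rest.
  have hP1 : P 0 → P 1 := by
    refine isPreconnected_Icc.induction₂' (α := ℝ) (s := Icc 0 1) (fun t t' ↦ P t → P t') ?_ ?_
      (left_mem_Icc.2 zero_le_one) (right_mem_Icc.2 zero_le_one)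
    · intro t ht
      obtain ⟨B, hB, hz, -⟩ := hDb univ (γ.extend t) isOpen_univ (mem_univ _)
      obtain ⟨δ, hδ, hball⟩ := Metric.mem_nhds_iff.1
        (γ.continuous_extend.continuousAt.preimage_mem_nhds (B.isOpen_dom.mem_nhds hz))
      have hnear : Metric.ball t δ ∩ Icc 0 1 ∈ 𝓝[Icc 0 1] t :=
        Filter.inter_mem (mem_nhdsWithin_of_mem_nhds (Metric.ball_mem_nhds t hδ)) self_mem_nhdsWithin
      filter_upwards [hnear] with t' ht'
      have hsub : Icc (min t t') (max t t') ⊆ Metric.ball t δ := by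
        have := (convex_ball t δ).ordConnected.uIcc_subset (Metric.mem_ball_self hδ) ht'.1
        exact this
      have hd : ∀ r ∈ Icc (min t t') (max t t'), γ.extend r ∈ B.dom := fun r hr ↦ hball (hsub hr)
      have m1 : t ∈ Icc (min t t') (max t t') := ⟨min_le_left _ _, le_max_left _ _⟩
      have m2 : t' ∈ Icc (min t t') (max t t') := ⟨min_le_right _ _, le_max_right _ _⟩
      exact ⟨hlocal _ _ (le_min ht.1 ht'.2.1) (max_le ht.2 ht'.2.2) B hB hd _ m1 _ m2,
        hlocal _ _ (le_min ht.1 ht'.2.1) (max_le ht.2 ht'.2.2) B hB hd _ m2 _ m1⟩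
    · exact fun a b c _ _ _ hab hbc ha ↦ hbc (hab ha)
  have h1 := hP1 hP0
  simp only [P, γ.extend_one] at h1
  exact h1

/-- Every holonomy element is `σ k` with `σ` from a countable list given by the frames and `k` in
the group generated by the curvature algebra. A `C¹` curve of such elements is tangent to that
algebra. -/
theorem holonomySubspace_le_curvatureAlgebra [SecondCountableTopology M]
    (h : f.HasCoordImmersions cov κ) : holonomySubspace h x ≤ f.curvatureAlgebra cov x := by
  classical
  intro X hX
  obtain ⟨C, hC, hCX⟩ := mem_holonomySubspace.1 hX
  obtain ⟨K, hK, hKv, hKey⟩ := exists_countable_frames x h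
  let G : f.Frame x → f.normalF x →L[ℝ] f.normalF x := fun s ↦
    if hx : x ∈ s.ball.dom then
      (s.iso.trans (s.ball.transport h s.ball.center_mem_dom hx)).opUnit else 1
  refine mem_of_hasDerivAt_of_countable_cosets (𝔸 := f.normalF x →L[ℝ] f.normalF x)
    (fun X hX Y hY ↦ lie_mem_curvatureAlgebra h hX hY) (c := C) hC.contDiff.continuous hC.zero hCX
    (hK.image G) fun t ↦ ?_
  obtain ⟨γ, τ, -, hτ, hCt⟩ := hC.mem t
  obtain ⟨Φ, hΦ, h0, h1⟩ := hτ.exists_family h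
  obtain ⟨s, hs, hx, hk⟩ := hKey x γ Φ hΦ h0
  obtain ⟨β, hβ⟩ := hKv s hs
  set σ := s.iso.trans (s.ball.transport h s.ball.center_mem_dom hx) with hσ
  have hσd := hβ.trans h (s.ball.isDisplacement_segment h s.ball.center_mem_dom hx)
  set k := s.ball.pullback s.iso h x (Φ 1) with hkdef
  have hτk : C t = σ.opUnit * k := by
    rw [hCt]
    ext1 v
    have h2 := s.ball.transport_pullback (A := s.iso) h hx (T := Φ 1) (v := v)
      (by rw [h1]; exact (τ v).2)
    have h3 : (⟨Φ 1 v, by rw [h1]; exact (τ v).2⟩ : f.normalF x) = τ v := Subtype.ext (h1 v)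
    exact (h2.trans h3).symm
  -- `σ` is itself a displacement along a loop at `x`, so it normalizes the curvature algebra and
  -- its group. Hence `σ k = (σ k σ⁻¹) σ` lies in a coset of the form required.
  have hconj : ∀ Y ∈ f.curvatureAlgebra cov x, (σ.opUnit : f.normalF x →L[ℝ] f.normalF x) * Y *
      (↑σ.opUnit⁻¹ : f.normalF x →L[ℝ] f.normalF x) ∈ f.curvatureAlgebra cov x := by
    intro Y hY
    have h2 := conj_mem_curvatureAlgebra h (hσd.symm h) hY
    have h3 : σ.symm.opUnit = σ.opUnit⁻¹ := (LinearEquiv.opUnit_inv σ).symm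
    rw [h3, inv_inv] at h2
    exact h2
  refine ⟨_, conj_mem_expGroup (𝔸 := f.normalF x →L[ℝ] f.normalF x) hconj hk, G s,
    mem_image_of_mem G hs, ?_⟩
  have hG : G s = σ.opUnit := dif_pos hx
  rw [hτk, hG, mul_assoc, Units.inv_mul, mul_one]

/-- The normal holonomy algebra consists of the combinations of displaced curvature operators. -/
theorem mem_holonomyAlgebra_iff_mem_curvatureAlgebra [SecondCountableTopology M]
    (h : f.HasCoordImmersions cov κ) (A : Module.End ℝ (f.normalF x)) :
    A ∈ f.holonomyAlgebra cov x ↔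
      LinearMap.toContinuousLinearMap A ∈ f.curvatureAlgebra cov x :=
  (mem_holonomyAlgebra_iff h A).trans
    ⟨fun hA ↦ holonomySubspace_le_curvatureAlgebra h hA,
      fun hA ↦ curvatureAlgebra_le_holonomySubspace h hA⟩

end SpacelikeImmersion

/-! ### The algebra of the Ricci equation -/

/-- Curvature operators `ρ` given by the Ricci equation from symmetric shape operators `a`. -/
structure RicciDatum {V : Type*} [AddCommGroup V] [Module ℝ V] (β : LinearMap.BilinForm ℝ V)
    (ι : Type*) [Fintype ι] where
  a : V →ₗ[ℝ] Matrix ι ι ℝ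
  ρ : ι → ι → Module.End ℝ V
  transpose_a : ∀ ξ, (a ξ).transpose = a ξ
  form_ρ : ∀ i j ξ η, β (ρ i j ξ) η = (a η * a ξ - a ξ * a η) i j

namespace RicciDatum

variable {V : Type*} [AddCommGroup V] [Module ℝ V] {β : LinearMap.BilinForm ℝ V}
  {ι : Type*} [Fintype ι] (d : RicciDatum β ι)

/-- The algebraic curvature tensor `∑ₖₗ (a ξ₁ a ξ₂)ₖₗ ρₖₗ`. -/
noncomputable def curv : V →ₗ[ℝ] V →ₗ[ℝ] Module.End ℝ V :=
  LinearMap.mk₂ ℝ (fun ξ₁ ξ₂ ↦ ∑ k, ∑ l, (d.a ξ₁ * d.a ξ₂) k l • d.ρ k l)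
    (by intros; simp [add_mul, add_smul, Finset.sum_add_distrib])
    (by intros; simp [mul_smul, Finset.smul_sum])
    (by intros; simp [mul_add, add_smul, Finset.sum_add_distrib])
    (by intros; simp [mul_smul, Finset.smul_sum])

theorem curv_apply (ξ₁ ξ₂ : V) :
    d.curv ξ₁ ξ₂ = ∑ k, ∑ l, (d.a ξ₁ * d.a ξ₂) k l • d.ρ k l := rfl

/-- The trace of a product of four shape operators. -/
noncomputable def tr (ξ₁ ξ₂ ξ₃ ξ₄ : V) : ℝ := (d.a ξ₁ * d.a ξ₂ * (d.a ξ₃ * d.a ξ₄)).trace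

theorem tr_rotate (ξ₁ ξ₂ ξ₃ ξ₄ : V) : d.tr ξ₁ ξ₂ ξ₃ ξ₄ = d.tr ξ₂ ξ₃ ξ₄ ξ₁ := by
  rw [tr, tr, mul_assoc, Matrix.trace_mul_comm]
  simp only [mul_assoc]

/-- Transposition reverses a product of symmetric matrices and preserves the trace. -/
theorem tr_reverse (ξ₁ ξ₂ ξ₃ ξ₄ : V) : d.tr ξ₁ ξ₂ ξ₃ ξ₄ = d.tr ξ₄ ξ₃ ξ₂ ξ₁ := by
  rw [tr, tr, ← Matrix.trace_transpose]
  simp only [Matrix.transpose_mul, transpose_a, mul_assoc]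

/-- The double sum pairs two matrices entrywise, which is the trace of one times the transpose of
the other. All the curvature symmetries then reduce to rotations and reversals of a trace of four
matrices. -/
theorem form_curv (ξ₁ ξ₂ ξ₃ ξ₄ : V) :
    β (d.curv ξ₁ ξ₂ ξ₃) ξ₄ = d.tr ξ₁ ξ₂ ξ₃ ξ₄ - d.tr ξ₁ ξ₂ ξ₄ ξ₃ := by
  have key : ∀ X Y : Matrix ι ι ℝ, ∑ k, ∑ l, X k l * Y k l = (X * Y.transpose).trace :=
    fun X Y ↦ by simp [Matrix.trace, Matrix.mul_apply]
  rw [tr, tr, ← Matrix.trace_sub, ← mul_sub,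
    show d.a ξ₃ * d.a ξ₄ - d.a ξ₄ * d.a ξ₃ =
      (d.a ξ₄ * d.a ξ₃ - d.a ξ₃ * d.a ξ₄).transpose by
      simp [Matrix.transpose_mul, transpose_a], ← key]
  simp [curv_apply, form_ρ]

theorem form_curv_swap_left (ξ₁ ξ₂ ξ₃ ξ₄ : V) :
    β (d.curv ξ₁ ξ₂ ξ₃) ξ₄ = -β (d.curv ξ₂ ξ₁ ξ₃) ξ₄ := by
  rw [form_curv, form_curv, d.tr_reverse ξ₂ ξ₁ ξ₃, d.tr_reverse ξ₂ ξ₁ ξ₄,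
    ← d.tr_rotate ξ₂ ξ₄ ξ₃ ξ₁, ← d.tr_rotate ξ₁ ξ₂ ξ₄ ξ₃, ← d.tr_rotate ξ₂ ξ₃ ξ₄ ξ₁,
    ← d.tr_rotate ξ₁ ξ₂ ξ₃ ξ₄]
  ring

theorem form_curv_swap_right (ξ₁ ξ₂ ξ₃ ξ₄ : V) :
    β (d.curv ξ₁ ξ₂ ξ₃) ξ₄ = -β (d.curv ξ₁ ξ₂ ξ₄) ξ₃ := by
  rw [form_curv, form_curv]
  ring

theorem form_curv_pair (ξ₁ ξ₂ ξ₃ ξ₄ : V) :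
    β (d.curv ξ₁ ξ₂ ξ₃) ξ₄ = β (d.curv ξ₃ ξ₄ ξ₁) ξ₂ := by
  rw [form_curv, form_curv, d.tr_reverse ξ₃ ξ₄ ξ₂ ξ₁, d.tr_rotate ξ₃ ξ₄ ξ₁ ξ₂,
    d.tr_rotate ξ₄ ξ₁ ξ₂ ξ₃]

theorem form_curv_bianchi (ξ₁ ξ₂ ξ₃ ξ₄ : V) :
    β (d.curv ξ₁ ξ₂ ξ₃) ξ₄ + β (d.curv ξ₂ ξ₃ ξ₁) ξ₄ + β (d.curv ξ₃ ξ₁ ξ₂) ξ₄ = 0 := by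
  have h1 := d.tr_rotate ξ₁ ξ₂ ξ₃ ξ₄
  have h2 : d.tr ξ₃ ξ₁ ξ₂ ξ₄ = d.tr ξ₁ ξ₂ ξ₄ ξ₃ := d.tr_rotate ξ₃ ξ₁ ξ₂ ξ₄
  have h3 : d.tr ξ₂ ξ₃ ξ₁ ξ₄ = d.tr ξ₃ ξ₁ ξ₄ ξ₂ := d.tr_rotate ξ₂ ξ₃ ξ₁ ξ₄
  rw [form_curv, form_curv, form_curv, h2, h3, ← h1]
  ring

/-- The values of the algebraic curvature tensor span all the curvature operators. -/
theorem ρ_mem_span_curv [FiniteDimensional ℝ V] (hβ : ∀ ξ, (∀ η, β ξ η = 0) → ξ = 0) (i j : ι) :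
    d.ρ i j ∈ Submodule.span ℝ (range fun p : V × V ↦ d.curv p.1 p.2) := by
  by_contra hij
  -- Duality: a functional that vanishes on all values of `curv` but not on `ρ i j`. By `h0` the
  -- matrix `φ(ρ k l)` is orthogonal to every product of two shape operators.
  obtain ⟨φ, hφ, hker⟩ := Submodule.exists_le_ker_of_notMem hij
  have h0 : ∀ ξ η, ∑ k, ∑ l, (d.a ξ * d.a η) k l * φ (d.ρ k l) = 0 := fun ξ η ↦ by
    have h1 : φ (d.curv ξ η) = 0 := hker (Submodule.subset_span ⟨(ξ, η), rfl⟩)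
    simpa [curv_apply] using h1
  -- By nondegeneracy of `β`, the functionals `X ↦ β (X ξ) η` separate endomorphisms, so they span
  -- the dual.
  have htop : Submodule.span ℝ (range fun p : V × V ↦
      ((β.flip p.2) ∘ₗ LinearMap.applyₗ p.1 : Module.Dual ℝ (Module.End ℝ V))) = ⊤ := by
    refine Submodule.span_eq_top_of_ne_zero fun X hX ↦ ?_
    by_contra! hcon
    refine hX (LinearMap.ext fun ξ ↦ hβ _ fun η ↦ ?_)
    exact hcon _ ⟨(ξ, η), rfl⟩
  -- For the spanning functionals the matrix `ψ(ρ k l)` is a commutator of shape operators by the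
  -- Ricci equation, hence orthogonal to the matrix of `φ`. The relation is linear in `ψ`.
  have h1 : ∀ ψ : Module.Dual ℝ (Module.End ℝ V), ∑ k, ∑ l, ψ (d.ρ k l) * φ (d.ρ k l) = 0 := by
    intro ψ
    have hψ : ψ ∈ (⊤ : Submodule ℝ (Module.Dual ℝ (Module.End ℝ V))) := trivial
    rw [← htop] at hψ
    induction hψ using Submodule.span_induction with
    | mem ψ h =>
      obtain ⟨⟨ξ, η⟩, rfl⟩ := h
      have e : ∀ k l, (β.flip η ∘ₗ LinearMap.applyₗ ξ : Module.Dual ℝ (Module.End ℝ V))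
          (d.ρ k l) = (d.a η * d.a ξ - d.a ξ * d.a η) k l := fun k l ↦ d.form_ρ k l ξ η
      simp only [e, Matrix.sub_apply, sub_mul, Finset.sum_sub_distrib, h0, sub_zero]
    | zero => simp
    | add ψ ψ' _ _ h h' => simp [add_mul, Finset.sum_add_distrib, h, h']
    | smul c ψ _ h => simp [mul_assoc, ← Finset.mul_sum, h]
  -- With `ψ = φ` a sum of squares vanishes, which contradicts `φ(ρ i j) ≠ 0`.
  have h2 := h1 φ
  rw [Finset.sum_eq_zero_iff_of_nonneg fun k _ ↦ Finset.sum_nonneg fun l _ ↦ mul_self_nonneg _] at h2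
  have h3 := h2 i (Finset.mem_univ i)
  rw [Finset.sum_eq_zero_iff_of_nonneg fun l _ ↦ mul_self_nonneg _] at h3
  exact hφ (mul_self_eq_zero.1 (h3 j (Finset.mem_univ j)))

end RicciDatum

/-! ### The Ricci equation of a spacelike immersion -/

namespace SpacelikeImmersion

variable {E : Type*} [NormedAddCommGroup E] [NormedSpace ℝ E] [FiniteDimensional ℝ E]
  {M : Type*} [TopologicalSpace M] [ChartedSpace E M] [IsManifold 𝓘(ℝ, E) ∞ M]
  {F : Type*} [NormedAddCommGroup F] [NormedSpace ℝ F] [FiniteDimensional ℝ F]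
  {N : Type*} [TopologicalSpace N] [ChartedSpace F N] [IsManifold 𝓘(ℝ, F) ∞ N]
  {g : PseudoRiemannianMetric F N} {f : SpacelikeImmersion E M g}
  {cov : CovariantDerivative 𝓘(ℝ, F) F (TangentSpace 𝓘(ℝ, F) : N → Type _)} {κ : ℝ} {x y : M}
  {ι : Type*} [Fintype ι]

/-- The induced metric as a bilinear form. -/
noncomputable def inducedForm (f : SpacelikeImmersion E M g) (y : M) :
    LinearMap.BilinForm ℝ (TangentSpace 𝓘(ℝ, E) y) :=
  (f.form y).compl₁₂ (f.d y) (f.d y)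

/-- The scalar product on the normal space as a bilinear form. -/
noncomputable def normalForm (f : SpacelikeImmersion E M g) (y : M) :
    LinearMap.BilinForm ℝ (f.normalF y) :=
  (f.form y).compl₁₂ (f.normalSpace y).subtype (f.normalSpace y).subtype

theorem eq_of_normalForm_eq {ξ ξ' : f.normalF y}
    (h : ∀ η, f.normalForm y ξ η = f.normalForm y ξ' η) : ξ = ξ' := by
  rw [← sub_eq_zero]
  have h1 : ∀ η, f.normalForm y (ξ - ξ') η = 0 := fun η ↦ by
    rw [map_sub, LinearMap.sub_apply, h, sub_self]
  exact eq_zero_of_normalInner_eq_zero h1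

theorem IsOrthonormal.inducedForm_basis {o : Module.Basis ι ℝ (TangentSpace 𝓘(ℝ, E) y)}
    (ho : f.IsOrthonormal o) (u : TangentSpace 𝓘(ℝ, E) y) (k : ι) :
    f.inducedForm y u (o k) = o.repr u k := by
  classical
  have h1 : ∀ i j, f.inducedForm y (o i) (o j) = if i = j then 1 else 0 := fun i j ↦ by
    split_ifs with hij
    · exact hij ▸ ho.1 i
    · exact ho.2 i j hij
  conv_lhs => rw [← o.sum_repr u]
  simp only [map_sum, map_smul, LinearMap.sum_apply, LinearMap.smul_apply, h1]
  simp

theorem IsOrthonormal.inducedForm_sum {o : Module.Basis ι ℝ (TangentSpace 𝓘(ℝ, E) y)}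
    (ho : f.IsOrthonormal o) (u v : TangentSpace 𝓘(ℝ, E) y) :
    f.inducedForm y u v = ∑ k, f.inducedForm y u (o k) * f.inducedForm y v (o k) := by
  conv_lhs => rw [← o.sum_repr v]
  simp only [map_sum, map_smul, ho.inducedForm_basis, smul_eq_mul, mul_comm]

theorem IsOrthonormal.sum_smul {o : Module.Basis ι ℝ (TangentSpace 𝓘(ℝ, E) y)}
    (ho : f.IsOrthonormal o) (u : TangentSpace 𝓘(ℝ, E) y) :
    ∑ k, f.inducedForm y u (o k) • o k = u := by
  simp only [ho.inducedForm_basis, o.sum_repr]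

/-- The shape operator. -/
noncomputable def shapeF (f : SpacelikeImmersion E M g)
    (cov : CovariantDerivative 𝓘(ℝ, F) F (TangentSpace 𝓘(ℝ, F) : N → Type _)) (ξ : f.normalF y) :
    TangentSpace 𝓘(ℝ, E) y →ₗ[ℝ] TangentSpace 𝓘(ℝ, E) y :=
  f.shapeOperatorAt cov (x := y) ξ

/-- The normal curvature. -/
noncomputable def curvT (f : SpacelikeImmersion E M g)
    (cov : CovariantDerivative 𝓘(ℝ, F) F (TangentSpace 𝓘(ℝ, F) : N → Type _))
    (u v : TangentSpace 𝓘(ℝ, E) y) (ξ : f.normalF y) : f.normalF y :=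
  f.normalCurvatureAt cov (x := y) u v ξ

/-- The second fundamental form, as a linear map in the normal vector. -/
theorem exists_linear_inner_shapeF (h : f.HasCoordImmersions cov κ)
    (u w : TangentSpace 𝓘(ℝ, E) y) : ∃ L : f.normalF y →ₗ[ℝ] ℝ,
      ∀ ξ, L ξ = f.inducedForm y (f.shapeF cov ξ u) w := by
  refine ⟨((f.coordMetricAlong y (extChartAt 𝓘(ℝ, E) y y) (f.coordShape cov y
    (extChartAt 𝓘(ℝ, E) y y) (chartCoord y y u)
    (f.coordDifferential y (extChartAt 𝓘(ℝ, E) y y) (chartCoord y y w))) : F →L[ℝ] ℝ) ∘ₗ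
    (f.vecCoord y y : F →ₗ[ℝ] F)) ∘ₗ (f.normalF y).subtype, fun ξ ↦ ?_⟩
  exact (inner_shapeOperatorAt (h y) ξ u w).symm

/-- The matrix of the shape operator. -/
noncomputable def shapeMatrix (h : f.HasCoordImmersions cov κ)
    (o : Module.Basis ι ℝ (TangentSpace 𝓘(ℝ, E) y)) : f.normalF y →ₗ[ℝ] Matrix ι ι ℝ :=
  LinearMap.pi fun i ↦ LinearMap.pi fun j ↦
    (exists_linear_inner_shapeF h (o j) (o i)).choose

theorem shapeMatrix_apply (h : f.HasCoordImmersions cov κ)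
    (o : Module.Basis ι ℝ (TangentSpace 𝓘(ℝ, E) y)) (ξ : f.normalF y) (i j : ι) :
    shapeMatrix h o ξ i j = f.inducedForm y (f.shapeF cov ξ (o j)) (o i) :=
  (exists_linear_inner_shapeF h (o j) (o i)).choose_spec ξ

theorem shapeMatrix_comm (h : f.HasCoordImmersions cov κ)
    (o : Module.Basis ι ℝ (TangentSpace 𝓘(ℝ, E) y)) (ξ : f.normalF y) (i j : ι) :
    shapeMatrix h o ξ i j = shapeMatrix h o ξ j i := by
  rw [shapeMatrix_apply, shapeMatrix_apply]
  exact inducedInner_shapeOperatorAt_comm (h y) ξ (o j) (o i)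

theorem normalForm_curvT (h : f.HasCoordImmersions cov κ)
    (u v : TangentSpace 𝓘(ℝ, E) y) (ξ η : f.normalF y) :
    f.normalForm y (f.curvT cov u v ξ) η =
      f.inducedForm y (f.shapeF cov ξ v) (f.shapeF cov η u) -
      f.inducedForm y (f.shapeF cov ξ u) (f.shapeF cov η v) :=
  inner_normalCurvatureAt (h y) u v ξ η

theorem shapeF_add (h : f.HasCoordImmersions cov κ)
    {o : Module.Basis ι ℝ (TangentSpace 𝓘(ℝ, E) y)} (ho : f.IsOrthonormal o) (ξ η : f.normalF y) (u : TangentSpace 𝓘(ℝ, E) y) :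
    f.shapeF cov (ξ + η) u =
      f.shapeF cov ξ u + f.shapeF cov η u := by
  rw [← ho.sum_smul (f.shapeF cov (ξ + η) u),
    ← ho.sum_smul (f.shapeF cov ξ u),
    ← ho.sum_smul (f.shapeF cov η u), ← Finset.sum_add_distrib]
  refine Finset.sum_congr rfl fun k _ ↦ ?_
  obtain ⟨L, hL⟩ := exists_linear_inner_shapeF h u (o k)
  rw [← add_smul, ← hL, ← hL, ← hL, map_add]

theorem shapeF_smul (h : f.HasCoordImmersions cov κ)
    {o : Module.Basis ι ℝ (TangentSpace 𝓘(ℝ, E) y)} (ho : f.IsOrthonormal o) (c : ℝ) (ξ : f.normalF y) (u : TangentSpace 𝓘(ℝ, E) y) :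
    f.shapeF cov (c • ξ) u = c • f.shapeF cov ξ u := by
  rw [← ho.sum_smul (f.shapeF cov (c • ξ) u),
    ← ho.sum_smul (f.shapeF cov ξ u), Finset.smul_sum]
  refine Finset.sum_congr rfl fun k _ ↦ ?_
  obtain ⟨L, hL⟩ := exists_linear_inner_shapeF h u (o k)
  rw [← hL, ← hL, map_smul, smul_eq_mul, mul_smul]

/-- The normal curvature as an endomorphism. -/
noncomputable def curvEnd (h : f.HasCoordImmersions cov κ)
    {o : Module.Basis ι ℝ (TangentSpace 𝓘(ℝ, E) y)} (ho : f.IsOrthonormal o)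
    (u v : TangentSpace 𝓘(ℝ, E) y) : Module.End ℝ (f.normalF y) where
  toFun ξ := f.curvT cov u v ξ
  -- Linearity is read off from the Ricci equation, whose right-hand side is visibly linear, instead
  -- of from the tensoriality of the curvature of a connection.
  map_add' ξ ξ' := eq_of_normalForm_eq fun η ↦ by
    simp only [normalForm_curvT h, shapeF_add h ho, map_add, LinearMap.add_apply]
    ring
  map_smul' c ξ := eq_of_normalForm_eq fun η ↦ by
    simp only [normalForm_curvT h, shapeF_smul h ho, map_smul, LinearMap.smul_apply, smul_eq_mul,
      RingHom.id_apply]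
    ring

theorem normalForm_curvEnd (h : f.HasCoordImmersions cov κ)
    {o : Module.Basis ι ℝ (TangentSpace 𝓘(ℝ, E) y)} (ho : f.IsOrthonormal o)
    (u v : TangentSpace 𝓘(ℝ, E) y) (ξ η : f.normalF y) :
    f.normalForm y (curvEnd h ho u v ξ) η =
      f.inducedForm y (f.shapeF cov ξ v) (f.shapeF cov η u) -
      f.inducedForm y (f.shapeF cov ξ u) (f.shapeF cov η v) :=
  normalForm_curvT h u v ξ η

/-- The normal curvature as a bilinear map. -/
noncomputable def curvMap (h : f.HasCoordImmersions cov κ)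
    {o : Module.Basis ι ℝ (TangentSpace 𝓘(ℝ, E) y)} (ho : f.IsOrthonormal o) :
    TangentSpace 𝓘(ℝ, E) y →ₗ[ℝ] TangentSpace 𝓘(ℝ, E) y →ₗ[ℝ] Module.End ℝ (f.normalF y) :=
  LinearMap.mk₂ ℝ (curvEnd h ho)
    (fun u u' v ↦ LinearMap.ext fun ξ ↦ eq_of_normalForm_eq fun η ↦ by
      simp only [normalForm_curvEnd h, map_add, LinearMap.add_apply]
      ring)
    (fun c u v ↦ LinearMap.ext fun ξ ↦ eq_of_normalForm_eq fun η ↦ by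
      simp only [normalForm_curvEnd h, map_smul, LinearMap.smul_apply, smul_eq_mul]
      ring)
    (fun u v v' ↦ LinearMap.ext fun ξ ↦ eq_of_normalForm_eq fun η ↦ by
      simp only [normalForm_curvEnd h, map_add, LinearMap.add_apply]
      ring)
    (fun c u v ↦ LinearMap.ext fun ξ ↦ eq_of_normalForm_eq fun η ↦ by
      simp only [normalForm_curvEnd h, map_smul, LinearMap.smul_apply, smul_eq_mul]
      ring)

theorem curvMap_eq_sum (h : f.HasCoordImmersions cov κ)
    {o : Module.Basis ι ℝ (TangentSpace 𝓘(ℝ, E) y)} (ho : f.IsOrthonormal o)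
    (u v : TangentSpace 𝓘(ℝ, E) y) :
    curvMap h ho u v = ∑ k, ∑ l, (f.inducedForm y u (o k) * f.inducedForm y v (o l)) •
      curvMap h ho (o k) (o l) := by
  conv_lhs => rw [← ho.sum_smul u, ← ho.sum_smul v]
  simp only [map_sum, map_smul, LinearMap.sum_apply, LinearMap.smul_apply, mul_smul,
    Finset.smul_sum]
  refine Finset.sum_comm.trans (Finset.sum_congr rfl fun k _ ↦ Finset.sum_congr rfl fun l _ ↦ ?_)
  rw [smul_comm]

/-- The Ricci equation at `y`, transported to `N_x M` by an isometry. -/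
noncomputable def ricciDatum (h : f.HasCoordImmersions cov κ)
    {o : Module.Basis ι ℝ (TangentSpace 𝓘(ℝ, E) y)} (ho : f.IsOrthonormal o)
    (τ : f.normalF x ≃ₗ[ℝ] f.normalF y)
    (hτ : ∀ ξ η, f.normalForm y (τ ξ) (τ η) = f.normalForm x ξ η) :
    RicciDatum (f.normalForm x) ι where
  a := shapeMatrix h o ∘ₗ (τ : f.normalF x →ₗ[ℝ] f.normalF y)
  ρ i j := (τ.symm : f.normalF y →ₗ[ℝ] f.normalF x) ∘ₗ curvMap h ho (o i) (o j) ∘ₗ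
    (τ : f.normalF x →ₗ[ℝ] f.normalF y)
  transpose_a ξ := by
    ext i j
    exact shapeMatrix_comm h o (τ ξ) j i
  form_ρ i j ξ η := by
    have h1 : ∀ ζ : f.normalF y, f.normalForm x (τ.symm ζ) η = f.normalForm y ζ (τ η) :=
      fun ζ ↦ by rw [← hτ, τ.apply_symm_apply]
    refine (h1 _).trans ((normalForm_curvT h (o i) (o j) (τ ξ) (τ η)).trans ?_)
    rw [ho.inducedForm_sum, ho.inducedForm_sum]
    simp only [← shapeMatrix_apply h o, Matrix.sub_apply, Matrix.mul_apply, LinearMap.comp_apply,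
      LinearEquiv.coe_coe]
    congr 1
    · exact Finset.sum_congr rfl fun k _ ↦ by rw [shapeMatrix_comm h o _ k i, mul_comm]
    · exact Finset.sum_congr rfl fun k _ ↦ by rw [shapeMatrix_comm h o _ k i]

section

variable (h : f.HasCoordImmersions cov κ) {o : Module.Basis ι ℝ (TangentSpace 𝓘(ℝ, E) y)}
    (ho : f.IsOrthonormal o) (τ : f.normalF x ≃ₗ[ℝ] f.normalF y)
    (hτ : ∀ ξ η, f.normalForm y (τ ξ) (τ η) = f.normalForm x ξ η)

theorem ricciDatum_ρ_apply (i j : ι) (ξ : f.normalF x) : (ricciDatum h ho τ hτ).ρ i j ξ =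
    τ.symm (curvMap h ho (o i) (o j) (τ ξ)) := rfl

theorem curvMap_mem_span (u v : TangentSpace 𝓘(ℝ, E) y) {X : Module.End ℝ (f.normalF x)}
    (hX : ∀ ξ, X ξ = τ.symm (curvMap h ho u v (τ ξ))) :
    X ∈ Submodule.span ℝ (range fun p : f.normalF x × f.normalF x ↦
      (ricciDatum h ho τ hτ).curv p.1 p.2) := by
  have h1 : X = ∑ k, ∑ l, (f.inducedForm y u (o k) * f.inducedForm y v (o l)) •
      (ricciDatum h ho τ hτ).ρ k l := by
    ext1 ξ
    rw [hX, curvMap_eq_sum]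
    simp only [LinearMap.sum_apply, LinearMap.smul_apply, map_sum, map_smul, ricciDatum_ρ_apply]
  rw [h1]
  refine Submodule.sum_mem _ fun k _ ↦ Submodule.sum_mem _ fun l _ ↦ Submodule.smul_mem _ _ ?_
  refine (ricciDatum h ho τ hτ).ρ_mem_span_curv (fun ξ hξ ↦ ?_) k l
  exact eq_zero_of_normalInner_eq_zero hξ

/-- Expand `A_{ξ₁} oᵢ` and `A_{ξ₂} oᵢ` in the orthonormal basis. The sum over `i` becomes the matrix
product of the two shape operators, by symmetry of the second. -/
theorem ricciDatum_curv_apply (ξ₁ ξ₂ ξ₃ : f.normalF x) :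
    (ricciDatum h ho τ hτ).curv ξ₁ ξ₂ ξ₃ =
      τ.symm (f.algCurvature cov (x := y) o (τ ξ₁) (τ ξ₂) (τ ξ₃)) := by
  have h1 : f.algCurvature cov (x := y) o (τ ξ₁) (τ ξ₂) (τ ξ₃) = ∑ i, curvMap h ho
      (f.shapeF cov (τ ξ₁) (o i)) (f.shapeF cov (τ ξ₂) (o i))
      (τ ξ₃) := rfl
  have ha : ∀ ξ, (ricciDatum h ho τ hτ).a ξ = shapeMatrix h o (τ ξ) := fun _ ↦ rfl
  refine Eq.trans ?_ (congrArg τ.symm h1).symm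
  have h2 : ∀ u v, τ.symm (curvMap h ho u v (τ ξ₃)) =
      ∑ k, ∑ l, (f.inducedForm y u (o k) * f.inducedForm y v (o l)) •
        (ricciDatum h ho τ hτ).ρ k l ξ₃ := fun u v ↦ by
    rw [curvMap_eq_sum]
    simp only [LinearMap.sum_apply, LinearMap.smul_apply, map_sum, map_smul, ricciDatum_ρ_apply]
  simp only [map_sum, h2, ← shapeMatrix_apply h o, LinearMap.sum_apply, LinearMap.smul_apply,
    RicciDatum.curv_apply, ha, Matrix.mul_apply, Finset.sum_smul]
  refine Eq.symm (Finset.sum_comm.trans (Finset.sum_congr rfl fun k _ ↦ Finset.sum_comm.trans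
    (Finset.sum_congr rfl fun l _ ↦ Finset.sum_congr rfl fun i _ ↦ ?_)))
  rw [shapeMatrix_comm h o _ l i]

end

end SpacelikeImmersion

/-! ### The screen holonomy algebra -/

namespace ScreenBasis

open SpacelikeImmersion

variable {E : Type*} [NormedAddCommGroup E] [NormedSpace ℝ E] [FiniteDimensional ℝ E]
  {M : Type*} [TopologicalSpace M] [ChartedSpace E M] [IsManifold 𝓘(ℝ, E) ∞ M]
  {F : Type*} [NormedAddCommGroup F] [NormedSpace ℝ F] [FiniteDimensional ℝ F]
  {N : Type*} [TopologicalSpace N] [ChartedSpace F N] [IsManifold 𝓘(ℝ, F) ∞ N]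
  {g : PseudoRiemannianMetric F N} {f : SpacelikeImmersion E M g}
  {cov : CovariantDerivative 𝓘(ℝ, F) F (TangentSpace 𝓘(ℝ, F) : N → Type _)} {κ : ℝ} {x y : M}
  {p q : ℕ} (b : ScreenBasis f x p q) {ι : Type*} [Fintype ι]

/-- The screen, as a subspace of `f.normalF x`. -/
noncomputable def screenF : Submodule ℝ (f.normalF x) := b.screen

/-- The isotropic subspace `Ξ`, as a subspace of `f.normalF x`. -/
noncomputable def isotropicF : Submodule ℝ (f.normalF x) := b.isotropic

/-- The vectors `eₖ`, as elements of `f.normalF x`. -/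
noncomputable def eF (k : Fin q) : f.normalF x := b.e k

theorem eF_mem (k : Fin q) : b.eF k ∈ b.screenF :=
  Submodule.subset_span (R := ℝ) (M := f.normalSpace x) (mem_range_self k)

theorem v_mem_isotropicF (i : Fin p) : (b.v i : f.normalF x) ∈ b.isotropicF :=
  Submodule.subset_span (R := ℝ) (M := f.normalSpace x) (mem_range_self i)

/-- The projection to the screen. -/
noncomputable def projF : f.normalF x →ₗ[ℝ] b.screenF := b.proj

theorem projF_apply (ξ : f.normalF x) : b.projF ξ = ∑ k, f.normalForm x ξ (b.eF k) •
    (⟨b.eF k, b.eF_mem k⟩ : b.screenF) := by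
  refine (LinearMap.sum_apply (M := f.normalSpace x) (M₂ := b.screen) _ _ _).trans ?_
  rfl

/-- The compression of an endomorphism of the normal space to the screen. -/
noncomputable def compress : Module.End ℝ (f.normalF x) →ₗ[ℝ] Module.End ℝ b.screenF where
  toFun A := b.projF ∘ₗ A ∘ₗ b.screenF.subtype
  map_add' A B := by ext1 Z; simp
  map_smul' c A := by ext1 Z; simp

theorem compress_apply (A : Module.End ℝ (f.normalF x)) (Z : b.screenF) :
    b.compress A Z = b.projF (A Z) := rfl

theorem compress_eq_zero {A : Module.End ℝ (f.normalF x)}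
    (hA : ∀ Z ∈ b.screenF, ∀ Y ∈ b.screenF, f.normalForm x (A Z) Y = 0) : b.compress A = 0 := by
  ext1 Z
  rw [compress_apply, projF_apply]
  refine Finset.sum_eq_zero fun k _ ↦ ?_
  rw [hA Z Z.2 _ (b.eF_mem k), zero_smul]

theorem normalForm_isotropic_screen {ξ Z : f.normalF x} (hξ : ξ ∈ b.isotropicF)
    (hZ : Z ∈ b.screenF) : f.normalForm x ξ Z = 0 := by
  have h1 : b.isotropicF ≤ LinearMap.ker ((f.normalForm x).flip Z) := by
    refine Submodule.span_le.2 ?_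
    rintro _ ⟨i, rfl⟩
    have h2 : b.screenF ≤ LinearMap.ker (f.normalForm x (b.v i)) := by
      refine Submodule.span_le.2 ?_
      rintro _ ⟨j, rfl⟩
      exact b.v_e i j
    exact h2 hZ
  exact h1 hξ

section Datum

variable {b} {d : RicciDatum (f.normalForm x) ι}

/-- For `Z`, `Y` in the screen the Bianchi identity leaves `⟨𝓡(η, Z)ξ, Y⟩` and `⟨𝓡(Z, ξ)η, Y⟩`. The
first vanishes since `Ξ` is invariant and orthogonal to the screen; pair symmetry turns the second
into `-⟨𝓡(η, Y)ξ, Z⟩`, which vanishes likewise. -/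
theorem compress_curv_left (hd : ∀ ξ η, ∀ ζ ∈ b.isotropicF, d.curv ξ η ζ ∈ b.isotropicF)
    {ξ : f.normalF x} (hξ : ξ ∈ b.isotropicF) (η : f.normalF x) :
    b.compress (d.curv ξ η) = 0 := by
  refine b.compress_eq_zero fun Z hZ Y hY ↦ ?_
  have h1 := d.form_curv_bianchi ξ η Z Y
  rwa [b.normalForm_isotropic_screen (hd η Z ξ hξ) hY, d.form_curv_pair Z ξ η Y,
    d.form_curv_swap_right η Y Z ξ, b.normalForm_isotropic_screen (hd η Y ξ hξ) hZ, neg_zero,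
    add_zero, add_zero] at h1

theorem compress_curv_swap (ξ η : f.normalF x) :
    b.compress (d.curv ξ η) = (-1 : ℝ) • b.compress (d.curv η ξ) := by
  rw [← map_smul]
  congr 1
  refine LinearMap.ext fun ζ ↦ eq_of_normalForm_eq fun θ ↦ ?_
  rw [d.form_curv_swap_left, LinearMap.smul_apply, map_smul, LinearMap.smul_apply,
    smul_eq_mul, neg_one_mul]

/-- The compressed curvature is determined on the screen and the vectors `wₖ`. -/
theorem compress_curv_mem (hd : ∀ ξ η, ∀ ζ ∈ b.isotropicF, d.curv ξ η ζ ∈ b.isotropicF)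
    {W : Submodule ℝ (Module.End ℝ b.screenF)}
    (hee : ∀ Y₁ ∈ b.screenF, ∀ Y₂ ∈ b.screenF, b.compress (d.curv Y₁ Y₂) ∈ W)
    (hwe : ∀ k, ∀ Y ∈ b.screenF, b.compress (d.curv (b.w k) Y) ∈ W)
    (hww : ∀ i j, b.compress (d.curv (b.w i) (b.w j)) ∈ W) (ξ η : f.normalF x) :
    b.compress (d.curv ξ η) ∈ W := by
  have ht : ∀ S : Submodule ℝ (f.normalF x), (∀ i, b.v i ∈ S) → (∀ k, b.e k ∈ S) →
      (∀ i, b.w i ∈ S) → ∀ ζ, ζ ∈ S := fun S hv he hw ζ ↦ by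
    have h1 : Submodule.span ℝ (range b.v ∪ range b.e ∪ range b.w) ≤ S := by
      refine Submodule.span_le.2 ?_
      rintro _ ((⟨i, rfl⟩ | ⟨i, rfl⟩) | ⟨i, rfl⟩)
      exacts [hv i, he i, hw i]
    exact h1 (b.span_eq_top.symm ▸ Submodule.mem_top)
  have hv : ∀ i, ∀ ζ, b.compress (d.curv (b.v i) ζ) ∈ W := fun i ζ ↦ by
    rw [compress_curv_left hd (b.v_mem_isotropicF i)]
    exact W.zero_mem
  have hs : ∀ ξ η, b.compress (d.curv ξ η) ∈ W → b.compress (d.curv η ξ) ∈ W := fun ξ η h ↦ by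
    rw [compress_curv_swap]
    exact W.smul_mem _ h
  refine ht (W.comap (b.compress ∘ₗ d.curv.flip η)) (fun i ↦ hv i η) (fun k ↦ ?_) (fun i ↦ ?_) ξ
  · exact ht (W.comap (b.compress ∘ₗ d.curv (b.eF k))) (fun j ↦ hs _ _ (hv j _))
      (fun l ↦ hee _ (b.eF_mem k) _ (b.eF_mem l)) (fun j ↦ hs _ _ (hwe j _ (b.eF_mem k))) η
  · exact ht (W.comap (b.compress ∘ₗ d.curv (b.w i))) (fun j ↦ hs _ _ (hv j _))
      (fun l ↦ hwe i _ (b.eF_mem l)) (fun j ↦ hww i j) η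

end Datum

theorem isScreenCurvature_iff (h : f.HasCoordImmersions cov κ)
    {o : Module.Basis ι ℝ (TangentSpace 𝓘(ℝ, E) y)} (ho : f.IsOrthonormal o)
    (τ : f.normalF x ≃ₗ[ℝ] f.normalF y)
    (hτ : ∀ ξ η, f.normalForm y (τ ξ) (τ η) = f.normalForm x ξ η) (ξ₁ ξ₂ : f.normalF x)
    (B : Module.End ℝ b.screen) : b.IsScreenCurvature cov o τ ξ₁ ξ₂ B ↔
      B = b.compress ((ricciDatum h ho τ hτ).curv ξ₁ ξ₂) := by
  have h1 : ∀ Z : b.screenF, b.compress ((ricciDatum h ho τ hτ).curv ξ₁ ξ₂) Z =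
      b.projF (τ.symm (f.algCurvature cov (x := y) o (τ ξ₁) (τ ξ₂) (τ Z))) := fun Z ↦ by
    rw [compress_apply]
    exact congrArg b.projF (ricciDatum_curv_apply h ho τ hτ ξ₁ ξ₂ Z)
  exact ⟨fun hB ↦ LinearMap.ext fun Z ↦ (hB Z).trans (h1 Z).symm, fun hB Z ↦ by
    rw [hB]
    exact h1 Z⟩

theorem ricciDatum_curv_mem (h : f.HasCoordImmersions cov κ)
    {o : Module.Basis ι ℝ (TangentSpace 𝓘(ℝ, E) y)} (ho : f.IsOrthonormal o) {γ : Path x y}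
    {τ : f.normalF x ≃ₗ[ℝ] f.normalF y} (hd : f.IsDisplacement cov γ τ)
    (hτ : ∀ ξ η, f.normalForm y (τ ξ) (τ η) = f.normalForm x ξ η) (ξ₁ ξ₂ : f.normalF x) :
    LinearMap.toContinuousLinearMap ((ricciDatum h ho τ hτ).curv ξ₁ ξ₂) ∈
      f.curvatureAlgebra cov x := by
  rw [RicciDatum.curv_apply]
  simp only [map_sum, map_smul]
  refine Submodule.sum_mem _ fun k _ ↦ Submodule.sum_mem _ fun l _ ↦ Submodule.smul_mem _ _ ?_
  exact Submodule.subset_span ⟨y, γ, τ, o k, o l, hd, fun ξ ↦ rfl⟩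

end ScreenBasis

/-! ### The two inclusions of the description of the screen holonomy algebra. -/

theorem mainTheorem6
    {E : Type*} [NormedAddCommGroup E] [NormedSpace ℝ E] [FiniteDimensional ℝ E]
    {M : Type*} [TopologicalSpace M] [T2Space M] [SigmaCompactSpace M]
    [ChartedSpace E M] [IsManifold 𝓘(ℝ, E) ∞ M]
    {F : Type*} [NormedAddCommGroup F] [NormedSpace ℝ F] [FiniteDimensional ℝ F]
    {N : Type*} [TopologicalSpace N] [T2Space N] [SigmaCompactSpace N]
    [ChartedSpace F N] [IsManifold 𝓘(ℝ, F) ∞ N]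
    (g : PseudoRiemannianMetric F N)
    (cov : CovariantDerivative 𝓘(ℝ, F) F (TangentSpace 𝓘(ℝ, F) : N → Type _))
    (hcov : g.IsLeviCivita cov) (κ : ℝ) (hκ : g.HasConstantCurvature cov κ)
    (f : SpacelikeImmersion E M g)
    (o : ∀ y : M, Module.Basis (Fin (Module.finrank ℝ E)) ℝ (TangentSpace 𝓘(ℝ, E) y))
    (ho : ∀ y, f.IsOrthonormal (o y))
    (x : M) {p q : ℕ} (b : ScreenBasis f x p q)
    (hb : ∀ A ∈ f.holonomyAlgebra cov x, ∀ ξ ∈ b.isotropic, A ξ ∈ b.isotropic) :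
    b.screenHolonomyAlgebra cov =
      (Submodule.span ℝ
        {B : Module.End ℝ b.screen | ∃ (y : M) (γ : Path x y)
          (τ : f.normalSpace x ≃ₗ[ℝ] f.normalSpace y),
          γ.IsPiecewiseSmooth E ∧ f.IsParallelDisplacement cov γ τ ∧
          ((∃ Y₁ Y₂ : b.screen, b.IsScreenCurvature cov (o y) τ Y₁ Y₂ B) ∨
           (∃ (k : Fin p) (Y : b.screen), b.IsScreenCurvature cov (o y) τ (b.w k) Y B) ∨
           (∃ i j : Fin p, b.IsScreenCurvature cov (o y) τ (b.w i) (b.w j) B))} :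
        Set (Module.End ℝ b.screen)) := by

  -- Second countability is what limits the holonomy group to countably many cosets.
  have hM : SecondCountableTopology M := ChartedSpace.secondCountable_of_sigmaCompact E M
  have h : f.HasCoordImmersions cov κ := fun y ↦ f.coordImmersion hcov hκ y
  have hmem := SpacelikeImmersion.mem_holonomyAlgebra_iff_mem_curvatureAlgebra (x := x) h
  have hiso : ∀ {y : M} {γ : Path x y} {τ : f.normalF x ≃ₗ[ℝ] f.normalF y},
      f.IsDisplacement cov γ τ → ∀ ξ η, f.normalForm y (τ ξ) (τ η) = f.normalForm x ξ η :=
    fun hτ ξ η ↦ SpacelikeImmersion.IsDisplacement.inner_eq h hτ ξ η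
  let T : Module.End ℝ (f.normalF x) ≃ₗ[ℝ] (f.normalF x →L[ℝ] f.normalF x) :=
    LinearMap.toContinuousLinearMap
  refine Subset.antisymm ?_ fun B hB ↦ ?_
  · rintro _ ⟨A, hA, rfl⟩
    set s := {B : Module.End ℝ b.screen | ∃ (y : M) (γ : Path x y)
          (τ : f.normalSpace x ≃ₗ[ℝ] f.normalSpace y),
          γ.IsPiecewiseSmooth E ∧ f.IsParallelDisplacement cov γ τ ∧
          ((∃ Y₁ Y₂ : b.screen, b.IsScreenCurvature cov (o y) τ Y₁ Y₂ B) ∨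
           (∃ (k : Fin p) (Y : b.screen), b.IsScreenCurvature cov (o y) τ (b.w k) Y B) ∨
           (∃ i j : Fin p, b.IsScreenCurvature cov (o y) τ (b.w i) (b.w j) B))} with hs
    have hsub : ∀ B ∈ s, B ∈ Submodule.span ℝ s := fun B hB ↦ Submodule.subset_span hB
    set W := Submodule.span ℝ s
    -- It suffices to treat a displaced curvature operator; it is a combination of values of `𝓡^τ`
    -- with the same `τ`, and their compressions are reduced to the arguments `eₖ` and `wₖ`.
    have h1 : f.curvatureAlgebra cov x ≤ Submodule.comap (b.compress ∘ₗ T.symm.toLinearMap) W := by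
      refine Submodule.span_le.2 ?_
      rintro X ⟨y, γ, τ, u, v, hτ, hX⟩
      have h2 := SpacelikeImmersion.curvMap_mem_span h (ho y) τ (hiso hτ) u v
        (X := (X : f.normalF x →ₗ[ℝ] f.normalF x)) hX
      refine (Submodule.span_le (p := W.comap b.compress)).2 ?_ h2
      rintro _ ⟨⟨ξ, η⟩, rfl⟩
      refine ScreenBasis.compress_curv_mem
        (b := b) (W := W) (d := SpacelikeImmersion.ricciDatum h (ho y) τ (hiso hτ)) (fun ξ η ζ hζ ↦ ?_) ?_ ?_ ?_ ξ η
      -- The values of `𝓡^τ` belong to the holonomy algebra by the easy half of Ambrose–Singer, so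
      -- the invariance of `Ξ` applies to them.
      · exact hb _ ((hmem _).2 (ScreenBasis.ricciDatum_curv_mem h (ho y) hτ (hiso hτ) ξ η)) ζ hζ
      · exact fun Y₁ hY₁ Y₂ hY₂ ↦ hsub _ ⟨y, γ, τ, hτ.smooth, hτ.parallel,
          Or.inl ⟨⟨Y₁, hY₁⟩, ⟨Y₂, hY₂⟩,
            (b.isScreenCurvature_iff h (ho y) τ (hiso hτ) _ _ _).2 rfl⟩⟩
      · exact fun k Y hY ↦ hsub _ ⟨y, γ, τ, hτ.smooth, hτ.parallel,
          Or.inr (Or.inl ⟨k, ⟨Y, hY⟩,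
            (b.isScreenCurvature_iff h (ho y) τ (hiso hτ) _ _ _).2 rfl⟩)⟩
      · exact fun i j ↦ hsub _ ⟨y, γ, τ, hτ.smooth, hτ.parallel,
          Or.inr (Or.inr ⟨i, j, (b.isScreenCurvature_iff h (ho y) τ (hiso hτ) _ _ _).2 rfl⟩)⟩
    exact h1 ((hmem A).1 hA)
  -- The screen holonomy algebra is the image of a linear space under the compression, so it is
  -- enough that it contains the generators, and each `𝓡^τ(ξ, η)` is a combination of displaced
  -- curvature operators.
  · have h1 : ∀ B : Module.End ℝ b.screen, B ∈ b.screenHolonomyAlgebra cov ↔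
        B ∈ ((f.curvatureAlgebra cov x).comap T.toLinearMap).map b.compress :=
      fun B ↦ ⟨fun ⟨A, hA, e⟩ ↦ ⟨A, (hmem A).1 hA, e⟩, fun ⟨A, hA, e⟩ ↦ ⟨A, (hmem A).2 hA, e⟩⟩
    refine (h1 B).2 ((Submodule.span_le
      (p := ((f.curvatureAlgebra cov x).comap T.toLinearMap).map b.compress)).2 ?_ hB)
    rintro B ⟨y, γ, τ, hγ, hp, hB⟩
    have hτ : f.IsDisplacement cov γ τ := ⟨hγ, hp⟩
    have h2 : ∀ ξ η, b.IsScreenCurvature cov (o y) τ ξ η B →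
        B ∈ ((f.curvatureAlgebra cov x).comap T.toLinearMap).map b.compress :=
      fun ξ η hB ↦ ⟨_, ScreenBasis.ricciDatum_curv_mem h (ho y) hτ (hiso hτ) ξ η,
        ((b.isScreenCurvature_iff h (ho y) τ (hiso hτ) ξ η B).1 hB).symm⟩
    rcases hB with ⟨Y₁, Y₂, hB⟩ | ⟨k, Y, hB⟩ | ⟨i, j, hB⟩ <;> exact h2 _ _ hB
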